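/- Let $\lambda\ge 0$, $\mu>0$, $E>0$, $T>0$, put $A=\mu\frac{E-T}{2E}$, and let $\gamma$ be the centred Gaussian law on $\mathbb R$ with variance $T$. For probability measures $\nu,\tilde\nu$ on $\mathbb R^k$ let $$W_2(\nu,\tilde\nu)=\Big(\inf \mathbb E\Big[\tfrac1k\sum_{i=1}^k|X_i-Y_i|^2\Big]\Big)^{1/2},$$ the infimum being over all couplings $(X,Y)$ of $\nu$ and $\tilde\nu$. *Kinetic equation.* For measures $\nu,\tilde\nu$ on $\mathbb R$ let $\int\phi\,dB_2[\nu,\tilde\nu]=\int\int\int_0^{2\pi}\phi(v\cos\theta+v_*\sin\theta)\frac{d\theta}{2\pi}\nu(dv)\tilde\nu(dv_*)$, and let $B_1[t]$ be the law of $e^{-At}w$ for $w\sim\gamma$. Given a probability measure $f_0$ on $\mathbb R$, let $(f_t)_{t\ge0}$ be the weak solution of $$\partial_t f_t=2\lambda(B_2[f_t,f_t]-f_t)+\mu(\gamma-f_t)-A\,\partial_v(vf_t),$$ that is, the $f_t$ are probability measures such that the images $g_t$ of $f_t$ under $v\mapsto e^{-At}v$ are continuous in $t$ in total variation and satisfy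 $$g_t=f_0+\int_0^t\{2\lambda(B_2[g_s,g_s]-g_s)+\mu(B_1[s]-g_s)\}\,ds\qquad\text{for all }t\ge0.$$ *Particle system.* For $N\ge2$ let $\beta_N(w)=\sqrt{\frac{NE}{NE-E+w^2}}$, and let $\mathbf V_t=(V^1_t,\dots,V^N_t)$ be the càdlàg Markov jump process on $\mathbb R^N$ in which (i) at total rate $N\lambda$ an ordered pair $i\ne j$ is chosen uniformly, together with a uniform $\theta\in[0,2\pi)$, and $(v_i,v_j)$ is replaced by $(v_i\cos\theta-v_j\sin\theta,\ v_i\sin\theta+v_j\cos\theta)$; (ii) at rate $\mu$ for each $i$, $v_i$ is replaced by a sample $w\sim\gamma$ and then all $N$ velocities are multiplied by $\beta_N(w)$. The initial vector $\mathbf V_0$ is exchangeable with $\mathbb E[(V_0^1)^2]=E$. Write $f_0^N=\mathrm{Law}(\mathbf V_0)$ and $\bar{\mathbf V}_t=\frac1N\sum_{i=1}^N\delta_{V_t^i}$. **Theorem (propagation of chaos).** Let $r>2$ satisfy $rA<2\lambda C_r+\mu$, where $C_r=1-2\int_0^{2\pi}|\cos\theta|^r\frac{d\theta}{2\pi}$,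 and assume $\int|v|^rf_0(dv)<\infty$. Then there is a finite constant $C$, depending only on $\lambda,\mu,E,T,r$ and $\int|v|^rf_0(dv)$, such that for all $N\ge2$ and all $t\ge0$ $$\mathbb E\big[W_2^2(\bar{\mathbf V}_t,f_t)\big]\le4e^{-\frac{\mu T}{E}t}\,W_2^2(f_0^N,f_0^{\otimes N})+C\begin{cases}N^{-1/3},&r>4,\\N^{-1/3}(\log N)^{2/3},&r=4,\\N^{-\frac{r-2}{2(r-1)}},&r\in(2,4).\end{cases}$$ -/

import Mathlib

open MeasureTheory ProbabilityTheory Filter Topology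
open scoped NNReal ENNReal

noncomputable section

namespace KacThermostat

/-! ### Wasserstein distances -/

/-- Optimal transport cost between `ν` and `ν'` for the cost `c`: the infimum of `∫ c dπ` over all
couplings `π` of `ν` and `ν'`. -/
def transportCost {α : Type*} [MeasurableSpace α] (c : α → α → ℝ≥0∞) (ν ν' : Measure α) : ℝ≥0∞ :=
  ⨅ π ∈ {π : Measure (α × α) | π.map Prod.fst = ν ∧ π.map Prod.snd = ν'}, ∫⁻ p, c p.1 p.2 ∂π

/-- The `2`-Wasserstein distance between measures on `ℝ^k`, with the normalized squared cost
`(1/k) ∑ᵢ |xᵢ - yᵢ|²`. -/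
def W2 {k : ℕ} (ν ν' : Measure (Fin k → ℝ)) : ℝ≥0∞ :=
  (transportCost (fun x y => ENNReal.ofReal ((k : ℝ)⁻¹ * ∑ i, (x i - y i) ^ 2)) ν ν') ^ (1 / 2 : ℝ)

/-- The `2`-Wasserstein distance between measures on `ℝ` (the case `k = 1` of `W2`). -/
def W2Line (ν ν' : Measure ℝ) : ℝ≥0∞ :=
  (transportCost (fun x y => ENNReal.ofReal ((x - y) ^ 2)) ν ν') ^ (1 / 2 : ℝ)

/-- The empirical measure `(1/N) ∑ᵢ δ_{vᵢ}` of `v ∈ ℝ^N`. -/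
def empirical {N : ℕ} (v : Fin N → ℝ) : Measure ℝ :=
  (N : ℝ≥0∞)⁻¹ • ∑ i, Measure.dirac (v i)

/-! ### Parameters and reference laws -/

/-- The uniform distribution `dθ / 2π` on `[0, 2π)`. -/
def angleLaw : Measure ℝ :=
  ENNReal.ofReal (2 * Real.pi)⁻¹ • volume.restrict (Set.Ico 0 (2 * Real.pi))

/-- The thermostat distribution: the centred Gaussian with variance `T`. -/
def thermostat (T : ℝ) : Measure ℝ := gaussianReal 0 T.toNNReal

/-- The drift constant `A = mu (E - T) / (2 E)`. -/
def drift (mu E T : ℝ) : ℝ := mu * ((E - T) / (2 * E))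

/-- The constant `C_r = 1 - 2 ∫ |cos θ|^r dθ/2π`. -/
def momentConst (r : ℝ) : ℝ := 1 - 2 * ∫ θ, |Real.cos θ| ^ r ∂angleLaw

/-! ### The kinetic equation -/

/-- The collision operator
`∫ φ dB₂[ν, ν'] = ∫∫∫ φ(v cos θ + v' sin θ) dθ/2π ν(dv) ν'(dv')`. -/
def collision (ν ν' : Measure ℝ) : Measure ℝ :=
  (ν.prod (ν'.prod angleLaw)).map fun p => p.1 * Real.cos p.2.2 + p.2.1 * Real.sin p.2.2

/-- The image of `ν` under the dilation `v ↦ e^{-a t} v`. -/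
def rescale (a : ℝ) (t : ℝ) (ν : Measure ℝ) : Measure ℝ :=
  ν.map fun v => Real.exp (-(a * t)) * v

/-- Weak solutions `(f_t)_{t ≥ 0}`, started at `f₀`, of
`∂ₜ f = 2 lam (B₂[f, f] - f) + mu (γ - f) - A ∂ᵥ(v f)`.
The drift is removed by passing to `g_t`, the image of `f_t` under `v ↦ e^{-At} v`, and the
equation for `g_t` is an identity of measures. The measure `rescale A s (thermostat T)` has
density `e^{As} γ(e^{As} v)`. -/
structure IsWeakSolution (lam mu E T : ℝ) (f₀ : Measure ℝ) (f : ℝ≥0 → Measure ℝ) : Prop where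
  isProbabilityMeasure : ∀ t, IsProbabilityMeasure (f t)
  /-- Continuity of `t ↦ g_t` in total variation, that is, uniformly over measurable sets. -/
  continuous_tv : ∀ t : ℝ≥0,
    TendstoUniformlyOn (fun (s : ℝ≥0) (S : Set ℝ) => (rescale (drift mu E T) s (f s)).real S)
      (fun S => (rescale (drift mu E T) t (f t)).real S) (𝓝 t) {S | MeasurableSet S}
  equation : ∀ t : ℝ≥0, ∀ S : Set ℝ, MeasurableSet S →
    (rescale (drift mu E T) t (f t)).real S = f₀.real S +
      ∫ s in (0 : ℝ)..t,
        (2 * lam *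
            ((collision (rescale (drift mu E T) s (f s.toNNReal))
                (rescale (drift mu E T) s (f s.toNNReal))).real S
              - (rescale (drift mu E T) s (f s.toNNReal)).real S)
          + mu *
            ((rescale (drift mu E T) s (thermostat T)).real S
              - (rescale (drift mu E T) s (f s.toNNReal)).real S))

/-! ### The particle system -/

/-- The rescaling factor `β_N(w) = √(N E / (N E - E + w²))`. -/
def beta (N : ℕ) (E w : ℝ) : ℝ := Real.sqrt (N * E / (N * E - E + w ^ 2))

/-- Kac collision of the particles `i ≠ j` with angle `θ`. -/
def kacJump {N : ℕ} (i j : Fin N) (v : Fin N → ℝ) (θ : ℝ) : Fin N → ℝ := fun k =>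
  if k = i then v i * Real.cos θ - v j * Real.sin θ
  else if k = j then v i * Real.sin θ + v j * Real.cos θ
  else v k

/-- Thermostat interaction of particle `i`, whose velocity is replaced by `w`, followed by the
multiplication of all the velocities by `β_N(w)`. -/
def thermoJump {N : ℕ} (E : ℝ) (i : Fin N) (v : Fin N → ℝ) (w : ℝ) : Fin N → ℝ := fun k =>
  if k = i then beta N E w * w else beta N E w * v k

/-- The generator of the particle system: Kac collisions take place at total rate `N * lam`,
between an ordered pair `i ≠ j` chosen uniformly and with a uniform angle, and each particle
interacts with the thermostat at rate `mu`. -/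
def generator (N : ℕ) (lam mu E T : ℝ) (φ : (Fin N → ℝ) → ℝ) (v : Fin N → ℝ) : ℝ :=
  N * lam * ((N * (N - 1) : ℝ)⁻¹ *
      ∑ i, ∑ j, if i ≠ j then ∫ θ, (φ (kacJump i j v θ) - φ v) ∂angleLaw else 0)
    + mu * ∑ i, ∫ w, (φ (thermoJump E i v w) - φ v) ∂(thermostat T)

/-- `V` is (a version of) the particle system, the Markov jump process on `ℝ^N` with the above
generator: it has càdlàg paths, and it solves the martingale problem for the generator on the
bounded measurable functions. -/
structure IsParticleSystem {Ω : Type*} [MeasurableSpace Ω] (P : Measure Ω) (N : ℕ)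
    (lam mu E T : ℝ) (V : ℝ≥0 → Ω → Fin N → ℝ) : Prop where
  rightContinuous : ∀ ω t, ContinuousWithinAt (fun s => V s ω) (Set.Ici t) t
  leftLimits : ∀ ω t, ∃ l, Tendsto (fun s => V s ω) (𝓝[<] t) (𝓝 l)
  martingaleProblem : ∃ ℱ : Filtration ℝ≥0 ‹MeasurableSpace Ω›,
    (∀ t, Measurable[ℱ t] (V t)) ∧
    ∀ φ : (Fin N → ℝ) → ℝ, Measurable φ → (∃ K, ∀ v, |φ v| ≤ K) →
      Martingale (fun (t : ℝ≥0) ω =>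
        φ (V t ω) - ∫ s in (0 : ℝ)..t, generator N lam mu E T φ (V s.toNNReal ω)) ℱ P

/-- Exchangeability of a law on `ℝ^N`. -/
def Exchangeable {N : ℕ} (ν : Measure (Fin N → ℝ)) : Prop :=
  ∀ σ : Equiv.Perm (Fin N), ν.map (fun v => v ∘ σ) = ν

/-- The rate of chaos: `N^{-1/3}` for `r > 4`, `N^{-1/3} (log N)^{2/3}` for `r = 4`, and
`N^{-(r-2)/(2(r-1))}` for `r < 4`. -/
def chaosRate (r : ℝ) (N : ℕ) : ℝ :=
  if 4 < r then (N : ℝ) ^ (-(1 / 3) : ℝ)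
  else if r = 4 then (N : ℝ) ^ (-(1 / 3) : ℝ) * Real.log N ^ (2 / 3 : ℝ)
  else (N : ℝ) ^ (-((r - 2) / (2 * (r - 1))))

end KacThermostat

end

open KacThermostat

/-! The particle system is coupled with `N` nonlinear particles. Dilating by `e^{-At}` removes the
drift, so the kinetic equation becomes a pure jump equation for the dilated law `g_t`, and the
nonlinear particles live in that frame. When `i` and `j` collide in the particle system, the `i`-th
nonlinear particle is rotated by the same angle, but with a sample of `g_t` in the role of the
`j`-th velocity, and symmetrically for `j`. When `i` meets the thermostat, both systems use the same
Gaussian sample, and only the particle system is rescaled by `β_N`.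

The sample attached to `j` is the quantile of `g_t` at level `(rank of u_j + ρ) / (N - 1)`, with the
rank taken among the particles other than `i` and `ρ` uniform. It is close to `u_j` as soon as the
empirical measure is close to `g_t`, and averaged over `j ≠ i` its law is exactly `g_t`. Hence the
nonlinear particles are unbiased (`IsCoupling.integral_mean`): their empirical measure has mean
`g_t` at all times, although they do not stay independent. Since the total jump rate is constant,
the law of the coupling is built as a series over the number of jumps (`exists_jumpFlow`). Its first
marginal is the law of the given particle system, by uniqueness for the forward equation
(`IsCoupling.map_fst`).

Independence is replaced by a variance estimate (`exists_fluctuation_le`). The variance of the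
average of `φ` over the nonlinear particles is dissipated at rate `4λ + 2μ`, is fed by `4λ` times
the covariance with the average of the post-collisional `Qφ`, and has a source of order `1/N`. Up to
a factor close to `1`, `Q` preserves a class of quadratically bounded functions, so the thermostat
wins and the variance is `O(1/N)` uniformly in time.

Applied to `y 1_{z ≤ y}` or `y 1_{z > y}`, this gives `|y| E|F_N(y) - F(y)| = O(N^{-1/2})` for the
distribution functions. The cost of the monotone coupling is at most `4 ∫ |y| |F_N - F| dy`. Using
the variance for moderate `y` and the `r`-th moment for large `y` yields the rate
`N^{-(r-2)/(2(r-1))}` (`exists_partnerCost_le`), which is never worse than the rate claimed. The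
condition on `r` is what bounds the `r`-th moment uniformly in time (`exists_moment_bound_uniform`).

It remains to follow the squared distance between the two systems in the frame with drift. The mean
energy of the particle system stays below `E` and that of the nonlinear particles is known, so only
the correlation has to be studied (`IsCoupling.deviation_deriv_le`). Collisions rotate both systems
alike and cost only the mismatch between `u_j` and its sample. Expanding `β_N` to first order in
`1/N`, the thermostat and the drift give relaxation at rate `μ - 2A = μT/E`. A Grönwall argument
with a time-dependent weight in Young's inequality (`IsPrimitive.le_of_deriv_le_young`) keeps this
full rate at the price of a factor `2`. Another factor `2` comes from `(x + y)² ≤ 2x² + 2y²` when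
passing from the nonlinear particles to `f_t`. The initial coupling is arbitrary, so the infimum
over it can be taken at the end. -/

/-! ### Absolutely continuous functions of time and Grönwall inequalities. -/

/-- `y` is on `[0, t]` a primitive of the integrable function `D`. -/
def IsPrimitive (y D : ℝ → ℝ) (t : ℝ) : Prop :=
  IntervalIntegrable D volume 0 t ∧ ∀ s ∈ Set.Icc 0 t, y s = y 0 + ∫ r in (0 : ℝ)..s, D r

namespace IsPrimitive

variable {y z D F : ℝ → ℝ} {t : ℝ}

lemma mono (h : IsPrimitive y D t) {s : ℝ} (hs : s ∈ Set.Icc 0 t) : IsPrimitive y D s :=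
  ⟨h.1.mono_set (by rw [Set.uIcc_of_le hs.1, Set.uIcc_of_le (hs.1.trans hs.2)]
                    exact Set.Icc_subset_Icc_right hs.2),
    fun r hr => h.2 r ⟨hr.1, hr.2.trans hs.2⟩⟩

lemma absolutelyContinuous (h : IsPrimitive y D t) :
    AbsolutelyContinuousOnInterval (fun s => y 0 + ∫ r in (0 : ℝ)..s, D r) 0 t := by
  have h1 := h.1.absolutelyContinuousOnInterval_intervalIntegral (c := 0) (by simp)
  have h2 : AbsolutelyContinuousOnInterval (fun _ : ℝ => y 0) 0 t :=
    (LipschitzWith.const (y 0)).lipschitzOnWith.absolutelyContinuousOnInterval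
  exact h2.add h1

lemma continuousOn (h : IsPrimitive y D t) (ht : 0 ≤ t) : ContinuousOn y (Set.Icc 0 t) := by
  have := h.absolutelyContinuous.continuousOn
  rw [Set.uIcc_of_le ht] at this
  exact this.congr fun s hs => h.2 s hs

/-- Integration by parts, applied to the absolutely continuous functions `y 0 + ∫ D` and `z 0 + ∫
F`, since nothing is known of `y` and `z` outside `[0, t]`; their derivatives are `D` and `F` almost
everywhere by Lebesgue differentiation. -/
lemma mul (hy : IsPrimitive y D t) (hz : IsPrimitive z F t) (ht : 0 ≤ t) :
    IsPrimitive (fun s => y s * z s) (fun s => D s * z s + y s * F s) t := by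
  have hyc := hy.continuousOn ht
  have hzc := hz.continuousOn ht
  rw [← Set.uIcc_of_le ht] at hyc hzc
  refine ⟨(hy.1.mul_continuousOn hzc).add (hz.1.continuousOn_mul hyc), fun s hs => ?_⟩
  have hy' := hy.mono hs
  have hz' := hz.mono hs
  have key := hy'.absolutelyContinuous.integral_deriv_mul_eq_sub
    hz'.absolutelyContinuous
  rw [← hy'.2 s (Set.right_mem_Icc.2 hs.1), ← hz'.2 s (Set.right_mem_Icc.2 hs.1)] at key
  simp only [intervalIntegral.integral_same, add_zero] at key
  have : ∫ x in (0 : ℝ)..s, (D x * z x + y x * F x) = y s * z s - y 0 * z 0 := by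
    rw [← key]
    apply intervalIntegral.integral_congr_ae
    filter_upwards [hy'.1.ae_hasDerivAt_integral, hz'.1.ae_hasDerivAt_integral] with x h1 h2 hx
    have hx' : x ∈ Set.uIcc 0 s := Set.uIoc_subset_uIcc hx
    have hx2 : x ∈ Set.Icc 0 s := by rwa [Set.uIcc_of_le hs.1] at hx'
    have e1 := ((h1 hx' 0 (by simp)).const_add (y 0)).deriv
    have e2 := ((h2 hx' 0 (by simp)).const_add (z 0)).deriv
    rw [e1, e2, ← hy'.2 x hx2, ← hz'.2 x hx2]
  rw [this]; ring

lemma of_hasDerivAt (hy : ∀ s, HasDerivAt y (D s) s) (hD : Continuous D) :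
    IsPrimitive y D t := by
  refine ⟨hD.intervalIntegrable _ _, fun s _ => ?_⟩
  rw [intervalIntegral.integral_eq_sub_of_hasDerivAt (fun x _ => hy x)
    (hD.intervalIntegrable _ _)]
  ring

lemma exp (a : ℝ) : IsPrimitive (fun s => Real.exp (a * s)) (fun s => a * Real.exp (a * s)) t := by
  refine of_hasDerivAt (fun s => ?_) (by fun_prop)
  have := ((hasDerivAt_id s).const_mul a).exp
  simpa [mul_comm] using this

lemma const (c : ℝ) : IsPrimitive (fun _ => c) (fun _ => 0) t :=
  of_hasDerivAt (fun s => hasDerivAt_const s c) continuous_const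

lemma const_mul (c : ℝ) (h : IsPrimitive y D t) :
    IsPrimitive (fun s => c * y s) (fun s => c * D s) t := by
  refine ⟨h.1.const_mul c, fun s hs => ?_⟩
  simp only [h.2 s hs, intervalIntegral.integral_const_mul]; ring

lemma add (hy : IsPrimitive y D t) (hz : IsPrimitive z F t) :
    IsPrimitive (fun s => y s + z s) (fun s => D s + F s) t := by
  refine ⟨hy.1.add hz.1, fun s hs => ?_⟩
  rw [intervalIntegral.integral_add (hy.mono hs).1 (hz.mono hs).1]
  simp only [hy.2 s hs, hz.2 s hs]; ring

lemma congr (h : IsPrimitive y D t) (ht : 0 ≤ t) {y' D' : ℝ → ℝ}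
    (hy : ∀ s ∈ Set.Icc 0 t, y' s = y s) (hD : ∀ s ∈ Set.Icc 0 t, D' s = D s) :
    IsPrimitive y' D' t := by
  refine ⟨h.1.congr (fun s hs => (hD s ?_).symm), fun s hs => ?_⟩
  · rw [Set.uIoc_of_le ht] at hs; exact ⟨hs.1.le, hs.2⟩
  rw [hy s hs, hy 0 ⟨le_rfl, ht⟩, h.2 s hs]
  congr 1
  refine intervalIntegral.integral_congr fun x hx => (hD x ?_).symm
  rw [Set.uIcc_of_le hs.1] at hx
  exact ⟨hx.1, hx.2.trans hs.2⟩

/-- Grönwall's lemma: `y' ≤ -c y + R` implies `y t ≤ e^{-ct} y 0 + ∫ e^{-c(t-s)} R s ds`. -/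
lemma le_of_deriv_le (h : IsPrimitive y D t) (ht : 0 ≤ t) {c : ℝ} {R : ℝ → ℝ}
    (hR : IntervalIntegrable R volume 0 t) (hD : ∀ s ∈ Set.Icc 0 t, D s ≤ -c * y s + R s) :
    y t ≤ Real.exp (-(c * t)) * y 0 + ∫ s in (0 : ℝ)..t, Real.exp (-(c * (t - s))) * R s := by
  -- The derivative of `y e^{cs}` is at most `e^{cs} R`.
  have h1 := h.mul (IsPrimitive.exp c) ht
  have h2 := h1.2 t (Set.right_mem_Icc.2 ht)
  simp only [mul_zero, Real.exp_zero, mul_one] at h2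
  have hle : ∫ s in (0 : ℝ)..t, (D s * Real.exp (c * s) + y s * (c * Real.exp (c * s))) ≤
      ∫ s in (0 : ℝ)..t, Real.exp (c * s) * R s := by
    refine intervalIntegral.integral_mono_on ht h1.1
      (hR.continuousOn_mul (by fun_prop)) fun s hs => ?_
    nlinarith [hD s hs, Real.exp_pos (c * s)]
  have h3 : ∫ s in (0 : ℝ)..t, Real.exp (-(c * (t - s))) * R s =
      Real.exp (-(c * t)) * ∫ s in (0 : ℝ)..t, Real.exp (c * s) * R s := by
    rw [← intervalIntegral.integral_const_mul]
    refine intervalIntegral.integral_congr fun s _ => ?_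
    simp only [← mul_assoc, ← Real.exp_add]; ring_nf
  rw [h3, ← mul_add]
  calc y t = Real.exp (-(c * t)) * (y t * Real.exp (c * t)) := by
        rw [mul_left_comm, ← Real.exp_add]; simp
    _ ≤ _ := by
        rw [h2]; gcongr

end IsPrimitive

lemma integral_exp_neg_mul_sub {c : ℝ} (hc : c ≠ 0) (t : ℝ) :
    ∫ s in (0 : ℝ)..t, Real.exp (-(c * (t - s))) = (1 - Real.exp (-(c * t))) / c := by
  have h : ∀ s, HasDerivAt (fun s => Real.exp (-(c * (t - s))) / c)
      (Real.exp (-(c * (t - s)))) s := by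
    intro s
    have := (((hasDerivAt_const s t).sub (hasDerivAt_id s)).const_mul c).neg.exp.div_const c
    convert! this using 1
    simp; field_simp
  rw [intervalIntegral.integral_eq_sub_of_hasDerivAt (fun s _ => h s)
    (Continuous.intervalIntegrable (by fun_prop) _ _)]
  simp; ring

lemma integral_exp_neg_mul_sub_le {c : ℝ} (hc : 0 < c) (t : ℝ) :
    ∫ s in (0 : ℝ)..t, Real.exp (-(c * (t - s))) ≤ 1 / c := by
  rw [integral_exp_neg_mul_sub hc.ne']
  have := Real.exp_pos (-(c * t))
  gcongr; linarith

/-- A number below each element of a set of bounds which is stable under `B ↦ θ B + c` is at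
most the fixed point of this map. -/
lemma le_div_of_improvable {P : ℝ → Prop} {x θ c B₀ : ℝ} (hθ0 : 0 ≤ θ) (hθ1 : θ < 1)
    (hx : ∀ B, P B → x ≤ B) (h0 : P B₀) (hP : ∀ B, P B → P (θ * B + c)) :
    x ≤ c / (1 - θ) := by
  have h1 : (1 - θ) ≠ 0 := by linarith
  -- Each application of the map divides the distance to its fixed point by `1 / θ`.
  have hn : ∀ n : ℕ, P (c / (1 - θ) + θ ^ n * (B₀ - c / (1 - θ))) := by
    intro n
    induction n with
    | zero => simpa using h0
    | succ n ih =>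
      have := hP _ ih
      convert! this using 1
      field_simp; ring
  have hlim : Tendsto (fun n : ℕ => c / (1 - θ) + θ ^ n * (B₀ - c / (1 - θ))) atTop
      (𝓝 (c / (1 - θ) + 0 * (B₀ - c / (1 - θ)))) :=
    ((tendsto_pow_atTop_nhds_zero_of_lt_one hθ0 hθ1).mul_const _).const_add _
  rw [zero_mul, add_zero] at hlim
  exact ge_of_tendsto' hlim fun n => hx _ (hn n)

/-- A linear integral inequality, `y ≤ c + b ∫ y` on `[0, t]`, for each member of a bounded
family, where the member on the right may change with time. -/
lemma le_of_family_integral_le {ι : Type*} {y : ι → ℝ → ℝ} {c b t B₀ : ℝ} (hb : 0 < b)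
    (hc : 0 ≤ c) (hB₀ : ∀ i, ∀ s ∈ Set.Icc 0 t, y i s ≤ B₀)
    (h : ∀ i, ∀ s ∈ Set.Icc 0 t, ∀ Y : ℝ → ℝ, Continuous Y →
      (∀ j, ∀ r ∈ Set.Icc 0 s, y j r ≤ Y r) → y i s ≤ c + b * ∫ r in (0 : ℝ)..s, Y r)
    (i : ι) {s : ℝ} (hs : s ∈ Set.Icc 0 t) : y i s ≤ 2 * c * Real.exp (2 * b * s) := by
  -- In the weight `e^{-2bs}` one use of the inequality turns a bound `B` into `B / 2 + c`.
  -- Improving bounds avoids taking a supremum over the family, which need not be measurable in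
  -- time.
  have key : Real.exp (-(2 * b * s)) * y i s ≤ c / (1 - 1 / 2) := by
    refine le_div_of_improvable
      (P := fun B => 0 ≤ B ∧ ∀ j, ∀ r ∈ Set.Icc 0 t, Real.exp (-(2 * b * r)) * y j r ≤ B)
      (B₀ := max B₀ 0) (by norm_num) (by norm_num) (fun B hB => hB.2 i s hs)
      ⟨le_max_right _ _, fun j r hr => ?_⟩
      fun B hB => ⟨by linarith [hB.1], fun j r hr => ?_⟩
    · have h1 : Real.exp (-(2 * b * r)) ≤ 1 := by
        rw [Real.exp_le_one_iff]; nlinarith [hr.1]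
      calc _ ≤ Real.exp (-(2 * b * r)) * max B₀ 0 := by
            gcongr; exact (hB₀ j r hr).trans (le_max_left _ _)
        _ ≤ 1 * max B₀ 0 := by gcongr
        _ = _ := one_mul _
    · have h2 := h j r hr (fun s => B * Real.exp (2 * b * s)) (by fun_prop) fun k s hs => by
        have := hB.2 k s ⟨hs.1, hs.2.trans hr.2⟩
        rw [Real.exp_neg, inv_mul_le_iff₀ (Real.exp_pos _)] at this
        linarith
      rw [intervalIntegral.integral_const_mul] at h2
      have h3 : b * ∫ s in (0 : ℝ)..r, Real.exp (2 * b * s) = (Real.exp (2 * b * r) - 1) / 2 := by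
        have := (IsPrimitive.exp (2 * b) (t := r)).2 r (Set.right_mem_Icc.2 hr.1)
        rw [intervalIntegral.integral_const_mul] at this
        simp only [mul_zero, Real.exp_zero] at this; linarith
      have h4 : y j r ≤ c + B * ((Real.exp (2 * b * r) - 1) / 2) := by
        rw [← h3]; linarith
      rw [Real.exp_neg, inv_mul_le_iff₀ (Real.exp_pos _)]
      have : 1 ≤ Real.exp (2 * b * r) := Real.one_le_exp (by nlinarith [hr.1])
      nlinarith [hB.1]
  rw [Real.exp_neg, inv_mul_le_iff₀ (Real.exp_pos _)] at key
  calc y i s ≤ _ := key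
    _ = _ := by ring

/-! ### Linear jump equations for families of measures. -/

section Flow

variable {X : Type*} [MeasurableSpace X]

/-- The family `m` of measures solves `∂ₜ m = gain - L m`, tested on nonnegative functions. -/
def IsFlow (L : ℝ≥0) (m gain : Kernel ℝ X) : Prop :=
  ∀ t : ℝ, 0 ≤ t → ∀ φ : X → ℝ≥0∞, Measurable φ →
    ∫⁻ x, φ x ∂m t + L * ∫⁻ s in Set.Ioc 0 t, ∫⁻ x, φ x ∂m s =
      ∫⁻ x, φ x ∂m 0 + ∫⁻ s in Set.Ioc 0 t, ∫⁻ x, φ x ∂gain s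

lemma lintegral_eq_ofReal_interval {F : ℝ → ℝ≥0∞} (hF : Measurable F) {t : ℝ} (ht : 0 ≤ t)
    (hfin : ∫⁻ s in Set.Ioc 0 t, F s ≠ ∞) :
    IntervalIntegrable (fun s => (F s).toReal) volume 0 t ∧
      ∫⁻ s in Set.Ioc 0 t, F s = ENNReal.ofReal (∫ s in (0 : ℝ)..t, (F s).toReal) := by
  constructor
  · rw [intervalIntegrable_iff_integrableOn_Ioc_of_le ht]
    exact integrable_toReal_of_lintegral_ne_top hF.aemeasurable hfin
  · rw [intervalIntegral.integral_of_le ht, integral_toReal hF.aemeasurable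
      (ae_lt_top hF hfin), ENNReal.ofReal_toReal hfin]

/-- Moving the loss term to the left makes the equation on sets an identity between measures, which
can then be integrated against any nonnegative function. -/
lemma isFlow_of_real {L : ℝ≥0} {m gain : Kernel ℝ X} [IsMarkovKernel m]
    (hg : ∀ s, gain s Set.univ ≤ L)
    (h : ∀ t : ℝ, 0 ≤ t → ∀ S, MeasurableSet S → (m t).real S = (m 0).real S +
      ∫ s in (0 : ℝ)..t, ((gain s).real S - L * (m s).real S)) : IsFlow L m gain := by
  intro t ht φ hφ
  have hvol : volume (Set.Ioc 0 t) ≠ ∞ := by simp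
  have hmeas : m t + (L : ℝ≥0∞) • (volume.restrict (Set.Ioc 0 t)).bind m =
      m 0 + (volume.restrict (Set.Ioc 0 t)).bind gain := by
    ext S hS
    have f1 : ∫⁻ s in Set.Ioc 0 t, m s S ≠ ∞ := by
      refine ne_top_of_le_ne_top (b := ∫⁻ s in Set.Ioc 0 t, 1) (by simp) ?_
      exact lintegral_mono fun s => prob_le_one
    have f2 : ∫⁻ s in Set.Ioc 0 t, gain s S ≠ ∞ := by
      refine ne_top_of_le_ne_top (b := ∫⁻ s in Set.Ioc 0 t, (L : ℝ≥0∞)) ?_ ?_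
      · simp [ENNReal.mul_eq_top]
      · exact lintegral_mono fun s => (measure_mono (Set.subset_univ S)).trans (hg s)
    obtain ⟨i1, e1⟩ := lintegral_eq_ofReal_interval (m.measurable_coe hS) ht f1
    obtain ⟨i2, e2⟩ := lintegral_eq_ofReal_interval (gain.measurable_coe hS) ht f2
    have n1 : 0 ≤ ∫ s in (0 : ℝ)..t, (m s S).toReal :=
      intervalIntegral.integral_nonneg ht fun _ _ => ENNReal.toReal_nonneg
    have n2 : 0 ≤ ∫ s in (0 : ℝ)..t, (gain s S).toReal :=
      intervalIntegral.integral_nonneg ht fun _ _ => ENNReal.toReal_nonneg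
    have key := h t ht S hS
    simp only [Measure.real] at key
    rw [intervalIntegral.integral_sub i2 (i1.const_mul _),
      intervalIntegral.integral_const_mul] at key
    simp only [Measure.add_apply, Measure.smul_apply, smul_eq_mul]
    rw [Measure.bind_apply hS m.measurable.aemeasurable,
      Measure.bind_apply hS gain.measurable.aemeasurable, e1, e2,
      ← ENNReal.ofReal_toReal (measure_ne_top (m t) S),
      ← ENNReal.ofReal_toReal (measure_ne_top (m 0) S), ← ENNReal.ofReal_coe_nnreal,
      ← ENNReal.ofReal_mul (by positivity), ← ENNReal.ofReal_add (by positivity) (by positivity),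
      ← ENNReal.ofReal_add (by positivity) n2, key]
    congr 1; ring
  have := congrArg (fun μ => ∫⁻ x, φ x ∂μ) hmeas
  simp only [lintegral_add_measure, lintegral_smul_measure] at this
  rwa [Measure.lintegral_bind m.measurable.aemeasurable hφ.aemeasurable,
    Measure.lintegral_bind gain.measurable.aemeasurable hφ.aemeasurable] at this

namespace IsFlow

variable {L : ℝ≥0} {m gain : Kernel ℝ X}

/-- The flow equation itself bounds the gain by its left-hand side: no separate estimate of the gain
is needed. -/
lemma lintegral_gain_ne_top (h : IsFlow L m gain) {φ : X → ℝ≥0∞} (hφ : Measurable φ) {t : ℝ}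
    (ht : 0 ≤ t) {B : ℝ≥0∞} (hB : B ≠ ∞) (hm : ∀ s ∈ Set.Icc 0 t, ∫⁻ x, φ x ∂m s ≤ B) :
    ∫⁻ s in Set.Ioc 0 t, ∫⁻ x, φ x ∂m s ≠ ∞ ∧
      ∫⁻ s in Set.Ioc 0 t, ∫⁻ x, φ x ∂gain s ≠ ∞ := by
  have h1 : ∫⁻ s in Set.Ioc 0 t, ∫⁻ x, φ x ∂m s ≠ ∞ := by
    refine ne_top_of_le_ne_top (b := ∫⁻ s in Set.Ioc 0 t, B)
      (by simp [ENNReal.mul_eq_top, hB]) ?_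
    exact setLIntegral_mono measurable_const fun s hs => hm s ⟨hs.1.le, hs.2⟩
  refine ⟨h1, ?_⟩
  have h2 := h t ht φ hφ
  refine ne_top_of_le_ne_top ?_ (le_add_self.trans h2.ge)
  exact ENNReal.add_ne_top.2 ⟨ne_top_of_le_ne_top hB (hm t ⟨ht, le_rfl⟩),
    ENNReal.mul_ne_top (by simp) h1⟩

lemma isPrimitive_of_nonneg (h : IsFlow L m gain) {ψ : X → ℝ} (hψ : Measurable ψ)
    (h0 : ∀ x, 0 ≤ ψ x) {t : ℝ} (ht : 0 ≤ t) {B : ℝ≥0∞} (hB : B ≠ ∞)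
    (hm : ∀ s ∈ Set.Icc 0 t, ∫⁻ x, ENNReal.ofReal (ψ x) ∂m s ≤ B) :
    IsPrimitive (fun s => ∫ x, ψ x ∂m s) (fun s => ∫ x, ψ x ∂gain s - L * ∫ x, ψ x ∂m s) t := by
  have hφ : Measurable fun x => ENNReal.ofReal (ψ x) := hψ.ennreal_ofReal
  have e : ∀ μ : Measure X, ∫ x, ψ x ∂μ = (∫⁻ x, ENNReal.ofReal (ψ x) ∂μ).toReal := fun μ =>
    integral_eq_lintegral_of_nonneg_ae (ae_of_all _ h0) hψ.aestronglyMeasurable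
  have key : ∀ s ∈ Set.Icc 0 t,
      IntervalIntegrable (fun s => ∫ x, ψ x ∂gain s) volume 0 s ∧
      IntervalIntegrable (fun s => ∫ x, ψ x ∂m s) volume 0 s ∧
      ∫ x, ψ x ∂m s = ∫ x, ψ x ∂m 0 + (∫ r in (0 : ℝ)..s, ∫ x, ψ x ∂gain r)
        - L * ∫ r in (0 : ℝ)..s, ∫ x, ψ x ∂m r := by
    intro s hs
    have hm' : ∀ r ∈ Set.Icc 0 s, ∫⁻ x, ENNReal.ofReal (ψ x) ∂m r ≤ B :=
      fun r hr => hm r ⟨hr.1, hr.2.trans hs.2⟩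
    obtain ⟨f1, f2⟩ := h.lintegral_gain_ne_top hφ hs.1 hB hm'
    obtain ⟨i1, e1⟩ := lintegral_eq_ofReal_interval hφ.lintegral_kernel hs.1 f1
    obtain ⟨i2, e2⟩ := lintegral_eq_ofReal_interval hφ.lintegral_kernel hs.1 f2
    simp only [e]
    refine ⟨i2, i1, ?_⟩
    have h2 := h s hs.1 _ hφ
    have g1 := ne_top_of_le_ne_top hB (hm' s ⟨hs.1, le_rfl⟩)
    have g2 := ne_top_of_le_ne_top hB (hm' 0 ⟨le_rfl, hs.1⟩)
    have h3 := congrArg ENNReal.toReal h2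
    rw [ENNReal.toReal_add g1 (ENNReal.mul_ne_top (by simp) f1), ENNReal.toReal_add g2 f2,
      ENNReal.toReal_mul, e1, e2, ENNReal.toReal_ofReal, ENNReal.toReal_ofReal] at h3
    · simp only [ENNReal.coe_toReal] at h3; linarith
    · exact intervalIntegral.integral_nonneg hs.1 fun _ _ => ENNReal.toReal_nonneg
    · exact intervalIntegral.integral_nonneg hs.1 fun _ _ => ENNReal.toReal_nonneg
  obtain ⟨i2, i1, _⟩ := key t ⟨ht, le_rfl⟩
  refine ⟨i2.sub (i1.const_mul _), fun s hs => ?_⟩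
  obtain ⟨j2, j1, e3⟩ := key s hs
  rw [intervalIntegral.integral_sub j2 (j1.const_mul _), intervalIntegral.integral_const_mul]
  beta_reduce
  rw [e3]
  ring

lemma isPrimitive (h : IsFlow L m gain) {ψ φ : X → ℝ} (hψ : Measurable ψ)
    (hψφ : ∀ x, |ψ x| ≤ φ x) {t : ℝ} (ht : 0 ≤ t) {B : ℝ≥0∞} (hB : B ≠ ∞)
    (hm : ∀ s ∈ Set.Icc 0 t, ∫⁻ x, ENNReal.ofReal (φ x) ∂m s ≤ B)
    (hgain : ∀ s ∈ Set.Icc 0 t, Integrable ψ (gain s)) :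
    IsPrimitive (fun s => ∫ x, ψ x ∂m s) (fun s => ∫ x, ψ x ∂gain s - L * ∫ x, ψ x ∂m s) t := by
  have hint : ∀ s ∈ Set.Icc 0 t, Integrable ψ (m s) := fun s hs => by
    refine ⟨hψ.aestronglyMeasurable, (lintegral_mono fun x => ?_).trans_lt
      ((hm s hs).trans_lt hB.lt_top)⟩
    rw [Real.enorm_eq_ofReal_abs]
    exact ENNReal.ofReal_le_ofReal (hψφ x)
  have hle : ∀ ε : ℝ, |ε| = 1 → ∀ s ∈ Set.Icc 0 t,
      ∫⁻ x, ENNReal.ofReal (max (ε * ψ x) 0) ∂m s ≤ B := fun ε hε s hs => by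
    refine (lintegral_mono fun x => ENNReal.ofReal_le_ofReal ?_).trans (hm s hs)
    refine max_le ((le_abs_self _).trans ?_) ((abs_nonneg _).trans (hψφ x))
    rw [abs_mul, hε, one_mul]; exact hψφ x
  have hp := h.isPrimitive_of_nonneg (ψ := fun x => max (1 * ψ x) 0) (by fun_prop)
    (fun x => le_max_right _ _) ht hB (hle 1 (by simp))
  have hn := h.isPrimitive_of_nonneg (ψ := fun x => max (-1 * ψ x) 0) (by fun_prop)
    (fun x => le_max_right _ _) ht hB (hle (-1) (by simp))
  have hsplit : ∀ μ : Measure X, Integrable ψ μ →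
      ∫ x, ψ x ∂μ = ∫ x, max (1 * ψ x) 0 ∂μ + -1 * ∫ x, max (-1 * ψ x) 0 ∂μ := fun μ hμ => by
    have := integral_eq_integral_pos_part_sub_integral_neg_part hμ
    simp only [Real.coe_toNNReal'] at this
    simp only [one_mul, neg_mul]
    rw [this]; ring
  refine (hp.add (hn.const_mul (-1))).congr ht (fun s hs => hsplit _ (hint s hs)) fun s hs => ?_
  rw [hsplit _ (hint s hs), hsplit _ (hgain s hs)]; ring

lemma isPrimitive_of_bounded (h : IsFlow L m gain) [IsMarkovKernel m] [IsFiniteKernel gain]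
    {ψ : X → ℝ} (hψ : Measurable ψ) {K : ℝ} (hK : ∀ x, |ψ x| ≤ K) {t : ℝ} (ht : 0 ≤ t) :
    IsPrimitive (fun s => ∫ x, ψ x ∂m s) (fun s => ∫ x, ψ x ∂gain s - L * ∫ x, ψ x ∂m s) t :=
  h.isPrimitive hψ hK ht (B := ENNReal.ofReal K) (by simp) (fun s _ => by simp)
    fun s _ => Integrable.of_bound hψ.aestronglyMeasurable K (ae_of_all _ hK)

end IsFlow

/-! ### Existence of pure jump flows -/

/-- The kernel `t ↦ 1_{(0, t]} ds`. -/
noncomputable def timeKernel : Kernel ℝ ℝ :=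
  Kernel.withDensity (Kernel.const ℝ volume)
    fun t s => ((if s ∈ Set.Ioc 0 t then 1 else 0 : ℝ≥0) : ℝ≥0∞)

instance : IsSFiniteKernel timeKernel := by unfold timeKernel; infer_instance

lemma lintegral_timeKernel {F : ℝ → ℝ≥0∞} (hF : Measurable F) (t : ℝ) :
    ∫⁻ s, F s ∂timeKernel t = ∫⁻ s in Set.Ioc 0 t, F s := by
  have hm : MeasurableSet {p : ℝ × ℝ | p.2 ∈ Set.Ioc 0 p.1} :=
    (measurableSet_lt measurable_const measurable_snd).inter
      (measurableSet_le measurable_snd measurable_fst)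
  rw [timeKernel, Kernel.lintegral_withDensity _ _ _ hF, Kernel.const_apply,
    ← lintegral_indicator measurableSet_Ioc]
  · refine lintegral_congr fun s => ?_
    by_cases hs : s ∈ Set.Ioc 0 t <;> simp [Set.indicator, hs]
  · exact (Measurable.ite hm measurable_const measurable_const).coe_nnreal_ennreal

/-- The law after exactly `n` jumps of the jump process with rate kernel `R`, multiplied by the
inverse of the probability of having no jump. -/
noncomputable def jumpTerm (R : Kernel (ℝ × X) X) (m₀ : Measure X) : ℕ → Kernel ℝ X
  | 0 => Kernel.const ℝ m₀
  | n + 1 => (R ∘ₖ (Kernel.id ×ₖ jumpTerm R m₀ n)) ∘ₖ timeKernel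

variable (R : Kernel (ℝ × X) X)

lemma lintegral_comp_id_prod (m : Kernel ℝ X) [IsSFiniteKernel m] {φ : X → ℝ≥0∞}
    (hφ : Measurable φ) (s : ℝ) :
    ∫⁻ x, φ x ∂(R ∘ₖ (Kernel.id ×ₖ m)) s = ∫⁻ x, ∫⁻ y, φ y ∂(R (s, x)) ∂m s := by
  rw [Kernel.lintegral_comp _ _ _ hφ, Kernel.lintegral_id_prod (hφ.lintegral_kernel)]

lemma measurable_lintegral_jump (m : Kernel ℝ X) [IsSFiniteKernel m] {φ : X → ℝ≥0∞}
    (hφ : Measurable φ) : Measurable fun s => ∫⁻ x, ∫⁻ y, φ y ∂(R (s, x)) ∂m s := by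
  simp_rw [← lintegral_comp_id_prod R m hφ]
  exact hφ.lintegral_kernel

variable [IsFiniteKernel R] (m₀ : Measure X) [IsProbabilityMeasure m₀]

instance (n : ℕ) : IsSFiniteKernel (jumpTerm R m₀ n) := by
  induction n with
  | zero => unfold jumpTerm; infer_instance
  | succ n ih => unfold jumpTerm; infer_instance

lemma lintegral_jumpTerm_succ {φ : X → ℝ≥0∞} (hφ : Measurable φ) (n : ℕ) (t : ℝ) :
    ∫⁻ x, φ x ∂jumpTerm R m₀ (n + 1) t =
      ∫⁻ s in Set.Ioc 0 t, ∫⁻ x, ∫⁻ y, φ y ∂(R (s, x)) ∂jumpTerm R m₀ n s := by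
  rw [jumpTerm, Kernel.lintegral_comp _ _ _ hφ, lintegral_timeKernel hφ.lintegral_kernel]
  simp_rw [lintegral_comp_id_prod R _ hφ]

lemma sum_jumpTerm_succ {φ : X → ℝ≥0∞} (hφ : Measurable φ) (n : ℕ) (t : ℝ) :
    ∑ k ∈ Finset.range (n + 1), ∫⁻ x, φ x ∂jumpTerm R m₀ k t =
      ∫⁻ x, φ x ∂m₀ + ∫⁻ s in Set.Ioc 0 t,
        ∑ k ∈ Finset.range n, ∫⁻ x, ∫⁻ y, φ y ∂(R (s, x)) ∂jumpTerm R m₀ k s := by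
  rw [Finset.sum_range_succ', add_comm, lintegral_finsetSum _ fun k _ =>
    measurable_lintegral_jump R _ hφ]
  simp_rw [lintegral_jumpTerm_succ R m₀ hφ]
  rfl

lemma one_add_lintegral_exp (L : ℝ≥0) {t : ℝ} (ht : 0 ≤ t) :
    1 + ∫⁻ s in Set.Ioc 0 t, L * ENNReal.ofReal (Real.exp (L * s)) =
      ENNReal.ofReal (Real.exp (L * t)) := by
  have h1 : ∀ s : ℝ, (L : ℝ≥0∞) * ENNReal.ofReal (Real.exp (L * s)) =
      ENNReal.ofReal (L * Real.exp (L * s)) := fun s => by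
    rw [ENNReal.ofReal_mul (by positivity), ENNReal.ofReal_coe_nnreal]
  have hp := IsPrimitive.exp (L : ℝ) (t := t)
  have h2 := hp.2 t ⟨ht, le_rfl⟩
  simp only [mul_zero, Real.exp_zero] at h2
  simp_rw [h1]
  rw [← ofReal_integral_eq_lintegral_ofReal, ← intervalIntegral.integral_of_le ht,
    ← ENNReal.ofReal_one, ← ENNReal.ofReal_add zero_le_one, ← h2]
  · exact intervalIntegral.integral_nonneg ht fun _ _ => by positivity
  · exact (intervalIntegrable_iff_integrableOn_Ioc_of_le ht).1 hp.1
  · exact ae_of_all _ fun s => by positivity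

/-- By induction on `n`, because `B e^{Lt}` is a supersolution of the recursion `sum_jumpTerm_succ`.
The additive constant `d` brings in the total mass of the partial sums; `hd` carries the factor `d`
so that it is void for `d = 0`, the case from which the mass bound is deduced. -/
lemma sum_jumpTerm_le {L : ℝ≥0} {φ : X → ℝ≥0∞} (hφ : Measurable φ) {c d B : ℝ≥0∞}
    (hR : ∀ s x, ∫⁻ y, φ y ∂(R (s, x)) ≤ c * φ x + d) (hB : c * B + d ≤ L * B)
    (h0 : ∫⁻ x, φ x ∂m₀ ≤ B)
    (hd : ∀ n, ∀ t : ℝ, 0 ≤ t → d * ∑ k ∈ Finset.range n, jumpTerm R m₀ k t Set.univ ≤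
      d * ENNReal.ofReal (Real.exp (L * t))) (n : ℕ) :
    ∀ t : ℝ, 0 ≤ t → ∑ k ∈ Finset.range n, ∫⁻ x, φ x ∂jumpTerm R m₀ k t ≤
      B * ENNReal.ofReal (Real.exp (L * t)) := by
  induction n with
  | zero => simp
  | succ n ih =>
    intro t ht
    rw [sum_jumpTerm_succ R m₀ hφ, ← one_add_lintegral_exp L ht, mul_add, mul_one,
      ← lintegral_const_mul _ (by fun_prop)]
    refine add_le_add h0 (setLIntegral_mono (by fun_prop) fun s hs => ?_)
    calc ∑ k ∈ Finset.range n, ∫⁻ x, ∫⁻ y, φ y ∂(R (s, x)) ∂jumpTerm R m₀ k s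
        ≤ ∑ k ∈ Finset.range n, (c * ∫⁻ x, φ x ∂jumpTerm R m₀ k s
            + d * jumpTerm R m₀ k s Set.univ) := by
          refine Finset.sum_le_sum fun k _ => ?_
          rw [← lintegral_const_mul _ hφ, ← lintegral_const, ← lintegral_add_right _ (by fun_prop)]
          exact lintegral_mono fun x => hR s x
      _ ≤ c * (B * ENNReal.ofReal (Real.exp (L * s))) + d * ENNReal.ofReal (Real.exp (L * s)) := by
          rw [Finset.sum_add_distrib, ← Finset.mul_sum, ← Finset.mul_sum]
          exact add_le_add (by gcongr; exact ih s hs.1.le) (hd n s hs.1.le)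
      _ = (c * B + d) * ENNReal.ofReal (Real.exp (L * s)) := by ring
      _ ≤ L * B * ENNReal.ofReal (Real.exp (L * s)) := by gcongr
      _ = _ := by ring

lemma sum_jumpTerm_univ_le {L : ℝ≥0} (hL : ∀ p, R p Set.univ = L) (n : ℕ) (t : ℝ) (ht : 0 ≤ t) :
    ∑ k ∈ Finset.range n, jumpTerm R m₀ k t Set.univ ≤ ENNReal.ofReal (Real.exp (L * t)) := by
  have := sum_jumpTerm_le R m₀ (L := L) (φ := fun _ => 1) measurable_const (c := L) (d := 0)
    (B := 1) (by simp [hL]) (by simp) (by simp) (by simp) n t ht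
  simpa using this

/-- The full series solves the equation without loss term; the factor `e^{-Lt}` will restore the
loss. -/
lemma lintegral_sum_jumpTerm {φ : X → ℝ≥0∞} (hφ : Measurable φ) (t : ℝ) :
    ∫⁻ x, φ x ∂Kernel.sum (jumpTerm R m₀) t = ∫⁻ x, φ x ∂m₀ +
      ∫⁻ s in Set.Ioc 0 t, ∫⁻ x, ∫⁻ y, φ y ∂(R (s, x)) ∂Kernel.sum (jumpTerm R m₀) s := by
  simp_rw [Kernel.sum_apply, lintegral_sum_measure]
  rw [lintegral_tsum fun k => (measurable_lintegral_jump R _ hφ).aemeasurable,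
    tsum_eq_zero_add' ENNReal.summable]
  simp_rw [lintegral_jumpTerm_succ R m₀ hφ]
  rfl

/-- The flow of the pure jump process with rate kernel `R` of constant total mass `L`. -/
theorem exists_jumpFlow {L : ℝ≥0} (hL : ∀ p, R p Set.univ = L) :
    ∃ m : Kernel ℝ X, IsMarkovKernel m ∧ m 0 = m₀ ∧ IsFlow L m (R ∘ₖ (Kernel.id ×ₖ m)) ∧
      ∀ (φ : X → ℝ≥0∞) (c d B : ℝ≥0∞), Measurable φ →
        (∀ s x, ∫⁻ y, φ y ∂(R (s, x)) ≤ c * φ x + d) → c * B + d ≤ L * B → ∫⁻ x, φ x ∂m₀ ≤ B →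
        ∀ t, 0 ≤ t → ∫⁻ x, φ x ∂m t ≤ B := by
  set M := Kernel.sum (jumpTerm R m₀) with hM
  have hle : ∀ t, 0 ≤ t → M t Set.univ ≤ ENNReal.ofReal (Real.exp (L * t)) := by
    intro t ht
    rw [hM, Kernel.sum_apply, Measure.sum_apply _ MeasurableSet.univ]
    exact ENNReal.tsum_le_of_sum_range_le fun n => sum_jumpTerm_univ_le R m₀ hL n t ht
  have hprim : ∀ S, MeasurableSet S → ∀ t, 0 ≤ t → IsPrimitive (fun s => (M s).real S)
      (fun s => (∫⁻ x, R (s, x) S ∂M s).toReal) t := by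
    intro S hS t ht
    have hmeas : Measurable fun s => ∫⁻ x, R (s, x) S ∂M s := by
      have := measurable_lintegral_jump R M (φ := S.indicator 1) (measurable_one.indicator hS)
      simpa [lintegral_indicator_one hS] using this
    have heq : ∀ s, M s S = m₀ S + ∫⁻ r in Set.Ioc 0 s, ∫⁻ x, R (r, x) S ∂M r := by
      intro s
      have := lintegral_sum_jumpTerm R m₀ (φ := S.indicator 1) (measurable_one.indicator hS) s
      simpa [lintegral_indicator_one hS] using this
    have hfin : ∀ s, 0 ≤ s → ∫⁻ r in Set.Ioc 0 s, ∫⁻ x, R (r, x) S ∂M r ≠ ∞ := fun s hs =>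
      ne_top_of_le_ne_top ENNReal.ofReal_ne_top
        ((heq s ▸ le_add_self).trans ((measure_mono (Set.subset_univ S)).trans (hle s hs)))
    refine ⟨(lintegral_eq_ofReal_interval hmeas ht (hfin t ht)).1, fun s hs => ?_⟩
    obtain ⟨_, e⟩ := lintegral_eq_ofReal_interval hmeas hs.1 (hfin s hs.1)
    have h0 : M 0 S = m₀ S := by simpa using heq 0
    simp only [Measure.real]
    rw [ heq s, e, ENNReal.toReal_add (measure_ne_top _ _) (by simp),
      ENNReal.toReal_ofReal (intervalIntegral.integral_nonneg hs.1
        fun _ _ => ENNReal.toReal_nonneg), h0]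
  have hM0 : ∀ t, t ≤ 0 → M t = m₀ := by
    intro t ht
    ext S hS
    have := lintegral_sum_jumpTerm R m₀ (φ := S.indicator 1) (measurable_one.indicator hS) t
    simpa [lintegral_indicator_one hS, Set.Ioc_eq_empty (not_lt.2 ht)] using this
  -- The mass solves `y' = L y` with `y 0 = 1`.
  have hmass : ∀ t, 0 ≤ t → (M t).real Set.univ = Real.exp (L * t) := by
    intro t ht
    have h1 := (hprim _ MeasurableSet.univ t ht).mul (IsPrimitive.exp (-L : ℝ)) ht
    have h2 := h1.2 t ⟨ht, le_rfl⟩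
    have h3 : ∀ s, (∫⁻ x, R (s, x) Set.univ ∂M s).toReal = L * (M s).real Set.univ := by
      intro s; simp [hL, Measure.real]
    simp only [h3, neg_mul] at h2
    rw [intervalIntegral.integral_congr (g := fun _ => (0 : ℝ)) (fun s _ => by ring)] at h2
    simp only [hM0 0 le_rfl, Real.exp_neg, mul_zero, Real.exp_zero, intervalIntegral.integral_zero,
      probReal_univ] at h2
    field_simp at h2
    linarith
  -- The maximum with `0` makes `m` a probability at negative times as well, where `M` is `m₀`.
  let w : ℝ → ℝ≥0∞ := fun t => ENNReal.ofReal (Real.exp (-(L * max t 0)))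
  have hw : Measurable w := by fun_prop
  let m : Kernel ℝ X := ⟨fun t => w t • M t, Measure.measurable_of_measurable_coe _ fun S hS => by
    exact hw.mul (M.measurable_coe hS)⟩
  have hm : ∀ t, m t = w t • M t := fun t => rfl
  have hmk : IsMarkovKernel m := by
    refine ⟨fun t => ⟨?_⟩⟩
    rcases le_total 0 t with ht | ht
    · have h1 : M t Set.univ = ENNReal.ofReal (Real.exp (L * t)) := by
        rw [← hmass t ht, Measure.real, ENNReal.ofReal_toReal]
        exact ne_top_of_le_ne_top ENNReal.ofReal_ne_top (hle t ht)
      rw [hm, Measure.smul_apply, h1, smul_eq_mul, ← ENNReal.ofReal_mul (by positivity),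
        max_eq_left ht, ← Real.exp_add]
      simp
    · rw [hm, hM0 t ht]; simp [w, ht]
  have hreal : ∀ t, 0 ≤ t → ∀ S, (m t).real S = Real.exp (-L * t) * (M t).real S := by
    intro t ht S
    rw [hm, measureReal_ennreal_smul_apply, ENNReal.toReal_ofReal (by positivity), max_eq_left ht,
      neg_mul]
  refine ⟨m, hmk, ?_, isFlow_of_real (fun s => ?_) fun t ht S hS => ?_, ?_⟩
  · rw [hm, hM0 0 le_rfl]; simp [w]
  · have := lintegral_comp_id_prod R m (φ := fun _ => 1) measurable_const s
    simp only [lintegral_const, one_mul, hL, measure_univ, mul_one] at this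
    exact this.le
  · have h1 := (IsPrimitive.exp (-L : ℝ)).mul (hprim S hS t ht) ht
    have h2 := h1.2 t ⟨ht, le_rfl⟩
    beta_reduce at h2
    rw [hreal t ht, h2, hreal 0 le_rfl]
    congr 1
    refine intervalIntegral.integral_congr fun s hs => ?_
    rw [Set.uIcc_of_le ht] at hs
    have h3 := lintegral_comp_id_prod R m (φ := S.indicator 1) (measurable_one.indicator hS) s
    simp only [lintegral_indicator_one hS] at h3
    simp only [Measure.real, h3]
    rw [hm, lintegral_smul_measure, smul_eq_mul, ENNReal.toReal_mul, Measure.smul_apply,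
      smul_eq_mul, ENNReal.toReal_mul, ENNReal.toReal_ofReal (by positivity), max_eq_left hs.1]
    ring_nf
  · intro φ c d B hφ hR hB h0 t ht
    have h1 : ∫⁻ x, φ x ∂M t ≤ B * ENNReal.ofReal (Real.exp (L * t)) := by
      rw [hM, Kernel.sum_apply, lintegral_sum_measure]
      refine ENNReal.tsum_le_of_sum_range_le fun n =>
        sum_jumpTerm_le R m₀ hφ hR hB h0 (fun n t ht => ?_) n t ht
      gcongr
      exact sum_jumpTerm_univ_le R m₀ hL n t ht
    rw [hm, lintegral_smul_measure, smul_eq_mul]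
    calc _ ≤ w t * (B * ENNReal.ofReal (Real.exp (L * t))) := by gcongr
      _ = B * (w t * ENNReal.ofReal (Real.exp (L * t))) := by ring
      _ = B := by
        rw [← ENNReal.ofReal_mul (by positivity), max_eq_left ht, ← Real.exp_add]
        simp

end Flow

/-! ### The uniform angle -/

section Angle

open Real

lemma angleLaw_eq : angleLaw = ENNReal.ofReal (2 * π)⁻¹ • volume.restrict (Set.Ioc 0 (2 * π)) := by
  rw [angleLaw, restrict_Ico_eq_restrict_Ioc]

instance : IsProbabilityMeasure angleLaw := by
  refine ⟨?_⟩
  rw [angleLaw_eq]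
  simp only [Measure.smul_apply, Measure.restrict_apply MeasurableSet.univ, Set.univ_inter,
    Real.volume_Ioc, smul_eq_mul, sub_zero]
  rw [← ENNReal.ofReal_mul (by positivity), inv_mul_cancel₀ (by positivity), ENNReal.ofReal_one]

lemma integral_angleLaw (F : ℝ → ℝ) :
    ∫ θ, F θ ∂angleLaw = (2 * π)⁻¹ * ∫ θ in (0 : ℝ)..2 * π, F θ := by
  rw [angleLaw_eq, integral_smul_measure, intervalIntegral.integral_of_le (by positivity),
    ENNReal.toReal_ofReal (by positivity), smul_eq_mul]

lemma integral_cos_sq_angleLaw : ∫ θ, cos θ ^ 2 ∂angleLaw = 1 / 2 := by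
  rw [integral_angleLaw, integral_cos_sq]
  simp; field_simp

lemma integral_sin_sq_angleLaw : ∫ θ, sin θ ^ 2 ∂angleLaw = 1 / 2 := by
  rw [integral_angleLaw, integral_sin_sq]
  simp; field_simp

lemma integral_cos_mul_sin_angleLaw : ∫ θ, cos θ * sin θ ∂angleLaw = 0 := by
  rw [integral_angleLaw]
  have : ∀ θ, cos θ * sin θ = sin θ * cos θ := fun θ => mul_comm _ _
  simp [this, integral_sin_mul_cos₁]

lemma integral_abs_sin_rpow_angleLaw (r : ℝ) :
    ∫ θ, |sin θ| ^ r ∂angleLaw = ∫ θ, |cos θ| ^ r ∂angleLaw := by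
  rw [integral_angleLaw, integral_angleLaw]
  congr 1
  have h : Function.Periodic (fun θ => |cos θ| ^ r) (2 * π) := fun θ => by simp
  have h1 : ∀ θ, |sin θ| ^ r = (fun θ => |cos θ| ^ r) (θ - π / 2) := fun θ => by
    simp [cos_sub_pi_div_two]
  simp_rw [h1]
  rw [intervalIntegral.integral_comp_sub_right (fun θ => |cos θ| ^ r)]
  have := h.intervalIntegral_add_eq (0 - π / 2) 0
  rw [zero_add] at this
  rw [← this]
  congr 1; ring

/-- By the reflection `θ ↦ 2π - θ`. It reconciles the minus sign of the rotation of particle `i`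
with the plus sign in `collision`. -/
lemma integral_angleLaw_neg_sin (φ : ℝ → ℝ → ℝ) :
    ∫ θ, φ (cos θ) (-sin θ) ∂angleLaw = ∫ θ, φ (cos θ) (sin θ) ∂angleLaw := by
  have h1 : ∀ θ, φ (cos θ) (-sin θ) = (fun θ => φ (cos θ) (sin θ)) (2 * π - θ) := fun θ => by
    simp [cos_two_pi_sub, sin_two_pi_sub]
  simp_rw [h1]
  rw [integral_angleLaw, integral_angleLaw,
    intervalIntegral.integral_comp_sub_left (fun θ => φ (cos θ) (sin θ))]
  simp

end Angle

/-! ### Quantile functions -/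

/-- The uniform distribution on `(0, 1)`. -/
noncomputable def unitLaw : Measure ℝ := volume.restrict (Set.Ioo 0 1)

instance : IsProbabilityMeasure unitLaw := ⟨by simp [unitLaw]⟩

/-- The quantile function of a distribution on the line. -/
noncomputable def quantile (ν : Measure ℝ) (p : ℝ) : ℝ :=
  -- The value `0` outside `(0, 1)` is not seen by `unitLaw` and is compatible with dilations.
  open Classical in if p ∈ Set.Ioo 0 1 then sInf {x | p ≤ ν.real (Set.Iic x)} else 0

/-- The Galois connection between quantile and distribution function: right continuity of the latter
puts the infimum in the set. -/
lemma quantile_le_iff (ν : Measure ℝ) [IsProbabilityMeasure ν] {p : ℝ} (hp : p ∈ Set.Ioo 0 1)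
    (x : ℝ) : quantile ν p ≤ x ↔ p ≤ ν.real (Set.Iic x) := by
  rw [quantile, if_pos hp]
  have hcdf : ∀ x, ν.real (Set.Iic x) = cdf ν x := fun x => (cdf_eq_real ν x).symm
  simp_rw [hcdf]
  have hne : {x | p ≤ cdf ν x}.Nonempty := by
    obtain ⟨x, hx⟩ := ((tendsto_cdf_atTop ν).eventually (lt_mem_nhds hp.2)).exists
    exact ⟨x, hx.le⟩
  have hbdd : BddBelow {x | p ≤ cdf ν x} := by
    obtain ⟨y, hy⟩ := ((tendsto_cdf_atBot ν).eventually (gt_mem_nhds hp.1)).exists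
    refine ⟨y, fun x hx => ?_⟩
    by_contra! h
    exact absurd ((cdf ν).mono h.le) (not_le.2 (hy.trans_le hx))
  constructor
  · intro h
    have h1 : ∀ y, x < y → p ≤ cdf ν y := fun y hy => by
      obtain ⟨z, hz, hzy⟩ := (csInf_lt_iff hbdd hne).1 (h.trans_lt hy)
      exact le_trans hz ((cdf ν).mono hzy.le)
    have h2 : Tendsto (cdf ν) (𝓝[>] x) (𝓝 (cdf ν x)) :=
      ((cdf ν).right_continuous x).mono_left (nhdsWithin_mono _ Set.Ioi_subset_Ici_self)
    exact ge_of_tendsto h2 (by filter_upwards [self_mem_nhdsWithin] with y hy using h1 y hy)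
  · exact fun h => csInf_le hbdd h

lemma measurable_quantile_kernel (m : Kernel ℝ ℝ) [IsMarkovKernel m] :
    Measurable fun q : ℝ × ℝ => quantile (m q.1) q.2 := by
  classical
  refine measurable_of_Iic fun x => ?_
  have h1 : MeasurableSet {q : ℝ × ℝ | q.2 ∈ Set.Ioo 0 1} := measurable_snd measurableSet_Ioo
  have h2 : Measurable fun q : ℝ × ℝ => (m q.1).real (Set.Iic x) :=
    ((m.measurable_coe measurableSet_Iic).comp measurable_fst).ennreal_toReal
  have : (fun q : ℝ × ℝ => quantile (m q.1) q.2) ⁻¹' Set.Iic x =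
      ({q : ℝ × ℝ | q.2 ∈ Set.Ioo 0 1} ∩ {q | q.2 ≤ (m q.1).real (Set.Iic x)}) ∪
      ({q : ℝ × ℝ | q.2 ∈ Set.Ioo 0 1}ᶜ ∩ {_q | 0 ≤ x}) := by
    ext q
    by_cases hq : q.2 ∈ Set.Ioo 0 1
    · have := quantile_le_iff (m q.1) hq x
      simp only [Set.mem_preimage, Set.mem_Iic, this]
      simp [Set.mem_Ioo.1 hq]
    · simp only [Set.mem_preimage, Set.mem_Iic, quantile, Set.mem_union,
        Set.mem_inter_iff, Set.mem_ofPred_eq, Set.mem_compl_iff, hq, false_and, not_false_eq_true,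
        true_and, false_or, if_false]
  rw [this]
  exact (h1.inter (measurableSet_le measurable_snd h2)).union
    (h1.compl.inter (MeasurableSet.const _))

lemma measurable_quantile (ν : Measure ℝ) [IsProbabilityMeasure ν] : Measurable (quantile ν) :=
  (measurable_quantile_kernel (Kernel.const ℝ ν)).comp (measurable_prodMk_left (x := (0 : ℝ)))

lemma map_quantile (ν : Measure ℝ) [IsProbabilityMeasure ν] : unitLaw.map (quantile ν) = ν := by
  have : IsProbabilityMeasure (unitLaw.map (quantile ν)) :=
    Measure.isProbabilityMeasure_map (measurable_quantile ν).aemeasurable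
  refine Measure.ext_of_Iic _ _ fun x => ?_
  rw [Measure.map_apply (measurable_quantile ν) measurableSet_Iic, unitLaw,
    Measure.restrict_apply (measurable_quantile ν measurableSet_Iic)]
  have : quantile ν ⁻¹' Set.Iic x ∩ Set.Ioo 0 1 = Set.Iic (ν.real (Set.Iic x)) ∩ Set.Ioo 0 1 := by
    ext p
    simp only [Set.mem_inter_iff, Set.mem_preimage, Set.mem_Iic, and_congr_left_iff]
    exact fun hp => quantile_le_iff ν hp x
  have h0 : Set.Ioo (0 : ℝ) (ν.real (Set.Iic x)) ⊆ Set.Iic (ν.real (Set.Iic x)) ∩ Set.Ioo 0 1 :=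
    fun p hp => ⟨hp.2.le, hp.1, hp.2.trans_le measureReal_le_one⟩
  have h1 : Set.Iic (ν.real (Set.Iic x)) ∩ Set.Ioo 0 1 ⊆ Set.Ioc (0 : ℝ) (ν.real (Set.Iic x)) :=
    fun p hp => ⟨hp.2.1, hp.1⟩
  rw [this]
  apply le_antisymm
  · refine (measure_mono h1).trans ?_
    rw [Real.volume_Ioc, sub_zero, ofReal_measureReal]
  · refine le_trans ?_ (measure_mono h0)
    rw [Real.volume_Ioo, sub_zero, ofReal_measureReal]

lemma lintegral_quantile (ν : Measure ℝ) [IsProbabilityMeasure ν] {φ : ℝ → ℝ≥0∞}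
    (hφ : Measurable φ) : ∫⁻ p, φ (quantile ν p) ∂unitLaw = ∫⁻ x, φ x ∂ν := by
  conv_rhs => rw [← map_quantile ν, lintegral_map hφ (measurable_quantile ν)]

/-- The cells `(k / n, (k + 1) / n]` tile `(0, 1]`: a uniform point of a uniformly chosen cell is
uniform. -/
lemma sum_lintegral_unitLaw {G : ℝ → ℝ≥0∞} {n : ℕ} (hn : n ≠ 0) :
    ∑ k ∈ Finset.range n, ∫⁻ ρ, G ((k + ρ) / n) ∂unitLaw = n * ∫⁻ p, G p ∂unitLaw := by
  have hn' : (0 : ℝ) < n := by positivity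
  have key : ∀ m : ℕ, ∑ k ∈ Finset.range m, ∫⁻ ρ, G ((k + ρ) / n) ∂unitLaw =
      n * ∫⁻ p in Set.Ioc 0 ((m : ℝ) / n), G p := by
    intro m
    induction m with
    | zero => simp
    | succ m ih =>
      have hd : ∀ x ∈ Set.Ioc (0 : ℝ) 1, HasDerivWithinAt (fun ρ : ℝ => ((m : ℝ) + ρ) / n)
          (1 / (n : ℝ)) (Set.Ioc 0 1) x := fun x _ =>
        (((hasDerivAt_id x).const_add (m : ℝ)).div_const (n : ℝ)).hasDerivWithinAt
      have himg : (fun ρ : ℝ => ((m : ℝ) + ρ) / n) '' Set.Ioc 0 1 =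
          Set.Ioc ((m : ℝ) / n) ((m + 1 : ℕ) / n) := by
        ext y
        simp only [Set.mem_image, Set.mem_Ioc]
        constructor
        · rintro ⟨ρ, ⟨h1, h2⟩, rfl⟩
          constructor
          · gcongr; linarith
          · push_cast; gcongr
        · rintro ⟨h1, h2⟩
          refine ⟨n * y - m, ⟨?_, ?_⟩, ?_⟩
          · rw [div_lt_iff₀ hn'] at h1; linarith
          · rw [le_div_iff₀ hn'] at h2; push_cast at h2; linarith
          · field_simp; ring
      have h1 := lintegral_image_eq_lintegral_abs_deriv_mul measurableSet_Ioc hd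
        (fun x _ y _ h => by
          have h' : ((m : ℝ) + x) / n = (m + y) / n := h
          rw [div_left_inj' hn'.ne'] at h'
          linarith) G
      rw [himg, lintegral_const_mul' _ _ ENNReal.ofReal_ne_top, abs_of_pos (by positivity)] at h1
      have h2 : Set.Ioc 0 (((m + 1 : ℕ) : ℝ) / n) =
          Set.Ioc 0 ((m : ℝ) / n) ∪ Set.Ioc ((m : ℝ) / n) ((m + 1 : ℕ) / n) := by
        rw [Set.Ioc_union_Ioc_eq_Ioc (by positivity)]
        gcongr; simp
      rw [Finset.sum_range_succ, ih, h2, lintegral_union measurableSet_Ioc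
        (Set.disjoint_left.2 fun x hx hy => absurd hx.2 (not_le.2 hy.1)), mul_add, h1, ← mul_assoc,
        ← ENNReal.ofReal_natCast, ← ENNReal.ofReal_mul hn'.le, mul_one_div_cancel hn'.ne',
        ENNReal.ofReal_one, one_mul, unitLaw, restrict_Ioo_eq_restrict_Ioc]
  rw [key n, div_self hn'.ne', unitLaw, restrict_Ioo_eq_restrict_Ioc]

/-! ### Ranks and the monotone coupling -/

section Rank

/-- The distribution function of the empirical measure of `(u j)`, `j ∈ S`. -/
noncomputable def empiricalCdf {ι : Type*} (S : Finset ι) (u : ι → ℝ) (x : ℝ) : ℝ :=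
  (S.filter fun l => u l ≤ x).card / S.card

lemma empiricalCdf_mem {ι : Type*} {S : Finset ι} (u : ι → ℝ) (x : ℝ) : empiricalCdf S u x ∈ Set.Icc (0 : ℝ) 1 := by
  refine ⟨by unfold empiricalCdf; positivity, div_le_one_of_le₀ ?_ (by positivity)⟩
  exact_mod_cast Finset.card_filter_le _ _


variable {ι : Type*} [LinearOrder ι] (S : Finset ι) (u : ι → ℝ)

/-- The number of indices of `S` preceding `j` when the values of `u` are sorted. -/
noncomputable def rank (j : ι) : ℕ := (S.filter fun l => u l < u j ∨ (u l = u j ∧ l < j)).card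

variable {S}

lemma rank_lt {j : ι} (hj : j ∈ S) : rank S u j < S.card :=
  Finset.card_lt_card ⟨Finset.filter_subset _ _, fun h => by simpa using (Finset.mem_filter.1 (h hj)).2⟩

lemma rank_lt_rank {i j : ι} (hi : i ∈ S) (h : u i < u j ∨ (u i = u j ∧ i < j)) :
    rank S u i < rank S u j := by
  refine Finset.card_lt_card ⟨fun l hl => ?_, fun hsub => ?_⟩
  · simp only [Finset.mem_filter] at hl ⊢
    refine ⟨hl.1, ?_⟩
    rcases hl.2 with h1 | ⟨h1, h2⟩ <;> rcases h with h3 | ⟨h3, h4⟩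
    · exact Or.inl (h1.trans h3)
    · exact Or.inl (h3 ▸ h1)
    · exact Or.inl (h1 ▸ h3)
    · exact Or.inr ⟨h1.trans h3, h2.trans h4⟩
  · have := hsub (Finset.mem_filter.2 ⟨hi, h⟩)
    simp at this

lemma rank_injOn : Set.InjOn (rank S u) S := by
  intro i hi j hj hij
  by_contra hne
  rcases lt_trichotomy (u i) (u j) with h | h | h
  · exact (rank_lt_rank u hi (Or.inl h)).ne hij
  · rcases lt_or_gt_of_ne hne with h' | h'
    · exact (rank_lt_rank u hi (Or.inr ⟨h, h'⟩)).ne hij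
    · exact (rank_lt_rank u hj (Or.inr ⟨h.symm, h'⟩)).ne' hij
  · exact (rank_lt_rank u hj (Or.inl h)).ne' hij

lemma sum_rank {β : Type*} [AddCommMonoid β] (G : ℕ → β) :
    ∑ j ∈ S, G (rank S u j) = ∑ k ∈ Finset.range S.card, G k := by
  rw [← Finset.sum_image (rank_injOn u)]
  congr 1
  refine Finset.eq_of_subset_of_card_le (fun k hk => ?_) ?_
  · obtain ⟨j, hj, rfl⟩ := Finset.mem_image.1 hk
    exact Finset.mem_range.2 (rank_lt u hj)
  · rw [Finset.card_range, Finset.card_image_of_injOn (rank_injOn u)]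

/-- Expresses that `u j` is the empirical quantile at level `(rank + ρ) / card` for every `ρ` in
`(0, 1)`, also in the presence of ties. -/
lemma rank_add_le_iff {j : ι} (hj : j ∈ S) {ρ : ℝ} (hρ : ρ ∈ Set.Ioo 0 1) (x : ℝ) :
    (rank S u j : ℝ) + ρ ≤ (S.filter fun l => u l ≤ x).card ↔ u j ≤ x := by
  constructor
  · intro h
    by_contra! hx
    have : (S.filter fun l => u l ≤ x).card ≤ rank S u j := by
      refine Finset.card_le_card fun l hl => ?_
      simp only [Finset.mem_filter] at hl ⊢
      exact ⟨hl.1, Or.inl (hl.2.trans_lt hx)⟩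
    have : ((S.filter fun l => u l ≤ x).card : ℝ) ≤ rank S u j := by exact_mod_cast this
    linarith [hρ.1]
  · intro h
    have : rank S u j < (S.filter fun l => u l ≤ x).card := by
      refine Finset.card_lt_card ⟨fun l hl => ?_, fun hsub => ?_⟩
      · simp only [Finset.mem_filter] at hl ⊢
        refine ⟨hl.1, ?_⟩
        rcases hl.2 with h1 | ⟨h1, -⟩
        · exact h1.le.trans h
        · exact h1.le.trans h
      · have := hsub (Finset.mem_filter.2 ⟨hj, h⟩)
        simp at this
    have : (rank S u j : ℝ) + 1 ≤ (S.filter fun l => u l ≤ x).card := by exact_mod_cast this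
    linarith [hρ.2]

variable (S) in
/-- The quantile of `ν` associated with the `j`-th particle; `ρ` is a uniform variable. -/
noncomputable def partner (ν : Measure ℝ) (j : ι) (ρ : ℝ) : ℝ :=
  quantile ν ((rank S u j + ρ) / S.card)

lemma rank_add_div_mem {j : ι} (hj : j ∈ S) {ρ : ℝ} (hρ : ρ ∈ Set.Ioo 0 1) :
    ((rank S u j : ℝ) + ρ) / S.card ∈ Set.Ioo (0 : ℝ) 1 := by
  have h1 : (rank S u j : ℝ) + 1 ≤ S.card := by exact_mod_cast rank_lt u hj
  have h2 : (0 : ℝ) < S.card := by linarith [(rank S u j).cast_nonneg (α := ℝ)]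
  have h3 := (rank S u j).cast_nonneg (α := ℝ)
  exact ⟨div_pos (by linarith [hρ.1]) h2, (div_lt_one h2).2 (by linarith [hρ.2])⟩

lemma measurable_partner (ν : Measure ℝ) [IsProbabilityMeasure ν] (j : ι) :
    Measurable (partner S u ν j) :=
  (measurable_quantile ν).comp (by fun_prop)

lemma sum_lintegral_rank (hS : S.Nonempty) (G : ℝ → ℝ≥0∞) :
    ∑ j ∈ S, ∫⁻ ρ, G ((rank S u j + ρ) / S.card) ∂unitLaw = S.card * ∫⁻ p, G p ∂unitLaw := by
  rw [sum_rank u (fun k => ∫⁻ ρ, G (((k : ℕ) + ρ) / S.card) ∂unitLaw)]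
  exact sum_lintegral_unitLaw hS.card_ne_zero

/-- Averaged over the particles, the partner has law `ν`. -/
lemma sum_lintegral_partner (hS : S.Nonempty) (ν : Measure ℝ) [IsProbabilityMeasure ν]
    {φ : ℝ → ℝ≥0∞} (hφ : Measurable φ) :
    ∑ j ∈ S, ∫⁻ ρ, φ (partner S u ν j ρ) ∂unitLaw = S.card * ∫⁻ x, φ x ∂ν := by
  rw [← lintegral_quantile ν hφ, ← sum_lintegral_rank u hS fun p => φ (quantile ν p)]
  rfl

/-- The right-hand side is `4 |x|` integrated between `a` and `b`: it equals `2 |b² - a²|` when the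
signs agree and `2 a² + 2 b²` otherwise. The constant `4` is sharp, for `b = -a`. -/
lemma sq_sub_le_lintegral (a b : ℝ) :
    ENNReal.ofReal ((a - b) ^ 2) ≤ ∫⁻ x, ENNReal.ofReal (4 * |x|) *
      ENNReal.ofReal |(Set.Ici a).indicator 1 x - (Set.Ici b).indicator (1 : ℝ → ℝ) x| := by
  wlog hab : a ≤ b generalizing a b
  · have := this b a (le_of_not_ge hab)
    rw [← neg_sub, neg_sq] at this
    simpa only [abs_sub_comm] using this
  have h1 : ∀ x, ENNReal.ofReal (4 * |x|) *
      ENNReal.ofReal |(Set.Ici a).indicator 1 x - (Set.Ici b).indicator (1 : ℝ → ℝ) x| =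
      (Set.Ico a b).indicator (fun x => ENNReal.ofReal (4 * |x|)) x := by
    intro x
    by_cases ha : a ≤ x <;> by_cases hb : b ≤ x
    · simp [Set.indicator, ha, hb, not_lt.2 hb]
    · simp [Set.indicator, ha, hb, lt_of_not_ge hb]
    · exact absurd (hab.trans hb) ha
    · simp [Set.indicator, ha, hb]
  simp_rw [h1]
  rw [lintegral_indicator measurableSet_Ico, restrict_Ico_eq_restrict_Ioc,
    ← ofReal_integral_eq_lintegral_ofReal, ← intervalIntegral.integral_of_le hab]
  rotate_left
  · exact (intervalIntegrable_iff_integrableOn_Ioc_of_le hab).1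
      (Continuous.intervalIntegrable (by fun_prop) _ _)
  · exact ae_of_all _ fun x => by positivity
  refine ENNReal.ofReal_le_ofReal ?_
  have hc : ∀ c d : ℝ, IntervalIntegrable (fun x : ℝ => 4 * |x|) volume c d := fun c d =>
    Continuous.intervalIntegrable (by fun_prop) _ _
  have hpos : ∀ c d : ℝ, 0 ≤ c → c ≤ d → ∫ x in c..d, 4 * |x| = 2 * d ^ 2 - 2 * c ^ 2 := by
    intro c d h0 h
    rw [intervalIntegral.integral_congr (g := fun x => 4 * x)]
    · rw [intervalIntegral.integral_const_mul, integral_id]; ring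
    · intro x hx
      rw [Set.uIcc_of_le h] at hx
      simp [abs_of_nonneg (h0.trans hx.1)]
  have hneg : ∀ c d : ℝ, d ≤ 0 → c ≤ d → ∫ x in c..d, 4 * |x| = 2 * c ^ 2 - 2 * d ^ 2 := by
    intro c d h0 h
    rw [intervalIntegral.integral_congr (g := fun x => -4 * x)]
    · rw [intervalIntegral.integral_const_mul, integral_id]; ring
    · intro x hx
      rw [Set.uIcc_of_le h] at hx
      beta_reduce; rw [abs_of_nonpos (hx.2.trans h0)]; ring
  rcases le_total 0 a with h | h
  · rw [hpos a b h hab]; nlinarith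
  rcases le_total b 0 with h' | h'
  · rw [hneg a b h' hab]; nlinarith
  · rw [← intervalIntegral.integral_add_adjacent_intervals (hc a 0) (hc 0 b), hneg a 0 le_rfl h,
      hpos 0 b le_rfl h']
    nlinarith [sq_nonneg (a + b)]

lemma lintegral_abs_indicator_Iic_sub {a b : ℝ} (ha : a ∈ Set.Icc 0 1) (hb : b ∈ Set.Icc 0 1) :
    ∫⁻ p, ENNReal.ofReal |(Set.Iic a).indicator 1 p - (Set.Iic b).indicator (1 : ℝ → ℝ) p|
      ∂unitLaw = ENNReal.ofReal |a - b| := by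
  wlog hab : a ≤ b generalizing a b
  · have := this hb ha (le_of_not_ge hab)
    rw [abs_sub_comm]
    simpa only [abs_sub_comm] using this
  have h1 : ∀ x, ENNReal.ofReal |(Set.Iic a).indicator 1 x - (Set.Iic b).indicator (1 : ℝ → ℝ) x| =
      (Set.Ioc a b).indicator 1 x := by
    intro x
    by_cases ha : x ≤ a <;> by_cases hb : x ≤ b
    · simp [Set.indicator, ha, hb, not_lt.2 ha]
    · exact absurd (ha.trans hab) hb
    · simp [Set.indicator, ha, hb, lt_of_not_ge ha]
    · simp [Set.indicator, ha, hb]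
  simp_rw [h1]
  rw [lintegral_indicator_one measurableSet_Ioc, unitLaw, restrict_Ioo_eq_restrict_Ioc,
    Measure.restrict_apply measurableSet_Ioc, Set.inter_eq_left.2, Real.volume_Ioc, abs_sub_comm,
    abs_of_nonneg (by linarith)]
  exact Set.Ioc_subset_Ioc ha.1 hb.2

/-- The cost of the monotone coupling is controlled by the distribution functions. -/
lemma sum_lintegral_sq_sub_partner_le (hS : S.Nonempty) (ν : Measure ℝ) [IsProbabilityMeasure ν] :
    ∑ j ∈ S, ∫⁻ ρ, ENNReal.ofReal ((u j - partner S u ν j ρ) ^ 2) ∂unitLaw ≤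
      S.card * ∫⁻ x, ENNReal.ofReal (4 * |x|) *
        ENNReal.ofReal |empiricalCdf S u x - ν.real (Set.Iic x)| := by
  have hcard : (0 : ℝ) < S.card := by exact_mod_cast hS.card_pos
  let I : ℝ → ℝ → ℝ := fun a x => (Set.Ici a).indicator 1 x
  have hI : ∀ a x, I a x = (Set.Iic x).indicator 1 a := fun a x => by
    by_cases h : a ≤ x <;> simp [I, Set.indicator, h]
  have hm : ∀ j, Measurable (Function.uncurry fun ρ x : ℝ => ENNReal.ofReal (4 * |x|) *
      ENNReal.ofReal |I (u j) x - I (partner S u ν j ρ) x|) := by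
    intro j
    have h1 : Measurable fun q : ℝ × ℝ => I (u j) q.2 :=
      (measurable_one.indicator measurableSet_Ici).comp measurable_snd
    have h2 : Measurable fun q : ℝ × ℝ => I (partner S u ν j q.1) q.2 := by
      have hset : MeasurableSet {q : ℝ × ℝ | partner S u ν j q.1 ≤ q.2} :=
        measurableSet_le ((measurable_partner u ν j).comp measurable_fst) measurable_snd
      exact (measurable_one.indicator hset :
        Measurable (Set.indicator {q : ℝ × ℝ | partner S u ν j q.1 ≤ q.2} (1 : ℝ × ℝ → ℝ)))
    have h3 : Measurable fun q : ℝ × ℝ => |I (u j) q.2 - I (partner S u ν j q.1) q.2| :=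
      continuous_abs.measurable.comp (h1.sub h2)
    have h4 : Measurable fun q : ℝ × ℝ => ENNReal.ofReal (4 * |q.2|) := by fun_prop
    exact h4.mul h3.ennreal_ofReal
  calc _ ≤ ∑ j ∈ S, ∫⁻ ρ, (∫⁻ x, ENNReal.ofReal (4 * |x|) *
        ENNReal.ofReal |I (u j) x - I (partner S u ν j ρ) x|) ∂unitLaw := by
        gcongr with j hj
        exact sq_sub_le_lintegral _ _
    _ = ∫⁻ x, ∑ j ∈ S, ∫⁻ ρ, ENNReal.ofReal (4 * |x|) *
        ENNReal.ofReal |I (u j) x - I (partner S u ν j ρ) x| ∂unitLaw := by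
        refine (Finset.sum_congr rfl fun j _ => lintegral_lintegral_swap (hm j).aemeasurable).trans
          (lintegral_finsetSum S fun j _ => (hm j).lintegral_prod_left').symm
    _ = ∫⁻ x, ENNReal.ofReal (4 * |x|) * (S.card *
        ENNReal.ofReal |empiricalCdf S u x - ν.real (Set.Iic x)|) := by
        refine lintegral_congr fun x => ?_
        rw [← lintegral_abs_indicator_Iic_sub (empiricalCdf_mem u x)
          ⟨measureReal_nonneg, measureReal_le_one⟩, ← sum_lintegral_rank u hS, Finset.mul_sum]
        refine Finset.sum_congr rfl fun j hj => ?_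
        rw [lintegral_const_mul' _ _ ENNReal.ofReal_ne_top]
        congr 1
        refine setLIntegral_congr_fun measurableSet_Ioo fun ρ hρ => ?_
        -- Both indicators compare one and the same level `(rank + ρ) / card` with a distribution
        -- function at `x`, the empirical one here and that of `ν` next.
        have h1 : I (u j) x = (Set.Iic (empiricalCdf S u x)).indicator (1 : ℝ → ℝ)
            ((rank S u j + ρ) / S.card) := by
          have := rank_add_le_iff u hj hρ x
          rw [← div_le_div_iff_of_pos_right hcard] at this
          by_cases h : u j ≤ x
          · simp [hI, Set.indicator, h, empiricalCdf, this.2 h]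
          · simp [hI, Set.indicator, h, empiricalCdf, mt this.1 h]
        have h2 : I (partner S u ν j ρ) x = (Set.Iic (ν.real (Set.Iic x))).indicator (1 : ℝ → ℝ)
            ((rank S u j + ρ) / S.card) := by
          have := quantile_le_iff ν (rank_add_div_mem u hj hρ) x
          by_cases h : partner S u ν j ρ ≤ x
          · simp [hI, Set.indicator, h, this.1 h]
          · simp [hI, Set.indicator, h, mt this.2 h]
        simp only [h1, h2]
    _ = _ := by
        rw [← lintegral_const_mul' _ _ (by simp)]
        refine lintegral_congr fun x => ?_
        ring

end Rank

/-- The distance of an empirical measure to `ν`, estimated by the coupling which attaches to the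
`j`-th atom the quantiles of `ν` given by the rank of `u j`. -/
lemma W2Line_empirical_sq_le {N : ℕ} (hN : N ≠ 0) (v u : Fin N → ℝ) (ν : Measure ℝ)
    [IsProbabilityMeasure ν] :
    W2Line (empirical v) ν ^ 2 ≤ (N : ℝ≥0∞)⁻¹ * ∑ j, ∫⁻ ρ,
      ENNReal.ofReal ((v j - partner Finset.univ u ν j ρ) ^ 2) ∂unitLaw := by
  have : NeZero N := ⟨hN⟩
  have hm : ∀ j, Measurable fun ρ => (v j, partner Finset.univ u ν j ρ) := fun j =>
    measurable_const.prodMk (measurable_partner u ν j)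
  have hW : W2Line (empirical v) ν ^ 2 = transportCost
      (fun x y => ENNReal.ofReal ((x - y) ^ 2)) (empirical v) ν := by
    rw [W2Line, ← ENNReal.rpow_natCast, ← ENNReal.rpow_mul]; simp
  let π : Measure (ℝ × ℝ) := (N : ℝ≥0∞)⁻¹ • ∑ j, unitLaw.map
    fun ρ => (v j, partner Finset.univ u ν j ρ)
  have hπ : π ∈ {π : Measure (ℝ × ℝ) | π.map Prod.fst = empirical v ∧ π.map Prod.snd = ν} := by
    constructor
    · ext A hA
      simp only [π, empirical]
      rw [Measure.map_apply measurable_fst hA]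
      simp only [Measure.smul_apply, Measure.finsetSum_apply, smul_eq_mul]
      congr 1
      refine Finset.sum_congr rfl fun j _ => ?_
      rw [Measure.map_apply (hm j) (measurable_fst hA), Measure.dirac_apply' _ hA]
      by_cases h : v j ∈ A <;> simp [Set.preimage, h]
    · ext A hA
      have h1 := sum_lintegral_partner (S := Finset.univ) u Finset.univ_nonempty ν
        (φ := A.indicator 1) (measurable_one.indicator hA)
      rw [lintegral_indicator_one hA, Finset.card_univ, Fintype.card_fin] at h1
      simp only [π]
      rw [Measure.map_apply measurable_snd hA]
      simp only [Measure.smul_apply, Measure.finsetSum_apply, smul_eq_mul]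
      have h2 : ν A = (N : ℝ≥0∞)⁻¹ * (N * ν A) := by
        rw [← mul_assoc, ENNReal.inv_mul_cancel (by simpa using hN) (by simp), one_mul]
      rw [h2, ← h1]
      congr 1
      refine Finset.sum_congr rfl fun j _ => ?_
      rw [Measure.map_apply (hm j) (measurable_snd hA), ← lintegral_indicator_one
        ((hm j) (measurable_snd hA))]
      rfl
  rw [hW, transportCost]
  refine (iInf₂_le π hπ).trans (le_of_eq ?_)
  simp only [π, lintegral_smul_measure, lintegral_finsetSum_measure, smul_eq_mul]
  congr 1
  refine Finset.sum_congr rfl fun j _ => ?_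
  rw [lintegral_map (by fun_prop) (hm j)]

/-! ### The kinetic flow without drift -/

/-- The post-collisional laws along a family of distributions. -/
noncomputable def collisionKernel (g : Kernel ℝ ℝ) : Kernel ℝ ℝ :=
  (g ×ₖ (g ×ₖ Kernel.const ℝ angleLaw)).map
    fun p => p.1 * Real.cos p.2.2 + p.2.1 * Real.sin p.2.2

/-- The thermostat distributions seen from the expanding frame. -/
noncomputable def thermostatKernel (a T : ℝ) : Kernel ℝ ℝ :=
  (Kernel.id ×ₖ Kernel.const ℝ (thermostat T)).map fun p => Real.exp (-(a * p.1)) * p.2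

/-- The gain term of the kinetic equation. -/
noncomputable def kineticGain (lam mu a T : ℝ) (g : Kernel ℝ ℝ) : Kernel ℝ ℝ :=
  ⟨fun s => ENNReal.ofReal (2 * lam) • collisionKernel g s +
      ENNReal.ofReal mu • thermostatKernel a T s,
    Measure.measurable_of_measurable_coe _ fun S hS => by
      have h1 := (collisionKernel g).measurable_coe hS
      have h2 := (thermostatKernel a T).measurable_coe hS
      simp only [Measure.add_apply, Measure.smul_apply, smul_eq_mul]
      fun_prop⟩

section Kinetic

variable {lam mu a T : ℝ}

lemma measurable_collisionMap : Measurable fun p : ℝ × ℝ × ℝ =>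
    p.1 * Real.cos p.2.2 + p.2.1 * Real.sin p.2.2 := by fun_prop

instance : IsProbabilityMeasure (thermostat T) := by unfold thermostat; infer_instance

instance (g : Kernel ℝ ℝ) [IsMarkovKernel g] : IsMarkovKernel (collisionKernel g) :=
  Kernel.IsMarkovKernel.map _ measurable_collisionMap

instance : IsMarkovKernel (thermostatKernel a T) :=
  Kernel.IsMarkovKernel.map _ (by fun_prop)

lemma collisionKernel_apply (g : Kernel ℝ ℝ) [IsMarkovKernel g] (s : ℝ) :
    collisionKernel g s = collision (g s) (g s) := by
  rw [collisionKernel, Kernel.map_apply _ measurable_collisionMap, Kernel.prod_apply,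
    Kernel.prod_apply, Kernel.const_apply, collision]

lemma thermostatKernel_apply (s : ℝ) : thermostatKernel a T s = rescale a s (thermostat T) := by
  rw [thermostatKernel, Kernel.map_apply _ (by fun_prop), Kernel.prod_apply, Kernel.id_apply,
    Kernel.const_apply, rescale, Measure.dirac_prod, Measure.map_map (by fun_prop) (by fun_prop)]
  rfl

lemma kineticGain_apply (g : Kernel ℝ ℝ) (s : ℝ) : kineticGain lam mu a T g s =
    ENNReal.ofReal (2 * lam) • collisionKernel g s +
      ENNReal.ofReal mu • thermostatKernel a T s := rfl

lemma kineticGain_univ (g : Kernel ℝ ℝ) [IsMarkovKernel g] (hlam : 0 ≤ lam) (hmu : 0 ≤ mu)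
    (s : ℝ) : kineticGain lam mu a T g s Set.univ = (2 * lam + mu).toNNReal := by
  rw [kineticGain_apply]
  simp only [Measure.add_apply, Measure.smul_apply, measure_univ, smul_eq_mul, mul_one]
  rw [← ENNReal.ofReal_add (by positivity) hmu]; rfl

instance (g : Kernel ℝ ℝ) [IsMarkovKernel g] : IsFiniteKernel (kineticGain lam mu a T g) :=
  ⟨⟨ENNReal.ofReal (2 * lam) + ENNReal.ofReal mu,
    ENNReal.add_lt_top.2 ⟨ENNReal.ofReal_lt_top, ENNReal.ofReal_lt_top⟩, fun s => by
    rw [kineticGain_apply]; simp⟩⟩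

/-- `g` solves the kinetic equation in the frame without drift. -/
structure IsKineticFlow (lam mu a T : ℝ) (g : Kernel ℝ ℝ) : Prop where
  markov : IsMarkovKernel g
  flow : IsFlow (2 * lam + mu).toNNReal g (kineticGain lam mu a T g)

/-- Continuity in total variation serves to make the family measurable in time, hence a kernel;
negative times are clamped to `0`. -/
lemma IsWeakSolution.exists_isKineticFlow {E : ℝ} {f₀ : Measure ℝ} [IsProbabilityMeasure f₀]
    {f : ℝ≥0 → Measure ℝ} (hf : IsWeakSolution lam mu E T f₀ f) (hlam : 0 ≤ lam) (hmu : 0 ≤ mu) :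
    ∃ g : Kernel ℝ ℝ, IsKineticFlow lam mu (drift mu E T) T g ∧ g 0 = f₀ ∧
      ∀ t : ℝ≥0, g t = rescale (drift mu E T) t (f t) := by
  have hp := hf.isProbabilityMeasure
  have hp' : ∀ t : ℝ≥0, IsProbabilityMeasure (rescale (drift mu E T) t (f t)) := fun t =>
    Measure.isProbabilityMeasure_map (by fun_prop)
  let g : Kernel ℝ ℝ := ⟨fun s => rescale (drift mu E T) s.toNNReal (f s.toNNReal),
    Measure.measurable_of_measurable_coe _ fun S hS => by
      have hc : Continuous fun s : ℝ≥0 => (rescale (drift mu E T) s (f s)).real S :=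
        continuous_iff_continuousAt.2 fun t => (hf.continuous_tv t).tendsto_at hS
      have : Measurable fun s : ℝ => ENNReal.ofReal
          ((rescale (drift mu E T) s.toNNReal (f s.toNNReal)).real S) :=
        (hc.measurable.comp measurable_real_toNNReal).ennreal_ofReal
      have e : ∀ s : ℝ, ENNReal.ofReal
          ((rescale (drift mu E T) s.toNNReal (f s.toNNReal)).real S) =
          rescale (drift mu E T) s.toNNReal (f s.toNNReal) S := fun s => ofReal_measureReal
      simpa only [e] using this⟩
  have hg : ∀ s : ℝ, 0 ≤ s → g s = rescale (drift mu E T) s (f s.toNNReal) := fun s hs => by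
    change rescale _ _ _ = _
    rw [Real.coe_toNNReal s hs]
  have hmk : IsMarkovKernel g := ⟨fun s => hp' s.toNNReal⟩
  have hg0 : g 0 = f₀ := by
    ext S hS
    have h1 := hf.equation 0 S hS
    simp only [NNReal.coe_zero, intervalIntegral.integral_same, add_zero] at h1
    have h2 := hg 0 le_rfl
    rw [Real.toNNReal_zero] at h2
    rw [← h2] at h1
    exact (measureReal_eq_measureReal_iff (by simp) (by simp)).1 h1
  refine ⟨g, ⟨hmk, isFlow_of_real (fun s => (kineticGain_univ g hlam hmu s).le) ?_⟩, hg0,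
    fun t => ?_⟩
  · intro t ht S hS
    have h1 := hf.equation t.toNNReal S hS
    rw [Real.coe_toNNReal t ht, ← hg t ht] at h1
    rw [h1, hg0]
    congr 1
    refine intervalIntegral.integral_congr fun s hs => ?_
    rw [Set.uIcc_of_le ht] at hs
    have hfin : ∀ (c : ℝ) (ν : Measure ℝ) [IsProbabilityMeasure ν],
        (ENNReal.ofReal c • ν) S ≠ ∞ := fun c ν _ => by
      rw [Measure.smul_apply, smul_eq_mul]
      exact ENNReal.mul_ne_top ENNReal.ofReal_ne_top (measure_ne_top _ _)
    rw [← hg s hs.1, kineticGain_apply, measureReal_add_apply (hfin _ _) (hfin _ _), measureReal_ennreal_smul_apply,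
      measureReal_ennreal_smul_apply, collisionKernel_apply, thermostatKernel_apply,
      ENNReal.toReal_ofReal (by positivity), ENNReal.toReal_ofReal hmu,
      Real.coe_toNNReal _ (by positivity)]
    ring
  · rw [hg _ (NNReal.coe_nonneg t), Real.toNNReal_coe]

lemma integral_triple_mul {ν ν' : Measure ℝ} [IsProbabilityMeasure ν] [IsProbabilityMeasure ν']
    {F G H : ℝ → ℝ} (hF : Integrable F ν) (hG : Integrable G ν') (hH : Integrable H angleLaw) :
    Integrable (fun p : ℝ × ℝ × ℝ => F p.1 * (G p.2.1 * H p.2.2)) (ν.prod (ν'.prod angleLaw)) ∧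
    ∫ p, F p.1 * (G p.2.1 * H p.2.2) ∂(ν.prod (ν'.prod angleLaw)) =
      (∫ x, F x ∂ν) * ((∫ x, G x ∂ν') * ∫ x, H x ∂angleLaw) := by
  refine ⟨hF.mul_prod (hG.mul_prod hH), ?_⟩
  rw [integral_prod_mul F (fun q : ℝ × ℝ => G q.1 * H q.2), integral_prod_mul]

lemma integrable_angleLaw {F : ℝ → ℝ} (hF : Measurable F) {K : ℝ} (hK : ∀ x, |F x| ≤ K) :
    Integrable F angleLaw :=
  Integrable.of_bound hF.aestronglyMeasurable K (ae_of_all _ hK)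

/-- The averages of `cos²` and `sin²` are `1/2` and that of `cos sin` is `0`, so collisions conserve
the energy. -/
lemma integral_sq_collisionKernel (g : Kernel ℝ ℝ) [IsMarkovKernel g] {s : ℝ}
    (h : Integrable (fun v : ℝ => v ^ 2) (g s)) :
    Integrable (fun v : ℝ => v ^ 2) (collisionKernel g s) ∧
    ∫ v, v ^ 2 ∂collisionKernel g s = ∫ v, v ^ 2 ∂g s := by
  have h1 : Integrable (fun v : ℝ => v) (g s) :=
    ((memLp_two_iff_integrable_sq aestronglyMeasurable_id).2 h).integrable one_le_two
  have c2 : Integrable (fun θ => Real.cos θ ^ 2) angleLaw :=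
    integrable_angleLaw (by fun_prop) (K := 1) fun θ => by
      rw [abs_of_nonneg (by positivity)]; exact Real.cos_sq_le_one θ
  have s2 : Integrable (fun θ => Real.sin θ ^ 2) angleLaw :=
    integrable_angleLaw (by fun_prop) (K := 1) fun θ => by
      rw [abs_of_nonneg (by positivity)]; exact Real.sin_sq_le_one θ
  have cs : Integrable (fun θ => Real.cos θ * Real.sin θ) angleLaw :=
    integrable_angleLaw (by fun_prop) (K := 1) fun θ => by
      rw [abs_mul]; exact mul_le_one₀ (Real.abs_cos_le_one θ) (abs_nonneg _) (Real.abs_sin_le_one θ)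
  have k1 := integral_triple_mul (ν := g s) (ν' := g s) h (integrable_const 1) c2
  have k2 := integral_triple_mul (ν := g s) (ν' := g s) (integrable_const 1) h s2
  have k3 := integral_triple_mul (ν := g s) (ν' := g s) (h1.const_mul 2) h1 cs
  have e : ∀ p : ℝ × ℝ × ℝ, (p.1 * Real.cos p.2.2 + p.2.1 * Real.sin p.2.2) ^ 2 =
      (p.1 ^ 2 * (1 * Real.cos p.2.2 ^ 2) + 1 * (p.2.1 ^ 2 * Real.sin p.2.2 ^ 2)) +
        2 * p.1 * (p.2.1 * (Real.cos p.2.2 * Real.sin p.2.2)) := fun p => by ring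
  rw [collisionKernel_apply, collision]
  constructor
  · rw [integrable_map_measure (by fun_prop) (by fun_prop)]
    exact ((k1.1.add k2.1).add k3.1).congr (ae_of_all _ fun p => (e p).symm)
  · rw [integral_map (by fun_prop) (by fun_prop)]
    simp_rw [e]
    refine (integral_add (k1.1.add k2.1) k3.1).trans ?_
    rw [integral_add' k1.1 k2.1, k1.2, k2.2, k3.2,
      integral_cos_sq_angleLaw, integral_sin_sq_angleLaw, integral_cos_mul_sin_angleLaw]
    simp; ring

lemma integrable_abs_rpow_thermostat {r : ℝ} (hr : 0 ≤ r) :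
    Integrable (fun w : ℝ => |w| ^ r) (thermostat T) := by
  have := (memLp_id_gaussianReal (μ := 0) (v := T.toNNReal) r.toNNReal).integrable_norm_rpow'
  simpa [thermostat, Real.coe_toNNReal r hr] using this

lemma integral_thermostatKernel {F : ℝ → ℝ} (hF : Measurable F) (s : ℝ) :
    ∫ v, F v ∂thermostatKernel a T s = ∫ w, F (Real.exp (-(a * s)) * w) ∂thermostat T := by
  rw [thermostatKernel_apply, rescale, integral_map (by fun_prop) hF.aestronglyMeasurable]

lemma integrable_thermostatKernel {F : ℝ → ℝ} (hF : Measurable F) {s : ℝ}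
    (h : Integrable (fun w => F (Real.exp (-(a * s)) * w)) (thermostat T)) :
    Integrable F (thermostatKernel a T s) := by
  rw [thermostatKernel_apply, rescale, integrable_map_measure hF.aestronglyMeasurable (by fun_prop)]
  exact h

lemma abs_exp_mul_rpow (c w r : ℝ) :
    |Real.exp c * w| ^ r = Real.exp (r * c) * |w| ^ r := by
  rw [abs_mul, abs_of_pos (Real.exp_pos _), Real.mul_rpow (Real.exp_pos _).le (abs_nonneg _),
    ← Real.exp_mul, mul_comm c r]

lemma integral_abs_rpow_thermostatKernel {r : ℝ} (hr : 0 ≤ r) (s : ℝ) :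
    Integrable (fun v : ℝ => |v| ^ r) (thermostatKernel a T s) ∧
    ∫ v, |v| ^ r ∂thermostatKernel a T s =
      Real.exp (-(r * a * s)) * ∫ w, |w| ^ r ∂thermostat T := by
  have hm : Measurable fun v : ℝ => |v| ^ r := by fun_prop
  constructor
  · refine integrable_thermostatKernel hm ?_
    simp_rw [abs_exp_mul_rpow]
    exact (integrable_abs_rpow_thermostat hr).const_mul _
  · rw [integral_thermostatKernel hm]
    simp_rw [abs_exp_mul_rpow]
    rw [integral_const_mul]
    ring_nf

lemma integral_sq_thermostat (hT : 0 ≤ T) : ∫ w, w ^ 2 ∂thermostat T = T := by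
  have h := variance_id_gaussianReal (μ := 0) (v := T.toNNReal)
  rw [variance_eq_integral (by fun_prop)] at h
  simpa [thermostat, hT] using h

lemma integrable_sq_thermostat : Integrable (fun w : ℝ => w ^ 2) (thermostat T) := by
  simpa using integrable_abs_rpow_thermostat (T := T) (r := 2) (by norm_num)

lemma integral_kineticGain (g : Kernel ℝ ℝ) (hlam : 0 ≤ lam) (hmu : 0 ≤ mu) {s : ℝ} {F : ℝ → ℝ}
    (h1 : Integrable F (collisionKernel g s)) (h2 : Integrable F (thermostatKernel a T s)) :
    Integrable F (kineticGain lam mu a T g s) ∧ ∫ v, F v ∂kineticGain lam mu a T g s =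
      2 * lam * ∫ v, F v ∂collisionKernel g s + mu * ∫ v, F v ∂thermostatKernel a T s := by
  have i1 := h1.smul_measure (c := ENNReal.ofReal (2 * lam)) ENNReal.ofReal_ne_top
  have i2 := h2.smul_measure (c := ENNReal.ofReal mu) (by simp)
  rw [kineticGain_apply]
  refine ⟨i1.add_measure i2, ?_⟩
  rw [integral_add_measure i1 i2, integral_smul_measure, integral_smul_measure,
    ENNReal.toReal_ofReal (by positivity), ENNReal.toReal_ofReal hmu, smul_eq_mul, smul_eq_mul]

lemma add_rpow_le_mul {x y r : ℝ} (hx : 0 ≤ x) (hy : 0 ≤ y) (hr : 0 ≤ r) :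
    (x + y) ^ r ≤ 2 ^ r * (x ^ r + y ^ r) := by
  have h : ∀ z : ℝ, 0 ≤ z → 0 ≤ z ^ r := fun z hz => Real.rpow_nonneg hz r
  wlog hxy : x ≤ y generalizing x y
  · rw [add_comm x, add_comm (x ^ r)]; exact this hy hx (le_of_not_ge hxy)
  calc (x + y) ^ r ≤ (2 * y) ^ r := Real.rpow_le_rpow (by linarith) (by linarith) hr
    _ = 2 ^ r * y ^ r := Real.mul_rpow (by norm_num) hy
    _ ≤ _ := by
      have := h x hx
      gcongr; linarith

/-- Finiteness of moments is propagated by the kinetic equation. -/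
lemma IsKineticFlow.exists_moment_bound {g : Kernel ℝ ℝ} (hg : IsKineticFlow lam mu a T g)
    (hlam : 0 ≤ lam) (hmu : 0 ≤ mu) {r : ℝ} (hr : 0 ≤ r)
    (h0 : Integrable (fun v : ℝ => |v| ^ r) (g 0)) (t : ℝ) :
    ∃ B : ℝ, ∀ s ∈ Set.Icc 0 t, ∫⁻ v, ENNReal.ofReal (|v| ^ r) ∂g s ≤ ENNReal.ofReal B := by
  have := hg.markov
  rcases lt_or_ge t 0 with ht | ht
  · exact ⟨0, fun s hs => absurd (hs.1.trans hs.2) (not_le.2 ht)⟩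
  set M := ∫ v, |v| ^ r ∂g 0
  have hM : 0 ≤ M := integral_nonneg fun v => by positivity
  set G := Real.exp (r * |a| * t) * ∫ w, |w| ^ r ∂thermostat T
  have hG : 0 ≤ G := mul_nonneg (Real.exp_pos _).le (integral_nonneg fun v => by positivity)
  -- Growth rate due to collisions; the `+ 1` keeps it positive when `lam = 0`.
  set b := 2 * lam * (2 ^ r * 2) + 1
  set c := M + mu * G * t
  have hc : 0 ≤ c := by positivity
  have hb : 0 < b := by positivity
  -- Bounded truncations, for which every integral exists. They are subadditive up to the factor `2
  -- ^ r`, so the bound does not depend on `n` and passes to the limit by monotone convergence.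
  let φ : ℕ → ℝ → ℝ := fun n v => min |v| n ^ r
  have hφm : ∀ n, Measurable (φ n) := fun n => by simp only [φ]; fun_prop
  have hφ0 : ∀ n v, 0 ≤ φ n v := fun n v => by simp only [φ]; positivity
  have hφn : ∀ n v, φ n v ≤ (n : ℝ) ^ r := fun n v =>
    Real.rpow_le_rpow (by positivity) (min_le_right _ _) hr
  have hφr : ∀ n v, φ n v ≤ |v| ^ r := fun n v =>
    Real.rpow_le_rpow (by positivity) (min_le_left _ _) hr
  have hφi : ∀ n (μ : Measure ℝ) [IsProbabilityMeasure μ], Integrable (φ n) μ := fun n μ _ =>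
    Integrable.of_bound (hφm n).aestronglyMeasurable ((n : ℝ) ^ r) (ae_of_all _ fun v => by
      rw [Real.norm_eq_abs, abs_of_nonneg (hφ0 n v)]; exact hφn n v)
  have hφadd : ∀ n v w c s, |c| ≤ 1 → |s| ≤ 1 →
      φ n (v * c + w * s) ≤ 2 ^ r * (φ n v + φ n w) := by
    intro n v w c s hc hs
    refine le_trans (Real.rpow_le_rpow (by positivity) ?_ hr)
      (add_rpow_le_mul (by positivity) (by positivity) hr)
    have h1 : |v * c + w * s| ≤ |v| + |w| := by
      refine (abs_add_le _ _).trans (add_le_add ?_ ?_)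
      · rw [abs_mul]; exact mul_le_of_le_one_right (abs_nonneg _) hc
      · rw [abs_mul]; exact mul_le_of_le_one_right (abs_nonneg _) hs
    have hn : (0 : ℝ) ≤ n := n.cast_nonneg
    rcases le_total |v| n with h2 | h2
    · rcases le_total |w| n with h3 | h3
      · rw [min_eq_left h2, min_eq_left h3]; exact (min_le_left _ _).trans h1
      · rw [min_eq_right h3]
        have : (0 : ℝ) ≤ min |v| n := by positivity
        linarith [min_le_right |v * c + w * s| (n : ℝ)]
    · rw [min_eq_right h2]
      have : (0 : ℝ) ≤ min |w| n := by positivity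
      linarith [min_le_right |v * c + w * s| (n : ℝ)]
  have key : ∀ n, ∀ s ∈ Set.Icc 0 t, ∫ v, φ n v ∂g s ≤ 2 * c * Real.exp (2 * b * t) := by
    intro n s hs
    have hp := hg.flow.isPrimitive_of_bounded (hφm n) (K := (n : ℝ) ^ r) (fun v => by
      rw [abs_of_nonneg (hφ0 n v)]; exact hφn n v) ht
    refine (le_of_family_integral_le (ι := Unit) (y := fun _ s => ∫ v, φ n v ∂g s) hb hc
      (B₀ := (n : ℝ) ^ r) (t := t) ?_ ?_ () hs).trans ?_
    · intro _ s _
      refine (integral_mono (hφi n _) (integrable_const ((n : ℝ) ^ r)) (hφn n)).trans ?_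
      simp
    · intro _ s hs Y hY hle
      have hps := hp.mono hs
      have hps2 := hp.2 s hs
      beta_reduce at hps2
      rw [hps2]
      have hM' : ∫ v, φ n v ∂g 0 ≤ M := integral_mono (hφi n _) h0 (hφr n)
      have hI : ∫ r in (0 : ℝ)..s, (∫ x, φ n x ∂kineticGain lam mu a T g r -
          ((2 * lam + mu).toNNReal : ℝ) * ∫ x, φ n x ∂g r) ≤
          ∫ r in (0 : ℝ)..s, (mu * G + b * Y r) := by
        refine intervalIntegral.integral_mono_on hs.1 hps.1
          (Continuous.intervalIntegrable (by fun_prop) _ _) fun q hq => ?_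
        have hq0 : 0 ≤ ∫ x, φ n x ∂g q := integral_nonneg (hφ0 n)
        have h1 : ∫ x, φ n x ∂collisionKernel g q ≤ 2 ^ r * 2 * ∫ x, φ n x ∂g q := by
          rw [collisionKernel_apply, collision, integral_map (by fun_prop)
            (hφm n).aestronglyMeasurable]
          have k1 := integral_triple_mul (hφi n (g q)) (integrable_const (μ := g q) (1 : ℝ))
            (integrable_const (1 : ℝ))
          have k2 := integral_triple_mul (integrable_const (μ := g q) (1 : ℝ)) (hφi n (g q))
            (integrable_const (1 : ℝ))
          calc _ ≤ ∫ p : ℝ × ℝ × ℝ, 2 ^ r * (φ n p.1 * (1 * 1) + 1 * (φ n p.2.1 * 1))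
                ∂(g q).prod ((g q).prod angleLaw) := by
                refine integral_mono ?_ ((k1.1.add k2.1).const_mul _) fun p => ?_
                · exact Integrable.of_bound ((hφm n).comp
                    measurable_collisionMap).aestronglyMeasurable
                    ((n : ℝ) ^ r) (ae_of_all _ fun v => by
                    rw [Real.norm_eq_abs, abs_of_nonneg (hφ0 n _)]; exact hφn n _)
                · simpa using hφadd n p.1 p.2.1 _ _ (Real.abs_cos_le_one p.2.2)
                    (Real.abs_sin_le_one p.2.2)
            _ = _ := by
                rw [integral_const_mul, integral_add k1.1 k2.1, k1.2, k2.2]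
                simp; ring
        have h2 : ∫ x, φ n x ∂thermostatKernel a T q ≤ G := by
          obtain ⟨i, e⟩ := integral_abs_rpow_thermostatKernel (a := a) (T := T) hr q
          refine (integral_mono (hφi n _) i (hφr n)).trans ?_
          rw [e]
          have h0 : 0 ≤ ∫ w, |w| ^ r ∂thermostat T := integral_nonneg fun v => by positivity
          refine mul_le_mul_of_nonneg_right (Real.exp_le_exp.2 ?_) h0
          have h3 : -a ≤ |a| := neg_le_abs a
          have h4 : q ≤ t := hq.2.trans hs.2
          calc -(r * a * q) = r * (-a) * q := by ring
            _ ≤ r * |a| * t := by gcongr; exact hq.1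
        rw [(integral_kineticGain g hlam hmu (hφi n _) (hφi n _)).2]
        have h3 := hle () q hq
        have h4 : (0 : ℝ) ≤ (2 * lam + mu).toNNReal := NNReal.coe_nonneg _
        have h5 : (2 * lam) * ∫ x, φ n x ∂collisionKernel g q ≤
            2 * lam * (2 ^ r * 2 * ∫ x, φ n x ∂g q) := by gcongr
        have h6 : mu * ∫ x, φ n x ∂thermostatKernel a T q ≤ mu * G := by gcongr
        have h7 : b * ∫ x, φ n x ∂g q ≤ b * Y q := by gcongr
        have h8 : b * ∫ x, φ n x ∂g q = 2 * lam * (2 ^ r * 2 * ∫ x, φ n x ∂g q) +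
          ∫ x, φ n x ∂g q := by simp only [b]; ring
        nlinarith [mul_nonneg h4 hq0]
      rw [intervalIntegral.integral_add (by simp)
        (Continuous.intervalIntegrable (by fun_prop) _ _), intervalIntegral.integral_const,
        intervalIntegral.integral_const_mul, smul_eq_mul, sub_zero] at hI
      have : s * (mu * G) ≤ mu * G * t := by
        rw [mul_comm]; exact mul_le_mul_of_nonneg_left hs.2 (by positivity)
      simp only [c]
      linarith
    · have := hs.2
      gcongr
  refine ⟨2 * c * Real.exp (2 * b * t), fun s hs => ?_⟩
  have hlim : Tendsto (fun n => ∫⁻ v, ENNReal.ofReal (φ n v) ∂g s) atTop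
      (𝓝 (∫⁻ v, ENNReal.ofReal (|v| ^ r) ∂g s)) := by
    refine lintegral_tendsto_of_tendsto_of_monotone
      (fun n => (hφm n).ennreal_ofReal.aemeasurable) (ae_of_all _ fun v n k hnk => ?_)
      (ae_of_all _ fun v => ?_)
    · refine ENNReal.ofReal_le_ofReal (Real.rpow_le_rpow (by positivity) ?_ hr)
      exact min_le_min le_rfl (by exact_mod_cast hnk)
    · refine tendsto_const_nhds.congr' ?_
      obtain ⟨n₀, hn₀⟩ := exists_nat_ge |v|
      filter_upwards [eventually_ge_atTop n₀] with n hn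
      have : |v| ≤ n := hn₀.trans (by exact_mod_cast hn)
      simp only [φ, min_eq_left this]
  refine le_of_tendsto' hlim fun n => ?_
  rw [← ofReal_integral_eq_lintegral_ofReal (hφi n _) (ae_of_all _ (hφ0 n))]
  exact ENNReal.ofReal_le_ofReal (key n s hs)

lemma integrable_of_lintegral_le {X : Type*} [MeasurableSpace X] {μ : Measure X} {F : X → ℝ}
    (hF : Measurable F) (h0 : ∀ x, 0 ≤ F x) {B : ℝ}
    (h : ∫⁻ x, ENNReal.ofReal (F x) ∂μ ≤ ENNReal.ofReal B) : Integrable F μ := by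
  refine ⟨hF.aestronglyMeasurable, ?_⟩
  rw [hasFiniteIntegral_iff_ofReal (ae_of_all _ h0)]
  exact h.trans_lt ENNReal.ofReal_lt_top

lemma IsKineticFlow.integrable_rpow {g : Kernel ℝ ℝ} (hg : IsKineticFlow lam mu a T g)
    (hlam : 0 ≤ lam) (hmu : 0 ≤ mu) {r : ℝ} (hr : 0 ≤ r)
    (h0 : Integrable (fun v : ℝ => |v| ^ r) (g 0)) {t : ℝ} (ht : 0 ≤ t) :
    Integrable (fun v : ℝ => |v| ^ r) (g t) := by
  obtain ⟨B, hB⟩ := hg.exists_moment_bound hlam hmu hr h0 t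
  exact integrable_of_lintegral_le (by fun_prop) (fun v => by positivity) (hB t ⟨ht, le_rfl⟩)

/-- The energy in the original frame. -/
noncomputable def energy (a : ℝ) (g : Kernel ℝ ℝ) (t : ℝ) : ℝ :=
  Real.exp (2 * a * t) * ∫ v, v ^ 2 ∂g t

lemma energy_nonneg (g : Kernel ℝ ℝ) (t : ℝ) : 0 ≤ energy a g t :=
  mul_nonneg (Real.exp_pos _).le (integral_nonneg fun v => sq_nonneg v)

/-- Collisions conserve the energy, the thermostat relaxes it to `T` at rate `mu`, and undoing the
dilation makes it grow at rate `2 a`. -/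
lemma IsKineticFlow.energy_isPrimitive {g : Kernel ℝ ℝ} (hg : IsKineticFlow lam mu a T g)
    (hlam : 0 ≤ lam) (hmu : 0 ≤ mu) (hT : 0 ≤ T)
    (h0 : Integrable (fun v : ℝ => v ^ 2) (g 0)) {t : ℝ} (ht : 0 ≤ t) :
    IsPrimitive (energy a g) (fun s => -(mu - 2 * a) * energy a g s + mu * T) t := by
  have := hg.markov
  have h0' : Integrable (fun v : ℝ => |v| ^ (2 : ℝ)) (g 0) := by simpa using h0
  obtain ⟨B, hB⟩ := hg.exists_moment_bound hlam hmu (r := 2) (by norm_num) h0' t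
  have h1 := hg.flow.isPrimitive_of_nonneg (ψ := fun v => v ^ 2) (by fun_prop)
    (fun v => sq_nonneg v) ht (B := ENNReal.ofReal B) (by simp) (by simpa using hB)
  refine ((IsPrimitive.exp (2 * a)).mul h1 ht).congr ht (fun s hs => rfl) fun s hs => ?_
  have hi : Integrable (fun v : ℝ => v ^ 2) (g s) := by
    simpa using hg.integrable_rpow hlam hmu (r := 2) (by norm_num) h0' hs.1
  obtain ⟨i1, e1⟩ := integral_sq_collisionKernel g hi
  obtain ⟨i2, e2⟩ := integral_abs_rpow_thermostatKernel (a := a) (T := T) (r := 2)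
    (by norm_num) s
  simp only [Real.rpow_ofNat, sq_abs, integral_sq_thermostat hT] at i2 e2
  rw [(integral_kineticGain g hlam hmu i1 i2).2, e1, e2, Real.coe_toNNReal _ (by positivity),
    energy]
  have : Real.exp (2 * a * s) * Real.exp (-(2 * a * s)) = 1 := by
    rw [← Real.exp_add]; simp
  linear_combination (-mu * T) * this

lemma IsKineticFlow.energy_le {g : Kernel ℝ ℝ} (hg : IsKineticFlow lam mu a T g)
    (hlam : 0 ≤ lam) (hmu : 0 ≤ mu) (hT : 0 ≤ T) (ha : 2 * a < mu)
    (h0 : Integrable (fun v : ℝ => v ^ 2) (g 0)) {t : ℝ} (ht : 0 ≤ t) :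
    energy a g t ≤ energy a g 0 + mu * T / (mu - 2 * a) := by
  have h1 := (hg.energy_isPrimitive hlam hmu hT h0 ht).le_of_deriv_le ht
    (c := mu - 2 * a) (R := fun _ => mu * T) (by simp) fun s _ => le_rfl
  have hκ : 0 < mu - 2 * a := by linarith
  rw [intervalIntegral.integral_mul_const] at h1
  have h2 := integral_exp_neg_mul_sub_le hκ t
  have h3 : Real.exp (-((mu - 2 * a) * t)) ≤ 1 := Real.exp_le_one_iff.2 (by nlinarith)
  have h4 := energy_nonneg (a := a) g 0
  calc energy a g t ≤ _ := h1
    _ ≤ 1 * energy a g 0 + 1 / (mu - 2 * a) * (mu * T) := by gcongr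
    _ = _ := by ring

end Kinetic

/-! ### Moments of the kinetic flow, uniformly in time. -/

section Moments

variable {lam mu a T r : ℝ}

/-- With `|y| ≤ |x|` and `Z = |x| + |y|`, Bernoulli's inequality for `|x| / Z = 1 - |y| / Z` gives
`Z^r - r |y| Z^(r-1) ≤ |x|^r`, and `Z ≤ 2 |x|`. What matters is the coefficient `1` of the pure
powers, from which `momentConst r` arises. -/
lemma abs_add_rpow_le (hr : 1 ≤ r) (x y : ℝ) :
    |x + y| ^ r ≤ |x| ^ r + |y| ^ r +
      r * 2 ^ (r - 1) * (|x| ^ (r - 1) * |y| + |x| * |y| ^ (r - 1)) := by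
  have hr1 : 0 ≤ r - 1 := by linarith
  wlog hxy : |y| ≤ |x| generalizing x y
  · have := this y x (le_of_not_ge hxy)
    rw [add_comm x y]
    linarith
  set X := |x|
  set Y := |y|
  have hX : 0 ≤ X := abs_nonneg x
  have hY : 0 ≤ Y := abs_nonneg y
  have h0 : |x + y| ≤ X + Y := abs_add_le x y
  rcases hX.eq_or_lt with hX0 | hX0
  · have hY0 : Y = 0 := le_antisymm (hxy.trans hX0.symm.le) hY
    have : |x + y| = 0 := le_antisymm (by linarith) (abs_nonneg _)
    rw [this, Real.zero_rpow (by linarith)]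
    positivity
  · set Z := X + Y
    have hZ : 0 < Z := by positivity
    have hB := one_add_mul_self_le_rpow_one_add (s := -(Y / Z)) (p := r)
      (neg_le_neg ((div_le_one hZ).2 (by simp only [Z]; linarith))) hr
    have h1 : 1 + -(Y / Z) = X / Z := by field_simp; simp only [Z]; ring
    rw [h1, Real.div_rpow hX hZ.le, le_div_iff₀ (by positivity)] at hB
    have h2 : Z ^ r = Z ^ (r - 1) * Z := by
      rw [← Real.rpow_add_one hZ.ne']; congr 1; ring
    have h3 : Z ^ r - r * Y * Z ^ (r - 1) ≤ X ^ r := by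
      calc Z ^ r - r * Y * Z ^ (r - 1) = (1 + r * -(Y / Z)) * Z ^ r := by
            rw [h2]; field_simp; ring
        _ ≤ _ := hB
    have h4 : Z ^ (r - 1) ≤ 2 ^ (r - 1) * X ^ (r - 1) := by
      rw [← Real.mul_rpow (by norm_num) hX]
      exact Real.rpow_le_rpow hZ.le (by simp only [Z]; linarith) hr1
    have h5 : |x + y| ^ r ≤ Z ^ r := Real.rpow_le_rpow (abs_nonneg _) h0 (by linarith)
    have h6 : r * Y * Z ^ (r - 1) ≤ r * Y * (2 ^ (r - 1) * X ^ (r - 1)) := by gcongr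
    have h7 : 0 ≤ Y ^ r + r * 2 ^ (r - 1) * (X * Y ^ (r - 1)) := by positivity
    linarith

/-- Split at `x = 1 / δ`. Cross terms, of order `r - 1`, are thereby absorbed in a small part of the
`r`-th moment. -/
lemma rpow_sub_one_le {x δ : ℝ} (hx : 0 ≤ x) (hδ : 0 < δ) (hr : 1 < r) :
    x ^ (r - 1) ≤ δ * x ^ r + δ ^ (1 - r) := by
  have hr1 : 0 ≤ r - 1 := by linarith
  rcases le_or_gt 1 (δ * x) with h | h
  · have hx0 : 0 < x := by
      rcases hx.eq_or_lt with h0 | h0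
      · rw [← h0, mul_zero] at h; linarith
      · exact h0
    have h2 : x ^ r = x * x ^ (r - 1) := by
      rw [mul_comm, ← Real.rpow_add_one hx0.ne']; congr 1; ring
    have h3 : 0 ≤ δ ^ (1 - r) := by positivity
    have h4 : 0 ≤ x ^ (r - 1) := by positivity
    rw [h2, ← mul_assoc]
    nlinarith
  · have h1 : x ≤ δ⁻¹ := by rw [← one_div, le_div_iff₀ hδ]; linarith
    have h2 : x ^ (r - 1) ≤ δ⁻¹ ^ (r - 1) := Real.rpow_le_rpow hx h1 hr1
    have h3 : δ⁻¹ ^ (r - 1) = δ ^ (1 - r) := by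
      rw [Real.inv_rpow hδ.le, ← Real.rpow_neg hδ.le]; congr 1; ring
    have h4 : 0 ≤ δ * x ^ r := by positivity
    linarith

lemma integrable_rpow_of_le {ν : Measure ℝ} [IsProbabilityMeasure ν] {p : ℝ} (hp : 0 ≤ p)
    (hpr : p ≤ r) (h : Integrable (fun v : ℝ => |v| ^ r) ν) :
    Integrable (fun v : ℝ => |v| ^ p) ν := by
  refine ((integrable_const (1 : ℝ)).add h).mono' (by fun_prop) (ae_of_all _ fun v => ?_)
  rw [Real.norm_eq_abs, abs_of_nonneg (by positivity)]
  rcases le_total |v| 1 with h1 | h1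
  · exact (Real.rpow_le_one (abs_nonneg v) h1 hp).trans (by simp; positivity)
  · exact (Real.rpow_le_rpow_of_exponent_le h1 hpr).trans (by simp)

/-- The pure powers in `abs_add_rpow_le` contribute twice the average of `|cos|^r`, that is `1 -
momentConst r`; the cross terms involve only the moments of order `r - 1` and `1`. -/
lemma integral_rpow_collisionKernel_le (g : Kernel ℝ ℝ) [IsMarkovKernel g] {s : ℝ} (hr : 2 < r)
    (h : Integrable (fun v : ℝ => |v| ^ r) (g s)) :
    Integrable (fun v : ℝ => |v| ^ r) (collisionKernel g s) ∧
    ∫ v, |v| ^ r ∂collisionKernel g s ≤ (1 - momentConst r) * ∫ v, |v| ^ r ∂g s +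
      2 * (r * 2 ^ (r - 1)) * ((∫ v, |v| ^ (r - 1) ∂g s) * ∫ v, |v| ∂g s) := by
  have h1 : Integrable (fun v : ℝ => |v|) (g s) := by
    simpa using integrable_rpow_of_le zero_le_one (by linarith) h
  have h2 : Integrable (fun v : ℝ => |v| ^ (r - 1)) (g s) :=
    integrable_rpow_of_le (by linarith) (by linarith) h
  have hpow : ∀ {z : ℝ}, |z| ≤ 1 → |(|z| ^ r)| ≤ 1 := fun {z} hz => by
    rw [abs_of_nonneg (by positivity)]
    exact Real.rpow_le_one (abs_nonneg _) hz (by linarith)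
  have c2 : Integrable (fun θ => |Real.cos θ| ^ r) angleLaw :=
    integrable_angleLaw (by fun_prop) fun θ => hpow (Real.abs_cos_le_one θ)
  have s2 : Integrable (fun θ => |Real.sin θ| ^ r) angleLaw :=
    integrable_angleLaw (by fun_prop) fun θ => hpow (Real.abs_sin_le_one θ)
  have k1 := integral_triple_mul (ν := g s) (ν' := g s) h (integrable_const 1) c2
  have k2 := integral_triple_mul (ν := g s) (ν' := g s) (integrable_const 1) h s2
  have k3 := integral_triple_mul (ν := g s) (ν' := g s) h2 h1 (integrable_const 1)
  have k4 := integral_triple_mul (ν := g s) (ν' := g s) h1 h2 (integrable_const 1)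
  set C := r * 2 ^ (r - 1)
  have hC : 0 ≤ C := by simp only [C]; positivity
  have e : ∀ p : ℝ × ℝ × ℝ, |p.1 * Real.cos p.2.2 + p.2.1 * Real.sin p.2.2| ^ r ≤
      (|p.1| ^ r * (1 * |Real.cos p.2.2| ^ r) + 1 * (|p.2.1| ^ r * |Real.sin p.2.2| ^ r)) +
        C * (|p.1| ^ (r - 1) * (|p.2.1| * 1) + |p.1| * (|p.2.1| ^ (r - 1) * 1)) := by
    intro p
    refine (abs_add_rpow_le (by linarith) _ _).trans ?_
    have hx : |p.1 * Real.cos p.2.2| ≤ |p.1| := by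
      rw [abs_mul]; exact mul_le_of_le_one_right (abs_nonneg _) (Real.abs_cos_le_one _)
    have hy : |p.2.1 * Real.sin p.2.2| ≤ |p.2.1| := by
      rw [abs_mul]; exact mul_le_of_le_one_right (abs_nonneg _) (Real.abs_sin_le_one _)
    have e1 : |p.1 * Real.cos p.2.2| ^ r = |p.1| ^ r * |Real.cos p.2.2| ^ r := by
      rw [abs_mul, Real.mul_rpow (abs_nonneg _) (abs_nonneg _)]
    have e2 : |p.2.1 * Real.sin p.2.2| ^ r = |p.2.1| ^ r * |Real.sin p.2.2| ^ r := by
      rw [abs_mul, Real.mul_rpow (abs_nonneg _) (abs_nonneg _)]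
    have f1 := Real.rpow_le_rpow (z := r - 1) (abs_nonneg _) hx (by linarith)
    have f2 := Real.rpow_le_rpow (z := r - 1) (abs_nonneg _) hy (by linarith)
    rw [e1, e2, one_mul, one_mul, mul_one, mul_one]
    gcongr
  have k12 : Integrable (fun p : ℝ × ℝ × ℝ => |p.1| ^ r * (1 * |Real.cos p.2.2| ^ r) +
      1 * (|p.2.1| ^ r * |Real.sin p.2.2| ^ r)) ((g s).prod ((g s).prod angleLaw)) :=
    k1.1.add k2.1
  have k34 : Integrable (fun p : ℝ × ℝ × ℝ => |p.1| ^ (r - 1) * (|p.2.1| * 1) +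
      |p.1| * (|p.2.1| ^ (r - 1) * 1)) ((g s).prod ((g s).prod angleLaw)) := k3.1.add k4.1
  have hint := k12.add (k34.const_mul C)
  have hm : AEStronglyMeasurable (fun p : ℝ × ℝ × ℝ =>
      |p.1 * Real.cos p.2.2 + p.2.1 * Real.sin p.2.2| ^ r) ((g s).prod ((g s).prod angleLaw)) :=
    Measurable.aestronglyMeasurable (by fun_prop)
  have hi : Integrable (fun p : ℝ × ℝ × ℝ =>
      |p.1 * Real.cos p.2.2 + p.2.1 * Real.sin p.2.2| ^ r) ((g s).prod ((g s).prod angleLaw)) := by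
    refine hint.mono' hm (ae_of_all _ fun p => ?_)
    rw [Real.norm_eq_abs, abs_of_nonneg (by positivity)]
    exact e p
  rw [collisionKernel_apply, collision]
  have hm' : Measurable fun v : ℝ => |v| ^ r := by fun_prop
  refine ⟨(integrable_map_measure hm'.aestronglyMeasurable (by fun_prop)).2 hi, ?_⟩
  rw [integral_map (by fun_prop) hm'.aestronglyMeasurable]
  refine (integral_mono hi hint e).trans (le_of_eq ?_)
  rw [integral_add' k12 (k34.const_mul C), integral_add k1.1 k2.1, integral_const_mul C,
    integral_add k3.1 k4.1, k1.2, k2.2, k3.2, k4.2, integral_abs_sin_rpow_angleLaw, momentConst]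
  simp only [integral_const, probReal_univ, smul_eq_mul, mul_one, one_mul]
  ring

/-- Uniform propagation of moments by the kinetic equation. -/
lemma exists_moment_bound_uniform (hlam : 0 ≤ lam) (hmu : 0 < mu) (hT : 0 ≤ T) (ha : 2 * a < mu)
    (hr : 2 < r) (hra : r * a < 2 * lam * momentConst r + mu) (M : ℝ) :
    ∃ K : ℝ, ∀ g : Kernel ℝ ℝ, IsKineticFlow lam mu a T g →
      Integrable (fun v : ℝ => |v| ^ r) (g 0) → ∫ v, |v| ^ r ∂g 0 = M → ∀ t, 0 ≤ t →
      Real.exp (r * a * t) * ∫ v, |v| ^ r ∂g t ≤ K ∧ energy a g t ≤ K := by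
  -- The relaxation rate of the `r`-th moment in the frame with drift, before the cross terms; the
  -- hypothesis on `r` says that it is positive. Half of it will be spent on the cross terms.
  set η := 2 * lam * momentConst r + mu - r * a
  have hη : 0 < η := by simp only [η]; linarith
  set K₂ := 1 + M + mu * T / (mu - 2 * a)
  set C := r * 2 ^ (r - 1)
  have hC : 0 ≤ C := by simp only [C]; positivity
  -- Chosen so that `4 * lam * C * (1 + |K₂|) * δ ≤ η / 2`, where `K₂` bounds the energy; the `+ 1`
  -- prevents a zero denominator.
  set δ := η / (8 * lam * C * (1 + |K₂|) + 1)
  have hδ : 0 < δ := by positivity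
  set γ := ∫ w, |w| ^ r ∂thermostat T
  set R := 4 * lam * C * δ ^ (1 - r) * (1 + |K₂|) + mu * γ
  refine ⟨max (M + 2 * R / η) K₂, fun g hg h0 hM t ht => ?_⟩
  have := hg.markov
  have hsq : ∀ ν : Measure ℝ, IsProbabilityMeasure ν → Integrable (fun v : ℝ => |v| ^ r) ν →
      Integrable (fun v : ℝ => v ^ 2) ν := fun ν _ h => by
    simpa using integrable_rpow_of_le (p := 2) (by norm_num) hr.le h
  have hint : ∀ s, 0 ≤ s → Integrable (fun v : ℝ => |v| ^ r) (g s) := fun s hs =>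
    hg.integrable_rpow hlam hmu.le (by linarith) h0 hs
  have henergy : ∀ s, 0 ≤ s → energy a g s ≤ K₂ := by
    intro s hs
    refine (hg.energy_le hlam hmu.le hT ha (hsq _ inferInstance h0) hs).trans ?_
    have : energy a g 0 ≤ 1 + M := by
      simp only [energy, mul_zero, Real.exp_zero, one_mul]
      rw [← hM]
      have : ∫ v, (1 + |v| ^ r) ∂g 0 = 1 + ∫ v, |v| ^ r ∂g 0 := by
        rw [integral_add (integrable_const _) h0]; simp
      rw [← this]
      refine integral_mono (hsq _ inferInstance h0) ((integrable_const _).add h0) fun v => ?_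
      simp only
      rw [← sq_abs]
      rcases le_total |v| 1 with h1 | h1
      · have : 0 ≤ |v| ^ r := by positivity
        have : |v| ^ 2 ≤ 1 := pow_le_one₀ (abs_nonneg _) h1
        linarith
      · have := Real.rpow_le_rpow_of_exponent_le h1 hr.le
        rw [Real.rpow_ofNat] at this
        linarith
    simp only [K₂]; linarith
  refine ⟨?_, (henergy t ht).trans (le_max_right _ _)⟩
  obtain ⟨B, hB⟩ := hg.exists_moment_bound hlam hmu.le (by linarith : (0 : ℝ) ≤ r) h0 t
  have hp := (IsPrimitive.exp (r * a) (t := t)).mul (hg.flow.isPrimitive_of_nonneg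
    (ψ := fun v => |v| ^ r) (by fun_prop) (fun v => by positivity) ht
    (B := ENNReal.ofReal B) (by simp) hB) ht
  have hγ : 0 ≤ γ := integral_nonneg fun v => by positivity
  have hR : 0 ≤ R := by positivity
  have key := hp.le_of_deriv_le ht (c := η / 2) (R := fun _ => R) (by simp) fun s hs => ?_
  · rw [intervalIntegral.integral_mul_const] at key
    have h2 := integral_exp_neg_mul_sub_le (half_pos hη) t
    have h3 : Real.exp (-(η / 2 * t)) ≤ 1 := Real.exp_le_one_iff.2 (by nlinarith)
    have hM0 : 0 ≤ M := hM ▸ integral_nonneg fun v => by positivity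
    simp only [mul_zero, Real.exp_zero, one_mul, hM] at key
    refine le_trans ?_ (le_max_left _ _)
    calc _ ≤ _ := key
      _ ≤ 1 * M + 1 / (η / 2) * R := by gcongr
      _ = _ := by rw [one_mul, one_div_div]; ring
  · obtain ⟨i1, e1⟩ := integral_rpow_collisionKernel_le g hr (hint s hs.1)
    obtain ⟨i2, e2⟩ := integral_abs_rpow_thermostatKernel (a := a) (T := T) (r := r)
      (by linarith) s
    rw [(integral_kineticGain g hlam hmu.le i1 i2).2, e2, Real.coe_toNNReal _ (by positivity)]
    set y := ∫ v, |v| ^ r ∂g s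
    have hy : 0 ≤ y := integral_nonneg fun v => by positivity
    have m1 : Real.exp ((r - 1) * a * s) * ∫ v, |v| ^ (r - 1) ∂g s ≤
        δ * (Real.exp (r * a * s) * y) + δ ^ (1 - r) := by
      have : δ * (Real.exp (r * a * s) * y) + δ ^ (1 - r) =
          ∫ v, (δ * (Real.exp (r * a * s) * |v| ^ r) + δ ^ (1 - r)) ∂g s := by
        rw [integral_add (((hint s hs.1).const_mul _).const_mul _) (integrable_const _),
          integral_const_mul, integral_const_mul]
        simp [y]
      rw [this, ← integral_const_mul]
      refine integral_mono ((integrable_rpow_of_le (by linarith) (by linarith)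
        (hint s hs.1)).const_mul _) ((((hint s hs.1).const_mul _).const_mul _).add
        (integrable_const _)) fun v => ?_
      have h1 := rpow_sub_one_le (x := |Real.exp (a * s) * v|) (abs_nonneg _) hδ
        (by linarith : 1 < r)
      simp only [abs_exp_mul_rpow] at h1
      simp only [mul_assoc] at h1 ⊢
      exact h1
    have i3 : Integrable (fun v : ℝ => |v|) (g s) := by
      simpa using integrable_rpow_of_le zero_le_one (by linarith) (hint s hs.1)
    have m2 : Real.exp (a * s) * ∫ v, |v| ∂g s ≤ 1 + |K₂| := by
      have h1 : Real.exp (a * s) * ∫ v, |v| ∂g s ≤ 1 + energy a g s := by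
        have : 1 + energy a g s = ∫ v, (1 + Real.exp (2 * a * s) * v ^ 2) ∂g s := by
          rw [integral_add (integrable_const _) ((hsq _ inferInstance (hint s hs.1)).const_mul _),
            integral_const_mul]
          simp [energy]
        rw [this, ← integral_const_mul]
        refine integral_mono (i3.const_mul _) ((integrable_const _).add
          ((hsq _ inferInstance (hint s hs.1)).const_mul _)) fun v => ?_
        have h3 : Real.exp (2 * a * s) = Real.exp (a * s) ^ 2 := by
          rw [← Real.exp_nat_mul]; congr 1; push_cast; ring
        simp only [h3]
        rw [← sq_abs v]
        nlinarith [sq_nonneg (Real.exp (a * s) * |v| - 1)]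
      linarith [henergy s hs.1, le_abs_self K₂]
    set m := ∫ v, |v| ^ (r - 1) ∂g s
    set m' := ∫ v, |v| ∂g s
    have hm0 : 0 ≤ m := integral_nonneg fun v => by positivity
    have hm0' : 0 ≤ m' := integral_nonneg fun v => abs_nonneg v
    set X := Real.exp (r * a * s)
    have hX : 0 < X := Real.exp_pos _
    have hX1 : X = Real.exp ((r - 1) * a * s) * Real.exp (a * s) := by
      rw [← Real.exp_add]; simp only [X]; congr 1; ring
    have hX2 : X * Real.exp (-(r * a * s)) = 1 := by
      rw [← Real.exp_add]; simp
    have hprod : X * (m * m') ≤ (δ * (X * y) + δ ^ (1 - r)) * (1 + |K₂|) := by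
      calc X * (m * m') = (Real.exp ((r - 1) * a * s) * m) * (Real.exp (a * s) * m') := by
            rw [hX1]; ring
        _ ≤ _ := mul_le_mul m1 m2 (by positivity) (by positivity)
    have hδ' : 4 * lam * C * (1 + |K₂|) * δ ≤ η / 2 := by
      have : 4 * lam * C * (1 + |K₂|) * δ =
          η * (4 * lam * C * (1 + |K₂|)) / (8 * lam * C * (1 + |K₂|) + 1) := by
        simp only [δ]; ring
      rw [this, div_le_div_iff₀ (by positivity) (by norm_num)]
      nlinarith
    have hcoll : X * (2 * lam * ∫ v, |v| ^ r ∂collisionKernel g s) ≤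
        2 * lam * (1 - momentConst r) * (X * y) + 4 * lam * C * (1 + |K₂|) * δ * (X * y) +
          4 * lam * C * δ ^ (1 - r) * (1 + |K₂|) := by
      calc _ ≤ X * (2 * lam * ((1 - momentConst r) * y + 2 * C * (m * m'))) := by gcongr
        _ = 2 * lam * (1 - momentConst r) * (X * y) + 4 * lam * C * (X * (m * m')) := by ring
        _ ≤ 2 * lam * (1 - momentConst r) * (X * y) +
            4 * lam * C * ((δ * (X * y) + δ ^ (1 - r)) * (1 + |K₂|)) := by gcongr
        _ = _ := by ring
    have h8 := mul_le_mul_of_nonneg_right hδ' (by positivity : 0 ≤ X * y)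
    have h9 : X * (mu * (Real.exp (-(r * a * s)) * γ)) = mu * γ := by
      linear_combination (mu * γ) * hX2
    simp only [R, η] at h8 ⊢
    linarith

end Moments

/-! ### The coupling with nonlinear particles and its jump rates. -/

section Coupling

variable {N : ℕ}

lemma measurable_rank {ι : Type*} [LinearOrder ι] (S : Finset ι) (j : ι) :
    Measurable fun u : ι → ℝ => (rank S u j : ℝ) := by
  have : (fun u : ι → ℝ => (rank S u j : ℝ)) =
      fun u => ∑ l ∈ S, if u l < u j ∨ (u l = u j ∧ l < j) then (1 : ℝ) else 0 := by
    ext u; rw [rank, Finset.card_filter]; push_cast; rfl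
  rw [this]
  refine Finset.measurable_sum _ fun l _ => Measurable.ite ?_ measurable_const measurable_const
  have h1 : Measurable fun u : ι → ℝ => u l := measurable_pi_apply l
  have h2 : Measurable fun u : ι → ℝ => u j := measurable_pi_apply j
  exact (measurableSet_lt h1 h2).union ((measurableSet_eq_fun h1 h2).inter (MeasurableSet.const _))

lemma measurable_partner_joint {ι : Type*} [LinearOrder ι] (g : Kernel ℝ ℝ) [IsMarkovKernel g]
    (S : Finset ι) (j : ι) :
    Measurable fun q : ℝ × (ι → ℝ) × ℝ => partner S q.2.1 (g q.1) j q.2.2 :=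
  (measurable_quantile_kernel g).comp (measurable_fst.prodMk
    (((((measurable_rank S j).comp measurable_fst).comp measurable_snd).add
      (measurable_snd.comp measurable_snd)).div_const _))

lemma sum_map_partner {ι : Type*} [LinearOrder ι] {S : Finset ι} (u : ι → ℝ) (hS : S.Nonempty)
    (ν : Measure ℝ) [IsProbabilityMeasure ν] :
    ∑ j ∈ S, unitLaw.map (partner S u ν j) = (S.card : ℝ≥0∞) • ν := by
  ext A hA
  have h1 := sum_lintegral_partner u hS ν (φ := A.indicator 1) (measurable_one.indicator hA)
  rw [lintegral_indicator_one hA] at h1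
  simp only [Measure.finsetSum_apply, Measure.smul_apply, smul_eq_mul]
  rw [← h1]
  refine Finset.sum_congr rfl fun j _ => ?_
  rw [Measure.map_apply (measurable_partner u ν j) hA, ← lintegral_indicator_one
    (measurable_partner u ν j hA)]
  rfl

lemma integrable_partner {ι : Type*} [LinearOrder ι] {S : Finset ι} (u : ι → ℝ)
    (ν : Measure ℝ) [IsProbabilityMeasure ν] {φ : ℝ → ℝ} (hφ : Integrable φ ν) {j : ι}
    (hj : j ∈ S) : Integrable (fun ρ => φ (partner S u ν j ρ)) unitLaw := by
  have h1 : Integrable φ (∑ j ∈ S, unitLaw.map (partner S u ν j)) := by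
    rw [sum_map_partner u ⟨j, hj⟩]
    exact hφ.smul_measure (by simp)
  exact ((integrable_finsetSum_measure.1 h1) j hj).comp_measurable (measurable_partner u ν j)

lemma sum_integral_partner {ι : Type*} [LinearOrder ι] {S : Finset ι} (u : ι → ℝ)
    (hS : S.Nonempty) (ν : Measure ℝ) [IsProbabilityMeasure ν] {φ : ℝ → ℝ} (hφ : Integrable φ ν)
    (hφm : Measurable φ) :
    ∑ j ∈ S, ∫ ρ, φ (partner S u ν j ρ) ∂unitLaw = S.card * ∫ x, φ x ∂ν := by
  have h1 : Integrable φ (∑ j ∈ S, unitLaw.map (partner S u ν j)) := by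
    rw [sum_map_partner u hS]
    exact hφ.smul_measure (by simp)
  have h2 := integral_finsetSum_measure (integrable_finsetSum_measure.1 h1)
  rw [sum_map_partner u hS, integral_smul_measure] at h2
  simp only [ENNReal.toReal_natCast, smul_eq_mul] at h2
  rw [h2]
  exact Finset.sum_congr rfl fun j _ => (integral_map (measurable_partner u ν j).aemeasurable
    hφm.aestronglyMeasurable).symm

/-- Collision of the particles `i ≠ j` of a system of nonlinear particles, the post-collisional
velocities being computed with the partners `x` of `i` and `y` of `j`. -/
noncomputable def nonlinearJump (i j : Fin N) (u : Fin N → ℝ) (θ x y : ℝ) : Fin N → ℝ := fun k =>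
  if k = i then u i * Real.cos θ - x * Real.sin θ
  else if k = j then y * Real.sin θ + u j * Real.cos θ
  else u k

/-- Simultaneous collision in both systems; `z` is the angle and the quantile level. -/
noncomputable def couplingCollision (g : Kernel ℝ ℝ) (i j : Fin N) (s : ℝ)
    (x : (Fin N → ℝ) × (Fin N → ℝ)) (z : ℝ × ℝ) : (Fin N → ℝ) × (Fin N → ℝ) :=
  (kacJump i j x.1 z.1, nonlinearJump i j x.2 z.1
    -- The ranks exclude the particle which undergoes the collision, so that the laws of its
    -- partners over `j ≠ i` average exactly to `g s`.
    (partner (Finset.univ.erase i) x.2 (g s) j z.2) (partner (Finset.univ.erase j) x.2 (g s) i z.2))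

/-- Simultaneous interaction with the thermostat in both systems. -/
noncomputable def couplingThermo (a E : ℝ) (i : Fin N) (s : ℝ) (x : (Fin N → ℝ) × (Fin N → ℝ))
    (w : ℝ) : (Fin N → ℝ) × (Fin N → ℝ) :=
  (thermoJump E i x.1 w, Function.update x.2 i (Real.exp (-(a * s)) * w))

lemma measurable_couplingCollision (g : Kernel ℝ ℝ) [IsMarkovKernel g] (i j : Fin N) :
    Measurable fun q : (ℝ × (Fin N → ℝ) × (Fin N → ℝ)) × ℝ × ℝ =>
      couplingCollision g i j q.1.1 q.1.2 q.2 := by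
  have hp : ∀ (S : Finset (Fin N)) (k : Fin N), Measurable
      fun q : (ℝ × (Fin N → ℝ) × (Fin N → ℝ)) × ℝ × ℝ => partner S q.1.2.2 (g q.1.1) k q.2.2 :=
    fun S k => by
    have hf : Measurable fun q : (ℝ × (Fin N → ℝ) × (Fin N → ℝ)) × ℝ × ℝ =>
      (q.1.1, q.1.2.2, q.2.2) := (measurable_fst.comp measurable_fst).prodMk
      ((measurable_snd.comp (measurable_snd.comp measurable_fst)).prodMk
        (measurable_snd.comp measurable_snd))
    have h := Measurable.comp (measurable_partner_joint (ι := Fin N) g S k) hf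
    simp only [Function.comp_def] at h
    exact h
  have hv : ∀ k : Fin N, Measurable
      fun q : (ℝ × (Fin N → ℝ) × (Fin N → ℝ)) × ℝ × ℝ => q.1.2.1 k := fun k => by fun_prop
  have hu : ∀ k : Fin N, Measurable
      fun q : (ℝ × (Fin N → ℝ) × (Fin N → ℝ)) × ℝ × ℝ => q.1.2.2 k := fun k => by fun_prop
  have hc : Measurable
      fun q : (ℝ × (Fin N → ℝ) × (Fin N → ℝ)) × ℝ × ℝ => Real.cos q.2.1 := by fun_prop
  have hs : Measurable
      fun q : (ℝ × (Fin N → ℝ) × (Fin N → ℝ)) × ℝ × ℝ => Real.sin q.2.1 := by fun_prop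
  refine Measurable.prodMk (measurable_pi_lambda _ fun k => ?_)
    (measurable_pi_lambda _ fun k => ?_)
  · unfold kacJump
    split_ifs
    · exact ((hv i).mul hc).sub ((hv j).mul hs)
    · exact ((hv i).mul hs).add ((hv j).mul hc)
    · exact hv k
  · unfold nonlinearJump
    split_ifs
    · exact ((hu i).mul hc).sub ((hp _ j).mul hs)
    · exact ((hp _ i).mul hs).add ((hu j).mul hc)
    · exact hu k

lemma measurable_beta (E : ℝ) : Measurable (KacThermostat.beta N E) := by unfold KacThermostat.beta; fun_prop

lemma measurable_couplingThermo (a E : ℝ) (i : Fin N) :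
    Measurable fun q : (ℝ × (Fin N → ℝ) × (Fin N → ℝ)) × ℝ =>
      couplingThermo a E i q.1.1 q.1.2 q.2 := by
  have hb : Measurable fun q : (ℝ × (Fin N → ℝ) × (Fin N → ℝ)) × ℝ =>
      KacThermostat.beta N E q.2 := (measurable_beta E).comp measurable_snd
  have hv : ∀ k : Fin N, Measurable
      fun q : (ℝ × (Fin N → ℝ) × (Fin N → ℝ)) × ℝ => q.1.2.1 k := fun k => by fun_prop
  have hu : ∀ k : Fin N, Measurable
      fun q : (ℝ × (Fin N → ℝ) × (Fin N → ℝ)) × ℝ => q.1.2.2 k := fun k => by fun_prop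
  refine Measurable.prodMk (measurable_pi_lambda _ fun k => ?_)
    (measurable_pi_lambda _ fun k => ?_)
  · unfold thermoJump
    split_ifs
    · exact hb.mul measurable_snd
    · exact hb.mul (hv k)
  · simp only [Function.update_apply]
    split_ifs
    · fun_prop
    · exact hu k

/-- The kernel of the image measures of `ζ` under the maps `J p`. -/
noncomputable def jumpKernel {Y Z W : Type*} [MeasurableSpace Y] [MeasurableSpace Z]
    [MeasurableSpace W] (ζ : Measure Z) (J : Y → Z → W) : Kernel Y W :=
  (Kernel.id ×ₖ Kernel.const Y ζ).map (Function.uncurry J)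

lemma jumpKernel_apply {Y Z W : Type*} [MeasurableSpace Y] [MeasurableSpace Z]
    [MeasurableSpace W] (ζ : Measure Z) [IsProbabilityMeasure ζ] {J : Y → Z → W}
    (hJ : Measurable (Function.uncurry J)) (y : Y) : jumpKernel ζ J y = ζ.map (J y) := by
  rw [jumpKernel, Kernel.map_apply _ hJ, Kernel.prod_apply, Kernel.id_apply,
    Kernel.const_apply, Measure.dirac_prod, Measure.map_map hJ (by fun_prop)]
  rfl

/-- The jump rates of the coupling of the particle system with nonlinear particles. -/
noncomputable def couplingRate (N : ℕ) (lam mu a E T : ℝ) (g : Kernel ℝ ℝ) :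
    Kernel (ℝ × (Fin N → ℝ) × (Fin N → ℝ)) ((Fin N → ℝ) × (Fin N → ℝ)) :=
  -- The total rate `N * lam` is shared by the `N * (N - 1)` ordered pairs.
  ⟨fun p => ∑ i, ∑ j ∈ Finset.univ.erase i, ENNReal.ofReal (lam / (N - 1)) •
      jumpKernel (angleLaw.prod unitLaw)
        (fun p : ℝ × (Fin N → ℝ) × (Fin N → ℝ) => couplingCollision g i j p.1 p.2) p +
    ∑ i, ENNReal.ofReal mu • jumpKernel (thermostat T)
        (fun p : ℝ × (Fin N → ℝ) × (Fin N → ℝ) => couplingThermo a E i p.1 p.2) p,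
    Measure.measurable_of_measurable_coe _ fun S hS => by
      simp only [Measure.add_apply, Measure.finsetSum_apply, Measure.smul_apply, smul_eq_mul]
      refine Measurable.add ?_ ?_
      · exact Finset.measurable_sum _ fun i _ => Finset.measurable_sum _ fun j _ =>
          (Kernel.measurable_coe _ hS).const_mul _
      · exact Finset.measurable_sum _ fun i _ => (Kernel.measurable_coe _ hS).const_mul _⟩

lemma sum_erase_const (hN : 2 ≤ N) (c : ℝ) :
    ∑ i : Fin N, ∑ _j ∈ Finset.univ.erase i, c / ((N : ℝ) - 1) = N * c := by
  have : ((N : ℝ) - 1) ≠ 0 := by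
    have : (2 : ℝ) ≤ N := by exact_mod_cast hN
    linarith
  simp only [Finset.sum_const, Finset.card_erase_of_mem (Finset.mem_univ _), Finset.card_univ,
    Fintype.card_fin, nsmul_eq_mul]
  rw [Nat.cast_sub (by omega)]
  push_cast
  field_simp

variable {lam mu a E T : ℝ} (g : Kernel ℝ ℝ) [IsMarkovKernel g]

lemma couplingRate_apply (s : ℝ) (x : (Fin N → ℝ) × (Fin N → ℝ)) :
    couplingRate N lam mu a E T g (s, x) =
      ∑ i, ∑ j ∈ Finset.univ.erase i, ENNReal.ofReal (lam / (N - 1)) •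
        (angleLaw.prod unitLaw).map (couplingCollision g i j s x) +
      ∑ i, ENNReal.ofReal mu • (thermostat T).map (couplingThermo a E i s x) := by
  have h1 : ∀ i j, jumpKernel (angleLaw.prod unitLaw)
      (fun p : ℝ × (Fin N → ℝ) × (Fin N → ℝ) => couplingCollision g i j p.1 p.2) (s, x) =
      (angleLaw.prod unitLaw).map (couplingCollision g i j s x) := fun i j =>
    jumpKernel_apply _ (measurable_couplingCollision g i j) (s, x)
  have h2 : ∀ i, jumpKernel (thermostat T)
      (fun p : ℝ × (Fin N → ℝ) × (Fin N → ℝ) => couplingThermo a E i p.1 p.2) (s, x) =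
      (thermostat T).map (couplingThermo a E i s x) := fun i =>
    jumpKernel_apply _ (measurable_couplingThermo a E i) (s, x)
  simp_rw [← h1, ← h2]
  rfl

lemma measurable_couplingCollision_right (i j : Fin N) (s : ℝ) (x : (Fin N → ℝ) × (Fin N → ℝ)) :
    Measurable (couplingCollision g i j s x) :=
  (measurable_couplingCollision g i j).comp (measurable_prodMk_left (x := (s, x)))

lemma measurable_couplingThermo_right (i : Fin N) (s : ℝ) (x : (Fin N → ℝ) × (Fin N → ℝ)) :
    Measurable (couplingThermo a E i s x) :=
  (measurable_couplingThermo a E i).comp (measurable_prodMk_left (x := (s, x)))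

lemma lintegral_couplingRate {φ : (Fin N → ℝ) × (Fin N → ℝ) → ℝ≥0∞} (hφ : Measurable φ) (s : ℝ)
    (x : (Fin N → ℝ) × (Fin N → ℝ)) :
    ∫⁻ y, φ y ∂couplingRate N lam mu a E T g (s, x) =
      ∑ i, ∑ j ∈ Finset.univ.erase i, ENNReal.ofReal (lam / (N - 1)) *
        ∫⁻ z, φ (couplingCollision g i j s x z) ∂(angleLaw.prod unitLaw) +
      ∑ i, ENNReal.ofReal mu * ∫⁻ w, φ (couplingThermo a E i s x w) ∂thermostat T := by
  rw [couplingRate_apply, lintegral_add_measure]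
  simp only [lintegral_finsetSum_measure, lintegral_smul_measure, smul_eq_mul]
  simp_rw [lintegral_map hφ (measurable_couplingCollision_right g _ _ s x),
    lintegral_map hφ (measurable_couplingThermo_right _ s x)]

lemma couplingRate_univ (hN : 2 ≤ N) (hlam : 0 ≤ lam) (hmu : 0 ≤ mu)
    (p : ℝ × (Fin N → ℝ) × (Fin N → ℝ)) :
    couplingRate N lam mu a E T g p Set.univ = (N * (lam + mu)).toNNReal := by
  have h1 := lintegral_couplingRate (lam := lam) (mu := mu) (a := a) (E := E) (T := T) g
    (φ := fun _ => 1) measurable_const p.1 p.2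
  have hN1 : (0 : ℝ) ≤ N - 1 := by
    have : (2 : ℝ) ≤ N := by exact_mod_cast hN
    linarith
  simp only [lintegral_const, one_mul, measure_univ, mul_one] at h1
  rw [h1]
  have h2 := sum_erase_const hN lam
  have h3 : ∑ i : Fin N, ∑ j ∈ Finset.univ.erase i, ENNReal.ofReal (lam / (N - 1)) =
      ENNReal.ofReal (N * lam) := by
    rw [← h2, ENNReal.ofReal_sum_of_nonneg fun i _ => by positivity]
    exact Finset.sum_congr rfl fun i _ => (ENNReal.ofReal_sum_of_nonneg fun j _ => by
      positivity).symm
  rw [h3, Finset.sum_const, Finset.card_univ, Fintype.card_fin, nsmul_eq_mul,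
    ← ENNReal.ofReal_natCast, ← ENNReal.ofReal_mul (by positivity),
    ← ENNReal.ofReal_add (by positivity) (by positivity), ← mul_add]
  rfl

/-- The generator of the coupling. -/
lemma integral_couplingRate_sub (hN : 2 ≤ N) (hlam : 0 ≤ lam) (hmu : 0 ≤ mu)
    {ψ : (Fin N → ℝ) × (Fin N → ℝ) → ℝ} (hψ : Measurable ψ) (s : ℝ)
    (x : (Fin N → ℝ) × (Fin N → ℝ))
    (h1 : ∀ i j, j ≠ i → Integrable (fun z => ψ (couplingCollision g i j s x z))
      (angleLaw.prod unitLaw))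
    (h2 : ∀ i, Integrable (fun w => ψ (couplingThermo a E i s x w)) (thermostat T)) :
    Integrable ψ (couplingRate N lam mu a E T g (s, x)) ∧
    ∫ y, ψ y ∂couplingRate N lam mu a E T g (s, x) - (N * (lam + mu)).toNNReal * ψ x =
      lam / (N - 1) * ∑ i, ∑ j ∈ Finset.univ.erase i,
        ∫ z, (ψ (couplingCollision g i j s x z) - ψ x) ∂(angleLaw.prod unitLaw) +
      mu * ∑ i, ∫ w, (ψ (couplingThermo a E i s x w) - ψ x) ∂thermostat T := by
  have hN1 : (0 : ℝ) ≤ N - 1 := by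
    have : (2 : ℝ) ≤ N := by exact_mod_cast hN
    linarith
  have i1 : ∀ i, ∀ j ∈ Finset.univ.erase i, Integrable ψ (ENNReal.ofReal (lam / (N - 1)) •
      (angleLaw.prod unitLaw).map (couplingCollision g i j s x)) := fun i j hj =>
    ((integrable_map_measure hψ.aestronglyMeasurable
      (measurable_couplingCollision_right g i j s x).aemeasurable).2
      (h1 i j (Finset.ne_of_mem_erase hj))).smul_measure ENNReal.ofReal_ne_top
  have i2 : ∀ i, Integrable ψ (ENNReal.ofReal mu •
      (thermostat T).map (couplingThermo a E i s x)) := fun i =>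
    ((integrable_map_measure hψ.aestronglyMeasurable
      (measurable_couplingThermo_right i s x).aemeasurable).2 (h2 i)).smul_measure
      ENNReal.ofReal_ne_top
  have j1 : ∀ i ∈ Finset.univ, Integrable ψ (∑ j ∈ Finset.univ.erase i,
      ENNReal.ofReal (lam / (N - 1)) •
      (angleLaw.prod unitLaw).map (couplingCollision g i j s x)) :=
    fun i _ => integrable_finsetSum_measure.2 (i1 i)
  have k1 := integrable_finsetSum_measure.2 j1
  have k2 := integrable_finsetSum_measure.2 fun i (_ : i ∈ (Finset.univ : Finset (Fin N))) => i2 i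
  rw [couplingRate_apply]
  refine ⟨k1.add_measure k2, ?_⟩
  rw [integral_add_measure k1 k2, integral_finsetSum_measure j1,
    integral_finsetSum_measure fun i _ => i2 i]
  have e1 : ∀ i ∈ (Finset.univ : Finset (Fin N)), ∫ y, ψ y ∂(∑ j ∈ Finset.univ.erase i,
      ENNReal.ofReal (lam / (N - 1)) •
      (angleLaw.prod unitLaw).map (couplingCollision g i j s x)) =
      lam / (N - 1) * ∑ j ∈ Finset.univ.erase i,
        ∫ z, (ψ (couplingCollision g i j s x z) - ψ x) ∂(angleLaw.prod unitLaw) +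
      (∑ j ∈ Finset.univ.erase i, lam / ((N : ℝ) - 1)) * ψ x := by
    intro i _
    rw [integral_finsetSum_measure (i1 i), Finset.mul_sum, Finset.sum_mul,
      ← Finset.sum_add_distrib]
    refine Finset.sum_congr rfl fun j hj => ?_
    rw [integral_smul_measure, ENNReal.toReal_ofReal (by positivity),
      integral_map (measurable_couplingCollision_right g i j s x).aemeasurable
        hψ.aestronglyMeasurable,
      integral_sub (h1 i j (Finset.ne_of_mem_erase hj)) (integrable_const _)]
    simp
    ring
  have e2 : ∀ i ∈ (Finset.univ : Finset (Fin N)), ∫ y, ψ y ∂(ENNReal.ofReal mu •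
      (thermostat T).map (couplingThermo a E i s x)) =
      mu * ∫ w, (ψ (couplingThermo a E i s x w) - ψ x) ∂thermostat T + mu * ψ x := by
    intro i _
    rw [integral_smul_measure, ENNReal.toReal_ofReal hmu,
      integral_map (measurable_couplingThermo_right i s x).aemeasurable
        hψ.aestronglyMeasurable, integral_sub (h2 i) (integrable_const _)]
    simp
    ring
  rw [Finset.sum_congr rfl e1, Finset.sum_congr rfl e2, Finset.sum_add_distrib,
    Finset.sum_add_distrib, ← Finset.sum_mul, sum_erase_const hN, ← Finset.mul_sum,
    ← Finset.mul_sum, Real.coe_toNNReal _ (by positivity)]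
  simp only [Finset.sum_const, Finset.card_univ, Fintype.card_fin, nsmul_eq_mul]
  ring

end Coupling

/-! ### Jump rates tested on functions of one velocity -/

section Jump

variable {N : ℕ}

lemma sum_comp_eq_of_eq_off_pair {ι : Type*} [Fintype ι] [DecidableEq ι] {i j : ι} (hij : i ≠ j)
    {u w : ι → ℝ} (h : ∀ k, k ≠ i → k ≠ j → w k = u k) (φ : ℝ → ℝ) :
    ∑ k, φ (w k) = ∑ k, φ (u k) + ((φ (w i) - φ (u i)) + (φ (w j) - φ (u j))) := by
  rw [← Fintype.sum_eq_add (f := fun k => φ (w k) - φ (u k)) i j hij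
    (fun k hk => by rw [h k hk.1 hk.2, sub_self]), Finset.sum_sub_distrib]
  ring

lemma sum_comp_update {ι : Type*} [Fintype ι] [DecidableEq ι] (u : ι → ℝ) (i : ι) (y : ℝ)
    (φ : ℝ → ℝ) : ∑ k, φ (Function.update u i y k) = ∑ k, φ (u k) + (φ y - φ (u i)) := by
  have := Fintype.sum_eq_single (f := fun k => φ (Function.update u i y k) - φ (u k)) i
    (fun k hk => by simp [hk])
  rw [Finset.sum_sub_distrib] at this
  simp only [Function.update_self] at this
  linarith

/-- The average of `φ` over the particles. -/
noncomputable def mean (φ : ℝ → ℝ) (u : Fin N → ℝ) : ℝ := (N : ℝ)⁻¹ * ∑ k, φ (u k)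

lemma abs_mean_le {φ : ℝ → ℝ} {K : ℝ} (hK : ∀ y, |φ y| ≤ K) (u : Fin N → ℝ) : |mean φ u| ≤ K := by
  have h0 : 0 ≤ K := (abs_nonneg _).trans (hK 0)
  rcases Nat.eq_zero_or_pos N with rfl | hN
  · simpa [mean] using h0
  rw [mean, abs_mul, abs_of_nonneg (by positivity), inv_mul_le_iff₀ (by exact_mod_cast hN)]
  refine (Finset.abs_sum_le_sum_abs _ _).trans ((Finset.sum_le_sum fun k _ => hK _).trans ?_)
  simp

@[fun_prop]
lemma measurable_mean {φ : ℝ → ℝ} (hφ : Measurable φ) :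
    Measurable (mean φ : (Fin N → ℝ) → ℝ) := by
  unfold mean; fun_prop

/-- The law of a velocity `y` after a collision with a particle distributed according to `ν`,
tested on `φ`. -/
noncomputable def collisionMean (ν : Measure ℝ) (φ : ℝ → ℝ) (y : ℝ) : ℝ :=
  ∫ p, φ (y * Real.cos p.1 + p.2 * Real.sin p.1) ∂(angleLaw.prod ν)

variable {ν : Measure ℝ} [IsProbabilityMeasure ν]

lemma abs_collisionMean_le {φ : ℝ → ℝ} {K : ℝ} (hK : ∀ y, |φ y| ≤ K) (y : ℝ) :
    |collisionMean ν φ y| ≤ K := by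
  have := norm_integral_le_of_norm_le_const (μ := angleLaw.prod ν)
    (f := fun p => φ (y * Real.cos p.1 + p.2 * Real.sin p.1)) (ae_of_all _ fun p => hK _)
  simpa [collisionMean] using this

lemma measurable_collisionMean {φ : ℝ → ℝ} (hφ : Measurable φ) :
    Measurable (collisionMean ν φ) := by
  have : Measurable fun q : ℝ × ℝ × ℝ => φ (q.1 * Real.cos q.2.1 + q.2.2 * Real.sin q.2.1) := by
    fun_prop
  exact (this.stronglyMeasurable.integral_prod_right').measurable

lemma integral_collisionMean (g : Kernel ℝ ℝ) [IsMarkovKernel g] {φ : ℝ → ℝ} (hφ : Measurable φ)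
    {K : ℝ} (hK : ∀ y, |φ y| ≤ K) (s : ℝ) :
    ∫ y, collisionMean (g s) φ y ∂g s = ∫ y, φ y ∂collisionKernel g s := by
  rw [collisionKernel_apply, collision, integral_map measurable_collisionMap.aemeasurable
    hφ.aestronglyMeasurable, integral_prod _ (Integrable.of_bound
      (by exact (hφ.comp measurable_collisionMap).aestronglyMeasurable) K (ae_of_all _ fun p => hK _))]
  refine integral_congr_ae (ae_of_all _ fun y => ?_)
  simp only [collisionMean]
  rw [← integral_prod_swap]
  rfl

variable (g : Kernel ℝ ℝ) [IsMarkovKernel g]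

lemma integral_collisionMean_eq {φ : ℝ → ℝ} (hφ : Measurable φ) {K : ℝ} (hK : ∀ y, |φ y| ≤ K)
    (y : ℝ) : collisionMean ν φ y =
      ∫ θ, ∫ x, φ (y * Real.cos θ + x * Real.sin θ) ∂ν ∂angleLaw := by
  have hm : Measurable fun p : ℝ × ℝ => φ (y * Real.cos p.1 + p.2 * Real.sin p.1) := by fun_prop
  exact integral_prod _ (Integrable.of_bound hm.aestronglyMeasurable K (ae_of_all _ fun p => hK _))

lemma sum_integral_partner_angle {ι : Type*} [LinearOrder ι] {S : Finset ι} (hS : S.Nonempty)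
    (u : ι → ℝ) {φ : ℝ → ℝ} (hφ : Measurable φ) {K : ℝ} (hK : ∀ y, |φ y| ≤ K) (y : ℝ) :
    ∑ j ∈ S, ∫ z, φ (y * Real.cos z.1 + partner S u ν j z.2 * Real.sin z.1)
      ∂(angleLaw.prod unitLaw) = S.card * collisionMean ν φ y := by
  have hm : ∀ j, Measurable fun z : ℝ × ℝ =>
      φ (y * Real.cos z.1 + partner S u ν j z.2 * Real.sin z.1) := fun j => by
    have hp : Measurable fun z : ℝ × ℝ => partner S u ν j z.2 :=
      (measurable_partner u ν j).comp measurable_snd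
    fun_prop
  have hi : ∀ j, Integrable (fun z : ℝ × ℝ =>
      φ (y * Real.cos z.1 + partner S u ν j z.2 * Real.sin z.1)) (angleLaw.prod unitLaw) :=
    fun j => Integrable.of_bound (hm j).aestronglyMeasurable K (ae_of_all _ fun p => hK _)
  simp_rw [fun j => integral_prod _ (hi j)]
  rw [← integral_finsetSum _ fun j _ => (hi j).integral_prod_left, integral_collisionMean_eq hφ hK,
    ← integral_const_mul]
  refine integral_congr_ae (ae_of_all _ fun θ => ?_)
  have hmθ : Measurable fun x => φ (y * Real.cos θ + x * Real.sin θ) := by fun_prop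
  exact sum_integral_partner u hS ν (φ := fun x => φ (y * Real.cos θ + x * Real.sin θ))
    (Integrable.of_bound hmθ.aestronglyMeasurable K (ae_of_all _ fun p => hK _)) hmθ

/-- The sign of the sine is immaterial by `integral_angleLaw_neg_sin`: a particle has the same
post-collisional law whether it is first or second in the pair. -/
lemma sum_integral_partner_angle_neg {ι : Type*} [LinearOrder ι] {S : Finset ι} (hS : S.Nonempty)
    (u : ι → ℝ) {φ : ℝ → ℝ} (hφ : Measurable φ) {K : ℝ} (hK : ∀ y, |φ y| ≤ K) (y : ℝ) :
    ∑ j ∈ S, ∫ z, φ (y * Real.cos z.1 - partner S u ν j z.2 * Real.sin z.1)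
      ∂(angleLaw.prod unitLaw) = S.card * collisionMean ν φ y := by
  rw [← sum_integral_partner_angle hS u hφ hK]
  refine Finset.sum_congr rfl fun j _ => ?_
  have hp : Measurable fun z : ℝ × ℝ => partner S u ν j z.2 :=
    (measurable_partner u ν j).comp measurable_snd
  have hm : Measurable fun z : ℝ × ℝ =>
      φ (y * Real.cos z.1 + partner S u ν j z.2 * Real.sin z.1) := by fun_prop
  have hm' : Measurable fun z : ℝ × ℝ =>
      φ (y * Real.cos z.1 - partner S u ν j z.2 * Real.sin z.1) := by fun_prop
  rw [integral_prod _ (Integrable.of_bound hm.aestronglyMeasurable K (ae_of_all _ fun p => hK _)),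
    integral_prod _ (Integrable.of_bound hm'.aestronglyMeasurable K (ae_of_all _ fun p => hK _)),
    ← integral_angleLaw_neg_sin fun c s => ∫ ρ, φ (y * c + partner S u ν j ρ * s) ∂unitLaw]
  simp only [mul_neg, sub_eq_add_neg]

lemma erase_univ_nonempty (hN : 2 ≤ N) (i : Fin N) : (Finset.univ.erase i).Nonempty := by
  rw [← Finset.card_pos, Finset.card_erase_of_mem (Finset.mem_univ _), Finset.card_univ,
    Fintype.card_fin]
  omega

lemma card_erase_univ (hN : 2 ≤ N) (i : Fin N) :
    ((Finset.univ.erase i).card : ℝ) = N - 1 := by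
  rw [Finset.card_erase_of_mem (Finset.mem_univ _), Finset.card_univ,
    Fintype.card_fin, Nat.cast_sub (by omega)]
  simp

lemma sum_erase_comm {M : Type*} [AddCommMonoid M] (F : Fin N → Fin N → M) :
    ∑ i, ∑ j ∈ Finset.univ.erase i, F i j = ∑ j, ∑ i ∈ Finset.univ.erase j, F i j :=
  Finset.sum_comm' fun i j => by simp [eq_comm]

lemma nonlinearJump_left (i j : Fin N) (u : Fin N → ℝ) (θ x y : ℝ) :
    nonlinearJump i j u θ x y i = u i * Real.cos θ - x * Real.sin θ := by simp [nonlinearJump]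

lemma nonlinearJump_right {i j : Fin N} (hij : j ≠ i) (u : Fin N → ℝ) (θ x y : ℝ) :
    nonlinearJump i j u θ x y j = u j * Real.cos θ + y * Real.sin θ := by
  simp [nonlinearJump, hij, add_comm]

/-- Sum over all the collisions of the values of `φ` at the post-collisional velocities. -/
lemma sum_integral_couplingCollision (hN : 2 ≤ N) {φ : ℝ → ℝ} (hφ : Measurable φ) {K : ℝ}
    (hK : ∀ y, |φ y| ≤ K) (s : ℝ) (x : (Fin N → ℝ) × (Fin N → ℝ)) :
    ∑ i, ∑ j ∈ Finset.univ.erase i, ∫ z, (φ ((couplingCollision g i j s x z).2 i) +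
      φ ((couplingCollision g i j s x z).2 j)) ∂(angleLaw.prod unitLaw) =
    2 * (N - 1) * ∑ k, collisionMean (g s) φ (x.2 k) := by
  have hi : ∀ i j k, Integrable (fun z => φ ((couplingCollision g i j s x z).2 k))
      (angleLaw.prod unitLaw) := fun i j k => by
    refine Integrable.of_bound (Measurable.aestronglyMeasurable ?_) K (ae_of_all _ fun p => hK _)
    exact hφ.comp ((measurable_pi_apply k).comp
      (measurable_snd.comp (measurable_couplingCollision_right g i j s x)))
  simp_rw [fun i j => integral_add (hi i j i) (hi i j j), Finset.sum_add_distrib]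
  rw [sum_erase_comm (F := fun i j => ∫ z, φ ((couplingCollision g i j s x z).2 j)
    ∂(angleLaw.prod unitLaw))]
  have e1 : ∀ i, ∑ j ∈ Finset.univ.erase i, ∫ z, φ ((couplingCollision g i j s x z).2 i)
      ∂(angleLaw.prod unitLaw) = (N - 1) * collisionMean (g s) φ (x.2 i) := fun i => by
    rw [← card_erase_univ hN i, ← sum_integral_partner_angle_neg (erase_univ_nonempty hN i) x.2 hφ
      hK]
    refine Finset.sum_congr rfl fun j _ => ?_
    simp only [couplingCollision, nonlinearJump_left]
  have e2 : ∀ j, ∑ i ∈ Finset.univ.erase j, ∫ z, φ ((couplingCollision g i j s x z).2 j)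
      ∂(angleLaw.prod unitLaw) = (N - 1) * collisionMean (g s) φ (x.2 j) := fun j => by
    rw [← card_erase_univ hN j, ← sum_integral_partner_angle (erase_univ_nonempty hN j) x.2 hφ
      hK]
    refine Finset.sum_congr rfl fun i hi => ?_
    simp only [couplingCollision, nonlinearJump_right (Finset.ne_of_mem_erase hi).symm]
  simp_rw [e1, e2, ← Finset.mul_sum]
  ring

lemma sum_erase_add (hN : 2 ≤ N) (F : Fin N → ℝ) :
    ∑ i, ∑ j ∈ Finset.univ.erase i, (F i + F j) = 2 * (N - 1) * ∑ k, F k := by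
  simp_rw [Finset.sum_add_distrib]
  rw [sum_erase_comm (F := fun i j => F j)]
  simp_rw [Finset.sum_const, nsmul_eq_mul, card_erase_univ hN, ← Finset.mul_sum]
  ring

lemma mean_couplingCollision (g : Kernel ℝ ℝ) {φ : ℝ → ℝ} {i j : Fin N} (hij : j ≠ i) (s : ℝ)
    (x : (Fin N → ℝ) × (Fin N → ℝ)) (z : ℝ × ℝ) :
    mean φ (couplingCollision g i j s x z).2 - mean φ x.2 =
      (N : ℝ)⁻¹ * (φ ((couplingCollision g i j s x z).2 i) +
        φ ((couplingCollision g i j s x z).2 j) - (φ (x.2 i) + φ (x.2 j))) := by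
  rw [mean, sum_comp_eq_of_eq_off_pair hij.symm (u := x.2) (fun k h1 h2 => ?_), mean]
  · ring
  · simp [couplingCollision, nonlinearJump, h1, h2]

lemma mean_couplingThermo {a E : ℝ} {φ : ℝ → ℝ} (i : Fin N) (s : ℝ)
    (x : (Fin N → ℝ) × (Fin N → ℝ)) (w : ℝ) :
    mean φ (couplingThermo a E i s x w).2 - mean φ x.2 =
      (N : ℝ)⁻¹ * (φ (Real.exp (-(a * s)) * w) - φ (x.2 i)) := by
  simp only [mean, couplingThermo, sum_comp_update]
  ring

variable {lam mu a E T : ℝ}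

section Bounded

variable (hN : 2 ≤ N) {φ : ℝ → ℝ} (hφ : Measurable φ) {K : ℝ} (hK : ∀ y, |φ y| ≤ K)

include hφ hK

lemma integrable_couplingCollision_comp (i j k : Fin N) (s : ℝ)
    (x : (Fin N → ℝ) × (Fin N → ℝ)) :
    Integrable (fun z => φ ((couplingCollision g i j s x z).2 k)) (angleLaw.prod unitLaw) := by
  refine Integrable.of_bound (Measurable.aestronglyMeasurable ?_) K (ae_of_all _ fun p => hK _)
  exact hφ.comp ((measurable_pi_apply k).comp
    (measurable_snd.comp (measurable_couplingCollision_right g i j s x)))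

lemma integrable_thermostat_comp (c : ℝ) :
    Integrable (fun w => φ (c * w)) (thermostat T) :=
  Integrable.of_bound (hφ.comp (measurable_const_mul c)).aestronglyMeasurable K
    (ae_of_all _ fun _ => hK _)

lemma sum_integral_couplingThermo_sub (s : ℝ) (x : (Fin N → ℝ) × (Fin N → ℝ)) (c : ℝ) :
    ∑ i, ∫ w, (φ (Real.exp (-(a * s)) * w) + c * φ (x.2 i)) ∂thermostat T =
    N * (∫ y, φ y ∂thermostatKernel a T s) + c * ∑ k, φ (x.2 k) := by
  simp_rw [fun i => integral_add (integrable_thermostat_comp (T := T) hφ hK (Real.exp (-(a * s))))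
    (integrable_const (c * φ (x.2 i)))]
  rw [Finset.sum_add_distrib, integral_thermostatKernel hφ, Finset.mul_sum]
  simp

include hN

lemma sum_integral_couplingCollision_sub (s : ℝ) (x : (Fin N → ℝ) × (Fin N → ℝ)) (c : ℝ) :
    ∑ i, ∑ j ∈ Finset.univ.erase i, ∫ z, (φ ((couplingCollision g i j s x z).2 i) +
      φ ((couplingCollision g i j s x z).2 j) + c * (φ (x.2 i) + φ (x.2 j)))
        ∂(angleLaw.prod unitLaw) =
    2 * (N - 1) * (∑ k, collisionMean (g s) φ (x.2 k) + c * ∑ k, φ (x.2 k)) := by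
  rw [mul_add, ← sum_integral_couplingCollision g hN hφ hK, mul_left_comm,
    ← sum_erase_add hN (fun k => φ (x.2 k)), Finset.mul_sum, ← Finset.sum_add_distrib]
  refine Finset.sum_congr rfl fun i _ => ?_
  rw [Finset.mul_sum, ← Finset.sum_add_distrib]
  refine Finset.sum_congr rfl fun j _ => ?_
  have h1 := integral_add ((integrable_couplingCollision_comp g hφ hK i j i s x).add
    (integrable_couplingCollision_comp g hφ hK i j j s x))
    (integrable_const (c * (φ (x.2 i) + φ (x.2 j))))
  simp only [Pi.add_apply] at h1
  rw [h1]
  simp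

/-- There is no error term, because the partners average exactly to `g s`. The right-hand side is
the generator of the equation linearized along `g`, with the rate `2 * lam` because each particle
collides both as `i` and as `j`. -/
lemma integral_couplingRate_mean (hlam : 0 ≤ lam) (hmu : 0 ≤ mu) (s : ℝ)
    (x : (Fin N → ℝ) × (Fin N → ℝ)) :
    ∫ y, mean φ y.2 ∂couplingRate N lam mu a E T g (s, x) -
        (N * (lam + mu)).toNNReal * mean φ x.2 =
      2 * lam * (mean (collisionMean (g s) φ) x.2 - mean φ x.2) +
        mu * (∫ y, φ y ∂thermostatKernel a T s - mean φ x.2) := by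
  have hm : Measurable fun y : (Fin N → ℝ) × (Fin N → ℝ) => mean φ y.2 := by fun_prop
  rw [(integral_couplingRate_sub g hN hlam hmu (ψ := fun y => mean φ y.2) hm s x
    (fun i j _ => Integrable.of_bound (hm.comp
      (measurable_couplingCollision_right g i j s x)).aestronglyMeasurable K
      (ae_of_all _ fun z => abs_mean_le hK _))
    (fun i => Integrable.of_bound (hm.comp
      (measurable_couplingThermo_right i s x)).aestronglyMeasurable K
      (ae_of_all _ fun z => abs_mean_le hK _))).2]
  have e1 : ∀ i, ∀ j ∈ Finset.univ.erase i, ∫ z, (mean φ (couplingCollision g i j s x z).2 -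
      mean φ x.2) ∂(angleLaw.prod unitLaw) = (N : ℝ)⁻¹ *
      ∫ z, (φ ((couplingCollision g i j s x z).2 i) +
      φ ((couplingCollision g i j s x z).2 j) + (-1) * (φ (x.2 i) + φ (x.2 j)))
        ∂(angleLaw.prod unitLaw) := fun i j hj => by
    rw [← integral_const_mul]
    refine integral_congr_ae (ae_of_all _ fun z => ?_)
    simp only [mean_couplingCollision g (Finset.ne_of_mem_erase hj)]
    ring
  have e2 : ∀ i, ∫ w, (mean φ (couplingThermo a E i s x w).2 - mean φ x.2) ∂thermostat T =
      (N : ℝ)⁻¹ * ∫ w, (φ (Real.exp (-(a * s)) * w) + (-1) * φ (x.2 i)) ∂thermostat T :=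
      fun i => by
    rw [← integral_const_mul]
    refine integral_congr_ae (ae_of_all _ fun z => ?_)
    simp only [mean_couplingThermo]
    ring
  rw [Finset.sum_congr rfl fun i _ => Finset.sum_congr rfl (e1 i)]
  simp_rw [e2, ← Finset.mul_sum]
  rw [sum_integral_couplingCollision_sub g hN hφ hK, sum_integral_couplingThermo_sub hφ hK]
  have h2 : (2 : ℝ) ≤ N := by exact_mod_cast hN
  have h3 : (N : ℝ) - 1 ≠ 0 := by linarith
  simp only [mean]
  field_simp
  ring

/-- Expand `X² - Y² = 2 Y (X - Y) + (X - Y)²`. The first term is governed by the generator on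
averages. A jump moves the average by `1 / N` times at most four values of `φ`; as jumps occur at a
rate of order `N`, the squares contribute a term of order `1 / N`. -/
lemma integral_couplingRate_mean_sq_le (hlam : 0 ≤ lam) (hmu : 0 ≤ mu) (s : ℝ)
    (x : (Fin N → ℝ) × (Fin N → ℝ)) :
    ∫ y, mean φ y.2 ^ 2 ∂couplingRate N lam mu a E T g (s, x) -
        (N * (lam + mu)).toNNReal * mean φ x.2 ^ 2 ≤
      2 * mean φ x.2 * (2 * lam * (mean (collisionMean (g s) φ) x.2 - mean φ x.2) +
        mu * (∫ y, φ y ∂thermostatKernel a T s - mean φ x.2)) +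
      (N : ℝ)⁻¹ * (8 * lam * (mean (collisionMean (g s) (fun y => φ y ^ 2)) x.2 +
        mean (fun y => φ y ^ 2) x.2) + 2 * mu * (∫ y, φ y ^ 2 ∂thermostatKernel a T s +
        mean (fun y => φ y ^ 2) x.2)) := by
  have hm : Measurable fun y : (Fin N → ℝ) × (Fin N → ℝ) => mean φ y.2 := by fun_prop
  have hφ2 : Measurable fun y => φ y ^ 2 := by fun_prop
  have hK2 : ∀ y, |φ y ^ 2| ≤ K ^ 2 := fun y => by
    rw [abs_pow]; exact pow_le_pow_left₀ (abs_nonneg _) (hK y) 2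
  have hmK2 : ∀ u : Fin N → ℝ, |mean φ u ^ 2| ≤ K ^ 2 := fun y => by
    rw [abs_pow]; exact pow_le_pow_left₀ (abs_nonneg _) (abs_mean_le hK y) 2
  have h2 : (2 : ℝ) ≤ N := by exact_mod_cast hN
  have h3 : (0 : ℝ) < N - 1 := by linarith
  have hN0 : (0 : ℝ) < N := by linarith
  rw [(integral_couplingRate_sub g hN hlam hmu (ψ := fun y => mean φ y.2 ^ 2) (hm.pow_const 2) s x
    (fun i j _ => Integrable.of_bound ((hm.pow_const 2).comp
      (measurable_couplingCollision_right g i j s x)).aestronglyMeasurable (K ^ 2)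
      (ae_of_all _ fun z => hmK2 _))
    (fun i => Integrable.of_bound ((hm.pow_const 2).comp
      (measurable_couplingThermo_right i s x)).aestronglyMeasurable (K ^ 2)
      (ae_of_all _ fun z => hmK2 _))).2]
  have ic1 : ∀ i j k, Integrable (fun z => φ ((couplingCollision g i j s x z).2 k))
      (angleLaw.prod unitLaw) := fun i j k => integrable_couplingCollision_comp g hφ hK i j k s x
  have ic2 : ∀ i j k, Integrable (fun z => φ ((couplingCollision g i j s x z).2 k) ^ 2)
      (angleLaw.prod unitLaw) := fun i j k => integrable_couplingCollision_comp g hφ2 hK2 i j k s x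
  have it1 : Integrable (fun w => φ (Real.exp (-(a * s)) * w)) (thermostat T) :=
    integrable_thermostat_comp hφ hK _
  have it2 : Integrable (fun w => φ (Real.exp (-(a * s)) * w) ^ 2) (thermostat T) :=
    integrable_thermostat_comp hφ2 hK2 _
  have e1 : ∀ i, ∀ j ∈ Finset.univ.erase i, ∫ z, (mean φ (couplingCollision g i j s x z).2 ^ 2 -
      mean φ x.2 ^ 2) ∂(angleLaw.prod unitLaw) ≤ 2 * mean φ x.2 * (N : ℝ)⁻¹ *
      ∫ z, (φ ((couplingCollision g i j s x z).2 i) +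
      φ ((couplingCollision g i j s x z).2 j) + (-1) * (φ (x.2 i) + φ (x.2 j)))
        ∂(angleLaw.prod unitLaw) + 4 * (N : ℝ)⁻¹ ^ 2 *
      ∫ z, (φ ((couplingCollision g i j s x z).2 i) ^ 2 +
      φ ((couplingCollision g i j s x z).2 j) ^ 2 + 1 * (φ (x.2 i) ^ 2 + φ (x.2 j) ^ 2))
        ∂(angleLaw.prod unitLaw) := fun i j hj => by
    rw [← integral_const_mul, ← integral_const_mul, ← integral_add]
    · refine integral_mono ((Integrable.of_bound ((hm.pow_const 2).comp
        (measurable_couplingCollision_right g i j s x)).aestronglyMeasurable (K ^ 2)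
        (ae_of_all _ fun z => hmK2 _)).sub (integrable_const _))
        (((((ic1 i j i).add (ic1 i j j)).add (integrable_const _)).const_mul _).add
        ((((ic2 i j i).add (ic2 i j j)).add (integrable_const _)).const_mul _)) fun z => ?_
      have hd := mean_couplingCollision (φ := φ) g (Finset.ne_of_mem_erase hj) s x z
      beta_reduce
      generalize φ ((couplingCollision g i j s x z).2 i) = p at *
      generalize φ ((couplingCollision g i j s x z).2 j) = q at *
      rw [sub_eq_iff_eq_add] at hd
      rw [hd]
      nlinarith [mul_nonneg (sq_nonneg (N : ℝ)⁻¹) (add_nonneg (add_nonneg (sq_nonneg (p - q))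
        (sq_nonneg (φ (x.2 i) - φ (x.2 j)))) (sq_nonneg (p + q + φ (x.2 i) + φ (x.2 j))))]
    · exact (((ic1 i j i).add (ic1 i j j)).add (integrable_const _)).const_mul _
    · exact (((ic2 i j i).add (ic2 i j j)).add (integrable_const _)).const_mul _
  have e2 : ∀ i, ∫ w, (mean φ (couplingThermo a E i s x w).2 ^ 2 - mean φ x.2 ^ 2) ∂thermostat T ≤
      2 * mean φ x.2 * (N : ℝ)⁻¹ *
        ∫ w, (φ (Real.exp (-(a * s)) * w) + (-1) * φ (x.2 i)) ∂thermostat T +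
      2 * (N : ℝ)⁻¹ ^ 2 *
        ∫ w, (φ (Real.exp (-(a * s)) * w) ^ 2 + 1 * φ (x.2 i) ^ 2) ∂thermostat T :=
      fun i => by
    rw [← integral_const_mul, ← integral_const_mul, ← integral_add]
    · refine integral_mono ((Integrable.of_bound ((hm.pow_const 2).comp
        (measurable_couplingThermo_right i s x)).aestronglyMeasurable (K ^ 2)
        (ae_of_all _ fun z => hmK2 _)).sub (integrable_const _))
        (((it1.add (integrable_const _)).const_mul _).add
        ((it2.add (integrable_const _)).const_mul _)) fun w => ?_
      have hd := mean_couplingThermo (a := a) (E := E) (φ := φ) i s x w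
      beta_reduce
      generalize φ (Real.exp (-(a * s)) * w) = p at *
      rw [sub_eq_iff_eq_add] at hd
      rw [hd]
      nlinarith [mul_nonneg (sq_nonneg (N : ℝ)⁻¹) (sq_nonneg (p + φ (x.2 i)))]
    · exact (it1.add (integrable_const _)).const_mul _
    · exact (it2.add (integrable_const _)).const_mul _
  have s1 := Finset.sum_le_sum fun i (_ : i ∈ Finset.univ) => Finset.sum_le_sum (e1 i)
  have s2 := Finset.sum_le_sum fun i (_ : i ∈ Finset.univ) => e2 i
  simp_rw [Finset.sum_add_distrib, ← Finset.mul_sum] at s1 s2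
  rw [sum_integral_couplingCollision_sub g hN hφ hK,
    sum_integral_couplingCollision_sub g hN hφ2 hK2] at s1
  rw [sum_integral_couplingThermo_sub hφ hK, sum_integral_couplingThermo_sub hφ2 hK2] at s2
  refine (add_le_add (mul_le_mul_of_nonneg_left s1 (by positivity))
    (mul_le_mul_of_nonneg_left s2 hmu)).trans (le_of_eq ?_)
  simp only [mean]
  field_simp
  ring

end Bounded

end Jump

/-! ### Marginals of the coupling -/

lemma integral_comp_id_prod {X : Type*} [MeasurableSpace X] (R : Kernel (ℝ × X) X)
    [IsFiniteKernel R] (m : Kernel ℝ X) [IsMarkovKernel m] {ψ : X → ℝ} (hψ : Measurable ψ) {s : ℝ}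
    (h : Integrable ψ ((R ∘ₖ (Kernel.id ×ₖ m)) s)) :
    ∫ x, ψ x ∂(R ∘ₖ (Kernel.id ×ₖ m)) s = ∫ x, ∫ y, ψ y ∂(R (s, x)) ∂m s := by
  rw [Kernel.integral_comp h, Kernel.prod_apply, Kernel.id_apply, Measure.dirac_prod,
    integral_map (by fun_prop)
      (hψ.stronglyMeasurable.integral_kernel (κ := R)).aestronglyMeasurable]

/-- Grönwall's lemma with zero data for a family of test functions, where the derivative of one
member is controlled by the other members. It serves as the uniqueness argument for both marginals
of the coupling. -/
lemma nonpos_of_family {ι : Type*} {y D : ι → ℝ → ℝ} {b B₀ : ℝ} (hb : 0 < b) {t : ℝ}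
    (hB₀ : ∀ i, ∀ s ∈ Set.Icc 0 t, y i s ≤ B₀) (h0 : ∀ i, y i 0 ≤ 0)
    (hy : ∀ i, IsPrimitive (y i) (D i) t)
    (hD : ∀ i, ∀ s ∈ Set.Icc 0 t, ∀ Y, (∀ j, y j s ≤ Y) → D i s ≤ b * Y) (ht : 0 ≤ t) (i : ι) :
    y i t ≤ 0 := by
  have := le_of_family_integral_le (y := y) (c := 0) hb le_rfl hB₀ (fun i s hs Y hY hle => by
    rw [(hy i).2 s hs, zero_add, ← intervalIntegral.integral_const_mul]
    have := intervalIntegral.integral_mono_on hs.1 ((hy i).mono hs).1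
      ((hY.const_mul b).intervalIntegrable (μ := volume) 0 s)
      fun r hr => hD i r ⟨hr.1, hr.2.trans hs.2⟩ (Y r) fun j => hle j r hr
    linarith [h0 i]) i (s := t) ⟨ht, le_rfl⟩
  simpa using this

/-- `m` is a coupling of the particle system with nonlinear particles, initially independent and
distributed according to `g 0`. -/
structure IsCoupling {N : ℕ} (lam mu a E T : ℝ) (g : Kernel ℝ ℝ)
    (m : Kernel ℝ ((Fin N → ℝ) × (Fin N → ℝ))) : Prop where
  markov : IsMarkovKernel m
  flow : IsFlow (N * (lam + mu)).toNNReal m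
    (couplingRate N lam mu a E T g ∘ₖ (Kernel.id ×ₖ m))
  map_snd : (m 0).map Prod.snd = Measure.pi fun _ => g 0

section Marginals

variable {N : ℕ} {lam mu a E T : ℝ} (g : Kernel ℝ ℝ) [IsMarkovKernel g]

lemma isFiniteKernel_couplingRate (hN : 2 ≤ N) (hlam : 0 ≤ lam) (hmu : 0 ≤ mu) :
    IsFiniteKernel (couplingRate N lam mu a E T g) :=
  ⟨⟨_, ENNReal.coe_lt_top, fun p => (couplingRate_univ g hN hlam hmu p).le⟩⟩

variable {g}

lemma IsCoupling.isPrimitive {m : Kernel ℝ ((Fin N → ℝ) × (Fin N → ℝ))}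
    (h : IsCoupling lam mu a E T g m) (hN : 2 ≤ N) (hlam : 0 ≤ lam) (hmu : 0 ≤ mu)
    {ψ φ : (Fin N → ℝ) × (Fin N → ℝ) → ℝ} (hψ : Measurable ψ) (hψφ : ∀ x, |ψ x| ≤ φ x) {t : ℝ}
    (ht : 0 ≤ t) {B : ℝ≥0∞} (hB : B ≠ ∞)
    (hm : ∀ s ∈ Set.Icc 0 t, ∫⁻ x, ENNReal.ofReal (φ x) ∂m s ≤ B)
    (hgain : ∀ s ∈ Set.Icc 0 t,
      Integrable ψ ((couplingRate N lam mu a E T g ∘ₖ (Kernel.id ×ₖ m)) s)) :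
    IsPrimitive (fun s => ∫ x, ψ x ∂m s) (fun s => ∫ x, (∫ y, ψ y ∂couplingRate N lam mu a E T g
      (s, x) - (N * (lam + mu)).toNNReal * ψ x) ∂m s) t := by
  have := h.markov
  have := isFiniteKernel_couplingRate (a := a) (E := E) (T := T) g hN hlam hmu
  refine (h.flow.isPrimitive hψ hψφ ht hB hm hgain).congr ht (fun s _ => rfl) fun s hs => ?_
  have hint : Integrable ψ (m s) := by
    refine ⟨hψ.aestronglyMeasurable, (lintegral_mono fun x => ?_).trans_lt
      ((hm s hs).trans_lt hB.lt_top)⟩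
    rw [Real.enorm_eq_ofReal_abs]
    exact ENNReal.ofReal_le_ofReal (hψφ x)
  have hi := hgain s hs
  have h2 : Integrable (fun x => ∫ y, ψ y ∂couplingRate N lam mu a E T g (s, x)) (m s) := by
    have h3 := hi.integral_comp
    rw [Kernel.prod_apply, Kernel.id_apply, Measure.dirac_prod] at h3
    exact h3.comp_measurable (by fun_prop)
  rw [integral_comp_id_prod _ _ hψ hi, integral_sub h2 (hint.const_mul _), integral_const_mul]

lemma IsCoupling.isPrimitive_of_bounded {m : Kernel ℝ ((Fin N → ℝ) × (Fin N → ℝ))}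
    (h : IsCoupling lam mu a E T g m) (hN : 2 ≤ N) (hlam : 0 ≤ lam) (hmu : 0 ≤ mu)
    {ψ : (Fin N → ℝ) × (Fin N → ℝ) → ℝ} (hψ : Measurable ψ) {K : ℝ} (hK : ∀ x, |ψ x| ≤ K) {t : ℝ}
    (ht : 0 ≤ t) :
    IsPrimitive (fun s => ∫ x, ψ x ∂m s) (fun s => ∫ x, (∫ y, ψ y ∂couplingRate N lam mu a E T g
      (s, x) - (N * (lam + mu)).toNNReal * ψ x) ∂m s) t := by
  have := h.markov
  have := isFiniteKernel_couplingRate (a := a) (E := E) (T := T) g hN hlam hmu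
  exact h.isPrimitive hN hlam hmu hψ hK ht (B := ENNReal.ofReal K) (by simp) (fun s _ => by simp)
    fun s _ => Integrable.of_bound hψ.aestronglyMeasurable K (ae_of_all _ hK)

lemma integrable_mean {m : Measure ((Fin N → ℝ) × (Fin N → ℝ))} [IsFiniteMeasure m] {φ : ℝ → ℝ}
    (hφ : Measurable φ) {K : ℝ} (hK : ∀ y, |φ y| ≤ K) : Integrable (fun x => mean φ x.2) m :=
  Integrable.of_bound ((measurable_mean hφ).comp measurable_snd).aestronglyMeasurable K
    (ae_of_all _ fun _ => abs_mean_le hK _)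

lemma IsCoupling.isPrimitive_mean {m : Kernel ℝ ((Fin N → ℝ) × (Fin N → ℝ))}
    (h : IsCoupling lam mu a E T g m) (hN : 2 ≤ N) (hlam : 0 ≤ lam) (hmu : 0 ≤ mu)
    {φ : ℝ → ℝ} (hφ : Measurable φ) {K : ℝ} (hK : ∀ y, |φ y| ≤ K) {t : ℝ} (ht : 0 ≤ t) :
    IsPrimitive (fun s => ∫ x, mean φ x.2 ∂m s) (fun s =>
      2 * lam * (∫ x, mean (collisionMean (g s) φ) x.2 ∂m s - ∫ x, mean φ x.2 ∂m s) +
        mu * (∫ y, φ y ∂thermostatKernel a T s - ∫ x, mean φ x.2 ∂m s)) t := by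
  have := h.markov
  refine (h.isPrimitive_of_bounded hN hlam hmu (ψ := fun x => mean φ x.2) (by fun_prop)
    (fun x => abs_mean_le hK _) ht).congr ht (fun s _ => rfl) fun s hs => ?_
  simp_rw [integral_couplingRate_mean g hN hφ hK hlam hmu]
  have i1 : Integrable (fun x => mean φ x.2) (m s) := integrable_mean hφ hK
  have i2 : Integrable (fun x => mean (collisionMean (g s) φ) x.2) (m s) :=
    integrable_mean (measurable_collisionMean hφ) (abs_collisionMean_le hK)
  have j1 : Integrable (fun x => 2 * lam * (mean (collisionMean (g s) φ) x.2 - mean φ x.2)) (m s) :=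
    (i2.sub i1).const_mul _
  have j2 : Integrable (fun x => mu * (∫ y, φ y ∂thermostatKernel a T s - mean φ x.2)) (m s) :=
    ((integrable_const _).sub i1).const_mul _
  rw [integral_add j1 j2, integral_const_mul, integral_const_mul, integral_sub i2 i1,
    integral_sub (integrable_const _) i1]
  simp

lemma IsKineticFlow.isPrimitive_of_bounded (hg : IsKineticFlow lam mu a T g) (hlam : 0 ≤ lam)
    (hmu : 0 ≤ mu) {φ : ℝ → ℝ} (hφ : Measurable φ) {K : ℝ} (hK : ∀ y, |φ y| ≤ K) {t : ℝ}
    (ht : 0 ≤ t) :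
    IsPrimitive (fun s => ∫ y, φ y ∂g s) (fun s =>
      2 * lam * (∫ y, collisionMean (g s) φ y ∂g s - ∫ y, φ y ∂g s) +
        mu * (∫ y, φ y ∂thermostatKernel a T s - ∫ y, φ y ∂g s)) t := by
  refine (hg.flow.isPrimitive_of_bounded hφ hK ht).congr ht (fun s _ => rfl) fun s hs => ?_
  rw [(integral_kineticGain g hlam hmu (Integrable.of_bound hφ.aestronglyMeasurable K
    (ae_of_all _ hK)) (Integrable.of_bound hφ.aestronglyMeasurable K (ae_of_all _ hK))).2,
    integral_collisionMean g hφ hK, Real.coe_toNNReal _ (by positivity)]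
  ring

lemma IsCoupling.integral_mean_zero {m : Kernel ℝ ((Fin N → ℝ) × (Fin N → ℝ))}
    (h : IsCoupling lam mu a E T g m) (hN : 2 ≤ N) {φ : ℝ → ℝ} (hφ : Measurable φ)
    {K : ℝ} (hK : ∀ y, |φ y| ≤ K) : ∫ x, mean φ x.2 ∂m 0 = ∫ y, φ y ∂g 0 := by
  have e : ∫ x, mean φ x.2 ∂m 0 = ∫ u, mean φ u ∂(m 0).map Prod.snd :=
    (integral_map (by fun_prop) (by fun_prop)).symm
  have e2 : ∀ k, ∫ u : Fin N → ℝ, φ (u k) ∂(Measure.pi fun _ => g 0) = ∫ y, φ y ∂g 0 := fun k =>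
    by
      have hp := measurePreserving_eval (fun _ : Fin N => g 0) k
      have h1 := integral_map (μ := Measure.pi fun _ : Fin N => g 0) (f := φ) hp.measurable.aemeasurable hφ.aestronglyMeasurable
      rw [hp.map_eq] at h1
      exact h1.symm
  rw [e, h.map_snd]
  simp only [mean]
  have hi : ∀ k, Integrable (fun u : Fin N → ℝ => φ (u k)) (Measure.pi fun _ => g 0) := fun k =>
    Integrable.of_bound (hφ.comp (measurable_pi_apply k)).aestronglyMeasurable K
      (ae_of_all _ fun _ => hK _)
  rw [integral_const_mul, integral_finsetSum _ fun k _ => hi k]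
  simp_rw [e2]
  have : (N : ℝ) ≠ 0 := by positivity
  simp [this]

/-- The nonlinear particles are unbiased. -/
lemma IsCoupling.integral_mean {m : Kernel ℝ ((Fin N → ℝ) × (Fin N → ℝ))}
    (h : IsCoupling lam mu a E T g m) (hg : IsKineticFlow lam mu a T g) (hN : 2 ≤ N)
    (hlam : 0 ≤ lam) (hmu : 0 < mu) {φ : ℝ → ℝ} (hφ : Measurable φ)
    {K : ℝ} (hK : ∀ y, |φ y| ≤ K) {t : ℝ} (ht : 0 ≤ t) :
    ∫ x, mean φ x.2 ∂m t = ∫ y, φ y ∂g t := by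
  have := h.markov
  -- This family is stable under `collisionMean` and under change of sign.
  let ι := {φ : ℝ → ℝ // Measurable φ ∧ ∀ y, |φ y| ≤ 1}
  let y : ι → ℝ → ℝ := fun φ s => ∫ x, mean φ.1 x.2 ∂m s - ∫ y, φ.1 y ∂g s
  have hle : ∀ (φ : ι), y φ t ≤ 0 := by
    -- The collision term is bounded by `2 lam` times the largest discrepancy in the family and the
    -- loss term by `2 lam + mu` times it.
    refine nonpos_of_family (b := 4 * lam + mu) (B₀ := 2) (D := fun φ s =>
      2 * lam * (∫ x, mean (collisionMean (g s) φ.1) x.2 ∂m s -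
        ∫ y, collisionMean (g s) φ.1 y ∂g s) - (2 * lam + mu) * y φ s) (by positivity)
      (fun φ s _ => ?_) (fun φ => ?_) (fun φ => ?_) (fun φ s _ Y hY => ?_) ht
    · have h1 := norm_integral_le_of_norm_le_const (μ := m s) (f := fun x => mean φ.1 x.2)
        (ae_of_all _ fun x => abs_mean_le φ.2.2 _)
      have h2 := norm_integral_le_of_norm_le_const (μ := g s) (f := φ.1) (ae_of_all _ φ.2.2)
      simp only [probReal_univ, mul_one, Real.norm_eq_abs] at h1 h2
      simp only [y]
      linarith [(abs_le.1 h1).2, (abs_le.1 h2).1]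
    · simp only [y]
      rw [h.integral_mean_zero hN φ.2.1 φ.2.2, sub_self]
    · refine ((h.isPrimitive_mean hN hlam hmu.le φ.2.1 φ.2.2 ht).add
        ((hg.isPrimitive_of_bounded hlam hmu.le φ.2.1 φ.2.2 ht).const_mul (-1))).congr ht
        (fun s _ => ?_) fun s _ => ?_
      · simp only [y]; ring
      · simp only [y]; ring
    · have h1 := hY ⟨collisionMean (g s) φ.1, measurable_collisionMean φ.2.1,
        abs_collisionMean_le φ.2.2⟩
      have h2 := hY ⟨fun x => -φ.1 x, φ.2.1.neg, fun x => by rw [abs_neg]; exact φ.2.2 x⟩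
      simp only [y, mean, Finset.sum_neg_distrib, mul_neg, integral_neg] at h1 h2 ⊢
      nlinarith
  have key : ∀ (φ : ι), y φ t = 0 := fun φ => le_antisymm (hle φ) <| by
    have h2 := hle ⟨fun x => -φ.1 x, φ.2.1.neg, fun x => by rw [abs_neg]; exact φ.2.2 x⟩
    simp only [y, mean, Finset.sum_neg_distrib, mul_neg, integral_neg] at h2 ⊢
    linarith
  have hK0 : 0 ≤ K := (abs_nonneg _).trans (hK 0)
  have := key ⟨fun x => (K + 1)⁻¹ * φ x, hφ.const_mul _, fun x => by
    rw [abs_mul, abs_of_nonneg (by positivity), inv_mul_le_iff₀ (by positivity)]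
    linarith [hK x]⟩
  have e : ∀ u : Fin N → ℝ, mean (fun x => (K + 1)⁻¹ * φ x) u = (K + 1)⁻¹ * mean φ u := fun u => by
    simp only [mean, ← Finset.mul_sum]; ring
  simp only [y, e, integral_const_mul, ← mul_sub] at this
  rcases mul_eq_zero.1 this with h' | h'
  · exact absurd h' (by positivity)
  · linarith

lemma IsCoupling.lintegral_mean {m : Kernel ℝ ((Fin N → ℝ) × (Fin N → ℝ))}
    (h : IsCoupling lam mu a E T g m) (hg : IsKineticFlow lam mu a T g) (hN : 2 ≤ N)
    (hlam : 0 ≤ lam) (hmu : 0 < mu) {φ : ℝ → ℝ≥0∞} (hφ : Measurable φ) {t : ℝ} (ht : 0 ≤ t) :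
    ∑ k, ∫⁻ x, φ (x.2 k) ∂m t = N * ∫⁻ y, φ y ∂g t := by
  have := h.markov
  have hN0 : (N : ℝ) ≠ 0 := by positivity
  have hk : ∀ k, Measurable fun x : (Fin N → ℝ) × (Fin N → ℝ) => x.2 k := fun k => by fun_prop
  have key : ∑ k : Fin N, (m t).map (fun x => x.2 k) = (N : ℝ≥0∞) • g t := by
    ext S hS
    have h1 := h.integral_mean hg hN hlam hmu (φ := S.indicator 1) (measurable_one.indicator hS)
      (K := 1) (fun y => by by_cases hy : y ∈ S <;> simp [hy]) ht
    simp only [mean] at h1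
    have e : ∀ k, (fun x : (Fin N → ℝ) × (Fin N → ℝ) => (S.indicator 1 (x.2 k) : ℝ)) =
        ((fun x : (Fin N → ℝ) × (Fin N → ℝ) => x.2 k) ⁻¹' S).indicator 1 := fun k => rfl
    rw [integral_const_mul, integral_finsetSum] at h1
    · simp_rw [e, integral_indicator_one (hk _ hS)] at h1
      rw [integral_indicator_one hS, inv_mul_eq_iff_eq_mul₀ hN0] at h1
      simp only [Measure.finsetSum_apply, Measure.smul_apply, smul_eq_mul,
        Measure.map_apply (hk _) hS]
      rw [← ENNReal.toReal_eq_toReal_iff' (by simp [measure_ne_top])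
        (ENNReal.mul_ne_top (by simp) (measure_ne_top _ _)), ENNReal.toReal_sum (by
          simp [measure_ne_top]), ENNReal.toReal_mul]
      simpa [Measure.real] using h1
    · intro k _
      rw [e]
      exact (integrable_indicator_iff (hk _ hS)).2 (integrable_const _).integrableOn
  have h3 := congrArg (fun ν => ∫⁻ y, φ y ∂ν) key
  simp only [lintegral_finsetSum_measure, lintegral_smul_measure, smul_eq_mul] at h3
  rw [← h3]
  exact Finset.sum_congr rfl fun k _ => (lintegral_map hφ (hk k)).symm

/-! #### The particle system -/

/-- The particle system does not see its nonlinear companions, so on functions of the first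
component the coupling acts by the generator of the particle system. -/
lemma IsCoupling.integral_couplingRate_fst (hN : 2 ≤ N) (hlam : 0 ≤ lam) (hmu : 0 ≤ mu)
    {φ : (Fin N → ℝ) → ℝ} (hφ : Measurable φ) {K : ℝ} (hK : ∀ v, |φ v| ≤ K) (s : ℝ)
    (x : (Fin N → ℝ) × (Fin N → ℝ)) :
    ∫ y, φ y.1 ∂couplingRate N lam mu a E T g (s, x) - (N * (lam + mu)).toNNReal * φ x.1 =
      generator N lam mu E T φ x.1 := by
  have hm : Measurable fun y : (Fin N → ℝ) × (Fin N → ℝ) => φ y.1 := hφ.comp measurable_fst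
  have h2 : (2 : ℝ) ≤ N := by exact_mod_cast hN
  have h3 : (N : ℝ) - 1 ≠ 0 := by linarith
  rw [(integral_couplingRate_sub g hN hlam hmu (ψ := fun y => φ y.1) hm s x
    (fun i j _ => Integrable.of_bound (hm.comp
      (measurable_couplingCollision_right g i j s x)).aestronglyMeasurable K
      (ae_of_all _ fun z => hK _))
    (fun i => Integrable.of_bound (hm.comp
      (measurable_couplingThermo_right i s x)).aestronglyMeasurable K
      (ae_of_all _ fun z => hK _))).2, generator]
  have e : ∀ i j : Fin N, ∫ z, (φ (couplingCollision g i j s x z).1 - φ x.1)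
      ∂(angleLaw.prod unitLaw) = ∫ θ, (φ (kacJump i j x.1 θ) - φ x.1) ∂angleLaw := fun i j => by
    have := integral_fun_fst (μ := angleLaw) (ν := unitLaw) fun θ => φ (kacJump i j x.1 θ) - φ x.1
    simpa [couplingCollision] using this
  simp_rw [e]
  have e2 : ∀ i : Fin N, ∑ j ∈ Finset.univ.erase i,
      ∫ θ, (φ (kacJump i j x.1 θ) - φ x.1) ∂angleLaw =
      ∑ j, if i ≠ j then ∫ θ, (φ (kacJump i j x.1 θ) - φ x.1) ∂angleLaw else 0 := fun i => by
    rw [← Finset.sum_filter]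
    congr 1
    ext j
    simp [eq_comm]
  simp_rw [e2]
  have e3 : lam / ((N : ℝ) - 1) = N * lam * (N * (N - 1) : ℝ)⁻¹ := by field_simp
  rw [e3, mul_assoc]
  rfl

/-- The generator is an integral against the rates of the coupling, which are a kernel; any `g` will
do, here `δ₀`. -/
lemma measurable_generator (hN : 2 ≤ N) (hlam : 0 ≤ lam) (hmu : 0 ≤ mu)
    {φ : (Fin N → ℝ) → ℝ} (hφ : Measurable φ) {K : ℝ} (hK : ∀ v, |φ v| ≤ K) :
    Measurable (generator N lam mu E T φ) := by
  have := isFiniteKernel_couplingRate (N := N) (a := 0) (E := E) (T := T)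
    (Kernel.const ℝ (Measure.dirac (0 : ℝ))) hN hlam hmu
  have h1 : Measurable fun p : ℝ × (Fin N → ℝ) × (Fin N → ℝ) => ∫ y, φ y.1 ∂couplingRate N lam mu 0
      E T (Kernel.const ℝ (Measure.dirac (0 : ℝ))) p :=
    ((hφ.comp measurable_fst).stronglyMeasurable.integral_kernel).measurable
  have h2 : Measurable fun v : Fin N → ℝ => ((0 : ℝ), v, (0 : Fin N → ℝ)) := by fun_prop
  have h3 := (h1.comp h2).sub (hφ.const_mul ((N * (lam + mu)).toNNReal : ℝ))
  convert h3 using 1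
  ext v
  exact (IsCoupling.integral_couplingRate_fst hN hlam hmu hφ hK 0 (v, 0)).symm

lemma abs_generator_le (hN : 2 ≤ N) (hlam : 0 ≤ lam) (hmu : 0 ≤ mu)
    {φ : (Fin N → ℝ) → ℝ} (hφ : Measurable φ) {K : ℝ} (hK : ∀ v, |φ v| ≤ K) (v : Fin N → ℝ) :
    |generator N lam mu E T φ v| ≤ 2 * (N * (lam + mu)) * K := by
  have := isFiniteKernel_couplingRate (N := N) (a := 0) (E := E) (T := T)
    (Kernel.const ℝ (Measure.dirac (0 : ℝ))) hN hlam hmu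
  have hL : (0 : ℝ) ≤ N * (lam + mu) := by positivity
  have hK' := hK v
  rw [← IsCoupling.integral_couplingRate_fst (a := 0) (g := Kernel.const ℝ (Measure.dirac (0 : ℝ)))
    hN hlam hmu hφ hK 0 (v, 0)]
  have h1 := norm_integral_le_of_norm_le_const (μ := couplingRate N lam mu 0 E T
    (Kernel.const ℝ (Measure.dirac (0 : ℝ))) (0, v, 0)) (f := fun y => φ y.1)
    (ae_of_all _ fun y => hK y.1)
  rw [Measure.real, couplingRate_univ _ hN hlam hmu, ENNReal.coe_toReal,
    Real.coe_toNNReal _ hL, Real.norm_eq_abs] at h1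
  rw [Real.coe_toNNReal _ hL]
  refine (abs_sub _ _).trans ?_
  rw [abs_mul, abs_of_nonneg hL]
  nlinarith

/-- The process is the limit of its values at the next point of the grid of mesh `1 / (n + 1)`;
right continuity requires approaching `s` from the right. -/
lemma measurable_of_rightContinuous {Ω : Type*} [MeasurableSpace Ω] {V : ℝ≥0 → Ω → Fin N → ℝ}
    (hV : ∀ t, Measurable (V t)) (hc : ∀ ω t, ContinuousWithinAt (fun s => V s ω) (Set.Ici t) t) :
    Measurable fun p : ℝ≥0 × Ω => V p.1 p.2 := by
  let σ : ℕ → ℝ≥0 → ℝ≥0 := fun n s => ((⌊((n : ℝ≥0) + 1) * s⌋₊ : ℝ≥0) + 1) / (n + 1)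
  have hσ : ∀ n s, s ≤ σ n s ∧ σ n s ≤ s + 1 / (n + 1) := fun n s => by
    have hn : (0 : ℝ≥0) < n + 1 := by positivity
    constructor
    · rw [le_div_iff₀ hn, mul_comm]
      exact (Nat.lt_floor_add_one _).le
    · rw [div_le_iff₀ hn, add_mul s, one_div, inv_mul_cancel₀ hn.ne', mul_comm s]
      gcongr
      exact Nat.floor_le (by positivity)
  refine measurable_of_tendsto_metrizable (f := fun n (p : ℝ≥0 × Ω) => V (σ n p.1) p.2)
    (fun n => ?_) ?_
  · have h1 : Measurable fun q : ℕ × Ω => V (((q.1 : ℝ≥0) + 1) / (n + 1)) q.2 :=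
      measurable_from_prod_countable_right fun k => hV (((k : ℝ≥0) + 1) / (n + 1))
    have h2 : Measurable fun p : ℝ≥0 × Ω => (⌊((n : ℝ≥0) + 1) * p.1⌋₊, p.2) :=
      (Nat.measurable_floor.comp (measurable_fst.const_mul _)).prodMk measurable_snd
    have h3 := Measurable.comp h1 h2
    simp only [Function.comp_def] at h3
    exact h3
  · rw [tendsto_pi_nhds]
    rintro ⟨s, ω⟩
    refine (hc ω s).tendsto.comp (tendsto_nhdsWithin_iff.2 ⟨?_, Eventually.of_forall
      fun n => (hσ n s).1⟩)
    have h0 : Tendsto (fun n : ℕ => s + 1 / ((n : ℝ≥0) + 1)) atTop (𝓝 s) := by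
      have := (tendsto_const_nhds (x := s)).add (tendsto_one_div_add_atTop_nhds_zero_nat (𝕜 := ℝ≥0))
      simpa using this
    exact tendsto_of_tendsto_of_tendsto_of_le_of_le tendsto_const_nhds h0
      (fun n => (hσ n s).1) fun n => (hσ n s).2

section Particles

variable {Ω : Type*} [MeasurableSpace Ω] {P : Measure Ω} [IsProbabilityMeasure P]
  {V : ℝ≥0 → Ω → Fin N → ℝ}

omit [IsProbabilityMeasure P] in
lemma KacThermostat.IsParticleSystem.measurable (hV : IsParticleSystem P N lam mu E T V) (t : ℝ≥0) :
    Measurable (V t) := by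
  obtain ⟨ℱ, h, _⟩ := hV.martingaleProblem
  exact (h t).mono (ℱ.le t) le_rfl

/-- The expectation of the martingale is constant, and Fubini exchanges it with the time integral:
this is the forward equation of the law. -/
lemma KacThermostat.IsParticleSystem.isPrimitive (hV : IsParticleSystem P N lam mu E T V) (hN : 2 ≤ N)
    (hlam : 0 ≤ lam) (hmu : 0 ≤ mu) {φ : (Fin N → ℝ) → ℝ} (hφ : Measurable φ) {K : ℝ}
    (hK : ∀ v, |φ v| ≤ K) {t : ℝ} :
    IsPrimitive (fun s => ∫ ω, φ (V s.toNNReal ω) ∂P)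
      (fun s => ∫ ω, generator N lam mu E T φ (V s.toNNReal ω) ∂P) t := by
  obtain ⟨ℱ, -, hmart⟩ := hV.martingaleProblem
  have hm := hmart φ hφ ⟨K, hK⟩
  have hG := measurable_generator (E := E) (T := T) hN hlam hmu hφ hK
  have hGK := abs_generator_le (E := E) (T := T) hN hlam hmu hφ hK
  have hjoint : Measurable fun p : ℝ × Ω => generator N lam mu E T φ (V p.1.toNNReal p.2) :=
    hG.comp ((measurable_of_rightContinuous hV.measurable hV.rightContinuous).comp
      ((measurable_real_toNNReal.comp measurable_fst).prodMk measurable_snd))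
  have hD : Measurable fun s : ℝ => ∫ ω, generator N lam mu E T φ (V s.toNNReal ω) ∂P :=
    (hjoint.stronglyMeasurable.integral_prod_right').measurable
  refine ⟨?_, fun s hs => ?_⟩
  · refine ⟨?_, ?_⟩ <;>
    · refine Integrable.of_bound hD.aestronglyMeasurable (2 * (N * (lam + mu)) * K)
        (ae_of_all _ fun s => ?_)
      have := norm_integral_le_of_norm_le_const (μ := P) (f := fun ω =>
        generator N lam mu E T φ (V s.toNNReal ω)) (ae_of_all _ fun ω => hGK _)
      simpa using this
  · have e1 : ∫ ω, (φ (V s.toNNReal ω) -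
        ∫ r in (0 : ℝ)..s.toNNReal, generator N lam mu E T φ (V r.toNNReal ω)) ∂P =
        ∫ ω, φ (V 0 ω) ∂P := by
      have h1 := hm.setIntegral_eq (zero_le : 0 ≤ s.toNNReal) (s := Set.univ) MeasurableSet.univ
      simp only [Measure.restrict_univ, NNReal.coe_zero, intervalIntegral.integral_same,
        sub_zero] at h1
      exact h1.symm
    rw [Real.coe_toNNReal s hs.1] at e1
    have hi : Integrable (fun p : ℝ × Ω => generator N lam mu E T φ (V p.1.toNNReal p.2))
        ((volume.restrict (Set.Ioc 0 s)).prod P) :=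
      Integrable.of_bound hjoint.aestronglyMeasurable _ (ae_of_all _ fun p => hGK _)
    have hint : Integrable (fun ω => φ (V s.toNNReal ω)) P :=
      Integrable.of_bound (hφ.comp (hV.measurable _)).aestronglyMeasurable K
        (ae_of_all _ fun p => hK _)
    simp_rw [intervalIntegral.integral_of_le hs.1] at e1 ⊢
    rw [integral_sub hint hi.integral_prod_right, ← integral_integral_swap hi] at e1
    rw [Real.toNNReal_zero]
    linarith

/-- The first marginal of the coupling is the law of the particle system. -/
lemma IsCoupling.map_fst {m : Kernel ℝ ((Fin N → ℝ) × (Fin N → ℝ))}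
    (h : IsCoupling lam mu a E T g m) (hV : IsParticleSystem P N lam mu E T V)
    (h0 : (m 0).map Prod.fst = P.map (V 0)) (hN : 2 ≤ N) (hlam : 0 ≤ lam) (hmu : 0 < mu)
    (t : ℝ≥0) : (m t).map Prod.fst = P.map (V t) := by
  have := h.markov
  have ht : (0 : ℝ) ≤ t := t.2
  have hL : (0 : ℝ) < 2 * (N * (lam + mu)) := by positivity
  let ι := {φ : (Fin N → ℝ) → ℝ // Measurable φ ∧ ∀ v, |φ v| ≤ 1}
  let y : ι → ℝ → ℝ := fun φ s => ∫ x, φ.1 x.1 ∂m s - ∫ ω, φ.1 (V s.toNNReal ω) ∂P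
  have hle : ∀ (φ : ι), y φ t ≤ 0 := by
    refine nonpos_of_family (b := 2 * (N * (lam + mu))) (B₀ := 2) (D := fun φ s =>
      ∫ x, generator N lam mu E T φ.1 x.1 ∂m s -
        ∫ ω, generator N lam mu E T φ.1 (V s.toNNReal ω) ∂P) hL
      (fun φ s _ => ?_) (fun φ => ?_) (fun φ => ?_) (fun φ s _ Y hY => ?_) ht
    · have h1 := norm_integral_le_of_norm_le_const (μ := m s) (f := fun x => φ.1 x.1)
        (ae_of_all _ fun x => φ.2.2 _)
      have h2 := norm_integral_le_of_norm_le_const (μ := P) (f := fun ω => φ.1 (V s.toNNReal ω))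
        (ae_of_all _ fun _ => φ.2.2 _)
      simp only [probReal_univ, mul_one, Real.norm_eq_abs] at h1 h2
      simp only [y]
      linarith [(abs_le.1 h1).2, (abs_le.1 h2).1]
    · simp only [y]
      have e1 := integral_map (μ := m 0) (f := φ.1) measurable_fst.aemeasurable
        φ.2.1.aestronglyMeasurable
      have e2 := integral_map (μ := P) (f := φ.1) (hV.measurable 0).aemeasurable
        φ.2.1.aestronglyMeasurable
      rw [h0, e2] at e1
      rw [Real.toNNReal_zero, e1, sub_self]
    · refine ((h.isPrimitive_of_bounded hN hlam hmu.le (ψ := fun x => φ.1 x.1)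
        (φ.2.1.comp measurable_fst) (fun x => φ.2.2 _) ht).add
        ((hV.isPrimitive hN hlam hmu.le φ.2.1 φ.2.2).const_mul (-1))).congr ht
        (fun s _ => ?_) fun s _ => ?_
      · simp only [y]; ring
      · simp_rw [IsCoupling.integral_couplingRate_fst hN hlam hmu.le φ.2.1 φ.2.2]
        ring
    -- Divided by its norm bound, the generator maps the family of test functions into itself.
    · have h1 := hY ⟨fun v => (2 * (N * (lam + mu)))⁻¹ * generator N lam mu E T φ.1 v,
        (measurable_generator hN hlam hmu.le φ.2.1 φ.2.2).const_mul _, fun v => by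
          rw [abs_mul, abs_of_nonneg (by positivity), inv_mul_le_iff₀ hL]
          exact abs_generator_le hN hlam hmu.le φ.2.1 φ.2.2 v⟩
      simp only [y, integral_const_mul, ← mul_sub] at h1
      rwa [inv_mul_le_iff₀ hL] at h1
  have key : ∀ (φ : ι), y φ t = 0 := fun φ => le_antisymm (hle φ) <| by
    have h2 := hle ⟨fun x => -φ.1 x, φ.2.1.neg, fun x => by rw [abs_neg]; exact φ.2.2 x⟩
    simp only [y, integral_neg] at h2 ⊢
    linarith
  ext S hS
  have h1 := key ⟨S.indicator 1, measurable_one.indicator hS,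
    fun y => by by_cases hy : y ∈ S <;> simp [hy]⟩
  have e1 : (fun x : (Fin N → ℝ) × (Fin N → ℝ) => (S.indicator 1 x.1 : ℝ)) =
      (Prod.fst ⁻¹' S).indicator 1 := rfl
  have e2 : (fun ω => (S.indicator 1 (V t ω) : ℝ)) = (V t ⁻¹' S).indicator 1 := rfl
  simp only [y, Real.toNNReal_coe] at h1
  have e3 := integral_indicator_one (μ := P) (hV.measurable t hS)
  rw [e1, e2, integral_indicator_one (measurable_fst hS), e3, sub_eq_zero] at h1
  rw [Measure.map_apply measurable_fst hS, Measure.map_apply (hV.measurable t) hS]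
  exact (measureReal_eq_measureReal_iff (by simp) (by simp)).1 h1

end Particles

end Marginals

/-! ### Integrals of linear combinations. -/

/-- `f` is integrable, with integral `c`. -/
def HasIntegralEq {X : Type*} [MeasurableSpace X] (μ : Measure X) (f : X → ℝ) (c : ℝ) : Prop :=
  Integrable f μ ∧ ∫ x, f x ∂μ = c

namespace HasIntegralEq

variable {X : Type*} [MeasurableSpace X] {μ : Measure X} {f f' : X → ℝ} {c c' : ℝ}

lemma of_integrable (h : Integrable f μ) : HasIntegralEq μ f (∫ x, f x ∂μ) := ⟨h, rfl⟩

lemma add (h : HasIntegralEq μ f c) (h' : HasIntegralEq μ f' c') :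
    HasIntegralEq μ (fun x => f x + f' x) (c + c') :=
  ⟨h.1.add h'.1, by rw [integral_add h.1 h'.1, h.2, h'.2]⟩

lemma const_mul (b : ℝ) (h : HasIntegralEq μ f c) : HasIntegralEq μ (fun x => b * f x) (b * c) :=
  ⟨h.1.const_mul b, by rw [integral_const_mul, h.2]⟩

lemma const [IsProbabilityMeasure μ] (b : ℝ) : HasIntegralEq μ (fun _ => b) b :=
  ⟨integrable_const b, by simp⟩

lemma congr (h : HasIntegralEq μ f c) (hf : ∀ x, f' x = f x) (hc : c' = c) :
    HasIntegralEq μ f' c' := by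
  rw [funext hf, hc]; exact h

end HasIntegralEq

/-! ### Fluctuations of the nonlinear particles -/

section CollisionMean

variable {ν : Measure ℝ} [IsProbabilityMeasure ν]

lemma integrable_collision_comp {φ : ℝ → ℝ} (hφ : Measurable φ) {K : ℝ} (hK : ∀ y, |φ y| ≤ K)
    (y : ℝ) : Integrable (fun p : ℝ × ℝ => φ (y * Real.cos p.1 + p.2 * Real.sin p.1))
      (angleLaw.prod ν) := by
  have hm : Measurable fun p : ℝ × ℝ => φ (y * Real.cos p.1 + p.2 * Real.sin p.1) := by fun_prop
  exact Integrable.of_bound hm.aestronglyMeasurable K (ae_of_all _ fun p => hK _)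

omit [IsProbabilityMeasure ν] in
lemma collisionMean_const_mul (c : ℝ) (φ : ℝ → ℝ) (y : ℝ) :
    collisionMean ν (fun z => c * φ z) y = c * collisionMean ν φ y := integral_const_mul _ _

lemma sq_integral_le {X : Type*} [MeasurableSpace X] {μ : Measure X} [IsProbabilityMeasure μ]
    {f : X → ℝ} (hf : Integrable f μ) (hf2 : Integrable (fun x => f x ^ 2) μ) :
    (∫ x, f x ∂μ) ^ 2 ≤ ∫ x, f x ^ 2 ∂μ := by
  have h0 : 0 ≤ ∫ x, (f x - ∫ y, f y ∂μ) ^ 2 ∂μ := integral_nonneg fun x => sq_nonneg _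
  have e : ∫ x, (f x - ∫ y, f y ∂μ) ^ 2 ∂μ = ∫ x, f x ^ 2 ∂μ - (∫ y, f y ∂μ) ^ 2 := by
    set c := ∫ y, f y ∂μ with hc
    have : ∀ x, (f x - c) ^ 2 = f x ^ 2 + ((-(2 * c)) * f x + c ^ 2) := fun x => by ring
    simp_rw [this]
    rw [((HasIntegralEq.of_integrable hf2).add (((HasIntegralEq.of_integrable hf).const_mul _).add
      (.const _))).2, ← hc]
    ring
  linarith

/-- Jensen's inequality, then the average of `(y cos θ + v sin θ)²`. Quadratic bounds on test
functions therefore survive a collision, up to the energy of `ν`. -/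
lemma collisionMean_sq_le {φ : ℝ → ℝ} (hφ : Measurable φ) {K : ℝ} (hK : ∀ y, |φ y| ≤ K) {M : ℝ}
    (hM : ∀ y, φ y ^ 2 ≤ y ^ 2 + M) (hν : Integrable (fun v : ℝ => v ^ 2) ν) (y : ℝ) :
    collisionMean ν φ y ^ 2 ≤ y ^ 2 / 2 + (∫ v, v ^ 2 ∂ν) / 2 + M := by
  have hK2 : ∀ y, |φ y ^ 2| ≤ K ^ 2 := fun y => by
    rw [abs_pow]; exact pow_le_pow_left₀ (abs_nonneg _) (hK y) 2
  have i1 := integrable_collision_comp (ν := ν) hφ hK y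
  have i2 := integrable_collision_comp (ν := ν) (hφ.pow_const 2) hK2 y
  refine (sq_integral_le i1 i2).trans ?_
  have hν1 : Integrable (fun v : ℝ => v) ν :=
    ((memLp_two_iff_integrable_sq aestronglyMeasurable_id).2 hν).integrable one_le_two
  have c2 : Integrable (fun θ => Real.cos θ ^ 2) angleLaw :=
    integrable_angleLaw (by fun_prop) (K := 1) fun θ => by
      rw [abs_pow]; exact pow_le_one₀ (abs_nonneg _) (Real.abs_cos_le_one _)
  have s2 : Integrable (fun θ => Real.sin θ ^ 2) angleLaw :=
    integrable_angleLaw (by fun_prop) (K := 1) fun θ => by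
      rw [abs_pow]; exact pow_le_one₀ (abs_nonneg _) (Real.abs_sin_le_one _)
  have cs : Integrable (fun θ => Real.cos θ * Real.sin θ) angleLaw :=
    integrable_angleLaw (by fun_prop) (K := 1) fun θ => by
      rw [abs_mul]
      exact mul_le_one₀ (Real.abs_cos_le_one _) (abs_nonneg _) (Real.abs_sin_le_one _)
  have j1 : Integrable (fun p : ℝ × ℝ => y ^ 2 * (Real.cos p.1 ^ 2 * 1)) (angleLaw.prod ν) :=
    (c2.mul_prod (integrable_const 1)).const_mul _
  have j2 : Integrable (fun p : ℝ × ℝ => 2 * y * (Real.cos p.1 * Real.sin p.1 * p.2))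
    (angleLaw.prod ν) := (cs.mul_prod hν1).const_mul _
  have j3 : Integrable (fun p : ℝ × ℝ => Real.sin p.1 ^ 2 * p.2 ^ 2) (angleLaw.prod ν) :=
    s2.mul_prod hν
  have hle : ∀ p : ℝ × ℝ, φ (y * Real.cos p.1 + p.2 * Real.sin p.1) ^ 2 ≤
      y ^ 2 * (Real.cos p.1 ^ 2 * 1) + (2 * y * (Real.cos p.1 * Real.sin p.1 * p.2) +
        (Real.sin p.1 ^ 2 * p.2 ^ 2 + M)) := fun p => (hM _).trans (le_of_eq (by ring))
  refine (integral_mono i2 (j1.add (j2.add (j3.add (integrable_const M)))) hle).trans (le_of_eq ?_)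
  have e1 := integral_add j1 (j2.add (j3.add (integrable_const M)))
  have e2 := integral_add j2 (j3.add (integrable_const M))
  have e3 := integral_add j3 (integrable_const M)
  simp only [Pi.add_apply] at e1 e2 e3 ⊢
  rw [e1, e2, e3, integral_const_mul, integral_const_mul,
    integral_prod_mul (fun θ => Real.cos θ ^ 2) (fun _ : ℝ => (1 : ℝ)),
    integral_prod_mul (fun θ => Real.cos θ * Real.sin θ) (fun v : ℝ => v),
    integral_prod_mul (fun θ => Real.sin θ ^ 2) (fun v : ℝ => v ^ 2), integral_cos_sq_angleLaw,
    integral_cos_mul_sin_angleLaw, integral_sin_sq_angleLaw]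
  simp
  ring

lemma mean_sq_le {N : ℕ} (φ : ℝ → ℝ) (u : Fin N → ℝ) : mean φ u ^ 2 ≤ mean (fun y => φ y ^ 2) u := by
  rcases Nat.eq_zero_or_pos N with rfl | hN
  · simp [mean]
  have hN : (0 : ℝ) < N := by exact_mod_cast hN
  have := sq_sum_le_card_mul_sum_sq (s := Finset.univ) (f := fun k => φ (u k))
  simp only [Finset.card_univ, Fintype.card_fin] at this
  rw [mean, mean, mul_pow, inv_pow, inv_mul_le_iff₀ (by positivity)]
  refine this.trans (le_of_eq ?_)
  field_simp

lemma mean_const_mul {N : ℕ} (c : ℝ) (φ : ℝ → ℝ) (u : Fin N → ℝ) :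
    mean (fun x => c * φ x) u = c * mean φ u := by
  simp only [mean, ← Finset.mul_sum]; ring

lemma mean_add {N : ℕ} (φ χ : ℝ → ℝ) (u : Fin N → ℝ) :
    mean (fun x => φ x + χ x) u = mean φ u + mean χ u := by
  simp only [mean, Finset.sum_add_distrib]; ring

end CollisionMean

section Fluctuation

variable {N : ℕ} {lam mu a E T : ℝ} {g : Kernel ℝ ℝ} [IsMarkovKernel g]
  {m : Kernel ℝ ((Fin N → ℝ) × (Fin N → ℝ))}

/-- The variance of the average of `φ` over the nonlinear particles. -/
noncomputable def fluctuation (g : Kernel ℝ ℝ) (m : Kernel ℝ ((Fin N → ℝ) × (Fin N → ℝ)))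
    (φ : ℝ → ℝ) (s : ℝ) : ℝ := ∫ x, mean φ x.2 ^ 2 ∂m s - (∫ y, φ y ∂g s) ^ 2

omit [IsMarkovKernel g] in
lemma fluctuation_const_mul (c : ℝ) (φ : ℝ → ℝ) (s : ℝ) :
    fluctuation g m (fun x => c * φ x) s = c ^ 2 * fluctuation g m φ s := by
  simp only [fluctuation, mean_const_mul, mul_pow, integral_const_mul]
  ring

lemma integrable_mean_mul [IsMarkovKernel m] {φ χ : ℝ → ℝ} (hφ : Measurable φ) {K : ℝ}
    (hK : ∀ y, |φ y| ≤ K) (hχ : Measurable χ) {K' : ℝ} (hK' : ∀ y, |χ y| ≤ K') (s : ℝ) :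
    Integrable (fun x => mean φ x.2 * mean χ x.2) (m s) :=
  Integrable.of_bound (((measurable_mean hφ).comp measurable_snd).mul
    ((measurable_mean hχ).comp measurable_snd)).aestronglyMeasurable (K * K')
    (ae_of_all _ fun x => by
      rw [norm_mul]
      exact mul_le_mul (abs_mean_le hK _) (abs_mean_le hK' _) (norm_nonneg _)
        ((abs_nonneg _).trans (hK 0)))

/-- Unbiasedness makes `fluctuation` a true variance. -/
lemma IsCoupling.integral_sq_mean_sub (h : IsCoupling lam mu a E T g m)
    (hg : IsKineticFlow lam mu a T g) (hN : 2 ≤ N) (hlam : 0 ≤ lam) (hmu : 0 < mu) {φ : ℝ → ℝ}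
    (hφ : Measurable φ) {K : ℝ} (hK : ∀ y, |φ y| ≤ K) {s : ℝ} (hs : 0 ≤ s) :
    ∫ x, (mean φ x.2 - ∫ y, φ y ∂g s) ^ 2 ∂m s = fluctuation g m φ s := by
  have := h.markov
  have h1 := h.integral_mean hg hN hlam hmu hφ hK hs
  set c := ∫ y, φ y ∂g s with hc
  have e : ∀ x : (Fin N → ℝ) × (Fin N → ℝ), (mean φ x.2 - c) ^ 2 =
    mean φ x.2 * mean φ x.2 + (-(2 * c) * mean φ x.2 + c ^ 2) := fun x => by ring
  have i1 : Integrable (fun x => mean φ x.2) (m s) := integrable_mean hφ hK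
  simp_rw [e]
  rw [((HasIntegralEq.of_integrable (integrable_mean_mul hφ hK hφ hK s)).add
    (((HasIntegralEq.of_integrable i1).const_mul _).add (.const _))).2, h1, fluctuation, ← hc]
  simp only [pow_two]
  ring

lemma IsCoupling.fluctuation_nonneg (h : IsCoupling lam mu a E T g m)
    (hg : IsKineticFlow lam mu a T g) (hN : 2 ≤ N) (hlam : 0 ≤ lam) (hmu : 0 < mu) {φ : ℝ → ℝ}
    (hφ : Measurable φ) {K : ℝ} (hK : ∀ y, |φ y| ≤ K) {s : ℝ} (hs : 0 ≤ s) :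
    0 ≤ fluctuation g m φ s := by
  rw [← h.integral_sq_mean_sub hg hN hlam hmu hφ hK hs]
  exact integral_nonneg fun x => sq_nonneg _

/-- Expand the nonnegative fluctuation of `ρ φ - χ` and divide by `2 ρ`. -/
lemma IsCoupling.covariance_le (h : IsCoupling lam mu a E T g m)
    (hg : IsKineticFlow lam mu a T g) (hN : 2 ≤ N) (hlam : 0 ≤ lam) (hmu : 0 < mu) {φ χ : ℝ → ℝ}
    (hφ : Measurable φ) {K : ℝ} (hK : ∀ y, |φ y| ≤ K) (hχ : Measurable χ) {K' : ℝ}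
    (hK' : ∀ y, |χ y| ≤ K') {s : ℝ} (hs : 0 ≤ s) {ρ : ℝ} (hρ : 0 < ρ) :
    ∫ x, mean φ x.2 * mean χ x.2 ∂m s - (∫ y, φ y ∂g s) * ∫ y, χ y ∂g s ≤
      (ρ * fluctuation g m φ s + fluctuation g m χ s / ρ) / 2 := by
  have := h.markov
  have h0 := h.fluctuation_nonneg hg hN hlam hmu (φ := fun y => ρ * φ y + -1 * χ y)
    (by fun_prop) (K := ρ * K + K') (fun y => (abs_add_le _ _).trans (by
      rw [abs_mul, abs_of_pos hρ, neg_one_mul, abs_neg]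
      exact add_le_add (mul_le_mul_of_nonneg_left (hK y) hρ.le) (hK' y))) hs
  have e : ∀ x : (Fin N → ℝ) × (Fin N → ℝ), mean (fun y => ρ * φ y + -1 * χ y) x.2 ^ 2 =
    ρ ^ 2 * mean φ x.2 ^ 2 + (-(2 * ρ) * (mean φ x.2 * mean χ x.2) + mean χ x.2 ^ 2) := fun x => by
    rw [mean_add, mean_const_mul, mean_const_mul]; ring
  have i1 : Integrable (fun x => mean φ x.2 ^ 2) (m s) := by
    simpa only [pow_two] using integrable_mean_mul hφ hK hφ hK s
  have i2 : Integrable (fun x => mean χ x.2 ^ 2) (m s) := by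
    simpa only [pow_two] using integrable_mean_mul hχ hK' hχ hK' s
  have i3 : Integrable (fun x => mean φ x.2 * mean χ x.2) (m s) :=
    integrable_mean_mul hφ hK hχ hK' s
  have i4 : Integrable φ (g s) := Integrable.of_bound hφ.aestronglyMeasurable K (ae_of_all _ hK)
  have i5 : Integrable χ (g s) := Integrable.of_bound hχ.aestronglyMeasurable K' (ae_of_all _ hK')
  simp only [fluctuation] at h0 ⊢
  simp_rw [e] at h0
  rw [(((HasIntegralEq.of_integrable i1).const_mul _).add
    (((HasIntegralEq.of_integrable i3).const_mul _).add (.of_integrable i2))).2,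
    (((HasIntegralEq.of_integrable i4).const_mul _).add
      ((HasIntegralEq.of_integrable i5).const_mul _)).2] at h0
  rw [← sub_nonneg]
  have := div_nonneg h0 (by positivity : 0 ≤ 2 * ρ)
  refine this.trans (le_of_eq ?_)
  field_simp
  ring

/-- Subtract the derivative of `(∫ φ dg)²` from that of the second moment of the average. By
unbiasedness the thermostat terms cancel, and the collisions leave `4 lam` times the covariance of
the averages of `φ` and `collisionMean (g s) φ`, to which `covariance_le` applies. The squares of
the jumps give the term in `1 / N`. -/
lemma IsCoupling.exists_isPrimitive_fluctuation (h : IsCoupling lam mu a E T g m)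
    (hg : IsKineticFlow lam mu a T g) (hN : 2 ≤ N) (hlam : 0 ≤ lam) (hmu : 0 < mu) {φ : ℝ → ℝ}
    (hφ : Measurable φ) {K : ℝ} (hK : ∀ y, |φ y| ≤ K) {t : ℝ} (ht : 0 ≤ t) :
    ∃ D : ℝ → ℝ, IsPrimitive (fluctuation g m φ) D t ∧ ∀ s ∈ Set.Icc 0 t, ∀ ρ : ℝ, 0 < ρ →
      D s ≤ -(4 * lam + 2 * mu) * fluctuation g m φ s +
        2 * lam * (ρ * fluctuation g m φ s + fluctuation g m (collisionMean (g s) φ) s / ρ) +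
        (N : ℝ)⁻¹ * (8 * lam * (∫ y, φ y ^ 2 ∂collisionKernel g s + ∫ y, φ y ^ 2 ∂g s) +
          2 * mu * (∫ y, φ y ^ 2 ∂thermostatKernel a T s + ∫ y, φ y ^ 2 ∂g s)) := by
  have := h.markov
  have := isFiniteKernel_couplingRate (a := a) (E := E) (T := T) g hN hlam hmu.le
  have hm : Measurable fun y : (Fin N → ℝ) × (Fin N → ℝ) => mean φ y.2 := by fun_prop
  have hφ2 : Measurable fun y => φ y ^ 2 := by fun_prop
  have hK2 : ∀ y, |φ y ^ 2| ≤ K ^ 2 := fun y => by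
    rw [abs_pow]; exact pow_le_pow_left₀ (abs_nonneg _) (hK y) 2
  have hmK2 : ∀ x : (Fin N → ℝ) × (Fin N → ℝ), |mean φ x.2 ^ 2| ≤ K ^ 2 := fun y => by
    rw [abs_pow]; exact pow_le_pow_left₀ (abs_nonneg _) (abs_mean_le hK y.2) 2
  have h1 := h.isPrimitive_of_bounded hN hlam hmu.le (hm.pow_const 2) hmK2 ht
  have h2 := hg.isPrimitive_of_bounded hlam hmu.le hφ hK ht
  refine ⟨_, (h1.add ((h2.mul h2 ht).const_mul (-1))).congr ht (fun s _ => ?_) fun s _ => rfl,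
    fun s hs ρ hρ => ?_⟩
  · simp only [fluctuation]; ring
  have hcov := h.covariance_le hg hN hlam hmu hφ hK (measurable_collisionMean (ν := g s) hφ)
    (abs_collisionMean_le (ν := g s) hK) hs.1 hρ
  have hb1 := h.integral_mean hg hN hlam hmu hφ hK hs.1
  have hb2 := h.integral_mean hg hN hlam hmu hφ2 hK2 hs.1
  have hb3 := h.integral_mean hg hN hlam hmu (measurable_collisionMean (ν := g s) hφ2)
    (abs_collisionMean_le (ν := g s) hK2) hs.1
  rw [integral_collisionMean g hφ2 hK2] at hb3
  have j1 : Integrable (fun x => mean φ x.2 * mean φ x.2) (m s) := integrable_mean_mul hφ hK hφ hK s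
  have j2 : Integrable (fun x => mean φ x.2 * mean (collisionMean (g s) φ) x.2) (m s) :=
    integrable_mean_mul hφ hK (measurable_collisionMean (ν := g s) hφ)
      (abs_collisionMean_le (ν := g s) hK) s
  have j3 : Integrable (fun x => mean φ x.2) (m s) := integrable_mean hφ hK
  have j4 : Integrable (fun x => mean (fun y => φ y ^ 2) x.2) (m s) := integrable_mean hφ2 hK2
  have j5 : Integrable (fun x => mean (collisionMean (g s) (fun y => φ y ^ 2)) x.2) (m s) :=
    integrable_mean (measurable_collisionMean hφ2) (abs_collisionMean_le hK2)
  have hint := ((HasIntegralEq.of_integrable j2).const_mul (4 * lam)).add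
    (((HasIntegralEq.of_integrable j1).const_mul (-(4 * lam + 2 * mu))).add
    (((HasIntegralEq.of_integrable j3).const_mul (2 * mu * ∫ y, φ y ∂thermostatKernel a T s)).add
    (((HasIntegralEq.of_integrable j5).const_mul ((N : ℝ)⁻¹ * 8 * lam)).add
    (((HasIntegralEq.of_integrable j4).const_mul ((N : ℝ)⁻¹ * (8 * lam + 2 * mu))).add
    (.const ((N : ℝ)⁻¹ * 2 * mu * ∫ y, φ y ^ 2 ∂thermostatKernel a T s))))))
  have hle := integral_mono (μ := m s) (f := fun x => ∫ y, mean φ y.2 ^ 2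
      ∂couplingRate N lam mu a E T g (s, x) - (N * (lam + mu)).toNNReal * mean φ x.2 ^ 2)
    ((Integrable.of_bound (((hm.pow_const 2).stronglyMeasurable.integral_kernel
      (κ := couplingRate N lam mu a E T g)).comp_measurable measurable_prodMk_left).aestronglyMeasurable
      (K ^ 2 * (N * (lam + mu)).toNNReal) (ae_of_all _ fun x => by
        have h1 := norm_integral_le_of_norm_le_const (μ := couplingRate N lam mu a E T g (s, x))
          (f := fun y => mean φ y.2 ^ 2) (ae_of_all _ fun y => hmK2 y)
        rwa [Measure.real, couplingRate_univ _ hN hlam hmu.le, ENNReal.coe_toReal] at h1)).sub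
      (by simpa only [pow_two] using j1.const_mul _)) hint.1
    (fun x => (integral_couplingRate_mean_sq_le g hN hφ hK hlam hmu.le s x).trans
      (le_of_eq (by ring)))
  rw [hint.2, hb1, hb2, hb3] at hle
  have e1 : fluctuation g m φ s = ∫ x, mean φ x.2 * mean φ x.2 ∂m s - (∫ y, φ y ∂g s) ^ 2 := by
    simp only [fluctuation, pow_two]
  have hl := mul_le_mul_of_nonneg_left hcov (by positivity : 0 ≤ 4 * lam)
  have e2 := congrArg (fun q => (4 * lam + 2 * mu) * q) e1
  beta_reduce at e2 ⊢
  linarith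

lemma integral_sq_thermostatKernel (hT : 0 ≤ T) (s : ℝ) :
    HasIntegralEq (thermostatKernel a T s) (fun v => v ^ 2) (Real.exp (-(2 * a * s)) * T) := by
  obtain ⟨i2, e2⟩ := integral_abs_rpow_thermostatKernel (a := a) (T := T) (r := 2)
    (by norm_num) s
  simp only [Real.rpow_ofNat, sq_abs, integral_sq_thermostat hT] at i2 e2
  exact ⟨i2, e2⟩

/-- Initially the nonlinear particles are independent, so the variance of the average is a variance
divided by `N`. -/
lemma IsCoupling.fluctuation_zero_le (h : IsCoupling lam mu a E T g m) (hN : 2 ≤ N) {φ : ℝ → ℝ}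
    (hφ : Measurable φ) {K : ℝ} (hK : ∀ y, |φ y| ≤ K) :
    fluctuation g m φ 0 ≤ (N : ℝ)⁻¹ * ∫ y, φ y ^ 2 ∂g 0 := by
  have := h.markov
  have hN0 : (N : ℝ) ≠ 0 := by positivity
  have hmem : MemLp φ 2 (g 0) := MemLp.of_bound hφ.aestronglyMeasurable K (ae_of_all _ hK)
  have h1 := variance_sum_pi (μ := fun _ : Fin N => g 0) (X := fun _ => φ) fun _ => hmem
  have h2 : (∑ i, fun u : Fin N → ℝ => φ (u i)) = fun u => N * mean φ u := by
    ext u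
    simp only [Finset.sum_apply, mean]
    field_simp
  rw [h2, variance_const_mul] at h1
  simp only [Finset.sum_const, Finset.card_univ, Fintype.card_fin, nsmul_eq_mul] at h1
  have hmm : MemLp (mean φ) 2 (Measure.pi fun _ : Fin N => g 0) :=
    MemLp.of_bound (by fun_prop) K (ae_of_all _ (abs_mean_le hK))
  rw [variance_eq_sub hmm, variance_eq_sub hmem] at h1
  have e1 : ∫ u, mean φ u ∂(Measure.pi fun _ : Fin N => g 0) = ∫ y, φ y ∂g 0 := by
    rw [← h.integral_mean_zero hN hφ hK, ← h.map_snd]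
    exact integral_map (by fun_prop) (by fun_prop)
  have e2 : ∫ u, mean φ u ^ 2 ∂(Measure.pi fun _ : Fin N => g 0) = ∫ x, mean φ x.2 ^ 2 ∂m 0 := by
    rw [← h.map_snd]
    exact integral_map (by fun_prop) (by fun_prop)
  simp only [Pi.pow_apply] at h1
  rw [e1, e2] at h1
  have h3 : fluctuation g m φ 0 = (N : ℝ)⁻¹ * (∫ y, φ y ^ 2 ∂g 0 - (∫ y, φ y ∂g 0) ^ 2) := by
    rw [fluctuation]
    field_simp
    field_simp at h1
    linarith
  rw [h3]
  gcongr
  linarith [sq_nonneg (∫ y, φ y ∂g 0)]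

set_option maxHeartbeats 1000000 in
/-- The fluctuations of quadratically bounded observables are of order `1 / N`, uniformly in
time. -/
lemma exists_fluctuation_le (hlam : 0 ≤ lam) (hmu : 0 < mu) (hT : 0 ≤ T) (ha : 2 * a < mu)
    {K : ℝ} (hK0 : 0 ≤ K) : ∃ C : ℝ, 0 ≤ C ∧
    ∀ (g : Kernel ℝ ℝ), IsKineticFlow lam mu a T g → (∀ t, 0 ≤ t →
      Integrable (fun v : ℝ => v ^ 2) (g t) ∧ energy a g t ≤ K) →
    ∀ (N : ℕ) (E : ℝ) (m : Kernel ℝ ((Fin N → ℝ) × (Fin N → ℝ))), 2 ≤ N →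
      IsCoupling lam mu a E T g m → ∀ φ : ℝ → ℝ, Measurable φ → (∃ B, ∀ y, |φ y| ≤ B) →
      (∀ y, φ y ^ 2 ≤ y ^ 2) → ∀ t, 0 ≤ t →
      Real.exp (2 * a * t) * fluctuation g m φ t ≤ C / N := by
  -- The class of test functions used below shrinks in time for `a ≥ 0` and grows for `a < 0`. A
  -- function admissible at time `t` becomes admissible at an earlier time `s` once multiplied by
  -- `e^{-(b - a)(t - s)}`.
  set b := max a 0 with hb
  have hb0 : 0 ≤ b := le_max_right _ _
  have hba : a ≤ b := le_max_left _ _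
  have hbm : 2 * b < mu := by rcases max_cases a 0 with h | h <;> simp only [hb, h.1] <;> linarith
  set c := 4 * lam + 2 * mu with hc
  -- A collision raises the constant `M` in the quadratic bound by at most `K / 2`; division by `ρ >
  -- 1` brings it back, by the choice of `M`. At the same time `ρ` is so close to `1` that `θ < 1`.
  set ρ := 1 + mu / (8 * (lam + 1)) with hρ
  have hρ0 : 0 < ρ := by positivity
  set M := 2 * (lam + 1) * K / mu with hM
  have hM0 : 0 ≤ M := by positivity
  have hcb : 0 < c - 2 * b := by simp only [hc]; linarith
  have hρM : K / 2 + M ≤ ρ ^ 2 * M := by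
    have h1 : 1 + mu / (4 * (lam + 1)) ≤ ρ ^ 2 := by
      have : mu / (4 * (lam + 1)) = 2 * (mu / (8 * (lam + 1))) := by field_simp; norm_num
      rw [this, hρ]
      nlinarith [sq_nonneg (mu / (8 * (lam + 1)))]
    refine le_trans (le_of_eq ?_) (mul_le_mul_of_nonneg_right h1 hM0)
    simp only [hM]; field_simp; ring
  have hρ1 : 1 ≤ ρ ^ 2 := by
    have : 1 ≤ ρ := by simp only [hρ, le_add_iff_nonneg_right]; positivity
    nlinarith
  -- The covariances feed back at rate `4 * lam * ρ`, while the dissipation left after the change of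
  -- frame is `c - 2 * b`.
  set θ := 4 * lam * ρ / (c - 2 * b) with hθ
  have hθ0 : 0 ≤ θ := by positivity
  have hθ1 : θ < 1 := by
    rw [hθ, div_lt_one hcb]
    have : 4 * lam * ρ ≤ 4 * lam + mu / 2 := by
      have : lam / (lam + 1) ≤ 1 := (div_le_one (by linarith)).2 (by linarith)
      have e : 4 * lam * ρ = 4 * lam + mu / 2 * (lam / (lam + 1)) := by
        simp only [hρ]; field_simp; ring
      rw [e]
      nlinarith
    simp only [hc]; linarith
  set C₁ := 16 * lam * (K + M) + 2 * mu * (T + K + 2 * M) with hC₁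
  have hC₁0 : 0 ≤ C₁ := by positivity
  set C₂ := (K + M) + C₁ / (c - 2 * b) with hC₂
  have hC₂0 : 0 ≤ C₂ := by positivity
  refine ⟨C₂ / (1 - θ), div_nonneg hC₂0 (by linarith), ?_⟩
  intro g hg hgK N E m hN h φ₀ hφ₀ hB₀ hφ₀y t₀ ht₀
  have := hg.markov
  have := h.markov
  have hN0 : (0 : ℝ) < N := by positivity
  have hee : ∀ s, Real.exp (2 * a * s) * Real.exp (-(2 * a * s)) = 1 := fun s => by
    rw [← Real.exp_add]; simp
  have hm2 : ∀ s, 0 ≤ s → ∫ v, v ^ 2 ∂g s ≤ Real.exp (-(2 * a * s)) * K := fun s hs => by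
    have h1 := (hgK s hs).2
    rw [energy] at h1
    have h2 := mul_le_mul_of_nonneg_left h1 (Real.exp_pos (-(2 * a * s))).le
    rwa [← mul_assoc, mul_comm (Real.exp (-(2 * a * s))), hee, one_mul] at h2
  -- the class of test functions at time `s`
  let cls : ℝ → (ℝ → ℝ) → Prop := fun s φ => Measurable φ ∧ (∃ B, ∀ y, |φ y| ≤ B) ∧
    ∀ y, φ y ^ 2 ≤ y ^ 2 + M * Real.exp (-(2 * a * s))
  have hsq : ∀ s, 0 ≤ s → ∀ φ, cls s φ →
      ∫ y, φ y ^ 2 ∂g s ≤ Real.exp (-(2 * a * s)) * (K + M) ∧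
      ∫ y, φ y ^ 2 ∂collisionKernel g s ≤ Real.exp (-(2 * a * s)) * (K + M) ∧
      ∫ y, φ y ^ 2 ∂thermostatKernel a T s ≤ Real.exp (-(2 * a * s)) * (T + M) := by
    rintro s hs φ ⟨hφ, ⟨B, hB⟩, hφy⟩
    have hi : ∀ ν : Measure ℝ, IsProbabilityMeasure ν → ∀ q, HasIntegralEq ν (fun v => v ^ 2) q →
        ∫ y, φ y ^ 2 ∂ν ≤ q + M * Real.exp (-(2 * a * s)) := fun ν _ q hq => by
      have h1 := hq.add (.const (M * Real.exp (-(2 * a * s))))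
      rw [← h1.2]
      refine integral_mono (Integrable.of_bound (hφ.pow_const 2).aestronglyMeasurable (B ^ 2)
        (ae_of_all _ fun y => ?_)) h1.1 hφy
      rw [norm_pow]; exact pow_le_pow_left₀ (abs_nonneg _) (hB y) 2
    have h1 := hi (g s) inferInstance _ ⟨(hgK s hs).1, rfl⟩
    have h2 := hi (collisionKernel g s) inferInstance _
      (integral_sq_collisionKernel g (hgK s hs).1)
    have h3 := hi (thermostatKernel a T s) inferInstance _ (integral_sq_thermostatKernel hT s)
    have h4 := hm2 s hs
    refine ⟨?_, ?_, ?_⟩ <;> linarith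
  have hcoll : ∀ s, 0 ≤ s → ∀ φ, cls s φ → cls s (fun y => ρ⁻¹ * collisionMean (g s) φ y) := by
    rintro s hs φ ⟨hφ, ⟨B, hB⟩, hφy⟩
    refine ⟨(measurable_collisionMean hφ).const_mul _, ⟨ρ⁻¹ * B, fun y => ?_⟩, fun y => ?_⟩
    · rw [abs_mul, abs_of_pos (inv_pos.2 hρ0)]
      exact mul_le_mul_of_nonneg_left (abs_collisionMean_le hB y) (inv_pos.2 hρ0).le
    · have h1 := collisionMean_sq_le hφ hB hφy (hgK s hs).1 y
      have h2 := hm2 s hs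
      have h3 := mul_le_mul_of_nonneg_right hρM (Real.exp_pos (-(2 * a * s))).le
      rw [mul_pow, inv_pow, inv_mul_le_iff₀ (by positivity)]
      have h4 := mul_nonneg (sub_nonneg.2 hρ1) (sq_nonneg y)
      have h5 := sq_nonneg y
      linarith
  have hscale : ∀ s t, 0 ≤ s → s ≤ t → ∀ φ, cls t φ →
      cls s (fun y => Real.exp (-((b - a) * (t - s))) * φ y) := by
    rintro s t hs hst φ ⟨hφ, ⟨B, hB⟩, hφy⟩
    have h1 : Real.exp (-((b - a) * (t - s))) ≤ 1 :=
      Real.exp_le_one_iff.2 (by nlinarith)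
    refine ⟨hφ.const_mul _, ⟨B, fun y => ?_⟩, fun y => ?_⟩
    · rw [abs_mul, abs_of_pos (Real.exp_pos _)]
      nlinarith [hB y, abs_nonneg (φ y)]
    · have h2 : Real.exp (-((b - a) * (t - s))) ^ 2 * Real.exp (-(2 * a * t)) ≤
          Real.exp (-(2 * a * s)) := by
        rw [← Real.exp_nat_mul, ← Real.exp_add]
        refine Real.exp_le_exp.2 ?_
        push_cast
        nlinarith
      rw [mul_pow]
      have h3 := mul_le_mul_of_nonneg_left (hφy y) (sq_nonneg (Real.exp (-((b - a) * (t - s)))))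
      have h4 : Real.exp (-((b - a) * (t - s))) ^ 2 ≤ 1 := pow_le_one₀ (Real.exp_pos _).le h1
      have h5 := mul_le_mul_of_nonneg_right h4 (sq_nonneg y)
      have h6 := mul_le_mul_of_nonneg_left h2 hM0
      linarith
  have hcls₀ : cls t₀ φ₀ := ⟨hφ₀, hB₀, fun y => (hφ₀y y).trans (by
    simp only [le_add_iff_nonneg_right]; positivity)⟩
  -- Grönwall's lemma turns a bound `B` on the whole class up to time `t₀` into `θ B + C₂ / N`; the
  -- energy supplies the first bound `K + M`.
  have hfin := le_div_of_improvable (x := Real.exp (2 * a * t₀) * fluctuation g m φ₀ t₀)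
    (P := fun B => 0 ≤ B ∧ ∀ s ∈ Set.Icc 0 t₀, ∀ φ, cls s φ →
      Real.exp (2 * a * s) * fluctuation g m φ s ≤ B) (θ := θ) (c := C₂ / N) (B₀ := K + M) hθ0 hθ1
    (fun B hB => hB.2 t₀ ⟨ht₀, le_rfl⟩ φ₀ hcls₀) ⟨by positivity, fun s hs φ hφ => ?_⟩
    fun B hB => ⟨by have := hB.1; positivity, fun t ht φ hφ => ?_⟩
  · refine hfin.trans (le_of_eq ?_)
    field_simp
  · obtain ⟨hφm, ⟨B, hB⟩, hφy⟩ := id hφ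
    have hB2 : ∀ y, |φ y ^ 2| ≤ B ^ 2 := fun y => by
      rw [abs_pow]; exact pow_le_pow_left₀ (abs_nonneg _) (hB y) 2
    have h1 : fluctuation g m φ s ≤ Real.exp (-(2 * a * s)) * (K + M) := by
      refine le_trans ?_ (hsq s hs.1 φ hφ).1
      rw [← h.integral_mean hg hN hlam hmu (hφm.pow_const 2) hB2 hs.1, fluctuation]
      have : ∫ x, mean φ x.2 ^ 2 ∂m s ≤ ∫ x, mean (fun y => φ y ^ 2) x.2 ∂m s := by
        refine integral_mono ?_ (integrable_mean (hφm.pow_const 2) hB2)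
          fun x => mean_sq_le φ x.2
        simpa only [pow_two] using integrable_mean_mul hφm hB hφm hB s
      linarith [sq_nonneg (∫ y, φ y ∂g s)]
    have h2 := mul_le_mul_of_nonneg_left h1 (Real.exp_pos (2 * a * s)).le
    rwa [← mul_assoc, hee, one_mul] at h2
  · obtain ⟨hφm, ⟨B', hB'⟩, hφy⟩ := id hφ
    obtain ⟨D, hD, hDle⟩ := h.exists_isPrimitive_fluctuation hg hN hlam hmu hφm hB' ht.1
    -- The bound `B` at time `s` is used for the scaled test function; the first exponential undoes
    -- the scaling and the second returns to the frame without drift.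
    set R : ℝ → ℝ := fun s => Real.exp (2 * (b - a) * (t - s)) * Real.exp (-(2 * a * s)) *
      (4 * lam * ρ * B + C₁ / N) with hR
    have hRc : Continuous R := by fun_prop
    have hexp : ∀ s, Real.exp (2 * (b - a) * (t - s)) * Real.exp (-((b - a) * (t - s))) ^ 2 = 1 :=
      fun s => by
        rw [← Real.exp_nat_mul, ← Real.exp_add, Real.exp_eq_one_iff]
        push_cast; ring
    have hmain := hD.le_of_deriv_le ht.1 (c := c) (R := R) (hRc.intervalIntegrable _ _)
      fun s hs => ?_
    · have hq0 : fluctuation g m φ 0 ≤ Real.exp (2 * (b - a) * t) * ((K + M) / N) := by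
        have hc0 := hscale 0 t le_rfl ht.1 φ hφ
        have h1 := (hsq 0 le_rfl _ hc0).1
        have h2 := h.fluctuation_zero_le hN hc0.1 hc0.2.1.choose_spec
        rw [fluctuation_const_mul] at h2
        simp only [mul_zero, neg_zero, Real.exp_zero, one_mul] at h1
        have h3 : Real.exp (-((b - a) * (t - 0))) ^ 2 * fluctuation g m φ 0 ≤ (K + M) / N := by
          refine h2.trans ?_
          rw [div_eq_inv_mul]
          exact mul_le_mul_of_nonneg_left h1 (by positivity)
        have h4 := mul_le_mul_of_nonneg_left h3 (Real.exp_pos (2 * (b - a) * (t - 0))).le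
        rwa [← mul_assoc, hexp, one_mul, sub_zero] at h4
      have hint : ∀ s, Real.exp (2 * a * t) * (Real.exp (-(c * (t - s))) * R s) =
          Real.exp (-((c - 2 * b) * (t - s))) * (4 * lam * ρ * B + C₁ / N) := fun s => by
        simp only [hR]
        have : Real.exp (2 * a * t) * (Real.exp (-(c * (t - s))) *
            (Real.exp (2 * (b - a) * (t - s)) * Real.exp (-(2 * a * s)))) =
            Real.exp (-((c - 2 * b) * (t - s))) := by
          rw [← Real.exp_add, ← Real.exp_add, ← Real.exp_add]
          congr 1; ring
        rw [← this]; ring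
      have h1 := mul_le_mul_of_nonneg_left hmain (Real.exp_pos (2 * a * t)).le
      rw [mul_add, ← intervalIntegral.integral_const_mul] at h1
      simp_rw [hint] at h1
      rw [intervalIntegral.integral_mul_const] at h1
      have h2 := integral_exp_neg_mul_sub_le hcb t
      have h3 : 0 ≤ 4 * lam * ρ * B + C₁ / N := by have := hB.1; positivity
      have h4 := mul_le_mul_of_nonneg_right h2 h3
      have h5 : Real.exp (2 * a * t) * (Real.exp (-(c * t)) * fluctuation g m φ 0) ≤
          (K + M) / N := by
        have h6 : Real.exp (2 * a * t) * (Real.exp (-(c * t)) * Real.exp (2 * (b - a) * t)) ≤ 1 := by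
          rw [← Real.exp_add, ← Real.exp_add, Real.exp_le_one_iff]
          nlinarith [ht.1]
        have h7 : 0 ≤ (K + M) / N := by positivity
        calc _ ≤ Real.exp (2 * a * t) * (Real.exp (-(c * t)) *
              (Real.exp (2 * (b - a) * t) * ((K + M) / N))) := by gcongr
          _ = Real.exp (2 * a * t) * (Real.exp (-(c * t)) * Real.exp (2 * (b - a) * t)) *
              ((K + M) / N) := by ring
          _ ≤ 1 * ((K + M) / N) := mul_le_mul_of_nonneg_right h6 h7
          _ = _ := one_mul _
      refine h1.trans ((add_le_add h5 h4).trans (le_of_eq ?_))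
      simp only [hθ, hC₂]
      field_simp
      ring
    · have hst : s ∈ Set.Icc 0 t₀ := ⟨hs.1, hs.2.trans ht.2⟩
      have hcs := hscale s t hs.1 hs.2 φ hφ
      have hcs' := hcoll s hs.1 _ hcs
      set σ := Real.exp (-((b - a) * (t - s))) with hσ
      set σ' := Real.exp (2 * (b - a) * (t - s)) with hσ'
      have hσσ : σ' * σ ^ 2 = 1 := hexp s
      have hσ'0 : 0 < σ' := Real.exp_pos _
      set e := Real.exp (-(2 * a * s)) with he
      have he0 : 0 < e := Real.exp_pos _
      have hes : Real.exp (2 * a * s) * e = 1 := hee s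
      have hflip : ∀ q B, Real.exp (2 * a * s) * q ≤ B → q ≤ e * B := fun q B hq => by
        have := mul_le_mul_of_nonneg_left hq he0.le
        rwa [← mul_assoc, mul_comm e, hes, one_mul] at this
      have hflip' : ∀ q B, σ ^ 2 * q ≤ B → q ≤ σ' * B := fun q B hq => by
        have := mul_le_mul_of_nonneg_left hq hσ'0.le
        rwa [← mul_assoc, hσσ, one_mul] at this
      have q1 : fluctuation g m φ s ≤ σ' * (e * B) := by
        have := hflip _ _ (hB.2 s hst _ hcs)
        rw [fluctuation_const_mul] at this
        exact hflip' _ _ this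
      have q2 : fluctuation g m (collisionMean (g s) φ) s ≤ ρ ^ 2 * (σ' * (e * B)) := by
        have := hflip _ _ (hB.2 s hst _ hcs')
        simp only [collisionMean_const_mul] at this
        rw [fluctuation_const_mul, fluctuation_const_mul, inv_pow, inv_mul_le_iff₀ (by positivity)]
          at this
        refine (hflip' _ _ this).trans (le_of_eq (by ring))
      obtain ⟨s1, s2, s3⟩ := hsq s hs.1 _ hcs
      simp only [mul_pow, integral_const_mul] at s1 s2 s3
      have s1 := hflip' _ _ s1
      have s2 := hflip' _ _ s2
      have s3 := hflip' _ _ s3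
      refine (hDle s hs ρ hρ0).trans ?_
      have d1 : 2 * lam * (ρ * fluctuation g m φ s + fluctuation g m (collisionMean (g s) φ) s / ρ) ≤
          2 * lam * (ρ * (σ' * (e * B)) + ρ ^ 2 * (σ' * (e * B)) / ρ) := by gcongr
      have d2 : 2 * lam * (ρ * (σ' * (e * B)) + ρ ^ 2 * (σ' * (e * B)) / ρ) =
          σ' * e * (4 * lam * ρ * B) := by field_simp; ring
      have d3 : (N : ℝ)⁻¹ * (8 * lam * (∫ y, φ y ^ 2 ∂collisionKernel g s + ∫ y, φ y ^ 2 ∂g s) +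
          2 * mu * (∫ y, φ y ^ 2 ∂thermostatKernel a T s + ∫ y, φ y ^ 2 ∂g s)) ≤
          (N : ℝ)⁻¹ * (8 * lam * (σ' * (e * (K + M)) + σ' * (e * (K + M))) +
          2 * mu * (σ' * (e * (T + M)) + σ' * (e * (K + M)))) := by gcongr
      have d4 : (N : ℝ)⁻¹ * (8 * lam * (σ' * (e * (K + M)) + σ' * (e * (K + M))) +
          2 * mu * (σ' * (e * (T + M)) + σ' * (e * (K + M)))) = σ' * e * (C₁ / N) := by
        simp only [hC₁]; field_simp; ring
      simp only [hR]
      rw [d4] at d3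
      rw [d2] at d1
      linarith

end Fluctuation

/-! ### The transport cost between the nonlinear particles and their law -/

lemma lintegral_le_of_le_rpow {r X A B : ℝ} (hr : 2 < r) (hX : 0 < X) (hA : 0 ≤ A) (hB : 0 ≤ B)
    {H : ℝ → ℝ≥0∞} (h1 : ∀ y, |y| ≤ X → H y ≤ ENNReal.ofReal A)
    (h2 : ∀ y, X < |y| → H y ≤ ENNReal.ofReal (B * |y| ^ (1 - r))) :
    ∫⁻ y, H y ≤ ENNReal.ofReal (2 * X * A + 2 * (B * X ^ (2 - r) / (r - 2))) := by
  have hr2 : 0 < r - 2 := by linarith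
  have hB' : 0 ≤ B * X ^ (2 - r) / (r - 2) := by positivity
  have key : ∫⁻ y in Set.Ioi X, ENNReal.ofReal (B * |y| ^ (1 - r)) =
      ENNReal.ofReal (B * X ^ (2 - r) / (r - 2)) := by
    have hi := (integrableOn_Ioi_rpow_of_lt (a := 1 - r) (by linarith) hX).const_mul B
    have e := integral_Ioi_rpow_of_lt (a := 1 - r) (by linarith) hX
    rw [← setLIntegral_congr_fun (f := fun y => ENNReal.ofReal (B * y ^ (1 - r)))
      measurableSet_Ioi fun y hy => by
        beta_reduce; rw [abs_of_pos (hX.trans (Set.mem_Ioi.1 hy))],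
      ← ofReal_integral_eq_lintegral_ofReal hi ((ae_restrict_mem measurableSet_Ioi).mono
        fun y hy => mul_nonneg hB (Real.rpow_nonneg (hX.trans (Set.mem_Ioi.1 hy)).le _)),
      integral_const_mul, e]
    congr 1
    rw [show 1 - r + 1 = 2 - r by ring, ← neg_sub r 2, div_neg, neg_div, neg_neg, neg_sub]
    ring
  have key' : ∫⁻ y in Set.Iio (-X), ENNReal.ofReal (B * |y| ^ (1 - r)) =
      ENNReal.ofReal (B * X ^ (2 - r) / (r - 2)) := by
    rw [← key]
    have := (Measure.measurePreserving_neg (volume : Measure ℝ)).setLIntegral_comp_preimage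
      (s := Set.Iio (-X)) measurableSet_Iio
      (f := fun y => ENNReal.ofReal (B * |y| ^ (1 - r))) (by fun_prop)
    simp only [abs_neg] at this
    rw [← this]
    congr 2
    ext y; simp
  have hsub : (Set.univ : Set ℝ) ⊆ Set.Icc (-X) X ∪ (Set.Ioi X ∪ Set.Iio (-X)) := fun y _ => by
    rcases le_or_gt (|y|) X with h | h
    · exact Or.inl (abs_le.1 h)
    · rcases lt_abs.1 h with h | h
      · exact Or.inr (Or.inl h)
      · exact Or.inr (Or.inr (by rw [Set.mem_Iio]; linarith))
  calc ∫⁻ y, H y ≤ ∫⁻ y in Set.Icc (-X) X ∪ (Set.Ioi X ∪ Set.Iio (-X)), H y := by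
        rw [← setLIntegral_univ]; exact lintegral_mono_set hsub
    _ ≤ (∫⁻ y in Set.Icc (-X) X, H y) +
          ((∫⁻ y in Set.Ioi X, H y) + ∫⁻ y in Set.Iio (-X), H y) :=
        (lintegral_union_le _ _ _).trans (add_le_add le_rfl (lintegral_union_le _ _ _))
    _ ≤ ENNReal.ofReal (2 * X * A) + (ENNReal.ofReal (B * X ^ (2 - r) / (r - 2)) +
          ENNReal.ofReal (B * X ^ (2 - r) / (r - 2))) := by
        refine add_le_add ?_ (add_le_add ?_ ?_)
        · refine (setLIntegral_mono (s := Set.Icc (-X) X) measurable_const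
            fun y hy => h1 y (abs_le.2 hy)).trans ?_
          rw [setLIntegral_const, Real.volume_Icc, ← ENNReal.ofReal_mul hA]
          exact ENNReal.ofReal_le_ofReal (le_of_eq (by ring))
        · rw [← key]
          exact setLIntegral_mono (by fun_prop) fun y hy => h2 y (lt_abs.2 (Or.inl hy))
        · rw [← key']
          refine setLIntegral_mono (by fun_prop) fun y hy => h2 y (lt_abs.2 (Or.inr ?_))
          rw [Set.mem_Iio] at hy; linarith
    _ = _ := by
        rw [← ENNReal.ofReal_add hB' hB', ← ENNReal.ofReal_add (by positivity) (by positivity)]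
        congr 1; ring

/-! ### Distribution functions. -/

section Cdf

variable {N : ℕ}

/-- The indicator function of `(-∞, y]`. -/
noncomputable def step (y : ℝ) : ℝ → ℝ := (Set.Iic y).indicator 1

@[fun_prop]
lemma measurable_step (y : ℝ) : Measurable (step y) := measurable_one.indicator measurableSet_Iic

lemma step_mem (y z : ℝ) : step y z ∈ Set.Icc (0 : ℝ) 1 := by
  by_cases h : z ≤ y <;> simp [step, Set.indicator, h]

lemma abs_step_le (y z : ℝ) : |step y z| ≤ 1 :=
  abs_le.2 ⟨by linarith [(step_mem y z).1], (step_mem y z).2⟩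

lemma measurable_step_uncurry : Measurable fun p : ℝ × ℝ => step p.1 p.2 := by
  have : (fun p : ℝ × ℝ => step p.1 p.2) = {p : ℝ × ℝ | p.2 ≤ p.1}.indicator 1 := rfl
  rw [this]
  exact measurable_one.indicator (measurableSet_le measurable_snd measurable_fst)

lemma integral_step (ν : Measure ℝ) (y : ℝ) : ∫ z, step y z ∂ν = ν.real (Set.Iic y) :=
  integral_indicator_one measurableSet_Iic

lemma integrable_step (ν : Measure ℝ) [IsFiniteMeasure ν] (y : ℝ) : Integrable (step y) ν :=
  Integrable.of_bound (measurable_step y).aestronglyMeasurable 1 (ae_of_all _ (abs_step_le y))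

lemma card_mul_empiricalCdf {ι : Type*} {S : Finset ι} (hS : S.Nonempty) (u : ι → ℝ) (y : ℝ) :
    S.card * empiricalCdf S u y = ∑ k ∈ S, step y (u k) := by
  have : (S.card : ℝ) ≠ 0 := by exact_mod_cast hS.card_pos.ne'
  rw [empiricalCdf, mul_div_cancel₀ _ this, Finset.card_filter]
  push_cast
  refine Finset.sum_congr rfl fun k _ => ?_
  simp [step, Set.indicator]

lemma empiricalCdf_univ (hN : 2 ≤ N) (u : Fin N → ℝ) (y : ℝ) :
    empiricalCdf Finset.univ u y = mean (step y) u := by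
  have hN0 : (N : ℝ) ≠ 0 := by positivity
  have : NeZero N := ⟨by omega⟩
  have h := card_mul_empiricalCdf (S := Finset.univ) Finset.univ_nonempty u y
  rw [Finset.card_univ, Fintype.card_fin] at h
  rw [mean, ← h]
  field_simp

/-- The sum over the other particles is the full sum minus the `i`-th term, each centred at `G`. -/
lemma empiricalCdf_erase (hN : 2 ≤ N) (i : Fin N) (u : Fin N → ℝ) (y G : ℝ) :
    (N - 1) * |empiricalCdf (Finset.univ.erase i) u y - G| ≤
      N * |mean (step y) u - G| + |step y (u i) - G| := by
  have hN0 : (N : ℝ) ≠ 0 := by positivity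
  have hN1 : (0 : ℝ) ≤ N - 1 := by
    have : (2 : ℝ) ≤ N := by exact_mod_cast hN
    linarith
  have h := card_mul_empiricalCdf (erase_univ_nonempty hN i) u y
  rw [card_erase_univ hN] at h
  have h2 := Finset.sum_erase_add Finset.univ (fun k => step y (u k)) (Finset.mem_univ i)
  have h3 : N * mean (step y) u = ∑ k, step y (u k) := by rw [mean]; field_simp
  have e : ((N : ℝ) - 1) * (empiricalCdf (Finset.univ.erase i) u y - G) =
      N * (mean (step y) u - G) - (step y (u i) - G) := by
    rw [mul_sub, h, mul_sub, h3, ← h2]; ring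
  calc _ = |((N : ℝ) - 1) * (empiricalCdf (Finset.univ.erase i) u y - G)| := by
        rw [abs_mul, abs_of_nonneg hN1]
    _ ≤ |N * (mean (step y) u - G)| + |step y (u i) - G| := by rw [e]; exact abs_sub _ _
    _ = _ := by rw [abs_mul, Nat.abs_cast]

lemma integral_abs_step_sub_le_one (ν : Measure ℝ) [IsProbabilityMeasure ν] (y : ℝ) :
    ∫ z, |step y z - ν.real (Set.Iic y)| ∂ν ≤ 1 := by
  have h := integral_mono (((integrable_step ν y).sub
    (integrable_const (ν.real (Set.Iic y)))).abs) (integrable_const (1 : ℝ)) fun z => by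
      have h1 := step_mem y z
      have h2 : ν.real (Set.Iic y) ≤ 1 := measureReal_le_one
      have h3 : 0 ≤ ν.real (Set.Iic y) := measureReal_nonneg
      exact abs_le.2 ⟨by simp only [Pi.sub_apply]; linarith [h1.1],
        by simp only [Pi.sub_apply]; linarith [h1.2]⟩
  simpa using h

/-- The left-hand side is at most `2 F(y)` for `y < 0` and `2 (1 - F(y))` for `y > 0`, and Markov's
inequality bounds either tail. -/
lemma integral_abs_step_sub_le (ν : Measure ℝ) [IsProbabilityMeasure ν] {r M : ℝ} (hr : 0 ≤ r)
    (hi : Integrable (fun v : ℝ => |v| ^ r) ν) (hM : ∫ v, |v| ^ r ∂ν ≤ M) {y : ℝ} (hy : y ≠ 0) :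
    ∫ z, |step y z - ν.real (Set.Iic y)| ∂ν ≤ 2 * (M * |y| ^ (-r)) := by
  have hy0 : 0 < |y| := abs_pos.2 hy
  set G := ν.real (Set.Iic y) with hG
  have hG0 : 0 ≤ G := measureReal_nonneg
  have hG1 : G ≤ 1 := measureReal_le_one
  have hmark : ∀ χ : ℝ → ℝ, Measurable χ → (∀ z, χ z ≤ 1) → (∀ z, 0 ≤ χ z) →
      (∀ z, χ z ≠ 0 → |y| ≤ |z|) →
      ∫ z, χ z ∂ν ≤ M * |y| ^ (-r) := fun χ hχ h1 h0 h => by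
    rw [mul_comm]
    refine le_trans ?_ (mul_le_mul_of_nonneg_left hM (by positivity))
    rw [← integral_const_mul]
    refine integral_mono (Integrable.of_bound hχ.aestronglyMeasurable 1 (ae_of_all _ fun z =>
      abs_le.2 ⟨by linarith [h0 z], h1 z⟩)) (hi.const_mul _) fun z => ?_
    by_cases hz : χ z = 0
    · rw [hz]; positivity
    · refine (h1 z).trans ?_
      rw [Real.rpow_neg hy0.le, ← div_eq_inv_mul, one_le_div (by positivity)]
      exact Real.rpow_le_rpow hy0.le (h z hz) hr
  have hs := integrable_step ν y
  rcases lt_or_gt_of_ne hy with h | h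
  · have h1 := hmark (step y) (by fun_prop) (fun z => (step_mem y z).2) (fun z => (step_mem y z).1)
      fun z hz => by
        have : z ≤ y := by
          by_contra hc; exact hz (by simp [step, Set.indicator, hc])
        rw [abs_of_neg h, abs_of_neg (this.trans_lt h)]; linarith
    have h2 := integral_mono ((hs.sub (integrable_const G)).abs) (hs.add (integrable_const G))
      fun z => (abs_sub _ _).trans (le_of_eq (by
        rw [abs_of_nonneg (step_mem y z).1, abs_of_nonneg hG0]; rfl))
    have h3 := integral_add hs (integrable_const G)
    simp only [Pi.add_apply, Pi.sub_apply] at h2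
    rw [h3, integral_step, ← hG] at h2
    rw [integral_step, ← hG] at h1
    simp only [integral_const, probReal_univ, one_smul] at h2
    linarith
  · have h1 := hmark (fun z => 1 - step y z) (by fun_prop) (fun z => by linarith [(step_mem y z).1])
      (fun z => by linarith [(step_mem y z).2])
      fun z hz => by
        have : ¬ z ≤ y := by
          intro hc; exact hz (by simp [step, Set.indicator, hc])
        push Not at this
        rw [abs_of_pos h, abs_of_pos (h.trans this)]; exact this.le
    have h2 := integral_mono ((hs.sub (integrable_const G)).abs)
      (((integrable_const (1 : ℝ)).sub hs).add (integrable_const (1 - G)))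
      fun z => (by
        have : |step y z - G| ≤ (1 - step y z) + (1 - G) := by
          have := step_mem y z
          rw [abs_le]; constructor <;> linarith [this.1, this.2]
        exact this)
    have h3 := integral_add ((integrable_const (1 : ℝ)).sub hs) (integrable_const (μ := ν) (1 - G))
    have h4 := integral_sub (integrable_const (μ := ν) (1 : ℝ)) hs
    simp only [Pi.add_apply, Pi.sub_apply] at h2 h3
    rw [h3, h4, integral_step, ← hG] at h2
    rw [h4, integral_step, ← hG] at h1
    simp only [integral_const, probReal_univ, one_smul] at h1 h2
    linarith

end Cdf

/-! ### From fluctuations to transport costs. -/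

section Cost

variable {N : ℕ} {lam mu a E T : ℝ}

/-- The functions `y 1_{z ≤ y}` for `y ≤ 0` and `y 1_{z > y}` for `y > 0` satisfy `φ(z)² ≤ z²`,
which is why the variance estimate is needed for this class. -/
lemma IsCoupling.sq_mul_integral_sq_step_le {g : Kernel ℝ ℝ} [IsMarkovKernel g]
    {m : Kernel ℝ ((Fin N → ℝ) × (Fin N → ℝ))}
    (h : IsCoupling lam mu a E T g m) (hg : IsKineticFlow lam mu a T g) (hN : 2 ≤ N)
    (hlam : 0 ≤ lam) (hmu : 0 < mu) {t : ℝ} (ht : 0 ≤ t) {Q : ℝ}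
    (hQ : ∀ φ : ℝ → ℝ, Measurable φ → (∃ B, ∀ y, |φ y| ≤ B) → (∀ y, φ y ^ 2 ≤ y ^ 2) →
      fluctuation g m φ t ≤ Q) (y : ℝ) :
    y ^ 2 * ∫ x, (mean (step y) x.2 - (g t).real (Set.Iic y)) ^ 2 ∂m t ≤ Q := by
  have hN0 : (N : ℝ) ≠ 0 := by positivity
  have key : ∀ φ : ℝ → ℝ, Measurable φ → (∃ B, ∀ y, |φ y| ≤ B) → (∀ y, φ y ^ 2 ≤ y ^ 2) →
      ∫ x, (mean φ x.2 - ∫ y, φ y ∂g t) ^ 2 ∂m t ≤ Q := fun φ h1 ⟨B, h2⟩ h3 => by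
    rw [h.integral_sq_mean_sub hg hN hlam hmu h1 h2 ht]
    exact hQ φ h1 ⟨B, h2⟩ h3
  rcases le_or_gt y 0 with hy | hy
  · have h1 := key (fun z => y * step y z) (by fun_prop) ⟨|y|, fun z => by
      rw [abs_mul]; exact mul_le_of_le_one_right (abs_nonneg _) (abs_step_le y z)⟩ fun z => by
        by_cases hz : z ≤ y
        · simp only [step, Set.indicator, Set.mem_Iic, hz, if_true, Pi.one_apply, mul_one]
          nlinarith
        · simp only [step, Set.indicator, Set.mem_Iic, hz, if_false, mul_zero]
          nlinarith
    simp only [mean_const_mul, integral_const_mul, integral_step, ← mul_sub, mul_pow] at h1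
    exact h1
  · have h1 := key (fun z => y * (1 - step y z)) (by fun_prop) ⟨|y|, fun z => by
      rw [abs_mul]
      refine mul_le_of_le_one_right (abs_nonneg _) (abs_le.2 ?_)
      have := step_mem y z
      constructor <;> linarith [this.1, this.2]⟩ fun z => by
        by_cases hz : z ≤ y
        · simp only [step, Set.indicator, Set.mem_Iic, hz, if_true, Pi.one_apply, sub_self,
            mul_zero]
          nlinarith
        · simp only [step, Set.indicator, Set.mem_Iic, hz, if_false, sub_zero, mul_one]
          nlinarith
    have e1 : ∀ u : Fin N → ℝ, mean (fun z => 1 - step y z) u = 1 - mean (step y) u := fun u => by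
      simp only [mean, Finset.sum_sub_distrib, Finset.sum_const, Finset.card_univ,
        Fintype.card_fin, nsmul_eq_mul, mul_one]
      field_simp
    have e2 : ∫ z, (1 - step y z) ∂g t = 1 - (g t).real (Set.Iic y) := by
      rw [integral_sub (integrable_const _) (integrable_step _ _), integral_step]; simp
    simp only [mean_const_mul, integral_const_mul, e1, e2, ← mul_sub, mul_pow] at h1
    refine le_trans (le_of_eq ?_) h1
    congr 1
    refine integral_congr_ae (ae_of_all _ fun x => ?_)
    ring

lemma measurable_mean_step : Measurable fun p : ((Fin N → ℝ) × (Fin N → ℝ)) × ℝ =>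
    mean (step p.2) p.1.2 := by
  have : ∀ k : Fin N, Measurable fun p : ((Fin N → ℝ) × (Fin N → ℝ)) × ℝ =>
      step p.2 (p.1.2 k) := fun k => measurable_step_uncurry.comp
    (measurable_snd.prodMk ((measurable_pi_apply k).comp (measurable_snd.comp measurable_fst)))
  unfold mean
  fun_prop

lemma measurable_measureReal_Iic (ν : Measure ℝ) [IsFiniteMeasure ν] :
    Measurable fun y => ν.real (Set.Iic y) :=
  Monotone.measurable fun _ _ h => measureReal_mono (Set.Iic_subset_Iic.2 h)

/-- The first bound, for moderate `y`, is Cauchy–Schwarz and the variance estimate. The second, for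
the tails, is the triangle inequality over the particles followed by unbiasedness. -/
lemma IsCoupling.integral_abs_mean_step_le {g : Kernel ℝ ℝ} [IsMarkovKernel g]
    {m : Kernel ℝ ((Fin N → ℝ) × (Fin N → ℝ))}
    (h : IsCoupling lam mu a E T g m) (hg : IsKineticFlow lam mu a T g) (hN : 2 ≤ N)
    (hlam : 0 ≤ lam) (hmu : 0 < mu) {t : ℝ} (ht : 0 ≤ t) {Q : ℝ}
    (hQ : ∀ φ : ℝ → ℝ, Measurable φ → (∃ B, ∀ y, |φ y| ≤ B) → (∀ y, φ y ^ 2 ≤ y ^ 2) →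
      fluctuation g m φ t ≤ Q) (y : ℝ) :
    Integrable (fun x => |mean (step y) x.2 - (g t).real (Set.Iic y)|) (m t) ∧
    |y| * ∫ x, |mean (step y) x.2 - (g t).real (Set.Iic y)| ∂m t ≤ √Q ∧
    ∫ x, |mean (step y) x.2 - (g t).real (Set.Iic y)| ∂m t ≤
      ∫ z, |step y z - (g t).real (Set.Iic y)| ∂g t := by
  have := h.markov
  have hN0 : (N : ℝ) ≠ 0 := by positivity
  set G := (g t).real (Set.Iic y) with hG
  have hG0 : 0 ≤ G := measureReal_nonneg
  have hG1 : G ≤ 1 := measureReal_le_one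
  have hb : ∀ z, |step y z - G| ≤ 1 := fun z => by
    have := step_mem y z
    rw [abs_le]; constructor <;> linarith [this.1, this.2]
  have hmean : ∀ u : Fin N → ℝ, mean (step y) u - G = mean (fun z => step y z - G) u := fun u => by
    simp only [mean, Finset.sum_sub_distrib, Finset.sum_const, Finset.card_univ,
        Fintype.card_fin, nsmul_eq_mul]
    field_simp
  have hm : Measurable fun x : (Fin N → ℝ) × (Fin N → ℝ) => |mean (step y) x.2 - G| := by
    have : Measurable fun x : (Fin N → ℝ) × (Fin N → ℝ) => mean (step y) x.2 := by fun_prop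
    exact (this.sub_const G).abs
  have hle1 : ∀ x : (Fin N → ℝ) × (Fin N → ℝ), |mean (step y) x.2 - G| ≤ 1 := fun x => by
    rw [hmean]; exact abs_mean_le hb _
  have hi : Integrable (fun x => |mean (step y) x.2 - G|) (m t) :=
    Integrable.of_bound hm.aestronglyMeasurable 1 (ae_of_all _ fun x => by
      rw [Real.norm_eq_abs, abs_abs]; exact hle1 x)
  refine ⟨hi, ?_, ?_⟩
  · refine Real.le_sqrt_of_sq_le ?_
    rw [mul_pow, sq_abs]
    refine le_trans (mul_le_mul_of_nonneg_left ?_ (sq_nonneg y))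
      (h.sq_mul_integral_sq_step_le hg hN hlam hmu ht hQ y)
    have h1 := sq_integral_le hi (Integrable.of_bound (hm.pow_const 2).aestronglyMeasurable 1
      (ae_of_all _ fun x => by
        rw [norm_pow, Real.norm_eq_abs, abs_abs]
        exact pow_le_one₀ (abs_nonneg _) (hle1 x)))
    simpa only [sq_abs] using h1
  · have hmφ : Measurable fun z => |step y z - G| := by
      have := measurable_step y
      exact (this.sub_const G).abs
    have hbφ : ∀ z, |(|step y z - G|)| ≤ 1 := fun z => by rw [abs_abs]; exact hb z
    rw [← h.integral_mean hg hN hlam hmu hmφ hbφ ht]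
    refine integral_mono hi (integrable_mean hmφ hbφ) fun x => ?_
    beta_reduce
    rw [hmean, mean, mean, abs_mul, abs_of_nonneg (by positivity)]
    exact mul_le_mul_of_nonneg_left (Finset.abs_sum_le_sum_abs _ _) (by positivity)

/-- The exponent of the transport cost of the nonlinear particles. -/
noncomputable def costRate (r : ℝ) (N : ℕ) : ℝ := (N : ℝ) ^ (-((r - 2) / (2 * (r - 1))))

lemma costRate_nonneg (r : ℝ) : 0 ≤ costRate r N := by unfold costRate; positivity

lemma inv_le_costRate {r : ℝ} (hr : 2 < r) (hN : 2 ≤ N) : (N : ℝ)⁻¹ ≤ costRate r N := by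
  have hN1 : (1 : ℝ) ≤ N := by exact_mod_cast (by omega : 1 ≤ N)
  rw [costRate, ← Real.rpow_neg_one]
  refine Real.rpow_le_rpow_of_exponent_le hN1 (neg_le_neg ?_)
  rw [div_le_one (by linarith)]
  linarith

/-- The variance bound is integrated over `|y| ≤ e^{-at} Y` and the moment bound beyond, with `Y =
N^{1/(2(r-1))}`: at this cutoff the two contributions, `Y N^{-1/2}` and `Y^{2-r}`, are equal to
`costRate r N`. -/
lemma IsCoupling.lintegral_cdf_le {g : Kernel ℝ ℝ} [IsMarkovKernel g]
    {m : Kernel ℝ ((Fin N → ℝ) × (Fin N → ℝ))}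
    (h : IsCoupling lam mu a E T g m) (hg : IsKineticFlow lam mu a T g) (hN : 2 ≤ N)
    (hlam : 0 ≤ lam) (hmu : 0 < mu) {t : ℝ} (ht : 0 ≤ t) {C K r : ℝ} (hr : 2 < r) (hK : 0 ≤ K)
    (hC : 0 ≤ C)
    (hQ : ∀ φ : ℝ → ℝ, Measurable φ → (∃ B, ∀ y, |φ y| ≤ B) → (∀ y, φ y ^ 2 ≤ y ^ 2) →
      fluctuation g m φ t ≤ Real.exp (-(2 * a * t)) * (C / N))
    (hi : Integrable (fun v : ℝ => |v| ^ r) (g t))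
    (hM : ∫ v, |v| ^ r ∂g t ≤ Real.exp (-(r * a * t)) * K) :
    ∫⁻ x, (∫⁻ y, ENNReal.ofReal (4 * |y|) *
      ENNReal.ofReal |mean (step y) x.2 - (g t).real (Set.Iic y)|) ∂m t ≤
      ENNReal.ofReal (Real.exp (-(2 * a * t)) * ((8 * √C + 16 * K / (r - 2)) * costRate r N)) := by
  have := h.markov
  have hN0 : (0 : ℝ) < N := by positivity
  have hr2 : 0 < r - 2 := by linarith
  set e := Real.exp (-(a * t)) with he
  have he0 : 0 < e := Real.exp_pos _
  have he2 : Real.exp (-(2 * a * t)) = e ^ 2 := by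
    rw [he, ← Real.exp_nat_mul]; congr 1; push_cast; ring
  have her : Real.exp (-(r * a * t)) = e ^ r := by
    rw [he, ← Real.exp_mul]; congr 1; ring
  set Y : ℝ := (N : ℝ) ^ (1 / (2 * (r - 1))) with hY
  have hY0 : 0 < Y := by positivity
  have hG := measurable_measureReal_Iic (g t)
  rw [lintegral_lintegral_swap (by
    refine Measurable.aemeasurable ?_
    refine Measurable.mul (by fun_prop) (Measurable.ennreal_ofReal ?_)
    exact (measurable_mean_step.sub (hG.comp measurable_snd)).abs)]
  have key := fun y => h.integral_abs_mean_step_le hg hN hlam hmu ht hQ y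
  have e1 : ∀ y, ∫⁻ x, ENNReal.ofReal (4 * |y|) *
      ENNReal.ofReal |mean (step y) x.2 - (g t).real (Set.Iic y)| ∂m t =
      ENNReal.ofReal (4 * (|y| * ∫ x, |mean (step y) x.2 - (g t).real (Set.Iic y)| ∂m t)) :=
    fun y => by
      rw [lintegral_const_mul' _ _ ENNReal.ofReal_ne_top,
        ← ofReal_integral_eq_lintegral_ofReal (key y).1 (ae_of_all _ fun x => abs_nonneg _),
        ← ENNReal.ofReal_mul (by positivity), mul_assoc]
  simp_rw [e1]
  refine (lintegral_le_of_le_rpow (X := e * Y) (A := 4 * (e * √(C / N)))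
    (B := 8 * (e ^ r * K)) hr (by positivity) (by positivity) (by positivity) (fun y _ => ?_)
    fun y hy => ?_).trans (ENNReal.ofReal_le_ofReal (le_of_eq ?_))
  · refine ENNReal.ofReal_le_ofReal (mul_le_mul_of_nonneg_left ((key y).2.1.trans (le_of_eq ?_))
      (by norm_num))
    rw [he2, Real.sqrt_mul (by positivity), Real.sqrt_sq he0.le]
  · have hy0 : 0 < |y| := lt_trans (by positivity) hy
    refine ENNReal.ofReal_le_ofReal ?_
    rw [her] at hM
    have h1 := (key y).2.2.trans (integral_abs_step_sub_le (g t) (by linarith) hi hM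
      (abs_pos.1 hy0))
    have h2 : |y| ^ (1 - r) = |y| * |y| ^ (-r) := by
      rw [sub_eq_add_neg, Real.rpow_add hy0, Real.rpow_one]
    rw [h2]
    calc _ ≤ 4 * (|y| * (2 * (e ^ r * K * |y| ^ (-r)))) := by gcongr
      _ = _ := by ring
  · have hr1 : r - 1 ≠ 0 := by linarith
    have h1 : Y * √(C / N) = √C * costRate r N := by
      rw [Real.sqrt_div hC, costRate, hY, Real.sqrt_eq_rpow N, mul_div_left_comm,
        ← Real.rpow_sub hN0]
      congr 2
      field_simp
      ring
    have h2 : Y ^ (2 - r) = costRate r N := by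
      rw [costRate, hY, ← Real.rpow_mul hN0.le]
      congr 1
      field_simp
      ring
    have h3 : e ^ r * e ^ (2 - r) = e ^ 2 := by
      rw [← Real.rpow_add he0, ← Real.rpow_natCast]; congr 1; push_cast; ring
    rw [Real.mul_rpow he0.le hY0.le, h2, he2]
    have h4 : 2 * (e * Y) * (4 * (e * √(C / N))) = 8 * e ^ 2 * (Y * √(C / N)) := by ring
    have h5 : 2 * (8 * (e ^ r * K) * (e ^ (2 - r) * costRate r N) / (r - 2)) =
        16 * K / (r - 2) * costRate r N * (e ^ r * e ^ (2 - r)) := by ring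
    rw [h4, h5, h1, h3]
    ring

/-- The cost attributable to one excluded particle, which is only bounded, not small; the cutoff is
now at `e^{-at}`. -/
lemma lintegral_step_le {g : Kernel ℝ ℝ} [IsMarkovKernel g] {t : ℝ} {K r : ℝ} (hr : 2 < r)
    (hK : 0 ≤ K) (hi : Integrable (fun v : ℝ => |v| ^ r) (g t))
    (hM : ∫ v, |v| ^ r ∂g t ≤ Real.exp (-(r * a * t)) * K) :
    ∫⁻ z, (∫⁻ y, ENNReal.ofReal (4 * |y|) *
      ENNReal.ofReal |step y z - (g t).real (Set.Iic y)|) ∂g t ≤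
      ENNReal.ofReal (Real.exp (-(2 * a * t)) * (8 + 16 * K / (r - 2))) := by
  have hr2 : 0 < r - 2 := by linarith
  set e := Real.exp (-(a * t)) with he
  have he0 : 0 < e := Real.exp_pos _
  have he2 : Real.exp (-(2 * a * t)) = e ^ 2 := by
    rw [he, ← Real.exp_nat_mul]; congr 1; push_cast; ring
  have her : Real.exp (-(r * a * t)) = e ^ r := by
    rw [he, ← Real.exp_mul]; congr 1; ring
  have hG := measurable_measureReal_Iic (g t)
  rw [lintegral_lintegral_swap (by
    refine Measurable.aemeasurable ?_
    refine Measurable.mul (by fun_prop) (Measurable.ennreal_ofReal ?_)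
    exact ((measurable_step_uncurry.comp measurable_swap).sub (hG.comp measurable_snd)).abs)]
  have hia : ∀ y, Integrable (fun z => |step y z - (g t).real (Set.Iic y)|) (g t) := fun y =>
    ((integrable_step (g t) y).sub (integrable_const _)).abs
  have e1 : ∀ y, ∫⁻ z, ENNReal.ofReal (4 * |y|) *
      ENNReal.ofReal |step y z - (g t).real (Set.Iic y)| ∂g t =
      ENNReal.ofReal (4 * (|y| * ∫ z, |step y z - (g t).real (Set.Iic y)| ∂g t)) :=
    fun y => by
      rw [lintegral_const_mul' _ _ ENNReal.ofReal_ne_top,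
        ← ofReal_integral_eq_lintegral_ofReal (hia y) (ae_of_all _ fun x => abs_nonneg _),
        ← ENNReal.ofReal_mul (by positivity), mul_assoc]
  simp_rw [e1]
  refine (lintegral_le_of_le_rpow (X := e) (A := 4 * e)
    (B := 8 * (e ^ r * K)) hr (by positivity) (by positivity) (by positivity) (fun y hy => ?_)
    fun y hy => ?_).trans (ENNReal.ofReal_le_ofReal (le_of_eq ?_))
  · refine ENNReal.ofReal_le_ofReal (mul_le_mul_of_nonneg_left ?_ (by norm_num))
    refine (mul_le_mul hy (integral_abs_step_sub_le_one (g t) y)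
      (integral_nonneg fun z => abs_nonneg _) he0.le).trans (le_of_eq (mul_one _))
  · have hy0 : 0 < |y| := lt_trans (by positivity) hy
    refine ENNReal.ofReal_le_ofReal ?_
    rw [her] at hM
    have h1 := integral_abs_step_sub_le (g t) (by linarith) hi hM (abs_pos.1 hy0)
    have h2 : |y| ^ (1 - r) = |y| * |y| ^ (-r) := by
      rw [sub_eq_add_neg, Real.rpow_add hy0, Real.rpow_one]
    rw [h2]
    calc _ ≤ 4 * (|y| * (2 * (e ^ r * K * |y| ^ (-r)))) := by gcongr
      _ = _ := by ring
  · have h3 : e ^ r * e ^ (2 - r) = e ^ 2 := by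
      rw [← Real.rpow_add he0, ← Real.rpow_natCast]; congr 1; push_cast; ring
    have h5 : 2 * (8 * (e ^ r * K) * e ^ (2 - r) / (r - 2)) =
        16 * K / (r - 2) * (e ^ r * e ^ (2 - r)) := by ring
    rw [h5, h3, he2]
    ring

/-- The transport costs between the nonlinear particles and their law. -/
lemma exists_partnerCost_le (hlam : 0 ≤ lam) (hmu : 0 < mu) (hT : 0 ≤ T) (ha : 2 * a < mu)
    {K r : ℝ} (hr : 2 < r) (hK : 0 ≤ K) : ∃ C : ℝ, 0 ≤ C ∧
    ∀ (g : Kernel ℝ ℝ), IsKineticFlow lam mu a T g → (∀ t, 0 ≤ t →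
      Integrable (fun v : ℝ => |v| ^ r) (g t) ∧ Real.exp (r * a * t) * ∫ v, |v| ^ r ∂g t ≤ K ∧
      energy a g t ≤ K) →
    ∀ (N : ℕ) (E : ℝ) (m : Kernel ℝ ((Fin N → ℝ) × (Fin N → ℝ))), 2 ≤ N →
      IsCoupling lam mu a E T g m → ∀ t, 0 ≤ t →
      ∫⁻ x, ∑ i, ∑ j ∈ Finset.univ.erase i, ∫⁻ ρ, ENNReal.ofReal
        ((x.2 j - partner (Finset.univ.erase i) x.2 (g t) j ρ) ^ 2) ∂unitLaw ∂m t ≤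
        ENNReal.ofReal (N * (N - 1) * (Real.exp (-(2 * a * t)) * (C * costRate r N))) ∧
      ∫⁻ x, ∑ j, ∫⁻ ρ, ENNReal.ofReal
        ((x.2 j - partner Finset.univ x.2 (g t) j ρ) ^ 2) ∂unitLaw ∂m t ≤
        ENNReal.ofReal (N * (Real.exp (-(2 * a * t)) * (C * costRate r N))) := by
  obtain ⟨C₀, hC₀, hfl⟩ := exists_fluctuation_le (a := a) hlam hmu hT ha hK
  have hr2 : 0 < r - 2 := by linarith
  set C₁ := 8 * √C₀ + 16 * K / (r - 2) with hC₁
  set C₂ := 8 + 16 * K / (r - 2) with hC₂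
  have hC₁0 : 0 ≤ C₁ := by positivity
  have hC₂0 : 0 ≤ C₂ := by positivity
  refine ⟨2 * (C₁ + C₂), by positivity, fun g hg hgK N E m hN h t ht => ?_⟩
  have := hg.markov
  have := h.markov
  have : NeZero N := ⟨by omega⟩
  have hN2 : (2 : ℝ) ≤ N := by exact_mod_cast hN
  have hN1 : (0 : ℝ) ≤ N - 1 := by linarith
  obtain ⟨hi, hM, -⟩ := hgK t ht
  have hflip : ∀ c q B : ℝ, Real.exp c * q ≤ B → q ≤ Real.exp (-c) * B := fun c q B hq => by
    have := mul_le_mul_of_nonneg_left hq (Real.exp_pos (-c)).le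
    rwa [← mul_assoc, ← Real.exp_add, neg_add_cancel, Real.exp_zero, one_mul] at this
  have hM' := hflip _ _ _ hM
  have hsq : ∀ s, 0 ≤ s → Integrable (fun v : ℝ => v ^ 2) (g s) ∧ energy a g s ≤ K := fun s hs => by
    refine ⟨?_, (hgK s hs).2.2⟩
    simpa using integrable_rpow_of_le (p := 2) (by norm_num) hr.le (hgK s hs).1
  have hQ : ∀ φ : ℝ → ℝ, Measurable φ → (∃ B, ∀ y, |φ y| ≤ B) → (∀ y, φ y ^ 2 ≤ y ^ 2) →
      fluctuation g m φ t ≤ Real.exp (-(2 * a * t)) * (C₀ / N) := fun φ h1 h2 h3 =>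
    hflip _ _ _ (hfl g hg hsq N E m hN h φ h1 h2 h3 t ht)
  have d1 := h.lintegral_cdf_le hg hN hlam hmu ht hr hK hC₀ hQ hi hM'
  have d2 := lintegral_step_le hr hK hi hM'
  set e := Real.exp (-(2 * a * t)) with he
  have he0 : 0 < e := Real.exp_pos _
  have hG := measurable_measureReal_Iic (g t)
  have hR := costRate_nonneg (N := N) r
  have hw : ∀ k : Fin N, Measurable fun p : ((Fin N → ℝ) × (Fin N → ℝ)) × ℝ =>
      ENNReal.ofReal (4 * |p.2|) *
        ENNReal.ofReal |step p.2 (p.1.2 k) - (g t).real (Set.Iic p.2)| := fun k => by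
    have h1 : Measurable fun p : ((Fin N → ℝ) × (Fin N → ℝ)) × ℝ => step p.2 (p.1.2 k) :=
      measurable_step_uncurry.comp (measurable_snd.prodMk
        ((measurable_pi_apply k).comp (measurable_snd.comp measurable_fst)))
    exact Measurable.mul (by fun_prop) (h1.sub (hG.comp measurable_snd)).abs.ennreal_ofReal
  have hw' : Measurable fun p : ((Fin N → ℝ) × (Fin N → ℝ)) × ℝ =>
      ENNReal.ofReal (4 * |p.2|) *
        ENNReal.ofReal |mean (step p.2) p.1.2 - (g t).real (Set.Iic p.2)| :=
    Measurable.mul (by fun_prop)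
      (measurable_mean_step.sub (hG.comp measurable_snd)).abs.ennreal_ofReal
  constructor
  · have hpt : ∀ x : (Fin N → ℝ) × (Fin N → ℝ), ∑ i, ∑ j ∈ Finset.univ.erase i,
        ∫⁻ ρ, ENNReal.ofReal
          ((x.2 j - partner (Finset.univ.erase i) x.2 (g t) j ρ) ^ 2) ∂unitLaw ≤
        ENNReal.ofReal (N * N) * (∫⁻ y, ENNReal.ofReal (4 * |y|) *
          ENNReal.ofReal |mean (step y) x.2 - (g t).real (Set.Iic y)|) +
        ∑ k, ∫⁻ y, ENNReal.ofReal (4 * |y|) *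
          ENNReal.ofReal |step y (x.2 k) - (g t).real (Set.Iic y)| := fun x => by
      have hw1 := hw'.comp (measurable_prodMk_left (x := x))
      have hi : ∀ i, ∑ j ∈ Finset.univ.erase i, ∫⁻ ρ, ENNReal.ofReal
          ((x.2 j - partner (Finset.univ.erase i) x.2 (g t) j ρ) ^ 2) ∂unitLaw ≤
          ENNReal.ofReal N * (∫⁻ y, ENNReal.ofReal (4 * |y|) *
            ENNReal.ofReal |mean (step y) x.2 - (g t).real (Set.Iic y)|) +
          ∫⁻ y, ENNReal.ofReal (4 * |y|) *
            ENNReal.ofReal |step y (x.2 i) - (g t).real (Set.Iic y)| := fun i => by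
        refine (sum_lintegral_sq_sub_partner_le x.2 (erase_univ_nonempty hN i) (g t)).trans ?_
        have hcard : ((Finset.univ.erase i).card : ℝ≥0∞) = ENNReal.ofReal (N - 1) := by
          rw [← card_erase_univ hN i, ENNReal.ofReal_natCast]
        rw [hcard, ← lintegral_const_mul' _ _ ENNReal.ofReal_ne_top,
          ← lintegral_const_mul' _ _ ENNReal.ofReal_ne_top]
        refine le_trans (lintegral_mono fun y => ?_) (lintegral_add_left
          (hw1.const_mul _) _).le
        simp only [Function.comp_apply]
        rw [mul_left_comm, mul_left_comm (ENNReal.ofReal (N : ℝ)), ← mul_add,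
          ← ENNReal.ofReal_mul hN1, ← ENNReal.ofReal_mul (Nat.cast_nonneg N),
          ← ENNReal.ofReal_add (by positivity) (abs_nonneg _)]
        gcongr
        exact empiricalCdf_erase hN i x.2 y _
      refine (Finset.sum_le_sum fun i _ => hi i).trans (le_of_eq ?_)
      rw [Finset.sum_add_distrib, Finset.sum_const, Finset.card_univ, Fintype.card_fin,
        nsmul_eq_mul, ENNReal.ofReal_mul (Nat.cast_nonneg N), ENNReal.ofReal_natCast, mul_assoc]
    refine (lintegral_mono hpt).trans ?_
    have hm1 : Measurable fun x : (Fin N → ℝ) × (Fin N → ℝ) => ∫⁻ y, ENNReal.ofReal (4 * |y|) *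
          ENNReal.ofReal |mean (step y) x.2 - (g t).real (Set.Iic y)| := hw'.lintegral_prod_right'
    have hm2 : ∀ k, Measurable fun x : (Fin N → ℝ) × (Fin N → ℝ) => ∫⁻ y,
        ENNReal.ofReal (4 * |y|) * ENNReal.ofReal |step y (x.2 k) - (g t).real (Set.Iic y)| :=
      fun k => (hw k).lintegral_prod_right'
    have hm3 : Measurable fun z : ℝ => ∫⁻ y,
        ENNReal.ofReal (4 * |y|) * ENNReal.ofReal |step y z - (g t).real (Set.Iic y)| := by
      refine Measurable.lintegral_prod_right' (f := fun p : ℝ × ℝ => ENNReal.ofReal (4 * |p.2|) *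
        ENNReal.ofReal |step p.2 p.1 - (g t).real (Set.Iic p.2)|) ?_
      exact Measurable.mul (by fun_prop) ((measurable_step_uncurry.comp measurable_swap).sub
        (hG.comp measurable_snd)).abs.ennreal_ofReal
    rw [lintegral_add_left (hm1.const_mul _), lintegral_const_mul _ hm1,
      lintegral_finsetSum _ fun k _ => hm2 k, h.lintegral_mean hg hN hlam hmu hm3 ht]
    -- Relative to the number of pairs, the excluded particles weigh `1 / N`, which is at most the
    -- main rate.
    have hinv := inv_le_costRate hr hN
    calc _ ≤ ENNReal.ofReal (N * N) * ENNReal.ofReal (e * (C₁ * costRate r N)) +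
          N * ENNReal.ofReal (e * C₂) := by gcongr
      _ = ENNReal.ofReal (N * N * (e * (C₁ * costRate r N)) + N * (e * C₂)) := by
          rw [← ENNReal.ofReal_natCast, ← ENNReal.ofReal_mul (by positivity),
            ← ENNReal.ofReal_mul (by positivity), ← ENNReal.ofReal_add (by positivity)
            (by positivity)]
      _ ≤ _ := by
          refine ENNReal.ofReal_le_ofReal ?_
          have h1 : (N : ℝ) * N ≤ 2 * (N * (N - 1)) := by nlinarith
          have h2 : (1 : ℝ) ≤ N * costRate r N := by
            rwa [inv_le_iff_one_le_mul₀ (by linarith), mul_comm] at hinv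
          have h3 : 0 ≤ e * (C₁ * costRate r N) := by positivity
          have h4 : 0 ≤ N * (e * C₂) := by positivity
          have h5 : 0 ≤ e * (C₂ * costRate r N) := by positivity
          calc _ ≤ 2 * (N * (N - 1)) * (e * (C₁ * costRate r N)) +
                N * (e * C₂) * (N * costRate r N) := by
                exact add_le_add (mul_le_mul_of_nonneg_right h1 h3) (le_mul_of_one_le_right h4 h2)
            _ = 2 * (N * (N - 1)) * (e * (C₁ * costRate r N)) +
                N * N * (e * (C₂ * costRate r N)) := by ring
            _ ≤ 2 * (N * (N - 1)) * (e * (C₁ * costRate r N)) +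
                2 * (N * (N - 1)) * (e * (C₂ * costRate r N)) := by gcongr
            _ = _ := by ring
  · have hpt : ∀ x : (Fin N → ℝ) × (Fin N → ℝ), ∑ j, ∫⁻ ρ, ENNReal.ofReal
        ((x.2 j - partner Finset.univ x.2 (g t) j ρ) ^ 2) ∂unitLaw ≤
        ENNReal.ofReal N * (∫⁻ y, ENNReal.ofReal (4 * |y|) *
          ENNReal.ofReal |mean (step y) x.2 - (g t).real (Set.Iic y)|) := fun x => by
      refine (sum_lintegral_sq_sub_partner_le x.2 Finset.univ_nonempty (g t)).trans (le_of_eq ?_)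
      rw [Finset.card_univ, Fintype.card_fin, ENNReal.ofReal_natCast]
      simp_rw [empiricalCdf_univ hN]
    refine (lintegral_mono hpt).trans ?_
    rw [lintegral_const_mul' _ _ ENNReal.ofReal_ne_top]
    calc _ ≤ ENNReal.ofReal N * ENNReal.ofReal (e * (C₁ * costRate r N)) := by gcongr
      _ = ENNReal.ofReal (N * (e * (C₁ * costRate r N))) := by
          rw [← ENNReal.ofReal_mul (by positivity)]
      _ ≤ _ := by
          refine ENNReal.ofReal_le_ofReal ?_
          gcongr
          linarith

end Cost

/-! ### The rescaling factor -/

section Beta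

variable {N : ℕ} {E T : ℝ}

/-- If the other particles have total energy `E (N - 1)`, the rescaling restores the total `N E`. -/
lemma beta_sq (hN : 2 ≤ N) (hE : 0 < E) (w : ℝ) :
    KacThermostat.beta N E w ^ 2 * (E * (N - 1) + w ^ 2) = N * E := by
  have h2 : (2 : ℝ) ≤ N := by exact_mod_cast hN
  have h1 : 0 < E * (N - 1) + w ^ 2 := by
    have : 0 < E * ((N : ℝ) - 1) := mul_pos hE (by linarith)
    positivity
  have h3 : N * E - E + w ^ 2 = E * (N - 1) + w ^ 2 := by ring
  rw [KacThermostat.beta, h3, Real.sq_sqrt (by positivity), div_mul_cancel₀ _ h1.ne']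

lemma beta_nonneg (w : ℝ) : 0 ≤ KacThermostat.beta N E w := Real.sqrt_nonneg _

/-- `z = β² - 1` satisfies `z (E (N - 1) + w²) = E - w²`, and `2 (β - 1) = z - (β - 1)²`. To first
order one thermostat interaction thus stretches the other velocities by `(E - w²) / (2 E (N - 1))`.
-/
lemma beta_sq_sub_one_bounds (hN : 2 ≤ N) (hE : 0 < E) (w : ℝ) :
    |KacThermostat.beta N E w ^ 2 - 1| * (E * (N - 1)) ≤ E + w ^ 2 ∧
    |2 * (N - 1) * (KacThermostat.beta N E w - 1) - (E - w ^ 2) / E| ≤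
      2 * (E + w ^ 2) ^ 2 / (E ^ 2 * (N - 1)) := by
  have h2 : (2 : ℝ) ≤ N := by exact_mod_cast hN
  have hN1 : 0 < (N : ℝ) - 1 := by linarith
  set b := KacThermostat.beta N E w with hb
  set z := b ^ 2 - 1 with hz
  have hb0 : 0 ≤ b := beta_nonneg w
  have hD : 0 < E * (N - 1) + w ^ 2 := by positivity
  have hzD : z * (E * (N - 1) + w ^ 2) = E - w ^ 2 := by
    have := beta_sq hN hE w
    rw [hz, sub_mul, this]; ring
  have habs : |E - w ^ 2| ≤ E + w ^ 2 := by
    rw [abs_le]; constructor <;> nlinarith [sq_nonneg w]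
  have hz1 : |z| * (E * (N - 1) + w ^ 2) ≤ E + w ^ 2 := by
    rw [← abs_of_pos hD, ← abs_mul, hzD]; exact habs
  have hz2 : |z| * (E * (N - 1)) ≤ E + w ^ 2 := by
    have : 0 ≤ |z| * w ^ 2 := by positivity
    linarith
  refine ⟨hz2, ?_⟩
  have hb1 : |b - 1| ≤ |z| := by
    have : z = (b - 1) * (b + 1) := by rw [hz]; ring
    rw [this, abs_mul, abs_of_nonneg (by linarith : 0 ≤ b + 1)]
    nlinarith [abs_nonneg (b - 1)]
  have e1 : 2 * (N - 1) * (b - 1) - (E - w ^ 2) / E =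
      -((N - 1) * (b - 1) ^ 2) - z * w ^ 2 / E := by
    rw [← hzD]; field_simp; rw [hz]; ring
  rw [e1]
  refine (abs_sub _ _).trans ?_
  rw [abs_neg, abs_of_nonneg (by positivity), abs_div, abs_mul, abs_of_pos hE,
    abs_of_nonneg (sq_nonneg w)]
  have h3 : (b - 1) ^ 2 ≤ |z| ^ 2 := by rw [sq_abs]; exact sq_le_sq.2 hb1
  have h4 : ((N : ℝ) - 1) * (b - 1) ^ 2 ≤ (E + w ^ 2) ^ 2 / (E ^ 2 * (N - 1)) := by
    rw [le_div_iff₀ (by positivity)]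
    calc _ ≤ (N - 1) * |z| ^ 2 * (E ^ 2 * (N - 1)) := by gcongr
      _ = (|z| * (E * (N - 1))) ^ 2 := by ring
      _ ≤ _ := by gcongr
  have h5 : |z| * w ^ 2 / E ≤ (E + w ^ 2) ^ 2 / (E ^ 2 * (N - 1)) := by
    rw [div_le_div_iff₀ hE (by positivity)]
    calc |z| * w ^ 2 * (E ^ 2 * (N - 1)) = (|z| * (E * (N - 1))) * w ^ 2 * E := by ring
      _ ≤ (E + w ^ 2) * (E + w ^ 2) * E := by gcongr; linarith
      _ = _ := by ring
  calc _ ≤ (E + w ^ 2) ^ 2 / (E ^ 2 * (N - 1)) + (E + w ^ 2) ^ 2 / (E ^ 2 * (N - 1)) :=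
        add_le_add h4 h5
    _ = _ := by ring

lemma beta_le_two (hN : 2 ≤ N) (hE : 0 < E) (w : ℝ) : KacThermostat.beta N E w ≤ 2 := by
  have h2 : (2 : ℝ) ≤ N := by exact_mod_cast hN
  have h := beta_sq hN hE w
  have h0 := beta_nonneg (N := N) (E := E) w
  by_contra! hlt
  have h4 : 4 ≤ KacThermostat.beta N E w ^ 2 := by nlinarith
  have h5 : 0 < E * (N - 2) + E := by nlinarith
  nlinarith [sq_nonneg w]

lemma integrable_sq_add_sq_thermostat : Integrable (fun w : ℝ => (E + w ^ 2) ^ 2) (thermostat T) := by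
  have h4 : Integrable (fun w : ℝ => w ^ 4) (thermostat T) := by
    have := integrable_abs_rpow_thermostat (T := T) (r := 4) (by norm_num)
    refine this.congr (ae_of_all _ fun w => ?_)
    have : |w| ^ (4 : ℝ) = |w| ^ 4 := by exact_mod_cast Real.rpow_natCast |w| 4
    simp only [this]
    exact (show Even 4 by decide).pow_abs w
  have h := ((integrable_const (E ^ 2)).add
    ((integrable_sq_thermostat (T := T)).const_mul (2 * E))).add h4
  refine h.congr (ae_of_all _ fun w => ?_)
  simp only [Pi.add_apply]; ring

lemma integrable_beta_mul (hN : 2 ≤ N) (hE : 0 < E) {F : ℝ → ℝ} (hF : Integrable F (thermostat T)) :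
    Integrable (fun w => KacThermostat.beta N E w * F w) (thermostat T) :=
  hF.bdd_mul (c := 2) (measurable_beta E).aestronglyMeasurable (ae_of_all _ fun w => by
    rw [Real.norm_eq_abs, abs_of_nonneg (beta_nonneg w)]; exact beta_le_two hN hE w)

lemma integrable_beta (hN : 2 ≤ N) (hE : 0 < E) :
    Integrable (KacThermostat.beta N E) (thermostat T) := by
  simpa using integrable_beta_mul (T := T) hN hE (integrable_const (1 : ℝ))

/-- Averaging over `w` replaces `w²` by `T`: the mean stretching has the coefficient `(E - T) / (2
E)`, which is the origin of the drift. -/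
lemma abs_integral_beta_le (hN : 2 ≤ N) (hE : 0 < E) (hT : 0 ≤ T) :
    |2 * (N - 1) * (∫ w, KacThermostat.beta N E w ∂thermostat T - 1) - (E - T) / E| ≤
      4 * (∫ w, (E + w ^ 2) ^ 2 ∂thermostat T) / E ^ 2 / N ∧
    |∫ w, KacThermostat.beta N E w * w ^ 2 ∂thermostat T - T| ≤
      2 * (∫ w, (E + w ^ 2) ^ 2 ∂thermostat T) / E / N := by
  have h2 : (2 : ℝ) ≤ N := by exact_mod_cast hN
  have hN1 : 0 < (N : ℝ) - 1 := by linarith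
  have hS := integrable_sq_add_sq_thermostat (E := E) (T := T)
  have hw := integrable_sq_thermostat (T := T)
  set S := ∫ w, (E + w ^ 2) ^ 2 ∂thermostat T with hSdef
  have hS0 : 0 ≤ S := integral_nonneg fun w => by positivity
  have hinv : ((N : ℝ) - 1)⁻¹ ≤ 2 * (N : ℝ)⁻¹ := by
    rw [inv_le_iff_one_le_mul₀ hN1, mul_comm, ← mul_assoc, ← div_eq_mul_inv,
      le_div_iff₀ (by linarith)]
    linarith
  have e1 := (((HasIntegralEq.of_integrable (integrable_beta (T := T) hN hE)).const_mul
    (2 * (N - 1))).add (((HasIntegralEq.of_integrable hw).const_mul E⁻¹).add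
      (.const (-(2 * (N - 1)) - 1)))).congr
    (f' := fun w => 2 * (N - 1) * (KacThermostat.beta N E w - 1) - (E - w ^ 2) / E)
    (fun w => by field_simp; ring)
    (c' := 2 * (N - 1) * (∫ w, KacThermostat.beta N E w ∂thermostat T - 1) - (E - T) / E)
    (by rw [integral_sq_thermostat hT]; field_simp; ring)
  have e2 := ((HasIntegralEq.of_integrable (integrable_beta_mul hN hE hw)).add
    ((HasIntegralEq.of_integrable hw).const_mul (-1))).congr
    (f' := fun w => KacThermostat.beta N E w * w ^ 2 - w ^ 2)
    (fun w => by ring)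
    (c' := ∫ w, KacThermostat.beta N E w * w ^ 2 ∂thermostat T - T)
    (by rw [integral_sq_thermostat hT]; ring)
  rw [← e1.2, ← e2.2]
  constructor
  · refine (abs_integral_le_integral_abs.trans (integral_mono e1.1.abs
      (hS.const_mul (2 / (E ^ 2 * (N - 1)))) fun w => ?_)).trans ?_
    · refine (beta_sq_sub_one_bounds hN hE w).2.trans (le_of_eq ?_)
      ring
    · rw [integral_const_mul]
      calc 2 / (E ^ 2 * (N - 1)) * S = 2 * S / E ^ 2 * ((N : ℝ) - 1)⁻¹ := by field_simp
        _ ≤ 2 * S / E ^ 2 * (2 * (N : ℝ)⁻¹) := by gcongr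
        _ = _ := by field_simp; ring
  · refine (abs_integral_le_integral_abs.trans (integral_mono e2.1.abs
      (hS.const_mul (1 / (E * (N - 1)))) fun w => ?_)).trans ?_
    · have h3 := (beta_sq_sub_one_bounds hN hE w).1
      have h0 := beta_nonneg (N := N) (E := E) w
      have e : KacThermostat.beta N E w * w ^ 2 - w ^ 2 =
        (KacThermostat.beta N E w - 1) * w ^ 2 := by ring
      rw [e, abs_mul, abs_of_nonneg (sq_nonneg w), one_div, ← div_eq_inv_mul,
        le_div_iff₀ (by positivity)]
      have h4 : |KacThermostat.beta N E w - 1| ≤ |KacThermostat.beta N E w ^ 2 - 1| := by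
        have : KacThermostat.beta N E w ^ 2 - 1 =
          (KacThermostat.beta N E w - 1) * (KacThermostat.beta N E w + 1) := by ring
        rw [this, abs_mul, abs_of_nonneg (by linarith : 0 ≤ KacThermostat.beta N E w + 1)]
        nlinarith [abs_nonneg (KacThermostat.beta N E w - 1)]
      calc _ ≤ |KacThermostat.beta N E w ^ 2 - 1| * w ^ 2 * (E * (N - 1)) := by gcongr
        _ = |KacThermostat.beta N E w ^ 2 - 1| * (E * (N - 1)) * w ^ 2 := by ring
        _ ≤ (E + w ^ 2) * (E + w ^ 2) := by gcongr; linarith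
        _ = _ := by ring
    · rw [integral_const_mul]
      calc 1 / (E * (N - 1)) * S = S / E * ((N : ℝ) - 1)⁻¹ := by field_simp
        _ ≤ S / E * (2 * (N : ℝ)⁻¹) := by gcongr
        _ = _ := by field_simp

end Beta

/-- Exponential decay in the presence of an error which can be traded off against the solution. -/
lemma IsPrimitive.le_of_deriv_le_young {y D : ℝ → ℝ} {t κ lam ε c : ℝ} (h : IsPrimitive y D t)
    (ht : 0 ≤ t) (hκ : 0 < κ) (hlam : 0 ≤ lam) (hε : 0 ≤ ε) (hc : 0 ≤ c) (hy0 : 0 ≤ y 0)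
    (hD : ∀ s ∈ Set.Icc 0 t, ∀ δ, 0 < δ →
      D s ≤ -κ * y s + lam * (δ * y s + (1 + δ⁻¹) * ε) + c) :
    y t ≤ 2 * Real.exp (-(κ * t)) * y 0 +
      2 * (lam * ε * (1 / κ + 8 * (lam + 1) / κ ^ 2) + c / κ) := by
  -- The integral of `δ` over `[0, t]` is bounded independently of `t`, so the term `lam δ y` costs
  -- only a bounded factor, while `1 / δ` grows like `e^{κ(t-s)/2}` and is absorbed by
  -- `e^{-κ(t-s)}`. A constant `δ` would lower the decay rate.
  set δ : ℝ → ℝ := fun s => κ / (4 * (lam + 1)) * Real.exp (-(κ / 2 * (t - s))) with hδ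
  set G : ℝ → ℝ := fun s => lam / (2 * (lam + 1)) * Real.exp (-(κ / 2 * (t - s))) with hG
  have hδ0 : ∀ s, 0 < δ s := fun s => by positivity
  have hG0 : ∀ s, 0 ≤ G s := fun s => by positivity
  have hGd : ∀ s, HasDerivAt G (lam * δ s) s := fun s => by
    have h1 := ((((hasDerivAt_const s t).sub (hasDerivAt_id s)).const_mul (κ / 2)).neg.exp).const_mul
      (lam / (2 * (lam + 1)))
    convert! h1 using 1
    simp only [hδ, Pi.neg_apply, Pi.sub_apply, id]
    field_simp
    ring
  have hδc : Continuous δ := by simp only [hδ]; fun_prop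
  have hGc : Continuous G := by simp only [hG]; fun_prop
  have hq : IsPrimitive (fun s => Real.exp (-G s)) (fun s => Real.exp (-G s) * -(lam * δ s)) t :=
    .of_hasDerivAt (fun s => (hGd s).neg.exp) (by fun_prop)
  set R : ℝ → ℝ := fun s => lam * ((1 + (δ s)⁻¹) * ε) + c with hR
  have hRc : Continuous R := by
    simp only [hR]
    exact (((continuous_const.add (hδc.inv₀ fun s => (hδ0 s).ne')).mul continuous_const).const_mul
      _).add continuous_const
  have hR0 : ∀ s, 0 ≤ R s := fun s => by have := hδ0 s; positivity
  have key := (h.mul hq ht).le_of_deriv_le ht (c := κ) (R := R) (hRc.intervalIntegrable _ _)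
    fun s hs => by
      have h1 := hD s hs (δ s) (hδ0 s)
      have h2 : Real.exp (-G s) ≤ 1 := Real.exp_le_one_iff.2 (by linarith [hG0 s])
      have h3 := Real.exp_pos (-G s)
      have h4 : D s - lam * δ s * y s + κ * y s ≤ R s := by simp only [hR]; linarith
      have h5 : Real.exp (-G s) * (D s - lam * δ s * y s + κ * y s) ≤ Real.exp (-G s) * R s := by
        gcongr
      have h6 := mul_le_of_le_one_left (hR0 s) h2
      linarith
  -- `G t ≤ 1 / 2` and `1 - x ≤ e^{-x}`; this is the factor `2` of the conclusion.
  have hexp : Real.exp (G t) ≤ 2 := by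
    have h1 : G t ≤ 1 / 2 := by
      simp only [hG, sub_self, mul_zero, neg_zero, Real.exp_zero, mul_one]
      rw [div_le_div_iff₀ (by positivity) (by norm_num)]
      linarith
    have h2 := Real.add_one_le_exp (-(G t))
    rw [Real.exp_neg] at h2
    have h3 : (1 / 2 : ℝ) ≤ (Real.exp (G t))⁻¹ := by linarith
    rw [one_div] at h3
    exact (inv_le_inv₀ (by norm_num) (Real.exp_pos _)).1 h3
  have hint : ∫ s in (0 : ℝ)..t, Real.exp (-(κ * (t - s))) * R s ≤
      lam * ε * (1 / κ + 8 * (lam + 1) / κ ^ 2) + c / κ := by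
    have e : ∀ s, Real.exp (-(κ * (t - s))) * R s =
        (lam * ε + c) * Real.exp (-(κ * (t - s))) +
          lam * ε * (4 * (lam + 1) / κ) * Real.exp (-(κ / 2 * (t - s))) := fun s => by
      have h1 : Real.exp (-(κ * (t - s))) =
          Real.exp (-(κ / 2 * (t - s))) * Real.exp (-(κ / 2 * (t - s))) := by
        rw [← Real.exp_add]; congr 1; ring
      have := Real.exp_pos (-(κ / 2 * (t - s)))
      simp only [hR, hδ, h1]
      field_simp
      ring
    simp_rw [e]
    rw [intervalIntegral.integral_add (Continuous.intervalIntegrable (by fun_prop) _ _)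
      (Continuous.intervalIntegrable (by fun_prop) _ _), intervalIntegral.integral_const_mul,
      intervalIntegral.integral_const_mul]
    have h1 := integral_exp_neg_mul_sub_le hκ t
    have h2 := integral_exp_neg_mul_sub_le (half_pos hκ) t
    calc _ ≤ (lam * ε + c) * (1 / κ) + lam * ε * (4 * (lam + 1) / κ) * (1 / (κ / 2)) := by gcongr
      _ = _ := by field_simp; ring
  have h0 : Real.exp (-G 0) ≤ 1 := Real.exp_le_one_iff.2 (by linarith [hG0 0])
  have h7 : y t = Real.exp (G t) * (y t * Real.exp (-G t)) := by
    rw [mul_left_comm, ← Real.exp_add]; simp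
  have h8 : Real.exp (-(κ * t)) * (y 0 * Real.exp (-G 0)) ≤ Real.exp (-(κ * t)) * y 0 := by
    gcongr; exact mul_le_of_le_one_right hy0 h0
  set W := lam * ε * (1 / κ + 8 * (lam + 1) / κ ^ 2) + c / κ with hW
  have hW0 : 0 ≤ W := by positivity
  rw [h7]
  calc _ ≤ Real.exp (G t) * (Real.exp (-(κ * t)) * y 0 + W) := by
        refine mul_le_mul_of_nonneg_left ?_ (Real.exp_pos _).le
        linarith
    _ ≤ 2 * (Real.exp (-(κ * t)) * y 0 + W) := by gcongr
    _ = _ := by ring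

/-! ### Energy of the particle system and correlation with the nonlinear particles -/

section Correlation

variable {N : ℕ} {lam mu a E T : ℝ} {g : Kernel ℝ ℝ}

lemma sum_comp_eq_of_eq_off_pair₂ {ι : Type*} [Fintype ι] [DecidableEq ι] {i j : ι} (hij : i ≠ j)
    {v u v' u' : ι → ℝ} (hv : ∀ k, k ≠ i → k ≠ j → v' k = v k)
    (hu : ∀ k, k ≠ i → k ≠ j → u' k = u k) :
    ∑ k, v' k * u' k = ∑ k, v k * u k +
      ((v' i * u' i - v i * u i) + (v' j * u' j - v j * u j)) := by
  rw [← Fintype.sum_eq_add (f := fun k => v' k * u' k - v k * u k) i j hij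
    (fun k hk => by rw [hv k hk.1 hk.2, hu k hk.1 hk.2, sub_self]), Finset.sum_sub_distrib]
  ring

lemma sum_sq_kacJump {i j : Fin N} (hij : j ≠ i) (v : Fin N → ℝ) (θ : ℝ) :
    ∑ k, kacJump i j v θ k ^ 2 = ∑ k, v k ^ 2 := by
  have h := sum_comp_eq_of_eq_off_pair hij.symm (u := v) (w := kacJump i j v θ)
    (fun k h1 h2 => by simp [kacJump, h1, h2]) (fun x => x ^ 2)
  rw [h]
  simp only [kacJump, if_true, hij, if_false]
  linear_combination (v i ^ 2 + v j ^ 2) * Real.sin_sq_add_cos_sq θ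

lemma sum_sq_thermoJump (i : Fin N) (v : Fin N → ℝ) (w : ℝ) :
    ∑ k, thermoJump E i v w k ^ 2 =
      KacThermostat.beta N E w ^ 2 * (∑ k, v k ^ 2 + (w ^ 2 - v i ^ 2)) := by
  rw [← sum_comp_update v i w fun x => x ^ 2, Finset.mul_sum]
  refine Finset.sum_congr rfl fun k _ => ?_
  by_cases h : k = i <;> simp [thermoJump, h, mul_pow]

/-- Both systems undergo the same rotation: the right-hand side vanishes when the samples are `X =
x.2 j` and `Y = x.2 i`. -/
lemma sum_mul_couplingCollision {i j : Fin N} (hij : j ≠ i) (s : ℝ)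
    (x : (Fin N → ℝ) × (Fin N → ℝ)) (θ ρ : ℝ) {X Y : ℝ}
    (hX : partner (Finset.univ.erase i) x.2 (g s) j ρ = X)
    (hY : partner (Finset.univ.erase j) x.2 (g s) i ρ = Y) :
    ∑ k, (couplingCollision g i j s x (θ, ρ)).1 k * (couplingCollision g i j s x (θ, ρ)).2 k -
      ∑ k, x.1 k * x.2 k =
      Real.cos θ ^ 2 * (x.1 i * x.2 i + x.1 j * x.2 j) +
      Real.sin θ ^ 2 * (x.1 j * X + x.1 i * Y) +
      Real.cos θ * Real.sin θ * (x.1 j * Y + x.1 i * x.2 j - x.1 i * X - x.1 j * x.2 i) -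
      (x.1 i * x.2 i + x.1 j * x.2 j) := by
  rw [sum_comp_eq_of_eq_off_pair₂ hij.symm (v := x.1) (u := x.2)
    (fun k h1 h2 => by simp [couplingCollision, kacJump, h1, h2])
    (fun k h1 h2 => by simp [couplingCollision, nonlinearJump, h1, h2])]
  simp only [couplingCollision, nonlinearJump, kacJump, if_true, hij, if_false, hX, hY]
  ring

lemma sum_mul_couplingThermo (i : Fin N) (s : ℝ) (x : (Fin N → ℝ) × (Fin N → ℝ)) (w : ℝ) :
    ∑ k, (couplingThermo a E i s x w).1 k * (couplingThermo a E i s x w).2 k =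
      KacThermostat.beta N E w * (∑ k, x.1 k * x.2 k - x.1 i * x.2 i) +
        Real.exp (-(a * s)) * (KacThermostat.beta N E w * w ^ 2) := by
  have h := Fintype.sum_eq_single (f := fun k => (couplingThermo a E i s x w).1 k *
    (couplingThermo a E i s x w).2 k - KacThermostat.beta N E w * (x.1 k * x.2 k)) i
    (fun k hk => by simp [couplingThermo, thermoJump, hk, mul_assoc])
  rw [Finset.sum_sub_distrib, ← Finset.mul_sum, sub_eq_iff_eq_add] at h
  rw [h]
  simp only [couplingThermo, thermoJump, if_true, Function.update_self]
  ring

variable [IsMarkovKernel g]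

/-- The energy of the particle system is a supersolution. -/
lemma lintegral_sum_sq_le (hN : 2 ≤ N) (hlam : 0 ≤ lam) (hmu : 0 ≤ mu) (hE : 0 < E)
    {m : Kernel ℝ ((Fin N → ℝ) × (Fin N → ℝ))}
    (hm : ∀ (φ : (Fin N → ℝ) × (Fin N → ℝ) → ℝ≥0∞) (c d B : ℝ≥0∞), Measurable φ →
      (∀ s x, ∫⁻ y, φ y ∂(couplingRate N lam mu a E T g (s, x)) ≤ c * φ x + d) →
      c * B + d ≤ (N * (lam + mu)).toNNReal * B → ∫⁻ x, φ x ∂m 0 ≤ B →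
        ∀ t, 0 ≤ t → ∫⁻ x, φ x ∂m t ≤ B)
    (h0 : ∫⁻ x, ENNReal.ofReal (∑ k, x.1 k ^ 2) ∂m 0 ≤ ENNReal.ofReal (N * E)) {t : ℝ}
    (ht : 0 ≤ t) : ∫⁻ x, ENNReal.ofReal (∑ k, x.1 k ^ 2) ∂m t ≤ ENNReal.ofReal (N * E) := by
  have h2 : (2 : ℝ) ≤ N := by exact_mod_cast hN
  have hN1 : 0 < (N : ℝ) - 1 := by linarith
  have hbm := measurable_beta (N := N) E
  have hw : Integrable (fun w : ℝ => w ^ 2) (thermostat T) := integrable_sq_thermostat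
  have hb : Integrable (fun w => KacThermostat.beta N E w ^ 2) (thermostat T) := by
    simpa [pow_two] using integrable_beta_mul (T := T) hN hE (integrable_beta hN hE)
  have hbw : Integrable (fun w => KacThermostat.beta N E w ^ 2 * w ^ 2) (thermostat T) := by
    simpa [pow_two, mul_assoc] using integrable_beta_mul hN hE (integrable_beta_mul hN hE hw)
  set b := ∫ w, KacThermostat.beta N E w ^ 2 ∂thermostat T
  set q := ∫ w, KacThermostat.beta N E w ^ 2 * w ^ 2 ∂thermostat T
  have hb0 : 0 ≤ b := integral_nonneg fun w => by positivity
  have hq0 : 0 ≤ q := integral_nonneg fun w => by positivity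
  have hbq : b * (E * (N - 1)) + q = N * E := by
    have h := ((HasIntegralEq.of_integrable hb).const_mul (E * (N - 1))).add
      (HasIntegralEq.of_integrable hbw)
    rw [mul_comm b, ← h.2]
    have : ∀ w, E * (N - 1) * KacThermostat.beta N E w ^ 2 + KacThermostat.beta N E w ^ 2 * w ^ 2 =
        N * E := fun w => by rw [← beta_sq hN hE w]; ring
    simp_rw [this]
    simp
  -- The jumps act affinely on the energy, and `hbq`, the average of `beta_sq`, makes `N E` the
  -- stationary value.
  refine hm _ (ENNReal.ofReal (N * lam + mu * ((N - 1) * b))) (ENNReal.ofReal (mu * (N * q))) _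
    (by fun_prop) (fun s x => ?_) (le_of_eq ?_) h0 t ht
  · rw [lintegral_couplingRate g (by fun_prop)]
    have hx0 : 0 ≤ ∑ k, x.1 k ^ 2 := Finset.sum_nonneg fun k _ => sq_nonneg _
    have e1 : ∀ i : Fin N, ∑ j ∈ Finset.univ.erase i, ENNReal.ofReal (lam / (N - 1)) *
        ∫⁻ z, ENNReal.ofReal (∑ k, (couplingCollision g i j s x z).1 k ^ 2)
          ∂(angleLaw.prod unitLaw) =
        ENNReal.ofReal (∑ _j ∈ Finset.univ.erase i, lam / (N - 1)) *
          ENNReal.ofReal (∑ k, x.1 k ^ 2) := fun i => by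
      rw [ENNReal.ofReal_sum_of_nonneg fun j _ => by positivity, Finset.sum_mul]
      refine Finset.sum_congr rfl fun j hj => ?_
      simp only [couplingCollision, sum_sq_kacJump (Finset.ne_of_mem_erase hj), lintegral_const,
        measure_univ, mul_one]
    have e2 : ∀ i : Fin N, ∫⁻ w, ENNReal.ofReal (∑ k, (couplingThermo a E i s x w).1 k ^ 2)
        ∂thermostat T = ENNReal.ofReal (b * (∑ k, x.1 k ^ 2 - x.1 i ^ 2) + q) := fun i => by
      have h := ((HasIntegralEq.of_integrable hb).const_mul (∑ k, x.1 k ^ 2 - x.1 i ^ 2)).add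
        (HasIntegralEq.of_integrable hbw)
      have e : ∀ w, ∑ k, (couplingThermo a E i s x w).1 k ^ 2 =
          (∑ k, x.1 k ^ 2 - x.1 i ^ 2) * KacThermostat.beta N E w ^ 2 +
            KacThermostat.beta N E w ^ 2 * w ^ 2 := fun w => by
        simp only [couplingThermo]
        rw [sum_sq_thermoJump]; ring
      have hnn : ∀ w, 0 ≤ (∑ k, x.1 k ^ 2 - x.1 i ^ 2) * KacThermostat.beta N E w ^ 2 +
            KacThermostat.beta N E w ^ 2 * w ^ 2 := fun w => by
        rw [← e w]; exact Finset.sum_nonneg fun k _ => sq_nonneg _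
      simp_rw [e]
      rw [← ofReal_integral_eq_lintegral_ofReal h.1 (ae_of_all _ hnn), h.2, mul_comm b]
    have hi0 : ∀ i, 0 ≤ ∑ k, x.1 k ^ 2 - x.1 i ^ 2 := fun i =>
      sub_nonneg.2 (Finset.single_le_sum (f := fun k => x.1 k ^ 2) (fun k _ => sq_nonneg _)
        (Finset.mem_univ i))
    have hbi : ∀ i, 0 ≤ b * (∑ k, x.1 k ^ 2 - x.1 i ^ 2) + q := fun i => by
      have := hi0 i; positivity
    simp_rw [e1, e2]
    rw [← Finset.sum_mul, ← ENNReal.ofReal_sum_of_nonneg fun i _ =>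
      Finset.sum_nonneg fun j _ => by positivity, sum_erase_const hN, ← Finset.mul_sum,
      ← ENNReal.ofReal_sum_of_nonneg fun i _ => hbi i, ← ENNReal.ofReal_mul (by positivity),
      ← ENNReal.ofReal_mul hmu, ← ENNReal.ofReal_mul (by positivity),
      ← ENNReal.ofReal_add (by positivity) (mul_nonneg hmu (Finset.sum_nonneg fun i _ => hbi i)),
      ← ENNReal.ofReal_add (by positivity) (by positivity)]
    refine ENNReal.ofReal_le_ofReal (le_of_eq ?_)
    rw [Finset.sum_add_distrib, ← Finset.mul_sum, Finset.sum_sub_distrib]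
    simp
    ring
  · rw [← ENNReal.ofReal_mul (by positivity), ← ENNReal.ofReal_add (by positivity) (by positivity)]
    change _ = ENNReal.ofReal _ * _
    rw [← ENNReal.ofReal_mul (by positivity)]
    congr 1
    linear_combination mu * N * hbq


lemma integrable_of_integrable_sq {ν : Measure ℝ} [IsProbabilityMeasure ν]
    (h : Integrable (fun v : ℝ => v ^ 2) ν) : Integrable (fun v : ℝ => v) ν :=
  ((memLp_two_iff_integrable_sq (by fun_prop)).2 h).integrable (by norm_num)

lemma integrable_partner_sq {s : ℝ} (hg2 : Integrable (fun v : ℝ => v ^ 2) (g s)) {S : Finset (Fin N)}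
    (u : Fin N → ℝ) {j : Fin N} (hj : j ∈ S) :
    Integrable (partner S u (g s) j) unitLaw ∧
      Integrable (fun ρ => partner S u (g s) j ρ ^ 2) unitLaw :=
  ⟨integrable_partner u (g s) (φ := fun v => v) (integrable_of_integrable_sq hg2) hj,
    integrable_partner u (g s) hg2 hj⟩

/-- The average over the angles of the correlation between the two systems. -/
lemma integral_sum_mul_couplingCollision {s : ℝ} (hg2 : Integrable (fun v : ℝ => v ^ 2) (g s))
    {i j : Fin N} (hij : j ≠ i) (x : (Fin N → ℝ) × (Fin N → ℝ)) :
    Integrable (fun z => ∑ k, (couplingCollision g i j s x z).1 k *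
      (couplingCollision g i j s x z).2 k) (angleLaw.prod unitLaw) ∧
    ∫ z, (∑ k, (couplingCollision g i j s x z).1 k * (couplingCollision g i j s x z).2 k -
      ∑ k, x.1 k * x.2 k) ∂(angleLaw.prod unitLaw) =
    1 / 2 * (x.1 j * (∫ ρ, partner (Finset.univ.erase i) x.2 (g s) j ρ ∂unitLaw - x.2 j) +
      x.1 i * (∫ ρ, partner (Finset.univ.erase j) x.2 (g s) i ρ ∂unitLaw - x.2 i)) := by
  have hX := (integrable_partner_sq hg2 (S := Finset.univ.erase i) x.2
    (Finset.mem_erase.2 ⟨hij, Finset.mem_univ j⟩)).1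
  have hY := (integrable_partner_sq hg2 (S := Finset.univ.erase j) x.2
    (Finset.mem_erase.2 ⟨hij.symm, Finset.mem_univ i⟩)).1
  set X := partner (Finset.univ.erase i) x.2 (g s) j
  set Y := partner (Finset.univ.erase j) x.2 (g s) i
  have c2 : Integrable (fun θ => Real.cos θ ^ 2) angleLaw :=
    integrable_angleLaw (by fun_prop) (K := 1) fun θ => by
      rw [abs_of_nonneg (by positivity)]; exact Real.cos_sq_le_one θ
  have s2 : Integrable (fun θ => Real.sin θ ^ 2) angleLaw :=
    integrable_angleLaw (by fun_prop) (K := 1) fun θ => by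
      rw [abs_of_nonneg (by positivity)]; exact Real.sin_sq_le_one θ
  have cs : Integrable (fun θ => Real.cos θ * Real.sin θ) angleLaw :=
    integrable_angleLaw (by fun_prop) (K := 1) fun θ => by
      rw [abs_mul]; exact mul_le_one₀ (Real.abs_cos_le_one θ) (abs_nonneg _) (Real.abs_sin_le_one θ)
  have hm : ∀ {F G : ℝ → ℝ}, Integrable F angleLaw → Integrable G unitLaw →
      HasIntegralEq (angleLaw.prod unitLaw) (fun z : ℝ × ℝ => F z.1 * G z.2)
        ((∫ θ, F θ ∂angleLaw) * ∫ ρ, G ρ ∂unitLaw) := fun hF hG =>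
    ⟨hF.mul_prod hG, integral_prod_mul _ _⟩
  have h1 := hm c2 (integrable_const (x.1 i * x.2 i + x.1 j * x.2 j))
  have h2 := hm s2 ((hX.const_mul (x.1 j)).add (hY.const_mul (x.1 i)))
  have h3 := hm cs (((hY.const_mul (x.1 j)).add (integrable_const (x.1 i * x.2 j))).add
    ((hX.const_mul (-x.1 i)).add (integrable_const (-(x.1 j * x.2 i)))))
  have e2 : ∫ ρ, ((fun ρ => x.1 j * X ρ) + fun ρ => x.1 i * Y ρ) ρ ∂unitLaw =
      x.1 j * ∫ ρ, X ρ ∂unitLaw + x.1 i * ∫ ρ, Y ρ ∂unitLaw :=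
    (((HasIntegralEq.of_integrable hX).const_mul _).add
      ((HasIntegralEq.of_integrable hY).const_mul _)).2
  rw [e2, integral_sin_sq_angleLaw] at h2
  rw [integral_cos_sq_angleLaw] at h1
  rw [integral_cos_mul_sin_angleLaw] at h3
  have key := (h1.add (h2.add (h3.add (.const (-(x.1 i * x.2 i + x.1 j * x.2 j)))))).congr
    (f' := fun z => ∑ k, (couplingCollision g i j s x z).1 k * (couplingCollision g i j s x z).2 k -
      ∑ k, x.1 k * x.2 k)
    (fun z => by
      rw [sum_mul_couplingCollision hij s x z.1 z.2 (X := X z.2) (Y := Y z.2) rfl rfl]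
      simp only [Pi.add_apply]
      ring)
    (c' := 1 / 2 * (x.1 j * (∫ ρ, X ρ ∂unitLaw - x.2 j) + x.1 i * (∫ ρ, Y ρ ∂unitLaw - x.2 i)))
    (by simp; ring)
  refine ⟨?_, key.2⟩
  have := key.1.add (integrable_const (∑ k, x.1 k * x.2 k))
  refine this.congr (ae_of_all _ fun z => ?_)
  simp

lemma measurable_correlation :
    Measurable fun x : (Fin N → ℝ) × (Fin N → ℝ) => ∑ k, x.1 k * x.2 k := by fun_prop

/-- The generator of the coupling, on the correlation between the two systems. -/
lemma integral_couplingRate_correlation (hN : 2 ≤ N) (hlam : 0 ≤ lam) (hmu : 0 ≤ mu) (hE : 0 < E)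
    {s : ℝ} (hg2 : Integrable (fun v : ℝ => v ^ 2) (g s)) (x : (Fin N → ℝ) × (Fin N → ℝ)) :
    ∫ y, (∑ k, y.1 k * y.2 k) ∂couplingRate N lam mu a E T g (s, x) -
      (N * (lam + mu)).toNNReal * ∑ k, x.1 k * x.2 k =
    lam / (N - 1) * ∑ i, ∑ j ∈ Finset.univ.erase i,
      x.1 j * (∫ ρ, partner (Finset.univ.erase i) x.2 (g s) j ρ ∂unitLaw - x.2 j) +
    mu * (((N - 1) * ∫ w, KacThermostat.beta N E w ∂thermostat T - N) * ∑ k, x.1 k * x.2 k +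
      N * (Real.exp (-(a * s)) * ∫ w, KacThermostat.beta N E w * w ^ 2 ∂thermostat T)) := by
  have hth : ∀ i, HasIntegralEq (thermostat T) (fun w =>
      ∑ k, (couplingThermo a E i s x w).1 k * (couplingThermo a E i s x w).2 k)
      ((∑ k, x.1 k * x.2 k - x.1 i * x.2 i) * ∫ w, KacThermostat.beta N E w ∂thermostat T +
        Real.exp (-(a * s)) * ∫ w, KacThermostat.beta N E w * w ^ 2 ∂thermostat T) := fun i =>
    (((HasIntegralEq.of_integrable (integrable_beta hN hE)).const_mul _).add
      ((HasIntegralEq.of_integrable (integrable_beta_mul hN hE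
        integrable_sq_thermostat)).const_mul _)).congr
      (fun w => by rw [sum_mul_couplingThermo]; ring) rfl
  rw [(integral_couplingRate_sub g hN hlam hmu measurable_correlation s x
    (fun i j hij => (integral_sum_mul_couplingCollision hg2 hij x).1) (fun i => (hth i).1)).2]
  have e1 : ∀ i : Fin N, ∑ j ∈ Finset.univ.erase i, ∫ z,
      (∑ k, (couplingCollision g i j s x z).1 k * (couplingCollision g i j s x z).2 k -
        ∑ k, x.1 k * x.2 k) ∂(angleLaw.prod unitLaw) = ∑ j ∈ Finset.univ.erase i,
      (1 / 2 * (x.1 j * (∫ ρ, partner (Finset.univ.erase i) x.2 (g s) j ρ ∂unitLaw - x.2 j)) +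
       1 / 2 * (x.1 i * (∫ ρ, partner (Finset.univ.erase j) x.2 (g s) i ρ ∂unitLaw - x.2 i))) :=
    fun i => Finset.sum_congr rfl fun j hj => by
      rw [(integral_sum_mul_couplingCollision hg2 (Finset.ne_of_mem_erase hj) x).2]; ring
  have e2 : ∀ i : Fin N, ∫ w, (∑ k, (couplingThermo a E i s x w).1 k *
      (couplingThermo a E i s x w).2 k - ∑ k, x.1 k * x.2 k) ∂thermostat T = _ := fun i =>
    ((hth i).add (.const (-∑ k, x.1 k * x.2 k))).2
  simp_rw [← sub_eq_add_neg] at e2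
  simp_rw [e1, e2, Finset.sum_add_distrib]
  rw [sum_erase_comm (F := fun i j => 1 / 2 * (x.1 i *
    (∫ ρ, partner (Finset.univ.erase j) x.2 (g s) i ρ ∂unitLaw - x.2 i)))]
  simp_rw [Finset.sum_sub_distrib, Finset.sum_add_distrib, ← Finset.mul_sum, ← Finset.sum_mul,
    Finset.sum_sub_distrib]
  simp
  ring

/-- A crude bound, which guarantees that the correlation is still integrable after a jump. -/
lemma exists_lintegral_couplingRate_sum_sq_le (hN : 2 ≤ N) (hE : 0 < E) {s : ℝ}
    (hg2 : Integrable (fun v : ℝ => v ^ 2) (g s)) :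
    ∃ c d : ℝ≥0∞, c ≠ ∞ ∧ d ≠ ∞ ∧ ∀ x : (Fin N → ℝ) × (Fin N → ℝ),
      ∫⁻ y, ENNReal.ofReal (∑ k, y.1 k ^ 2 + ∑ k, y.2 k ^ 2) ∂couplingRate N lam mu a E T g (s, x) ≤
        c * ENNReal.ofReal (∑ k, x.1 k ^ 2 + ∑ k, x.2 k ^ 2) + d := by
  set M := ∫⁻ v, ENNReal.ofReal (v ^ 2) ∂g s with hM
  have hM' : M ≠ ∞ := by
    rw [hM, ← ofReal_integral_eq_lintegral_ofReal hg2 (ae_of_all _ fun v => sq_nonneg v)]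
    exact ENNReal.ofReal_ne_top
  set W := ∫⁻ w, ENNReal.ofReal (w ^ 2) ∂thermostat T with hW
  have hW' : W ≠ ∞ := by
    rw [hW, ← ofReal_integral_eq_lintegral_ofReal integrable_sq_thermostat
      (ae_of_all _ fun v => sq_nonneg v)]
    exact ENNReal.ofReal_ne_top
  set k₁ := ENNReal.ofReal (lam / (N - 1))
  set k₂ := ENNReal.ofReal mu
  set b := ENNReal.ofReal (4 + Real.exp (-(a * s)) ^ 2)
  have hp : ∀ (u : Fin N → ℝ) (i j : Fin N), j ≠ i → ∫⁻ ρ, ENNReal.ofReal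
      (partner (Finset.univ.erase i) u (g s) j ρ ^ 2) ∂unitLaw ≤ N * M := fun u i j hij => by
    have h1 := sum_lintegral_partner u (erase_univ_nonempty hN i) (g s)
      (φ := fun v => ENNReal.ofReal (v ^ 2)) (by fun_prop)
    refine (Finset.single_le_sum (f := fun j => ∫⁻ ρ, ENNReal.ofReal
      (partner (Finset.univ.erase i) u (g s) j ρ ^ 2) ∂unitLaw) (fun _ _ => zero_le)
      (Finset.mem_erase.2 ⟨hij, Finset.mem_univ j⟩)).trans (h1.le.trans ?_)
    gcongr
    exact (Finset.card_le_univ _).trans (by simp)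
  refine ⟨∑ i : Fin N, ∑ _j ∈ Finset.univ.erase i, k₁ + ∑ _i : Fin N, k₂ * 4,
    ∑ i : Fin N, ∑ _j ∈ Finset.univ.erase i, k₁ * (N * M + N * M) + ∑ _i : Fin N, k₂ * (b * W),
    ?_, ?_, fun x => ?_⟩
  · simp [k₁, k₂, ENNReal.mul_eq_top]
  · simp [k₁, k₂, b, ENNReal.mul_eq_top, hM', hW']
  rw [lintegral_couplingRate g (by fun_prop)]
  set Φ := ∑ k, x.1 k ^ 2 + ∑ k, x.2 k ^ 2 with hΦ
  have hv0 : 0 ≤ ∑ k, x.1 k ^ 2 := Finset.sum_nonneg fun k _ => sq_nonneg _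
  have hu0 : 0 ≤ ∑ k, x.2 k ^ 2 := Finset.sum_nonneg fun k _ => sq_nonneg _
  have hΦ0 : 0 ≤ Φ := by positivity
  have h1 : ∀ i j : Fin N, j ≠ i → ∫⁻ z, ENNReal.ofReal
      (∑ k, (couplingCollision g i j s x z).1 k ^ 2 + ∑ k, (couplingCollision g i j s x z).2 k ^ 2)
      ∂(angleLaw.prod unitLaw) ≤ ENNReal.ofReal Φ + (N * M + N * M) := fun i j hij => by
    set X := partner (Finset.univ.erase i) x.2 (g s) j with hX
    set Y := partner (Finset.univ.erase j) x.2 (g s) i with hY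
    have hXm : Measurable X := measurable_partner _ _ _
    have hYm : Measurable Y := measurable_partner _ _ _
    have hpt : ∀ z : ℝ × ℝ, ∑ k, (couplingCollision g i j s x z).1 k ^ 2 +
        ∑ k, (couplingCollision g i j s x z).2 k ^ 2 ≤ Φ + (X z.2 ^ 2 + Y z.2 ^ 2) := fun z => by
      have e := sum_comp_eq_of_eq_off_pair hij.symm (u := x.2)
        (w := (couplingCollision g i j s x z).2)
        (fun k h1 h2 => by simp [couplingCollision, nonlinearJump, h1, h2]) (fun y => y ^ 2)
      rw [e]
      have e' : ∑ k, (couplingCollision g i j s x z).1 k ^ 2 = ∑ k, x.1 k ^ 2 :=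
        sum_sq_kacJump hij _ _
      rw [e']
      simp only [couplingCollision, nonlinearJump_left, nonlinearJump_right hij, ← hX, ← hY, hΦ]
      have hcs : ∀ p q : ℝ, (p * Real.cos z.1 - q * Real.sin z.1) ^ 2 ≤ p ^ 2 + q ^ 2 ∧
          (p * Real.cos z.1 + q * Real.sin z.1) ^ 2 ≤ p ^ 2 + q ^ 2 := fun p q => by
        have h := Real.sin_sq_add_cos_sq z.1
        constructor <;>
        nlinarith [sq_nonneg (p * Real.sin z.1 + q * Real.cos z.1),
          sq_nonneg (p * Real.sin z.1 - q * Real.cos z.1)]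
      linarith [(hcs (x.2 i) (X z.2)).1, (hcs (x.2 j) (Y z.2)).2]
    refine (lintegral_mono fun z => ENNReal.ofReal_le_ofReal (hpt z)).trans ?_
    simp_rw [ENNReal.ofReal_add hΦ0 (add_nonneg (sq_nonneg _) (sq_nonneg _)),
      ENNReal.ofReal_add (sq_nonneg (X _)) (sq_nonneg (Y _))]
    rw [lintegral_add_left measurable_const, lintegral_add_left (by fun_prop), lintegral_const,
      measure_univ, mul_one]
    gcongr
    · refine le_trans (le_of_eq ?_) (hp x.2 i j hij)
      have := lintegral_prod (μ := angleLaw) (ν := unitLaw)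
        (fun z : ℝ × ℝ => ENNReal.ofReal (X z.2 ^ 2)) (by fun_prop)
      rw [this]
      simp [hX]
    · refine le_trans (le_of_eq ?_) (hp x.2 j i hij.symm)
      have := lintegral_prod (μ := angleLaw) (ν := unitLaw)
        (fun z : ℝ × ℝ => ENNReal.ofReal (Y z.2 ^ 2)) (by fun_prop)
      rw [this]
      simp [hY]
  have h2 : ∀ i : Fin N, ∫⁻ w, ENNReal.ofReal
      (∑ k, (couplingThermo a E i s x w).1 k ^ 2 + ∑ k, (couplingThermo a E i s x w).2 k ^ 2)
      ∂thermostat T ≤ 4 * ENNReal.ofReal Φ + b * W := fun i => by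
    have hpt : ∀ w, ∑ k, (couplingThermo a E i s x w).1 k ^ 2 +
        ∑ k, (couplingThermo a E i s x w).2 k ^ 2 ≤
        4 * Φ + (4 + Real.exp (-(a * s)) ^ 2) * w ^ 2 := fun w => by
      have e := sum_comp_update x.2 i (Real.exp (-(a * s)) * w) (fun y => y ^ 2)
      have e' := sum_sq_thermoJump (E := E) i x.1 w
      simp only [couplingThermo, e, e']
      have hb := beta_le_two hN hE w
      have hb0 := beta_nonneg (N := N) (E := E) w
      have hb2 : KacThermostat.beta N E w ^ 2 ≤ 4 := by nlinarith
      have hi : x.1 i ^ 2 ≤ ∑ k, x.1 k ^ 2 := Finset.single_le_sum (f := fun k => x.1 k ^ 2)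
        (fun k _ => sq_nonneg _) (Finset.mem_univ i)
      have hq : KacThermostat.beta N E w ^ 2 * (∑ k, x.1 k ^ 2 + (w ^ 2 - x.1 i ^ 2)) ≤
          4 * (∑ k, x.1 k ^ 2 + (w ^ 2 - x.1 i ^ 2)) :=
        mul_le_mul_of_nonneg_right hb2 (by nlinarith [sq_nonneg w])
      rw [mul_pow, hΦ]
      nlinarith [sq_nonneg (x.1 i), sq_nonneg (x.2 i)]
    refine (lintegral_mono fun z => ENNReal.ofReal_le_ofReal (hpt z)).trans (le_of_eq ?_)
    have e4 : (4 : ℝ≥0∞) = ENNReal.ofReal 4 := by norm_num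
    have e5 : ∀ w : ℝ, ENNReal.ofReal (4 * Φ + (4 + Real.exp (-(a * s)) ^ 2) * w ^ 2) =
        4 * ENNReal.ofReal Φ + b * ENNReal.ofReal (w ^ 2) := fun w => by
      rw [ENNReal.ofReal_add (by positivity) (by positivity), ENNReal.ofReal_mul (by norm_num),
        ENNReal.ofReal_mul (by positivity), e4]
    simp_rw [e5]
    rw [lintegral_add_left measurable_const, lintegral_const, measure_univ, mul_one,
      lintegral_const_mul _ (by fun_prop)]
  calc _ ≤ ∑ i : Fin N, ∑ j ∈ Finset.univ.erase i, k₁ * (ENNReal.ofReal Φ + (N * M + N * M)) +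
        ∑ i : Fin N, k₂ * (4 * ENNReal.ofReal Φ + b * W) := by
        gcongr with i _ j hj i _
        · exact h1 i j (Finset.ne_of_mem_erase hj)
        · exact h2 i
    _ = _ := by
        simp only [mul_add, Finset.sum_add_distrib, add_mul, Finset.sum_mul, mul_assoc]
        ring

end Correlation

/-! ### Distance between the two coupled systems -/

section Deviation

variable {N : ℕ} {lam mu a E T : ℝ} {g : Kernel ℝ ℝ}

/-- The transport cost, in dimension one, of matching the particles with their partners. -/
noncomputable def partnerCost (S : Finset (Fin N)) (ν : Measure ℝ) (j : Fin N) (u : Fin N → ℝ) :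
    ℝ≥0∞ := ∫⁻ ρ, ENNReal.ofReal ((u j - partner S u ν j ρ) ^ 2) ∂unitLaw

lemma measurable_partnerCost (S : Finset (Fin N)) (ν : Measure ℝ) [IsProbabilityMeasure ν]
    (j : Fin N) : Measurable (partnerCost S ν j) := by
  have h := Measurable.comp (measurable_partner_joint (Kernel.const ℝ ν) S j)
    (f := fun q : (Fin N → ℝ) × ℝ => ((0 : ℝ), q.1, q.2)) (by fun_prop)
  simp only [Function.comp_def, Kernel.const_apply] at h
  refine Measurable.lintegral_prod_right' (f := fun q : (Fin N → ℝ) × ℝ =>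
    ENNReal.ofReal ((q.1 j - partner S q.1 ν j q.2) ^ 2)) ?_
  exact (((((measurable_pi_apply j).comp measurable_fst).sub h)).pow_const 2).ennreal_ofReal

/-- Upper bound for `E` times the squared distance between the two systems, in the frame with
drift, the energy of the particle system being replaced by its upper bound `E`. -/
noncomputable def deviation (a E : ℝ) (g : Kernel ℝ ℝ) (m : Kernel ℝ ((Fin N → ℝ) × (Fin N → ℝ)))
    (s : ℝ) : ℝ :=
  E - 2 * (N : ℝ)⁻¹ * (Real.exp (a * s) * ∫ x, (∑ k, x.1 k * x.2 k) ∂m s) + energy a g s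

lemma IsCoupling.hasIntegralEq_sum_sq [IsMarkovKernel g]
    {m : Kernel ℝ ((Fin N → ℝ) × (Fin N → ℝ))}
    (h : IsCoupling lam mu a E T g m) (hg : IsKineticFlow lam mu a T g) (hN : 2 ≤ N)
    (hlam : 0 ≤ lam) (hmu : 0 < mu) {s : ℝ} (hs : 0 ≤ s)
    (hg2 : Integrable (fun v : ℝ => v ^ 2) (g s)) :
    HasIntegralEq (m s) (fun x => ∑ k, x.2 k ^ 2) (N * ∫ v, v ^ 2 ∂g s) := by
  have h1 := h.lintegral_mean hg hN hlam hmu (φ := fun v => ENNReal.ofReal (v ^ 2))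
    (by fun_prop) hs
  have hi0 : 0 ≤ ∫ v, v ^ 2 ∂g s := integral_nonneg fun v => sq_nonneg v
  have h2 : ∫⁻ x, ENNReal.ofReal (∑ k, x.2 k ^ 2) ∂m s = ENNReal.ofReal (N * ∫ v, v ^ 2 ∂g s) := by
    simp_rw [ENNReal.ofReal_sum_of_nonneg fun k _ => sq_nonneg _]
    rw [lintegral_finsetSum _ fun k _ => by fun_prop, h1,
      ← ofReal_integral_eq_lintegral_ofReal hg2 (ae_of_all _ fun v => sq_nonneg v),
      ENNReal.ofReal_mul (by positivity), ENNReal.ofReal_natCast]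
  have hm : Measurable fun x : (Fin N → ℝ) × (Fin N → ℝ) => ∑ k, x.2 k ^ 2 := by fun_prop
  have hnn : ∀ x : (Fin N → ℝ) × (Fin N → ℝ), 0 ≤ ∑ k, x.2 k ^ 2 := fun x =>
    Finset.sum_nonneg fun k _ => sq_nonneg _
  refine ⟨integrable_of_lintegral_le hm hnn h2.le, ?_⟩
  rw [integral_eq_lintegral_of_nonneg_ae (ae_of_all _ hnn) hm.aestronglyMeasurable, h2,
    ENNReal.toReal_ofReal (by positivity)]

/-- Split `x.1 j` into `x.1 j - e u` and `e u`, where `u = x.2 j`, and let `X` and `Z` be the first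
two moments of the partner. Young's inequality with weight `δ` and Jensen's inequality handle the
first part. For the second, `-2 u (X - u) = (u² - 2 u X + Z) + u² - Z`: the bracket is the cost,
whence the `1` in `1 + δ⁻¹`, and the sum of `u² - Z` has zero expectation by unbiasedness. -/
lemma sum_mul_partner_sub_le [IsMarkovKernel g] (hN : 2 ≤ N) {s : ℝ}
    (hg2 : Integrable (fun v : ℝ => v ^ 2) (g s)) (x : (Fin N → ℝ) × (Fin N → ℝ)) (e : ℝ) {δ : ℝ}
    (hδ : 0 < δ) :
    -(2 * e) * ∑ i, ∑ j ∈ Finset.univ.erase i,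
      x.1 j * (∫ ρ, partner (Finset.univ.erase i) x.2 (g s) j ρ ∂unitLaw - x.2 j) ≤
    δ * ((N - 1) * (∑ k, x.1 k ^ 2 - 2 * e * ∑ k, x.1 k * x.2 k + e ^ 2 * ∑ k, x.2 k ^ 2)) +
      (1 + δ⁻¹) * e ^ 2 * (∑ i, ∑ j ∈ Finset.univ.erase i,
        partnerCost (Finset.univ.erase i) (g s) j x.2).toReal -
      e ^ 2 * (N * (N - 1) * ∫ v, v ^ 2 ∂g s - (N - 1) * ∑ k, x.2 k ^ 2) := by
  have hX := fun (i j : Fin N) (hj : j ∈ Finset.univ.erase i) =>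
    integrable_partner_sq hg2 (S := Finset.univ.erase i) x.2 hj
  have hq : ∀ i, ∀ j ∈ Finset.univ.erase i, HasIntegralEq unitLaw
      (fun ρ => (x.2 j - partner (Finset.univ.erase i) x.2 (g s) j ρ) ^ 2)
      (x.2 j ^ 2 - 2 * x.2 j * ∫ ρ, partner (Finset.univ.erase i) x.2 (g s) j ρ ∂unitLaw +
        ∫ ρ, partner (Finset.univ.erase i) x.2 (g s) j ρ ^ 2 ∂unitLaw) := fun i j hj =>
    ((HasIntegralEq.const (x.2 j ^ 2)).add (((HasIntegralEq.of_integrable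
      (hX i j hj).1).const_mul (-(2 * x.2 j))).add
      (HasIntegralEq.of_integrable (hX i j hj).2))).congr (fun ρ => by ring) (by ring)
  have hcost : ∀ i, ∀ j ∈ Finset.univ.erase i,
      partnerCost (Finset.univ.erase i) (g s) j x.2 = ENNReal.ofReal (x.2 j ^ 2 -
        2 * x.2 j * ∫ ρ, partner (Finset.univ.erase i) x.2 (g s) j ρ ∂unitLaw +
        ∫ ρ, partner (Finset.univ.erase i) x.2 (g s) j ρ ^ 2 ∂unitLaw) := fun i j hj => by
    rw [← (hq i j hj).2, ofReal_integral_eq_lintegral_ofReal (hq i j hj).1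
      (ae_of_all _ fun ρ => sq_nonneg _), partnerCost]
  have hq0 : ∀ i, ∀ j ∈ Finset.univ.erase i, 0 ≤ x.2 j ^ 2 -
        2 * x.2 j * ∫ ρ, partner (Finset.univ.erase i) x.2 (g s) j ρ ∂unitLaw +
        ∫ ρ, partner (Finset.univ.erase i) x.2 (g s) j ρ ^ 2 ∂unitLaw := fun i j hj => by
    rw [← (hq i j hj).2]; exact integral_nonneg fun ρ => sq_nonneg _
  have hK : (∑ i, ∑ j ∈ Finset.univ.erase i,
      partnerCost (Finset.univ.erase i) (g s) j x.2).toReal =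
      ∑ i, ∑ j ∈ Finset.univ.erase i, (x.2 j ^ 2 -
        2 * x.2 j * ∫ ρ, partner (Finset.univ.erase i) x.2 (g s) j ρ ∂unitLaw +
        ∫ ρ, partner (Finset.univ.erase i) x.2 (g s) j ρ ^ 2 ∂unitLaw) := by
    rw [Finset.sum_congr rfl fun i _ => Finset.sum_congr rfl (hcost i),
      Finset.sum_congr rfl fun i _ => (ENNReal.ofReal_sum_of_nonneg (hq0 i)).symm,
      ← ENNReal.ofReal_sum_of_nonneg fun i _ => Finset.sum_nonneg (hq0 i),
      ENNReal.toReal_ofReal (Finset.sum_nonneg fun i _ => Finset.sum_nonneg (hq0 i))]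
  have hP : ∑ i, ∑ j ∈ Finset.univ.erase i,
      ∫ ρ, partner (Finset.univ.erase i) x.2 (g s) j ρ ^ 2 ∂unitLaw =
      N * (N - 1) * ∫ v, v ^ 2 ∂g s := by
    have : ∀ i : Fin N, ∑ j ∈ Finset.univ.erase i,
        ∫ ρ, partner (Finset.univ.erase i) x.2 (g s) j ρ ^ 2 ∂unitLaw =
        (N - 1) * ∫ v, v ^ 2 ∂g s := fun i => by
      rw [sum_integral_partner x.2 (erase_univ_nonempty hN i) (g s) hg2 (by fun_prop),
        card_erase_univ hN]
    simp_rw [this]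
    simp [mul_assoc]
  have hc : ∀ F : Fin N → ℝ, ∑ i : Fin N, ∑ j ∈ Finset.univ.erase i, F j =
      (N - 1) * ∑ k, F k := fun F => by
    rw [sum_erase_comm (F := fun _ j => F j)]
    simp_rw [Finset.sum_const, nsmul_eq_mul, card_erase_univ hN, ← Finset.mul_sum]
  have hd : ∑ k, x.1 k ^ 2 - 2 * e * ∑ k, x.1 k * x.2 k + e ^ 2 * ∑ k, x.2 k ^ 2 =
      ∑ k, (x.1 k - e * x.2 k) ^ 2 := by
    rw [Finset.mul_sum, Finset.mul_sum, ← Finset.sum_sub_distrib, ← Finset.sum_add_distrib]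
    exact Finset.sum_congr rfl fun k _ => by ring
  rw [hK, hd, ← hc, ← hc, ← hP, Finset.mul_sum, Finset.mul_sum, Finset.mul_sum,
    ← Finset.sum_add_distrib, ← Finset.sum_sub_distrib, Finset.mul_sum, ← Finset.sum_sub_distrib]
  refine Finset.sum_le_sum fun i _ => ?_
  rw [Finset.mul_sum, Finset.mul_sum, Finset.mul_sum,
    ← Finset.sum_add_distrib, ← Finset.sum_sub_distrib, Finset.mul_sum, ← Finset.sum_sub_distrib]
  refine Finset.sum_le_sum fun j hj => ?_
  have hv := sq_integral_le (hX i j hj).1 (hX i j hj).2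
  set X := ∫ ρ, partner (Finset.univ.erase i) x.2 (g s) j ρ ∂unitLaw
  set Z := ∫ ρ, partner (Finset.univ.erase i) x.2 (g s) j ρ ^ 2 ∂unitLaw
  set v := x.1 j
  set u := x.2 j
  have hy : 0 ≤ δ⁻¹ * (δ * (v - e * u) + e * (X - u)) ^ 2 := by positivity
  have hy' : δ⁻¹ * (δ * (v - e * u) + e * (X - u)) ^ 2 = δ * (v - e * u) ^ 2 +
      2 * e * (v - e * u) * (X - u) + δ⁻¹ * e ^ 2 * (X - u) ^ 2 := by
    field_simp; ring
  have hz : δ⁻¹ * e ^ 2 * (X - u) ^ 2 ≤ δ⁻¹ * e ^ 2 * (u ^ 2 - 2 * u * X + Z) := by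
    gcongr
    nlinarith
  linarith

section Evolution

variable {m : Kernel ℝ ((Fin N → ℝ) × (Fin N → ℝ))}

lemma abs_sum_mul_le (e : ℝ) (v u : Fin N → ℝ) :
    |2 * e * ∑ k, v k * u k| ≤ ∑ k, v k ^ 2 + e ^ 2 * ∑ k, u k ^ 2 := by
  have h1 : 0 ≤ ∑ k, (v k - e * u k) ^ 2 := Finset.sum_nonneg fun k _ => sq_nonneg _
  have h2 : 0 ≤ ∑ k, (v k + e * u k) ^ 2 := Finset.sum_nonneg fun k _ => sq_nonneg _
  have e1 : ∑ k, (v k - e * u k) ^ 2 =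
      ∑ k, v k ^ 2 - 2 * e * ∑ k, v k * u k + e ^ 2 * ∑ k, u k ^ 2 := by
    rw [Finset.mul_sum, Finset.mul_sum, ← Finset.sum_sub_distrib, ← Finset.sum_add_distrib]
    exact Finset.sum_congr rfl fun k _ => by ring
  have e2 : ∑ k, (v k + e * u k) ^ 2 =
      ∑ k, v k ^ 2 + 2 * e * ∑ k, v k * u k + e ^ 2 * ∑ k, u k ^ 2 := by
    rw [Finset.mul_sum, Finset.mul_sum, ← Finset.sum_add_distrib, ← Finset.sum_add_distrib]
    exact Finset.sum_congr rfl fun k _ => by ring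
  rw [abs_le]; constructor <;> linarith

lemma hasIntegralEq_correlation {μ : Measure ((Fin N → ℝ) × (Fin N → ℝ))}
    (h1 : Integrable (fun x => ∑ k, x.1 k ^ 2) μ) (h2 : Integrable (fun x => ∑ k, x.2 k ^ 2) μ) :
    Integrable (fun x => ∑ k, x.1 k * x.2 k) μ := by
  refine (h1.add h2).mono' measurable_correlation.aestronglyMeasurable (ae_of_all _ fun x => ?_)
  have h := abs_sum_mul_le 1 x.1 x.2
  simp only [Pi.add_apply, Real.norm_eq_abs, mul_one, one_pow, one_mul, abs_mul] at h ⊢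
  have : |(2 : ℝ)| = 2 := by norm_num
  rw [this] at h
  linarith [abs_nonneg (∑ k, x.1 k * x.2 k)]

variable [IsMarkovKernel g] (h : IsCoupling lam mu a E T g m) (hg : IsKineticFlow lam mu a T g)
  (hN : 2 ≤ N) (hlam : 0 ≤ lam) (hmu : 0 < mu) (hE : 0 < E)
  (hV : ∀ t, 0 ≤ t → ∫⁻ x, ENNReal.ofReal (∑ k, x.1 k ^ 2) ∂m t ≤ ENNReal.ofReal (N * E))
  (hg2 : ∀ t, 0 ≤ t → Integrable (fun v : ℝ => v ^ 2) (g t))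

include hV hE in
omit [IsMarkovKernel g] in
lemma integrable_sum_sq_fst {s : ℝ} (hs : 0 ≤ s) :
    Integrable (fun x => ∑ k, x.1 k ^ 2) (m s) ∧ ∫ x, ∑ k, x.1 k ^ 2 ∂m s ≤ N * E := by
  have hm : Measurable fun x : (Fin N → ℝ) × (Fin N → ℝ) => ∑ k, x.1 k ^ 2 := by fun_prop
  have hnn : ∀ x : (Fin N → ℝ) × (Fin N → ℝ), 0 ≤ ∑ k, x.1 k ^ 2 := fun x =>
    Finset.sum_nonneg fun k _ => sq_nonneg _
  refine ⟨integrable_of_lintegral_le hm hnn (hV s hs), ?_⟩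
  rw [integral_eq_lintegral_of_nonneg_ae (ae_of_all _ hnn) hm.aestronglyMeasurable]
  exact ENNReal.toReal_le_of_le_ofReal (by positivity) (hV s hs)

include h hg hN hlam hmu hE hV hg2 in
lemma IsCoupling.integrable_correlation_gain {s : ℝ} (hs : 0 ≤ s) :
    Integrable (fun x => ∑ k, x.1 k * x.2 k)
      ((couplingRate N lam mu a E T g ∘ₖ (Kernel.id ×ₖ m)) s) := by
  have := h.markov
  have := isFiniteKernel_couplingRate (N := N) (a := a) (E := E) (T := T) g hN hlam hmu.le
  obtain ⟨c, d, hc, hd, hcd⟩ := exists_lintegral_couplingRate_sum_sq_le (lam := lam) (mu := mu)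
    (a := a) (T := T) hN hE (hg2 s hs)
  refine ⟨measurable_correlation.aestronglyMeasurable, ?_⟩
  have h12 := ((HasIntegralEq.of_integrable (integrable_sum_sq_fst hE hV hs).1).add
    (h.hasIntegralEq_sum_sq hg hN hlam hmu hs (hg2 s hs))).1
  have hfin : ∫⁻ x, ENNReal.ofReal (∑ k, x.1 k ^ 2 + ∑ k, x.2 k ^ 2) ∂m s < ∞ := by
    rw [← ofReal_integral_eq_lintegral_ofReal h12 (ae_of_all _ fun x => add_nonneg
      (Finset.sum_nonneg fun k _ => sq_nonneg _) (Finset.sum_nonneg fun k _ => sq_nonneg _))]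
    exact ENNReal.ofReal_lt_top
  calc _ ≤ ∫⁻ x, ENNReal.ofReal (∑ k, x.1 k ^ 2 + ∑ k, x.2 k ^ 2)
        ∂(couplingRate N lam mu a E T g ∘ₖ (Kernel.id ×ₖ m)) s := lintegral_mono fun x => by
        rw [Real.enorm_eq_ofReal_abs]
        refine ENNReal.ofReal_le_ofReal ?_
        have h := abs_sum_mul_le 1 x.1 x.2
        have : |(2 : ℝ)| = 2 := by norm_num
        simp only [mul_one, one_pow, one_mul, abs_mul, this] at h
        linarith [abs_nonneg (∑ k, x.1 k * x.2 k)]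
    _ = ∫⁻ x, (∫⁻ y, ENNReal.ofReal (∑ k, y.1 k ^ 2 + ∑ k, y.2 k ^ 2)
          ∂(couplingRate N lam mu a E T g (s, x))) ∂m s :=
        lintegral_comp_id_prod _ _ (by fun_prop) s
    _ ≤ ∫⁻ x, (c * ENNReal.ofReal (∑ k, x.1 k ^ 2 + ∑ k, x.2 k ^ 2) + d) ∂m s :=
        lintegral_mono fun x => hcd x
    _ < ∞ := by
        rw [lintegral_add_right _ measurable_const, lintegral_const_mul _ (by fun_prop),
          lintegral_const, measure_univ, mul_one]
        exact ENNReal.add_lt_top.2 ⟨ENNReal.mul_lt_top hc.lt_top hfin, hd.lt_top⟩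

include h hg hN hlam hmu hE hV hg2 in
lemma IsCoupling.isPrimitive_deviation (hT : 0 ≤ T) {t : ℝ} (ht : 0 ≤ t) :
    IsPrimitive (deviation a E g m) (fun s =>
      -(2 * (N : ℝ)⁻¹ * (a * Real.exp (a * s) * (∫ x, (∑ k, x.1 k * x.2 k) ∂m s) +
        Real.exp (a * s) * ∫ x, (∫ y, (∑ k, y.1 k * y.2 k) ∂couplingRate N lam mu a E T g (s, x) -
          (N * (lam + mu)).toNNReal * ∑ k, x.1 k * x.2 k) ∂m s)) +
      (-(mu - 2 * a) * energy a g s + mu * T)) t := by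
  have := h.markov
  have hen := hg.energy_isPrimitive hlam hmu.le hT (hg2 0 le_rfl) ht
  obtain ⟨B, hB⟩ : ∃ B : ℝ, ∀ s ∈ Set.Icc 0 t, ∫ v, v ^ 2 ∂g s ≤ B := by
    have hc := (((IsPrimitive.exp (t := t) (-(2 * a))).mul hen ht).continuousOn ht)
    obtain ⟨B, hB⟩ := (isCompact_Icc.image_of_continuousOn hc).bddAbove
    refine ⟨B, fun s hs => ?_⟩
    have := hB ⟨s, hs, rfl⟩
    simp only [energy, ← mul_assoc, ← Real.exp_add] at this
    simpa using this
  have hp := h.isPrimitive hN hlam hmu.le (ψ := fun x => ∑ k, x.1 k * x.2 k)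
    (φ := fun x => ∑ k, x.1 k ^ 2 + ∑ k, x.2 k ^ 2) measurable_correlation
    (fun x => by
      have h := abs_sum_mul_le 1 x.1 x.2
      have : |(2 : ℝ)| = 2 := by norm_num
      simp only [mul_one, one_pow, one_mul, abs_mul, this] at h
      linarith [abs_nonneg (∑ k, x.1 k * x.2 k)]) ht
    (B := ENNReal.ofReal (N * E + N * B)) ENNReal.ofReal_ne_top
    (fun s hs => by
      have h1 := integrable_sum_sq_fst hE hV hs.1
      have h2 := h.hasIntegralEq_sum_sq hg hN hlam hmu hs.1 (hg2 s hs.1)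
      have h12 := (HasIntegralEq.of_integrable h1.1).add h2
      rw [← ofReal_integral_eq_lintegral_ofReal h12.1 (ae_of_all _ fun x => add_nonneg
        (Finset.sum_nonneg fun k _ => sq_nonneg _) (Finset.sum_nonneg fun k _ => sq_nonneg _)),
        h12.2]
      refine ENNReal.ofReal_le_ofReal (add_le_add h1.2 ?_)
      exact mul_le_mul_of_nonneg_left (hB s hs) (by positivity))
    (fun s hs => h.integrable_correlation_gain hg hN hlam hmu hE hV hg2 hs.1)
  refine (((IsPrimitive.const E).add ((((IsPrimitive.exp a).mul hp ht).const_mul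
    (-(2 * (N : ℝ)⁻¹))))).add hen).congr ht (fun s _ => ?_) fun s _ => ?_
  · simp only [deviation]; ring
  · ring

include h hg hN hlam hmu hE hV hg2 in
-- Expand the square: the particle system has energy at most `E` per particle, and by unbiasedness
-- the nonlinear particles have mean energy `energy a g s`.
lemma IsCoupling.lintegral_sq_sub_le {s : ℝ} (hs : 0 ≤ s) :
    ∫⁻ x, ENNReal.ofReal ((N : ℝ)⁻¹ * ∑ k, (x.1 k - Real.exp (a * s) * x.2 k) ^ 2) ∂m s ≤
      ENNReal.ofReal (deviation a E g m s) := by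
  have h1 := integrable_sum_sq_fst hE hV hs
  have h2 := h.hasIntegralEq_sum_sq hg hN hlam hmu hs (hg2 s hs)
  have h3 := hasIntegralEq_correlation h1.1 h2.1
  have h2N : (2 : ℝ) ≤ N := by exact_mod_cast hN
  have key := ((((HasIntegralEq.of_integrable h1.1).add (((HasIntegralEq.of_integrable
    h3).const_mul (-(2 * Real.exp (a * s)))).add (h2.const_mul (Real.exp (a * s) ^ 2)))).const_mul
      (N : ℝ)⁻¹)).congr
      (f' := fun x => (N : ℝ)⁻¹ * ∑ k, (x.1 k - Real.exp (a * s) * x.2 k) ^ 2)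
      (fun x => by
        rw [Finset.mul_sum _ _ (-(2 * Real.exp (a * s))), Finset.mul_sum _ _ (Real.exp (a * s) ^ 2),
          ← Finset.sum_add_distrib, ← Finset.sum_add_distrib]
        congr 1
        exact Finset.sum_congr rfl fun k _ => by ring) rfl
  rw [← ofReal_integral_eq_lintegral_ofReal key.1 (ae_of_all _ fun x =>
    mul_nonneg (by positivity) (Finset.sum_nonneg fun k _ => sq_nonneg _)), key.2]
  refine ENNReal.ofReal_le_ofReal ?_
  rw [deviation, energy]
  have h4 : (N : ℝ)⁻¹ * ∫ x, ∑ k, x.1 k ^ 2 ∂m s ≤ E := by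
    rw [inv_mul_le_iff₀ (by linarith)]; exact h1.2
  have h5 : (N : ℝ)⁻¹ * (Real.exp (a * s) ^ 2 * (N * ∫ v, v ^ 2 ∂g s)) =
      Real.exp (2 * a * s) * ∫ v, v ^ 2 ∂g s := by
    rw [← Real.exp_nat_mul]
    field_simp
    push_cast
    ring_nf
  rw [mul_add, mul_add, h5]
  linarith

set_option maxHeartbeats 1000000 in
include h hg hN hlam hmu hE hV hg2 in
-- Collisions contribute only the mismatch with the partners, estimated by `sum_mul_partner_sub_le`.
-- On the correlation, the thermostat acts at rate `-mu + a` up to `O(1 / N)`, where `a` is the mean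
-- stretching of the other particles, and the factor `e^{as}` adds another `a`: the rate is `-(mu -
-- 2 a)`. The sources balance because `mu T = (mu - 2 a) E`. The corrections of order `1 / N` are
-- the errors in `abs_integral_beta_le`.
lemma IsCoupling.deviation_deriv_le (hT : 0 ≤ T) (ha : mu * (E - T) = 2 * a * E) {s K ε δ : ℝ}
    (hs : 0 ≤ s) (hK : energy a g s ≤ K) (hδ : 0 < δ) (hε0 : 0 ≤ ε)
    (hε : ∫⁻ x, ∑ i, ∑ j ∈ Finset.univ.erase i, partnerCost (Finset.univ.erase i) (g s) j x.2 ∂m s ≤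
      ENNReal.ofReal (N * (N - 1) * (Real.exp (-(2 * a * s)) * ε))) :
    -(2 * (N : ℝ)⁻¹ * (a * Real.exp (a * s) * (∫ x, (∑ k, x.1 k * x.2 k) ∂m s) +
        Real.exp (a * s) * ∫ x, (∫ y, (∑ k, y.1 k * y.2 k) ∂couplingRate N lam mu a E T g (s, x) -
          (N * (lam + mu)).toNNReal * ∑ k, x.1 k * x.2 k) ∂m s)) +
      (-(mu - 2 * a) * energy a g s + mu * T) ≤
    -(mu - 2 * a) * deviation a E g m s + lam * (δ * deviation a E g m s + (1 + δ⁻¹) * ε) +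
      mu * (∫ w, (E + w ^ 2) ^ 2 ∂thermostat T) * (2 * (E + K) / E ^ 2 + 4 / E) / N := by
  have := h.markov
  have := isFiniteKernel_couplingRate (N := N) (a := a) (E := E) (T := T) g hN hlam hmu.le
  have h2N : (2 : ℝ) ≤ N := by exact_mod_cast hN
  have hN1 : (0 : ℝ) < N - 1 := by linarith
  have h1 := integrable_sum_sq_fst hE hV hs
  have h2 := h.hasIntegralEq_sum_sq hg hN hlam hmu hs (hg2 s hs)
  have h3 := hasIntegralEq_correlation h1.1 h2.1
  set e := Real.exp (a * s) with he
  have he0 : 0 < e := Real.exp_pos _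
  have he2 : Real.exp (2 * a * s) = e ^ 2 := by
    rw [he, ← Real.exp_nat_mul]; congr 1; push_cast; ring
  have he2' : e ^ 2 * Real.exp (-(2 * a * s)) = 1 := by
    rw [← he2, ← Real.exp_add]; simp
  set Kc : (Fin N → ℝ) × (Fin N → ℝ) → ℝ≥0∞ := fun x =>
    ∑ i, ∑ j ∈ Finset.univ.erase i, partnerCost (Finset.univ.erase i) (g s) j x.2 with hKc
  have hKm : Measurable Kc := Finset.measurable_sum _ fun i _ => Finset.measurable_sum _ fun j _ =>
    (measurable_partnerCost _ _ j).comp measurable_snd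
  have hKfin : ∫⁻ x, Kc x ∂m s ≠ ∞ := ne_top_of_le_ne_top ENNReal.ofReal_ne_top hε
  have hKi : Integrable (fun x => (Kc x).toReal) (m s) :=
    integrable_toReal_of_lintegral_ne_top hKm.aemeasurable hKfin
  have hKle : ∫ x, (Kc x).toReal ∂m s ≤ N * (N - 1) * (Real.exp (-(2 * a * s)) * ε) := by
    rw [integral_toReal hKm.aemeasurable (ae_lt_top hKm hKfin)]
    exact ENNReal.toReal_le_of_le_ofReal (by positivity) hε
  -- the generator, integrated against the law of the coupling
  have hgi : Integrable (fun x => ∫ y, (∑ k, y.1 k * y.2 k)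
      ∂couplingRate N lam mu a E T g (s, x) -
      (N * (lam + mu)).toNNReal * ∑ k, x.1 k * x.2 k) (m s) := by
    have i1 := (h.integrable_correlation_gain hg hN hlam hmu hE hV hg2 hs).integral_comp
    rw [Kernel.prod_apply, Kernel.id_apply, Measure.dirac_prod] at i1
    exact (i1.comp_measurable (by fun_prop)).sub (h3.const_mul _)
  set b₁ := ∫ w, KacThermostat.beta N E w ∂thermostat T
  set q₁ := ∫ w, KacThermostat.beta N E w * w ^ 2 ∂thermostat T
  have hU := ((((HasIntegralEq.of_integrable h1.1).add
    (((HasIntegralEq.of_integrable h3).const_mul (-(2 * e))).add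
      (h2.const_mul (e ^ 2)))).const_mul (lam * δ)).add
    (((HasIntegralEq.of_integrable hKi).const_mul (lam / (N - 1) * ((1 + δ⁻¹) * e ^ 2))).add
    ((h2.const_mul (lam * e ^ 2)).add
    (((HasIntegralEq.of_integrable h3).const_mul (-(2 * e * mu * ((N - 1) * b₁ - N)))).add
    (.const (-(lam * e ^ 2 * (N * ∫ v, v ^ 2 ∂g s)) -
      2 * e * mu * (N * (Real.exp (-(a * s)) * q₁))))))))
  have hle := integral_mono (hgi.const_mul (-(2 * e))) hU.1 fun x => by
    have hy := mul_le_mul_of_nonneg_left (sum_mul_partner_sub_le hN (hg2 s hs) x e hδ)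
      (by positivity : 0 ≤ lam / ((N : ℝ) - 1))
    simp only
    rw [integral_couplingRate_correlation hN hlam hmu.le hE (hg2 s hs)]
    have e1 : lam / ((N : ℝ) - 1) * (δ * ((N - 1) * (∑ k, x.1 k ^ 2 -
        2 * e * ∑ k, x.1 k * x.2 k + e ^ 2 * ∑ k, x.2 k ^ 2)) +
        (1 + δ⁻¹) * e ^ 2 * (Kc x).toReal -
        e ^ 2 * (N * (N - 1) * ∫ v, v ^ 2 ∂g s - (N - 1) * ∑ k, x.2 k ^ 2)) =
        lam * δ * (∑ k, x.1 k ^ 2 - 2 * e * ∑ k, x.1 k * x.2 k + e ^ 2 * ∑ k, x.2 k ^ 2) +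
        lam / (N - 1) * ((1 + δ⁻¹) * e ^ 2) * (Kc x).toReal -
        lam * e ^ 2 * (N * ∫ v, v ^ 2 ∂g s) + lam * e ^ 2 * ∑ k, x.2 k ^ 2 := by
      field_simp
      ring
    rw [e1] at hy
    linarith
  rw [hU.2, integral_const_mul] at hle
  have hcor : |2 * e * ∫ x, (∑ k, x.1 k * x.2 k) ∂m s| ≤ N * (E + energy a g s) := by
    rw [← integral_const_mul]
    refine abs_integral_le_integral_abs.trans ((integral_mono (h3.const_mul _).abs
      ((HasIntegralEq.of_integrable h1.1).add (h2.const_mul (e ^ 2))).1 fun x =>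
        abs_sum_mul_le e x.1 x.2).trans ?_)
    rw [((HasIntegralEq.of_integrable h1.1).add (h2.const_mul (e ^ 2))).2, energy, he2]
    linarith [h1.2]
  obtain ⟨hb, hq⟩ := abs_integral_beta_le (T := T) hN hE hT
  have hen0 := energy_nonneg (a := a) g s
  have hen : energy a g s = e ^ 2 * ∫ v, v ^ 2 ∂g s := by rw [energy, he2]
  set S := ∫ w, (E + w ^ 2) ^ 2 ∂thermostat T
  have hS0 : 0 ≤ S := integral_nonneg fun w => by positivity
  set I := ∫ x, (∑ k, x.1 k * x.2 k) ∂m s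
  set G := ∫ x, (∫ y, (∑ k, y.1 k * y.2 k) ∂couplingRate N lam mu a E T g (s, x) -
          (N * (lam + mu)).toNNReal * ∑ k, x.1 k * x.2 k) ∂m s
  set M := ∫ v, v ^ 2 ∂g s
  set V := ∫ x, ∑ k, x.1 k ^ 2 ∂m s
  set Q := ∫ x, (Kc x).toReal ∂m s
  set P := (N : ℝ)⁻¹ * (e * I) with hP
  have hdev : deviation a E g m s = E - 2 * P + energy a g s := by rw [deviation, hP]; ring
  have hPN : e * I = N * P := by rw [hP]; field_simp
  have heI : e * Real.exp (-(a * s)) = 1 := by rw [he, ← Real.exp_add]; simp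
  have hPabs : |2 * P| ≤ E + K := by
    have : 2 * e * I = N * (2 * P) := by rw [mul_assoc, hPN]; ring
    rw [this, abs_mul, Nat.abs_cast] at hcor
    exact (le_of_mul_le_mul_left hcor (by linarith)).trans (by linarith)
  have hQ : e ^ 2 * Q ≤ N * (N - 1) * ε := by
    calc e ^ 2 * Q ≤ e ^ 2 * (N * (N - 1) * (Real.exp (-(2 * a * s)) * ε)) := by gcongr
      _ = N * (N - 1) * ε * (e ^ 2 * Real.exp (-(2 * a * s))) := by ring
      _ = _ := by rw [he2', mul_one]
  have hG : -(2 * e) * G ≤ N * (lam * δ * (E - 2 * P + energy a g s) + lam * ((1 + δ⁻¹) * ε) -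
      2 * mu * ((N - 1) * b₁ - N) * P - 2 * mu * q₁) := by
    have t1 : lam * δ * V ≤ lam * δ * (N * E) := by gcongr; exact h1.2
    have t2 : lam / (N - 1) * ((1 + δ⁻¹) * e ^ 2) * Q ≤ N * (lam * ((1 + δ⁻¹) * ε)) := by
      calc _ = lam / (N - 1) * (1 + δ⁻¹) * (e ^ 2 * Q) := by ring
        _ ≤ lam / (N - 1) * (1 + δ⁻¹) * (N * (N - 1) * ε) := by gcongr
        _ = _ := by field_simp
    refine hle.trans ?_
    have t3 : lam * δ * (V + (-(2 * e) * I + e ^ 2 * (N * M))) =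
        lam * δ * V + lam * δ * (N * (- 2 * P + energy a g s)) := by
      rw [hen]; linear_combination (-2 * lam * δ) * hPN
    have t4 : -(2 * e * mu * ((N - 1) * b₁ - N)) * I = -(2 * mu * ((N - 1) * b₁ - N)) * (N * P) := by
      rw [← hPN]; ring
    have t5 : 2 * e * mu * (N * (Real.exp (-(a * s)) * q₁)) = 2 * mu * (N * q₁) := by
      linear_combination (2 * mu * N * q₁) * heI
    rw [t3, t4, t5]
    linarith
  have hG' : -(2 * (N : ℝ)⁻¹ * (a * e * I + e * G)) ≤ -(2 * a * P) +
      (lam * δ * (E - 2 * P + energy a g s) + lam * ((1 + δ⁻¹) * ε) -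
      2 * mu * ((N - 1) * b₁ - N) * P - 2 * mu * q₁) := by
    have t1 : -(2 * (N : ℝ)⁻¹ * (a * e * I + e * G)) = -(2 * a * P) +
        (N : ℝ)⁻¹ * (-(2 * e) * G) := by rw [hP]; ring
    rw [t1]
    gcongr
    rw [inv_mul_le_iff₀ (by linarith)]
    exact hG
  -- This identifies the mean stretching by the thermostat with the drift; `η` is the remaining
  -- error, of order `1 / N`.
  have hET : (E - T) / E * mu = 2 * a := by field_simp; linarith
  set η := 2 * (N - 1) * (b₁ - 1) - (E - T) / E with hη
  have e2 : -(2 * a * P) - 2 * mu * ((N - 1) * b₁ - N) * P =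
      2 * (mu - 2 * a) * P - mu * η * P := by
    rw [hη]; linear_combination (-P) * hET
  have hηP : -(mu * η * P) ≤ mu * (4 * S / E ^ 2 / N * ((E + K) / 2)) := by
    have hEK : 0 ≤ E + K := (abs_nonneg _).trans hPabs
    have hP2 : |P| ≤ (E + K) / 2 := by
      rw [abs_mul] at hPabs
      have : |(2 : ℝ)| = 2 := by norm_num
      rw [this] at hPabs; linarith
    calc -(mu * η * P) ≤ |mu * η * P| := neg_le_abs _
      _ = mu * (|η| * |P|) := by rw [abs_mul, abs_mul, abs_of_pos hmu, mul_assoc]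
      _ ≤ _ := by gcongr
  have hqT : -(2 * mu * (q₁ - T)) ≤ 2 * mu * (2 * S / E / N) := by
    have h3 := mul_le_mul_of_nonneg_left (abs_le.1 hq).1 (by positivity : 0 ≤ 2 * mu)
    linarith only [h3]
  have hfin : mu * S * (2 * (E + K) / E ^ 2 + 4 / E) / N =
      mu * (4 * S / E ^ 2 / N * ((E + K) / 2)) + 2 * mu * (2 * S / E / N) := by
    field_simp; ring
  rw [hdev, hfin]
  have hmuT : mu * T = (mu - 2 * a) * E := by linarith only [ha]
  linarith only [hG', e2, hηP, hqT, hmuT]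

end Evolution

end Deviation

/-! ### Propagation of chaos -/

section Conclusion

variable {N : ℕ} {lam mu a E T r : ℝ}

/-- A bound at the level of a coupling passes to the first marginal, even for functions which are
not known to be measurable. -/
lemma lintegral_comp_le_of_map_fst_eq {Ω α β : Type*} [MeasurableSpace Ω] [MeasurableSpace α]
    [MeasurableSpace β] [StandardBorelSpace β] [Nonempty β] {P : Measure Ω} {V : Ω → α}
    (hV : Measurable V) {ν : Measure (α × β)} [IsFiniteMeasure ν]
    (h : ν.map Prod.fst = P.map V) {F : α → ℝ≥0∞} {H : α × β → ℝ≥0∞} (hH : Measurable H)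
    (hFH : ∀ x, F x.1 ≤ H x) : ∫⁻ ω, F (V ω) ∂P ≤ ∫⁻ x, H x ∂ν := by
  have hm : Measurable fun v => ∫⁻ u, H (v, u) ∂ν.condKernel v := hH.lintegral_kernel_prod_right'
  calc ∫⁻ ω, F (V ω) ∂P ≤ ∫⁻ ω, (∫⁻ u, H (V ω, u) ∂ν.condKernel (V ω)) ∂P := by
        refine lintegral_mono fun ω => ?_
        calc F (V ω) = ∫⁻ _u, F (V ω) ∂ν.condKernel (V ω) := by simp
          _ ≤ _ := lintegral_mono fun u => hFH (V ω, u)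
    _ = ∫⁻ v, (∫⁻ u, H (v, u) ∂ν.condKernel v) ∂ν.fst := by
        rw [Measure.fst, h, lintegral_map hm hV]
    _ = _ := Measure.lintegral_condKernel hH

lemma quantile_map_mul (ν : Measure ℝ) [IsProbabilityMeasure ν] {c : ℝ} (hc : 0 < c) (p : ℝ) :
    quantile (ν.map fun v => c * v) p = c * quantile ν p := by
  have : IsProbabilityMeasure (ν.map fun v => c * v) :=
    Measure.isProbabilityMeasure_map (by fun_prop)
  by_cases hp : p ∈ Set.Ioo (0 : ℝ) 1
  · refine eq_of_forall_ge_iff fun x => ?_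
    rw [quantile_le_iff _ hp, ← le_div_iff₀' hc, quantile_le_iff _ hp, Measure.real,
      Measure.map_apply (by fun_prop) measurableSet_Iic, Measure.real]
    have : (fun v => c * v) ⁻¹' Set.Iic x = Set.Iic (x / c) := by
      ext v; simp [le_div_iff₀' hc]
    rw [this]
  · simp [quantile, hp]

lemma map_rescale (ν : Measure ℝ) (t : ℝ) :
    (rescale a t ν).map (fun v => Real.exp (a * t) * v) = ν := by
  rw [rescale, Measure.map_map (by fun_prop) (by fun_prop)]
  have : ((fun v => Real.exp (a * t) * v) ∘ fun v => Real.exp (-(a * t)) * v) = id := by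
    ext v
    simp [← mul_assoc, ← Real.exp_add]
  rw [this, Measure.map_id]

/-- From `(x + y)² ≤ 2 x² + 2 y²`, passing through the velocities `c * u k`. The atoms of the
empirical measure of `v` are matched according to the ranks of `u`, and quantiles commute with the
dilation by `c`. -/
lemma W2Line_empirical_sq_le_add (hN : N ≠ 0) (v u : Fin N → ℝ) (ν : Measure ℝ)
    [IsProbabilityMeasure ν] {c : ℝ} (hc : 0 < c) :
    W2Line (empirical v) (ν.map fun v => c * v) ^ 2 ≤
      2 * ENNReal.ofReal ((N : ℝ)⁻¹ * ∑ k, (v k - c * u k) ^ 2) +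
        ENNReal.ofReal (2 * c ^ 2 * (N : ℝ)⁻¹) * ∑ j, partnerCost Finset.univ ν j u := by
  have : IsProbabilityMeasure (ν.map fun v => c * v) :=
    Measure.isProbabilityMeasure_map (by fun_prop)
  refine (W2Line_empirical_sq_le hN v u (ν.map fun v => c * v)).trans ?_
  have hNinv : (N : ℝ≥0∞)⁻¹ = ENNReal.ofReal (N : ℝ)⁻¹ := by
    rw [ENNReal.ofReal_inv_of_pos (by positivity), ENNReal.ofReal_natCast]
  have h2 : (2 : ℝ≥0∞) = ENNReal.ofReal 2 := by norm_num
  have hj : ∀ j, ∫⁻ ρ, ENNReal.ofReal ((v j - partner Finset.univ u (ν.map fun v => c * v) j ρ) ^ 2)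
      ∂unitLaw ≤ ENNReal.ofReal (2 * (v j - c * u j) ^ 2) +
        ENNReal.ofReal (2 * c ^ 2) * partnerCost Finset.univ ν j u := fun j => by
    rw [partnerCost, ← lintegral_const_mul' _ _ ENNReal.ofReal_ne_top]
    have hconst : ENNReal.ofReal (2 * (v j - c * u j) ^ 2) =
        ∫⁻ _ρ, ENNReal.ofReal (2 * (v j - c * u j) ^ 2) ∂unitLaw := by simp
    rw [hconst, ← lintegral_add_left measurable_const]
    refine lintegral_mono fun ρ => ?_
    rw [← ENNReal.ofReal_mul (by positivity), ← ENNReal.ofReal_add (by positivity) (by positivity)]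
    refine ENNReal.ofReal_le_ofReal ?_
    rw [partner, quantile_map_mul ν hc, ← partner]
    nlinarith [sq_nonneg ((v j - c * u j) - c * (u j - partner Finset.univ u ν j ρ))]
  calc _ ≤ (N : ℝ≥0∞)⁻¹ * ∑ j, (ENNReal.ofReal (2 * (v j - c * u j) ^ 2) +
        ENNReal.ofReal (2 * c ^ 2) * partnerCost Finset.univ ν j u) := by gcongr with j; exact hj j
    _ = _ := by
        rw [Finset.sum_add_distrib, mul_add, ← Finset.mul_sum, ← mul_assoc, hNinv, h2,
          ← ENNReal.ofReal_sum_of_nonneg (fun j _ => by positivity),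
          ← ENNReal.ofReal_mul (by positivity), ← ENNReal.ofReal_mul (by positivity),
          ← ENNReal.ofReal_mul (by positivity), ← Finset.mul_sum]
        congr 2
        · ring
        · congr 1; ring

/-- The exponent `(r - 2) / (2 (r - 1))` increases with `r` and equals `1/3` at `r = 4`. The
constant serves only for `r = 4`, where `log N` is bounded below by `log 2`. -/
lemma costRate_le_chaosRate (hr : 2 < r) (hN : 2 ≤ N) :
    costRate r N ≤ (1 + (Real.log 2 ^ (2 / 3 : ℝ))⁻¹) * chaosRate r N := by
  have hN1 : (1 : ℝ) ≤ N := by exact_mod_cast (by omega : 1 ≤ N)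
  have hl2 : 0 < Real.log 2 ^ (2 / 3 : ℝ) := Real.rpow_pos_of_pos (Real.log_pos (by norm_num)) _
  have hone : (1 : ℝ) ≤ 1 + (Real.log 2 ^ (2 / 3 : ℝ))⁻¹ := by
    have := inv_pos.2 hl2; linarith
  have hpow : ∀ p : ℝ, 0 ≤ (N : ℝ) ^ p := fun p => by positivity
  unfold chaosRate costRate
  split_ifs with h1 h2
  · refine le_trans (Real.rpow_le_rpow_of_exponent_le hN1 (neg_le_neg ?_))
      (le_mul_of_one_le_left (hpow _) hone)
    rw [div_le_div_iff₀ (by norm_num) (by linarith)]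
    linarith
  · subst h2
    have hlog : Real.log 2 ^ (2 / 3 : ℝ) ≤ Real.log N ^ (2 / 3 : ℝ) :=
      Real.rpow_le_rpow (Real.log_nonneg (by norm_num))
        (Real.log_le_log (by norm_num) (by exact_mod_cast hN)) (by norm_num)
    have e : (-((4 - 2) / (2 * (4 - 1))) : ℝ) = -(1 / 3) := by norm_num
    rw [e]
    calc (N : ℝ) ^ (-(1 / 3) : ℝ) = (Real.log 2 ^ (2 / 3 : ℝ))⁻¹ *
          ((N : ℝ) ^ (-(1 / 3) : ℝ) * Real.log 2 ^ (2 / 3 : ℝ)) := by field_simp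
      _ ≤ (Real.log 2 ^ (2 / 3 : ℝ))⁻¹ *
          ((N : ℝ) ^ (-(1 / 3) : ℝ) * Real.log N ^ (2 / 3 : ℝ)) := by gcongr
      _ ≤ _ := by
          refine mul_le_mul_of_nonneg_right (by linarith) ?_
          have := hl2.le.trans hlog
          exact mul_nonneg (hpow _) this
  · exact le_mul_of_one_le_left (hpow _) hone

section Bound

variable {g : Kernel ℝ ℝ} {m : Kernel ℝ ((Fin N → ℝ) × (Fin N → ℝ))} [IsMarkovKernel g]

/-- If the energy of the particle system is initially equal to `E`, then so is the deviation to
the squared distance. -/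
lemma IsCoupling.hasIntegralEq_deviation_zero (h : IsCoupling lam mu a E T g m)
    (hg : IsKineticFlow lam mu a T g) (hN : 2 ≤ N) (hlam : 0 ≤ lam) (hmu : 0 < mu)
    (hV : HasIntegralEq (m 0) (fun x => ∑ k, x.1 k ^ 2) (N * E))
    (hg2 : Integrable (fun v : ℝ => v ^ 2) (g 0)) :
    HasIntegralEq (m 0) (fun x => (N : ℝ)⁻¹ * ∑ k, (x.1 k - x.2 k) ^ 2) (deviation a E g m 0) := by
  have h2 := h.hasIntegralEq_sum_sq hg hN hlam hmu le_rfl hg2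
  have h3 := hasIntegralEq_correlation hV.1 h2.1
  have h2N : (2 : ℝ) ≤ N := by exact_mod_cast hN
  refine ((hV.add (((HasIntegralEq.of_integrable h3).const_mul (-2)).add h2)).const_mul
    (N : ℝ)⁻¹).congr (fun x => ?_) ?_
  · rw [Finset.mul_sum _ _ (-2), ← Finset.sum_add_distrib, ← Finset.sum_add_distrib]
    congr 1
    exact Finset.sum_congr rfl fun k _ => by ring
  · simp only [deviation, energy, mul_zero, Real.exp_zero, one_mul]
    field_simp
    ring

end Bound

/-- The squared distance between the two coupled systems. -/
lemma exists_lintegral_sq_sub_le (hlam : 0 ≤ lam) (hmu : 0 < mu) (hE : 0 < E) (hT : 0 < T)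
    (ha : mu * (E - T) = 2 * a * E) (hr : 2 < r) {K : ℝ} (hK : 0 ≤ K) : ∃ C : ℝ, 0 ≤ C ∧
    ∀ (g : Kernel ℝ ℝ), IsKineticFlow lam mu a T g → (∀ t, 0 ≤ t →
      Integrable (fun v : ℝ => |v| ^ r) (g t) ∧ Real.exp (r * a * t) * ∫ v, |v| ^ r ∂g t ≤ K ∧
      energy a g t ≤ K) →
    ∀ (N : ℕ) (m : Kernel ℝ ((Fin N → ℝ) × (Fin N → ℝ))), 2 ≤ N → IsCoupling lam mu a E T g m →
      HasIntegralEq (m 0) (fun x => ∑ k, x.1 k ^ 2) (N * E) →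
      (∀ t, 0 ≤ t → ∫⁻ x, ENNReal.ofReal (∑ k, x.1 k ^ 2) ∂m t ≤ ENNReal.ofReal (N * E)) →
      ∀ t, 0 ≤ t →
      ∫⁻ x, ENNReal.ofReal ((N : ℝ)⁻¹ * ∑ k, (x.1 k - Real.exp (a * t) * x.2 k) ^ 2) ∂m t ≤
        ENNReal.ofReal (2 * Real.exp (-((mu - 2 * a) * t))) *
          ∫⁻ x, ENNReal.ofReal ((N : ℝ)⁻¹ * ∑ k, (x.1 k - x.2 k) ^ 2) ∂m 0 +
        ENNReal.ofReal (C * costRate r N) ∧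
      ∫⁻ x, ∑ j, partnerCost Finset.univ (g t) j x.2 ∂m t ≤
        ENNReal.ofReal (N * (Real.exp (-(2 * a * t)) * (C * costRate r N))) := by
  have hκ : 0 < mu - 2 * a := by
    have : (mu - 2 * a) * E = mu * T := by linarith
    exact pos_of_mul_pos_left (this ▸ mul_pos hmu hT) hE.le
  obtain ⟨C₀, hC₀, hcost⟩ := exists_partnerCost_le (a := a) hlam hmu hT.le (by linarith) hr hK
  set κ := mu - 2 * a
  set S := ∫ w, (E + w ^ 2) ^ 2 ∂thermostat T
  have hS : 0 ≤ S := integral_nonneg fun w => by positivity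
  set B := mu * S * (2 * (E + K) / E ^ 2 + 4 / E) with hB
  set C₁ := 2 * (lam * C₀ * (1 / κ + 8 * (lam + 1) / κ ^ 2) + B / κ) with hC₁
  have hC₁0 : 0 ≤ C₁ := by positivity
  refine ⟨C₀ + C₁, by positivity, fun g hg hgK N m hN h hV0 hV t ht => ?_⟩
  have := hg.markov
  have := h.markov
  have hg2 : ∀ t, 0 ≤ t → Integrable (fun v : ℝ => v ^ 2) (g t) := fun t ht => by
    simpa using integrable_rpow_of_le (p := 2) (by norm_num) hr.le (hgK t ht).1
  have hR := costRate_nonneg (N := N) r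
  have hinv := inv_le_costRate hr hN
  have h0 := h.hasIntegralEq_deviation_zero hg hN hlam hmu hV0 (hg2 0 le_rfl)
  have hnn : ∀ x : (Fin N → ℝ) × (Fin N → ℝ), 0 ≤ (N : ℝ)⁻¹ * ∑ k, (x.1 k - x.2 k) ^ 2 := fun x =>
    mul_nonneg (by positivity) (Finset.sum_nonneg fun k _ => sq_nonneg _)
  have hd0 : 0 ≤ deviation a E g m 0 := by rw [← h0.2]; exact integral_nonneg hnn
  constructor
  · refine (h.lintegral_sq_sub_le hg hN hlam hmu hE hV hg2 ht).trans ?_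
    have key := (h.isPrimitive_deviation hg hN hlam hmu hE hV hg2 hT.le ht).le_of_deriv_le_young ht
      hκ hlam (ε := C₀ * costRate r N) (c := B / N) (by positivity) (by positivity) hd0
      fun s hs δ hδ => h.deviation_deriv_le hg hN hlam hmu hE hV hg2 hT.le ha hs.1
        (hgK s hs.1).2.2 hδ (by positivity) (hcost g hg hgK N E m hN h s hs.1).1
    rw [← ofReal_integral_eq_lintegral_ofReal h0.1 (ae_of_all _ hnn), h0.2,
      ← ENNReal.ofReal_mul (by positivity), ← ENNReal.ofReal_add (by positivity) (by positivity)]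
    refine ENNReal.ofReal_le_ofReal (key.trans (add_le_add le_rfl ?_))
    have h1 : B / N / κ ≤ B / κ * costRate r N := by
      calc B / N / κ = B / κ * (N : ℝ)⁻¹ := by field_simp
        _ ≤ _ := by gcongr
    calc _ = 2 * (lam * C₀ * (1 / κ + 8 * (lam + 1) / κ ^ 2)) * costRate r N +
          2 * (B / N / κ) := by ring
      _ ≤ 2 * (lam * C₀ * (1 / κ + 8 * (lam + 1) / κ ^ 2)) * costRate r N +
          2 * (B / κ * costRate r N) := by gcongr
      _ = C₁ * costRate r N := by rw [hC₁]; ring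
      _ ≤ _ := by gcongr; linarith
  · refine (hcost g hg hgK N E m hN h t ht).2.trans (ENNReal.ofReal_le_ofReal ?_)
    gcongr
    linarith

/-- Propagation of chaos, for a given coupling of the initial conditions. -/
lemma exists_lintegral_W2Line_le (lam mu E T r M : ℝ) (hlam : 0 ≤ lam) (hmu : 0 < mu) (hE : 0 < E)
    (hT : 0 < T) (hr : 2 < r) (hrA : r * drift mu E T < 2 * lam * momentConst r + mu) :
    ∃ C : ℝ, 0 ≤ C ∧
      ∀ (f₀ : Measure ℝ) (_ : IsProbabilityMeasure f₀)
        (_ : Integrable (fun v : ℝ => |v| ^ r) f₀) (_ : ∫ v, |v| ^ r ∂f₀ = M)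
        (f : ℝ≥0 → Measure ℝ) (_ : IsWeakSolution lam mu E T f₀ f) (N : ℕ) (_ : 2 ≤ N)
        (Ω : Type*) (_ : MeasurableSpace Ω) (P : Measure Ω) (_ : IsProbabilityMeasure P)
        (V : ℝ≥0 → Ω → Fin N → ℝ) (_ : IsParticleSystem P N lam mu E T V)
        (_ : ∀ i, ∫ ω, (V 0 ω i) ^ 2 ∂P = E) (π : Measure ((Fin N → ℝ) × (Fin N → ℝ)))
        (_ : π.map Prod.fst = P.map (V 0)) (_ : π.map Prod.snd = Measure.pi fun _ => f₀)
        (t : ℝ≥0), ∫⁻ ω, W2Line (empirical (V t ω)) (f t) ^ 2 ∂P ≤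
          ENNReal.ofReal (4 * Real.exp (-(mu * T / E) * t)) *
            ∫⁻ x, ENNReal.ofReal ((N : ℝ)⁻¹ * ∑ k, (x.1 k - x.2 k) ^ 2) ∂π +
          ENNReal.ofReal (C * costRate r N) := by
  set a := drift mu E T with ha
  have haE : mu * (E - T) = 2 * a * E := by rw [ha, drift]; field_simp
  have hκ : mu - 2 * a = mu * T / E := by rw [eq_div_iff hE.ne']; linarith
  have hκ0 : 0 < mu - 2 * a := by rw [hκ]; positivity
  obtain ⟨K, hK⟩ := exists_moment_bound_uniform (T := T) hlam hmu hT.le (by linarith) hr hrA M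
  obtain ⟨C, hC, hmain⟩ := exists_lintegral_sq_sub_le hlam hmu hE hT haE hr (le_max_right K 0)
  refine ⟨4 * C, by positivity, fun f₀ _ hf₀ hM f hf N hN Ω _ P _ V hVP hVE π hπ1 hπ2 t => ?_⟩
  obtain ⟨g, hg, hg0, hgf⟩ := IsWeakSolution.exists_isKineticFlow hf hlam hmu.le
  have := hg.markov
  have hN0 : N ≠ 0 := by omega
  have h2N : (2 : ℝ) ≤ N := by exact_mod_cast hN
  have ht : (0 : ℝ) ≤ t := t.2
  have hgK : ∀ t, 0 ≤ t → Integrable (fun v : ℝ => |v| ^ r) (g t) ∧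
      Real.exp (r * a * t) * ∫ v, |v| ^ r ∂g t ≤ max K 0 ∧ energy a g t ≤ max K 0 := fun t ht => by
    have h0 : Integrable (fun v : ℝ => |v| ^ r) (g 0) := by rwa [hg0]
    have h1 := hK g hg h0 (by rw [hg0, hM]) t ht
    exact ⟨hg.integrable_rpow hlam hmu.le (by linarith) h0 ht, h1.1.trans (le_max_left _ _),
      h1.2.trans (le_max_left _ _)⟩
  have hπ : IsProbabilityMeasure π := by
    have : IsProbabilityMeasure (P.map (V 0)) :=
      Measure.isProbabilityMeasure_map (hVP.measurable 0).aemeasurable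
    refine ⟨?_⟩
    rw [← Set.preimage_univ (f := Prod.fst), ← Measure.map_apply measurable_fst MeasurableSet.univ,
      hπ1, measure_univ]
  have := isFiniteKernel_couplingRate (N := N) (a := a) (E := E) (T := T) g hN hlam hmu.le
  obtain ⟨m, hm, hm0, hflow, hsup⟩ := exists_jumpFlow (couplingRate N lam mu a E T g) π
    (couplingRate_univ g hN hlam hmu.le)
  have h : IsCoupling lam mu a E T g m := ⟨hm, hflow, by rw [hm0, hπ2, hg0]⟩
  have hV0 : HasIntegralEq (m 0) (fun x => ∑ k, x.1 k ^ 2) (N * E) := by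
    have hi : ∀ k, Integrable (fun ω => V 0 ω k ^ 2) P := fun k => by
      -- A non-integrable square would have integral `0` by convention, against `E > 0`.
      by_contra hn
      have := hVE k
      rw [integral_undef hn] at this
      exact hE.ne this
    have hs : HasIntegralEq P (fun ω => ∑ k, V 0 ω k ^ 2) (N * E) := by
      refine ⟨integrable_finsetSum _ fun k _ => hi k, ?_⟩
      rw [integral_finsetSum _ fun k _ => hi k]
      simp [hVE]
    have hmeas : Measurable fun v : Fin N → ℝ => ∑ k, v k ^ 2 := by fun_prop
    have h1 : HasIntegralEq (P.map (V 0)) (fun v => ∑ k, v k ^ 2) (N * E) :=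
      ⟨(integrable_map_measure hmeas.aestronglyMeasurable (hVP.measurable 0).aemeasurable).2 hs.1,
        by rw [integral_map (hVP.measurable 0).aemeasurable hmeas.aestronglyMeasurable, hs.2]⟩
    rw [← hπ1] at h1
    rw [hm0]
    exact ⟨h1.1.comp_measurable measurable_fst, by
      rw [← h1.2, integral_map measurable_fst.aemeasurable hmeas.aestronglyMeasurable]⟩
  have hVt : ∀ t, 0 ≤ t →
      ∫⁻ x, ENNReal.ofReal (∑ k, x.1 k ^ 2) ∂m t ≤ ENNReal.ofReal (N * E) := fun t ht => by
    refine lintegral_sum_sq_le (a := a) (T := T) (g := g) hN hlam hmu.le hE (fun φ c d B h1 h2 h3 h4 => ?_) ?_ ht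
    · exact hsup φ c d B h1 h2 h3 (by rwa [hm0] at h4)
    · rw [← ofReal_integral_eq_lintegral_ofReal hV0.1 (ae_of_all _ fun x =>
        Finset.sum_nonneg fun k _ => sq_nonneg _), hV0.2]
  obtain ⟨b1, b2⟩ := hmain g hg hgK N m hN h hV0 hVt t ht
  have hfst := h.map_fst hVP (by rw [hm0, hπ1]) hN hlam hmu t
  have hft : f t = (g t).map fun v => Real.exp (a * t) * v := by rw [hgf, map_rescale]
  have hHm : Measurable fun x : (Fin N → ℝ) × (Fin N → ℝ) =>
      ENNReal.ofReal (2 * Real.exp (a * t) ^ 2 * (N : ℝ)⁻¹) *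
        ∑ j, partnerCost Finset.univ (g t) j x.2 :=
    (Finset.measurable_sum _ fun j _ =>
      (measurable_partnerCost _ (g t) j).comp measurable_snd).const_mul _
  have hHm1 : Measurable fun x : (Fin N → ℝ) × (Fin N → ℝ) =>
      2 * ENNReal.ofReal ((N : ℝ)⁻¹ * ∑ k, (x.1 k - Real.exp (a * t) * x.2 k) ^ 2) := by fun_prop
  have hle := lintegral_comp_le_of_map_fst_eq (hVP.measurable t) (ν := m t) hfst
    (F := fun v => W2Line (empirical v) (f t) ^ 2) (hHm1.add hHm) fun x => by
      rw [hft]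
      exact W2Line_empirical_sq_le_add hN0 x.1 x.2 (g t) (Real.exp_pos _)
  refine hle.trans ?_
  simp only [Pi.add_apply]
  rw [lintegral_add_left hHm1, lintegral_const_mul' _ _ (by simp),
    lintegral_const_mul' _ _ ENNReal.ofReal_ne_top]
  rw [hm0] at b1
  set I := ∫⁻ x, ENNReal.ofReal ((N : ℝ)⁻¹ * ∑ k, (x.1 k - x.2 k) ^ 2) ∂π
  have hR := costRate_nonneg (N := N) r
  have e2 : (2 : ℝ≥0∞) = ENNReal.ofReal 2 := by norm_num
  -- The constant `4` is the product of the `2` in `W2Line_empirical_sq_le_add` and the `2` in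
  -- `le_of_deriv_le_young`.
  calc _ ≤ 2 * (ENNReal.ofReal (2 * Real.exp (-((mu - 2 * a) * t))) * I +
        ENNReal.ofReal (C * costRate r N)) +
        ENNReal.ofReal (2 * Real.exp (a * t) ^ 2 * (N : ℝ)⁻¹) *
          ENNReal.ofReal (N * (Real.exp (-(2 * a * t)) * (C * costRate r N))) := by gcongr
    _ = ENNReal.ofReal (4 * Real.exp (-((mu - 2 * a) * t))) * I +
        (ENNReal.ofReal (2 * (C * costRate r N)) + ENNReal.ofReal (2 * (C * costRate r N))) := by
        have h1 : Real.exp (a * t) ^ 2 * Real.exp (-(2 * a * t)) = 1 := by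
          rw [← Real.exp_nat_mul, ← Real.exp_add, Real.exp_eq_one_iff]
          push_cast; ring
        have h3 : 2 * Real.exp (a * t) ^ 2 * (N : ℝ)⁻¹ *
            (N * (Real.exp (-(2 * a * t)) * (C * costRate r N))) = 2 * (C * costRate r N) := by
          calc _ = 2 * (C * costRate r N) * ((N : ℝ)⁻¹ * N) *
                (Real.exp (a * t) ^ 2 * Real.exp (-(2 * a * t))) := by ring
            _ = _ := by rw [h1, inv_mul_cancel₀ (by linarith)]; ring
        have h4 : 2 * (2 * Real.exp (-((mu - 2 * a) * t))) =
            4 * Real.exp (-((mu - 2 * a) * t)) := by ring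
        rw [mul_add, ← mul_assoc, e2, ← ENNReal.ofReal_mul (by norm_num),
          ← ENNReal.ofReal_mul (by norm_num), ← ENNReal.ofReal_mul (by positivity), add_assoc, h3,
          h4]
    _ = _ := by
        have h1 : -((mu - 2 * a) * t) = -(mu * T / E) * t := by rw [hκ]; ring
        rw [← ENNReal.ofReal_add (by positivity) (by positivity), h1]
        congr 2
        ring

end Conclusion

theorem theorem2 (lam mu E T r M : ℝ) (hlam : 0 ≤ lam) (hmu : 0 < mu) (hE : 0 < E) (hT : 0 < T)
    (hr : 2 < r) (hrA : r * drift mu E T < 2 * lam * momentConst r + mu) :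
    ∃ C : ℝ,
      ∀ (f₀ : Measure ℝ) (_ : IsProbabilityMeasure f₀)
        (_ : Integrable (fun v : ℝ => |v| ^ r) f₀) (_ : ∫ v, |v| ^ r ∂f₀ = M)
        (f : ℝ≥0 → Measure ℝ) (_ : IsWeakSolution lam mu E T f₀ f)
        (N : ℕ) (_ : 2 ≤ N)
        (Ω : Type*) (_ : MeasurableSpace Ω) (P : Measure Ω) (_ : IsProbabilityMeasure P)
        (V : ℝ≥0 → Ω → Fin N → ℝ) (_ : IsParticleSystem P N lam mu E T V)
        (_ : Exchangeable (P.map (V 0)))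
        (_ : ∀ i, ∫ ω, (V 0 ω i) ^ 2 ∂P = E)
        (t : ℝ≥0),
        ∫⁻ ω, W2Line (empirical (V t ω)) (f t) ^ 2 ∂P ≤
          ENNReal.ofReal (4 * Real.exp (-(mu * T / E) * t)) *
              W2 (P.map (V 0)) (Measure.pi fun _ : Fin N => f₀) ^ 2
            + ENNReal.ofReal (C * chaosRate r N) := by
  obtain ⟨C, hC, hmain⟩ := exists_lintegral_W2Line_le lam mu E T r M hlam hmu hE hT hr hrA
  refine ⟨C * (1 + (Real.log 2 ^ (2 / 3 : ℝ))⁻¹), fun f₀ h1 h2 h3 f hf N hN Ω _ P hP V hV _ hVE t =>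
    ?_⟩
  have hrate : ENNReal.ofReal (C * costRate r N) ≤
      ENNReal.ofReal (C * (1 + (Real.log 2 ^ (2 / 3 : ℝ))⁻¹) * chaosRate r N) := by
    refine ENNReal.ofReal_le_ofReal ?_
    rw [mul_assoc]
    exact mul_le_mul_of_nonneg_left (costRate_le_chaosRate hr hN) hC
  refine le_trans ?_ (add_le_add le_rfl hrate)
  have hA0 : ENNReal.ofReal (4 * Real.exp (-(mu * T / E) * t)) ≠ 0 := by
    rw [ne_eq, ENNReal.ofReal_eq_zero, not_le]; positivity
  have hW : W2 (P.map (V 0)) (Measure.pi fun _ : Fin N => f₀) ^ 2 = transportCost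
      (fun x y => ENNReal.ofReal ((N : ℝ)⁻¹ * ∑ i, (x i - y i) ^ 2)) (P.map (V 0))
      (Measure.pi fun _ : Fin N => f₀) := by
    rw [W2, ← ENNReal.rpow_mul_natCast]; norm_num
  -- The right-hand side is affine in the transport cost, and `C` does not depend on the initial
  -- coupling: solving for the cost reduces the claim to a lower bound of the infimum, checked for
  -- each coupling `π`.
  rw [hW, ← tsub_le_iff_right, ← ENNReal.div_le_iff' hA0 ENNReal.ofReal_ne_top]
  refine le_iInf₂ fun π hπ => ?_
  rw [ENNReal.div_le_iff' hA0 ENNReal.ofReal_ne_top, tsub_le_iff_right]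
  exact hmain f₀ h1 h2 h3 f hf N hN Ω _ P hP V hV hVE π hπ.1 hπ.2 t
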